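/- Fix $\eta\neq 0$ and let $f(d)=\eta^{-2}(|d|^2-1)d$ for $d\in\mathbb R^3$. Consider on $\mathbb R^3\times(0,\infty)$ the nematic liquid crystal system $$u_t+u\cdot\nabla u+\nabla\pi=\Delta u-\nabla\cdot(\nabla d\otimes\nabla d),\qquad d_t+u\cdot\nabla d=\Delta d-f(d),\qquad \nabla\cdot u=0,$$ where $(\nabla d\otimes\nabla d)_{ij}=\partial_i d\cdot\partial_j d$, with initial data $u(0)=u_0$, $d(0)=d_0$. Assume that $\nabla\cdot u_0=0$, $|d_0|=1$ a.e., $u_0\in H^1(\mathbb R^3)$ and $d_0-w_0\in H^2(\mathbb R^3)\cap L^1(\mathbb R^3)$ for a unit vector $w_0\in\mathbb R^3$ (so $d_0-w_0\in L^p(\mathbb R^3)$ for all $1\le p\le\infty$). A *solution* is a triple $(u,\pi,d)$ such that $u$ and $d$ are of class $C^{1,2}$ in $(t,x)\in(0,\infty)\times\mathbb R^3$ (that is, they and their derivatives $\partial_t$, $D_x$, $D_x^2$ are continuous), $\pi(t,\cdot)$ is $C^1$ for every $t>0$ with $\nabla\pi$ continuous on $(0,\infty)\times\mathbb R^3$,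 the system holds pointwise for $t>0$, $u(t)-u_0\to0$ and $d(t)-d_0\to 0$ in $L^2(\mathbb R^3)$ as $t\to0^+$, and for every $T>0$ $$u\in L^\infty(0,T;H^1)\cap L^2(0,T;H^2),\qquad d-w_0\in L^\infty(0,T;H^2)\cap L^2(0,T;H^3),$$ where the $L^\infty(0,T)$ bounds hold at every time $t\in(0,T)$. **Theorem.** There is $\epsilon_0>0$, depending only on $\eta$, such that if in addition $u_0\in L^1(\mathbb R^3)$ and $$\|u_0\|_{H^1(\mathbb R^3)}^2+\|d_0-w_0\|_{H^2(\mathbb R^3)}^2\le\epsilon_0,$$ then every solution satisfies, for all $t>0$, $$\|d(\cdot,t)-w_0\|_{L^p(\mathbb R^3)}\le C_p\,\|d_0-w_0\|_{L^p(\mathbb R^3)}\,(1+t)^{-\frac32(1-\frac1p)}\qquad\text{for every }1\le p<\infty,$$ $$\|\nabla(d(\cdot,t)-w_0)\|_{L^2(\mathbb R^3)}^2\le C(1+t)^{-\frac34},\qquad \|u(\cdot,t)\|_{L^2(\mathbb R^3)}^2\le C(1+t)^{-\frac12}.$$ Here $C$ depends only on $\eta$ and the initial data $(u_0,d_0,w_0)$,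 and $C_p$ on these and on $p$. -/

import Mathlib

open MeasureTheory Filter Topology
open scoped ENNReal ContDiff

noncomputable section

namespace LiquidCrystal

/-- Euclidean three-space. -/
abbrev E3 : Type := EuclideanSpace ℝ (Fin 3)

/-- The standard basis vector `e i`. -/
def e (i : Fin 3) : E3 := EuclideanSpace.single i 1

/-! ### Sobolev norms through weak derivatives -/

/-- `g` is the weak (distributional) partial derivative `∂_i f` on `ℝ³`. -/
def IsWeakPartial (i : Fin 3) (f g : E3 → E3) : Prop :=
  LocallyIntegrable f volume ∧ LocallyIntegrable g volume ∧
    ∀ φ : E3 → ℝ, ContDiff ℝ ∞ φ → HasCompactSupport φ →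
      ∫ x, (fderiv ℝ φ x (e i)) • f x = - ∫ x, φ x • g x

/-- The squared norm of `H^k(ℝ³)`:
`‖f‖²_{H^{k+1}} = ‖f‖²_{L²} + ∑ i, ‖∂_i f‖²_{H^k}`, with weak derivatives. Weak derivatives are
unique up to null sets, so the infimum only selects one; it is `∞` if there is none. -/
def sobolevSq : ℕ → (E3 → E3) → ℝ≥0∞
  | 0, f => eLpNorm f 2 volume ^ 2
  | k + 1, f => eLpNorm f 2 volume ^ 2 +
      ∑ i : Fin 3, ⨅ (g : E3 → E3) (_ : IsWeakPartial i f g), sobolevSq k g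

/-- `f ∈ H^k(ℝ³; ℝ³)`. -/
def MemH (k : ℕ) (f : E3 → E3) : Prop :=
  AEStronglyMeasurable f volume ∧ sobolevSq k f < ⊤

/-! ### Differential operators -/

/-- The partial derivative `∂_i v`. -/
def partialD (i : Fin 3) (v : E3 → E3) (x : E3) : E3 := fderiv ℝ v x (e i)

/-- The divergence `∇ · v`. -/
def divergence (v : E3 → E3) (x : E3) : ℝ := ∑ i : Fin 3, (partialD i v x) i

/-- The matrix `∇d ⊗ ∇d`, with entries `∂_i d · ∂_j d`. -/
def stress (d : E3 → E3) (i j : Fin 3) (x : E3) : ℝ :=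
  inner ℝ (partialD i d x) (partialD j d x)

/-- The vector `∇ · (∇d ⊗ ∇d)`, whose `j`-th component is `∑ i, ∂_i (∂_i d · ∂_j d)`. -/
def divStress (d : E3 → E3) (x : E3) : E3 :=
  WithLp.toLp 2 fun j => ∑ i : Fin 3, fderiv ℝ (stress d i j) x (e i)

/-- The Ginzburg-Landau force `f(d) = η⁻² (|d|² - 1) d`. -/
def glForce (η : ℝ) (d : E3) : E3 := ((1 / η ^ 2) * (‖d‖ ^ 2 - 1)) • d

/-! ### Initial data and solutions -/

/-- The initial data: `∇ · u₀ = 0` (weakly), `|d₀| = 1`, `u₀ ∈ H¹`, `d₀ - w₀ ∈ H² ∩ L¹`,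
for a unit vector `w₀`. -/
structure IsData (w₀ : E3) (u₀ d₀ : E3 → E3) : Prop where
  norm_w₀ : ‖w₀‖ = 1
  u₀_mem : MemH 1 u₀
  u₀_div : ∀ φ : E3 → ℝ, ContDiff ℝ ∞ φ → HasCompactSupport φ →
    ∫ x, inner ℝ (u₀ x) (gradient φ x) = 0
  d₀_norm : ∀ᵐ x, ‖d₀ x‖ = 1
  d₀_mem : MemH 2 (fun x => d₀ x - w₀)
  d₀_L1 : MemLp (fun x => d₀ x - w₀) 1 volume

/-- `v` is of class `C^{1,2}` on `(0,∞) × ℝ³`: the derivatives `∂_t v`, `D_x v`, `D_x² v` exist and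
are continuous in `(t,x)`. -/
structure IsC12 (v : ℝ → E3 → E3) : Prop where
  diff_time : ∀ t, 0 < t → ∀ x, DifferentiableAt ℝ (fun s => v s x) t
  diff_space : ∀ t, 0 < t → ContDiff ℝ 2 (v t)
  cont : ContinuousOn (fun q : ℝ × E3 => v q.1 q.2) (Set.Ioi 0 ×ˢ Set.univ)
  cont_time : ContinuousOn (fun q : ℝ × E3 => deriv (fun s => v s q.2) q.1)
    (Set.Ioi 0 ×ˢ Set.univ)
  cont_fderiv : ContinuousOn (fun q : ℝ × E3 => fderiv ℝ (v q.1) q.2) (Set.Ioi 0 ×ˢ Set.univ)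
  cont_fderiv2 : ContinuousOn (fun q : ℝ × E3 => fderiv ℝ (fderiv ℝ (v q.1)) q.2)
    (Set.Ioi 0 ×ˢ Set.univ)

/-- `(u, π, d)` is a global classical solution of the liquid crystal system
`u_t + u·∇u + ∇π = Δu - ∇·(∇d ⊗ ∇d)`, `d_t + u·∇d = Δd - f(d)`, `∇·u = 0` on `(0,∞) × ℝ³`
with initial data `(u₀, d₀)` (attained in `L²`), in the energy class: for every `T > 0`,
`u ∈ L^∞(0,T;H¹) ∩ L²(0,T;H²)` and `d - w₀ ∈ L^∞(0,T;H²) ∩ L²(0,T;H³)`. -/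
structure IsSolution (η : ℝ) (w₀ : E3) (u₀ d₀ : E3 → E3)
    (u : ℝ → E3 → E3) (π : ℝ → E3 → ℝ) (d : ℝ → E3 → E3) : Prop where
  u_reg : IsC12 u
  d_reg : IsC12 d
  π_diff : ∀ t, 0 < t → ContDiff ℝ 1 (π t)
  π_cont : ContinuousOn (fun q : ℝ × E3 => gradient (π q.1) q.2) (Set.Ioi 0 ×ˢ Set.univ)
  momentum : ∀ t, 0 < t → ∀ x,
    deriv (fun s => u s x) t + fderiv ℝ (u t) x (u t x) + gradient (π t) x
      = Laplacian.laplacian (u t) x - divStress (d t) x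
  director : ∀ t, 0 < t → ∀ x,
    deriv (fun s => d s x) t + fderiv ℝ (d t) x (u t x)
      = Laplacian.laplacian (d t) x - glForce η (d t x)
  incompressible : ∀ t, 0 < t → ∀ x, divergence (u t) x = 0
  u_initial : Tendsto (fun t => eLpNorm (fun x => u t x - u₀ x) 2 volume) (𝓝[>] 0) (𝓝 0)
  d_initial : Tendsto (fun t => eLpNorm (fun x => d t x - d₀ x) 2 volume) (𝓝[>] 0) (𝓝 0)
  u_bound : ∀ T : ℝ, 0 < T → ∃ M : ℝ, ∀ t ∈ Set.Ioo 0 T, sobolevSq 1 (u t) ≤ ENNReal.ofReal M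
  d_bound : ∀ T : ℝ, 0 < T → ∃ M : ℝ, ∀ t ∈ Set.Ioo 0 T,
    sobolevSq 2 (fun x => d t x - w₀) ≤ ENNReal.ofReal M
  u_dissipation : ∀ T : ℝ, 0 < T → ∫⁻ t in Set.Ioo 0 T, sobolevSq 2 (u t) < ⊤
  d_dissipation : ∀ T : ℝ, 0 < T → ∫⁻ t in Set.Ioo 0 T, sobolevSq 3 (fun x => d t x - w₀) < ⊤

end LiquidCrystal

end

/-! Write h = |d - w₀| and ρ = |d|² - 1. The Ginzburg-Landau term acts on h only through 2 (d -
w₀)·f(d) = η⁻² (ρ² + ρ h²), which is bounded below by -η⁻² h⁴ / 4. Since u is solenoidal, suitable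
functions of |d - c|² are subsolutions of a transport-diffusion equation whose drift disappears on
integration over ℝ³ (`transport_le`, `transport_zero_le`). The first consequence is |d| ≤ 1
(`IsSolution.norm_le_one`), hence h ≤ 2.

Director. In L² the source is of order ∫ h⁴ ≤ C ‖h‖₂^(4/3) ‖∇d‖₂², which the diffusion absorbs when
‖d₀ - w₀‖₂ is small; a continuation argument keeps it small (`IsSolution.sqDist_dissipation`). In L¹
the source is of order ∫ h³ ≤ C (∫ h)^(1/2) ‖∇d‖₂², and ‖∇d‖₂² is integrable in time, so the L¹ norm
stays bounded (`IsSolution.exists_lintegral_norm_le`). Nash's inequality turns dissipation plus an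
L¹ bound into algebraic decay (`decay_of_nash`): first ‖h‖₂² = O(t^(-3/2)), then, applied to the
powers h^(2l), decay in L^(4l) from decay in L^(2l) (`IsSolution.exists_decay_double`).
Interpolation with L¹ gives every finite p.

Velocity. The energy E = ‖u‖² + ‖∇d‖² + potential dissipates 2 ‖∇u‖² (`IsSolution.energy_sub_le`),
and the director part of E is already integrable in time with weight 1 + t. The velocity part is
treated by Fourier splitting carried out in physical space: with A the mollification at radius R =
√((1 + t) / 2), ‖u‖² ≤ (1 + t) ‖∇u‖² + 2 ‖A u‖². The first term is absorbed by the dissipation. The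
second grows only through the quadratic nonlinearities, tested against A²u, whose gradient is at
most C R^(-5/2) ‖u‖₂. Thus E = O(t^(-a)) improves to E = O(t^(-(1/4 + 3a/2))) as long as 3a/2 < 1
(`EnergyDecay.improve`); three rounds from a = 0 pass the exponent 3/4, which contains both
remaining bounds.

Regularity. Neither ∇π nor ∂ₜu is known to lie in L². The time integral of ∇π does lie in L² and is
a gradient, hence orthogonal to solenoidal fields (`integral_inner_gradient_eq_zero`). Quadratic
energies are not differentiated in time: their increments are bounded by convexity and the partition
is refined (`sub_le_setIntegral_diag`). All constants in the decay statements are chosen before the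
solution, so that they depend on η and the data only. -/

namespace LiquidCrystal

/-! ### Sobolev norms of smooth fields through classical derivatives. -/

/-- The squared `L²` norm, as a lower integral. -/
noncomputable def nsq (f : E3 → E3) : ℝ≥0∞ := ∫⁻ x, ‖f x‖ₑ ^ 2

/-- The squared `L²` norm of the gradient. -/
noncomputable def gsq (f : E3 → E3) : ℝ≥0∞ := ∑ i : Fin 3, nsq (partialD i f)

lemma eLpNorm_two_sq (f : E3 → E3) : eLpNorm f 2 volume ^ 2 = nsq f := by
  rw [eLpNorm_eq_lintegral_rpow_enorm_toReal (by norm_num) (by norm_num), nsq]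
  rw [← ENNReal.rpow_natCast, ← ENNReal.rpow_mul]
  norm_num

lemma continuous_partialD {f : E3 → E3} (hf : ContDiff ℝ 1 f) (i : Fin 3) :
    Continuous (partialD i f) :=
  (hf.continuous_fderiv one_ne_zero).clm_apply continuous_const

lemma contDiff_partialD {f : E3 → E3} {n : ℕ} (hf : ContDiff ℝ (n + 1) f) (i : Fin 3) :
    ContDiff ℝ n (partialD i f) :=
  (hf.fderiv_right (m := n) le_rfl).clm_apply contDiff_const

lemma isWeakPartial_partialD {f : E3 → E3} (hf : ContDiff ℝ 1 f) (i : Fin 3) :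
    IsWeakPartial i f (partialD i f) := by
  have hc := continuous_partialD hf i
  refine ⟨hf.continuous.locallyIntegrable, hc.locallyIntegrable, fun φ hφ hs => ?_⟩
  have hφ1 : ContDiff ℝ 1 φ := hφ.of_le (by exact_mod_cast le_top)
  have hd : Continuous fun x => fderiv ℝ φ x (e i) :=
    (hφ1.continuous_fderiv one_ne_zero).clm_apply continuous_const
  have hds : HasCompactSupport fun x => fderiv ℝ φ x (e i) := hs.fderiv_apply ℝ (e i)
  have := integral_smul_fderiv_eq_neg_fderiv_smul_of_integrable (μ := (volume : Measure E3))
    (f := φ) (g := f) (v := e i)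
    ((hd.smul hf.continuous).integrable_of_hasCompactSupport hds.smul_right)
    ((hφ1.continuous.smul hc).integrable_of_hasCompactSupport hs.smul_right)
    ((hφ1.continuous.smul hf.continuous).integrable_of_hasCompactSupport hs.smul_right)
    (fun x _ => hφ1.differentiable one_ne_zero x) (fun x _ => hf.differentiable one_ne_zero x)
  rw [eq_neg_iff_add_eq_zero, add_comm, ← eq_neg_iff_add_eq_zero]
  exact this

lemma IsWeakPartial.ae_eq {i : Fin 3} {f g g' : E3 → E3} (h : IsWeakPartial i f g)
    (h' : IsWeakPartial i f g') : g =ᵐ[volume] g' := by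
  refine ae_eq_of_integral_contDiff_smul_eq h.2.1 h'.2.1 fun φ hφ hs => ?_
  have h1 := h.2.2 φ hφ hs
  rw [h'.2.2 φ hφ hs] at h1
  exact (neg_injective h1).symm

lemma IsWeakPartial.congr_left {i : Fin 3} {f f' g : E3 → E3} (h : IsWeakPartial i f g)
    (hf : f =ᵐ[volume] f') : IsWeakPartial i f' g := by
  refine ⟨h.1.congr hf, h.2.1, fun φ hφ hs => ?_⟩
  rw [← h.2.2 φ hφ hs]
  refine integral_congr_ae ?_
  filter_upwards [hf] with x hx
  rw [hx]

lemma sobolevSq_congr (k : ℕ) {f f' : E3 → E3} (hf : f =ᵐ[volume] f') :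
    sobolevSq k f = sobolevSq k f' := by
  cases k with
  | zero => simp only [sobolevSq, eLpNorm_congr_ae hf]
  | succ k =>
    simp only [sobolevSq, eLpNorm_congr_ae hf]
    congr 1
    refine Finset.sum_congr rfl fun i _ => iInf_congr fun g => ?_
    exact iInf_congr_Prop ⟨fun h => h.congr_left hf, fun h => h.congr_left hf.symm⟩ fun _ => rfl

/-- Weak derivatives are unique up to null sets, so every competitor in the infimum has the same
norm as the classical partial derivative. Through this identity the hypotheses on solutions become
bounds on integrals of classical derivatives. -/
lemma sobolevSq_succ {f : E3 → E3} (k : ℕ) (hf : ContDiff ℝ 1 f) :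
    sobolevSq (k + 1) f = nsq f + ∑ i, sobolevSq k (partialD i f) := by
  simp only [sobolevSq, eLpNorm_two_sq]
  congr 1
  refine Finset.sum_congr rfl fun i _ => le_antisymm ?_ ?_
  · exact iInf₂_le _ (isWeakPartial_partialD hf i)
  · exact le_iInf₂ fun g hg =>
      (sobolevSq_congr k ((isWeakPartial_partialD hf i).ae_eq hg)).le

lemma sobolevSq_zero (f : E3 → E3) : sobolevSq 0 f = nsq f := by
  simp only [sobolevSq, eLpNorm_two_sq]

lemma nsq_le_sobolevSq (k : ℕ) (f : E3 → E3) : nsq f ≤ sobolevSq k f := by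
  cases k with
  | zero => exact (sobolevSq_zero f).ge
  | succ k => simp only [sobolevSq, eLpNorm_two_sq]; exact le_self_add

lemma gsq_le_sobolevSq (k : ℕ) {f : E3 → E3} (hf : ContDiff ℝ 1 f) :
    gsq f ≤ sobolevSq (k + 1) f := by
  rw [sobolevSq_succ k hf]
  exact (Finset.sum_le_sum fun i _ => nsq_le_sobolevSq k _).trans le_add_self

lemma sobolevSq_partialD_le (k : ℕ) {f : E3 → E3} (hf : ContDiff ℝ 1 f) (i : Fin 3) :
    sobolevSq k (partialD i f) ≤ sobolevSq (k + 1) f := by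
  rw [sobolevSq_succ k hf]
  exact (Finset.single_le_sum (f := fun i => sobolevSq k (partialD i f))
    (fun _ _ => zero_le) (Finset.mem_univ i)).trans le_add_self

lemma partialD_sub_const (f : E3 → E3) (c : E3) (i : Fin 3) :
    partialD i (fun x => f x - c) = partialD i f := by
  ext1 x; simp [partialD, fderiv_sub_const]

lemma laplacian_eq_sum (f : E3 → E3) (x : E3) :
    Laplacian.laplacian f x = ∑ i, fderiv ℝ (fderiv ℝ f) x (e i) (e i) := by
  rw [InnerProductSpace.laplacian_eq_iteratedFDeriv_orthonormalBasis f
    (EuclideanSpace.basisFun (Fin 3) ℝ)]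
  simp [iteratedFDeriv_two_apply, e]

lemma partialD_partialD {f : E3 → E3} (hf : ContDiff ℝ 2 f) (i j : Fin 3) (x : E3) :
    partialD i (partialD j f) x = fderiv ℝ (fderiv ℝ f) x (e i) (e j) := by
  have h : DifferentiableAt ℝ (fderiv ℝ f) x :=
    ((hf.fderiv_right (m := 1) (by norm_num)).differentiable one_ne_zero) x
  unfold partialD
  rw [fderiv_clm_apply h (differentiableAt_const _)]
  simp

lemma partialD_comm {f : E3 → E3} (hf : ContDiff ℝ 2 f) (i j : Fin 3) (x : E3) :
    partialD i (partialD j f) x = partialD j (partialD i f) x := by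
  rw [partialD_partialD hf, partialD_partialD hf]
  exact (hf.contDiffAt.isSymmSndFDerivAt (by simp)) (e i) (e j)

lemma laplacian_eq_sum_partialD {f : E3 → E3} (hf : ContDiff ℝ 2 f) (x : E3) :
    Laplacian.laplacian f x = ∑ i, partialD i (partialD i f) x := by
  rw [laplacian_eq_sum]; simp only [partialD_partialD hf]

end LiquidCrystal

/-! ### Hölder-type inequalities for lower integrals, and convolution of nonnegative functions. -/

namespace LiquidCrystal

section Holder

variable {α : Type*} [MeasurableSpace α] {μ : Measure α}

lemma lintegral_mul_sq_le {f g : α → ℝ≥0∞} (hf : AEMeasurable f μ) (hg : AEMeasurable g μ) :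
    (∫⁻ a, f a * g a ∂μ) ^ 2 ≤ (∫⁻ a, f a ^ 2 ∂μ) * ∫⁻ a, g a ^ 2 ∂μ := by
  have h := ENNReal.lintegral_mul_le_Lp_mul_Lq μ Real.HolderConjugate.two_two hf hg
  have h2 := pow_le_pow_left₀ zero_le h 2
  simp only [Pi.mul_apply] at h2
  refine h2.trans (le_of_eq ?_)
  rw [mul_pow, ← ENNReal.rpow_natCast, ← ENNReal.rpow_natCast, ← ENNReal.rpow_mul,
    ← ENNReal.rpow_mul]
  norm_num

/-- Cauchy-Schwarz after splitting k f = k^(1/2) · (k^(1/2) f); when k has mass one this is Jensen's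
inequality for the square. -/
lemma lintegral_mul_sq_le_weighted {k f : α → ℝ≥0∞} (hk : AEMeasurable k μ)
    (hf : AEMeasurable f μ) :
    (∫⁻ a, k a * f a ∂μ) ^ 2 ≤ (∫⁻ a, k a ∂μ) * ∫⁻ a, k a * f a ^ 2 ∂μ := by
  have h := lintegral_mul_sq_le (hk.pow_const (1 / 2 : ℝ)) ((hk.pow_const (1 / 2 : ℝ)).mul hf)
  have hsq : ∀ x : ℝ≥0∞, x ^ (1 / 2 : ℝ) * x ^ (1 / 2 : ℝ) = x := fun x => by
    rw [← ENNReal.rpow_add_of_nonneg _ _ (by norm_num) (by norm_num)]; norm_num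
  simp only [Pi.mul_apply, mul_pow, sq (_ ^ (1 / 2 : ℝ)), hsq, ← mul_assoc] at h
  exact h

/-- Hölder with exponents 3/2 and 3. The L³ factor is later made small, while the L⁶ factor is
handed to the Sobolev inequality. -/
lemma lintegral_sq_mul_sq_le {f g : α → ℝ≥0∞} (hf : AEMeasurable f μ) (hg : AEMeasurable g μ) :
    ∫⁻ a, f a ^ 2 * g a ^ 2 ∂μ
      ≤ (∫⁻ a, f a ^ 3 ∂μ) ^ (2 / 3 : ℝ) * (∫⁻ a, g a ^ 6 ∂μ) ^ (1 / 3 : ℝ) := by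
  have hpq : (3 / 2 : ℝ).HolderConjugate 3 := by
    rw [Real.holderConjugate_iff]; norm_num
  have h := ENNReal.lintegral_mul_le_Lp_mul_Lq μ hpq (hf.pow_const 2) (hg.pow_const 2)
  have e1 : ∀ x : ℝ≥0∞, (x ^ 2) ^ (3 / 2 : ℝ) = x ^ 3 := fun x => by
    rw [← ENNReal.rpow_natCast, ← ENNReal.rpow_natCast, ← ENNReal.rpow_mul]; norm_num
  have e2 : ∀ x : ℝ≥0∞, (x ^ 2) ^ (3 : ℝ) = x ^ 6 := fun x => by
    rw [← ENNReal.rpow_natCast, ← ENNReal.rpow_natCast, ← ENNReal.rpow_mul]; norm_num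
  simp only [Pi.mul_apply, e1, e2] at h
  refine h.trans (le_of_eq ?_)
  norm_num

lemma lintegral_pow_four_mul_sq_le {f g : α → ℝ≥0∞} (hf : AEMeasurable f μ)
    (hg : AEMeasurable g μ) :
    ∫⁻ a, f a ^ 4 * g a ^ 2 ∂μ
      ≤ (∫⁻ a, f a ^ 6 ∂μ) ^ (2 / 3 : ℝ) * (∫⁻ a, g a ^ 6 ∂μ) ^ (1 / 3 : ℝ) := by
  have h := lintegral_sq_mul_sq_le (hf.pow_const 2) hg
  simpa only [← pow_mul, Nat.reduceMul] using h

lemma lintegral_pow_four_sq_le {f : α → ℝ≥0∞} (hf : AEMeasurable f μ) :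
    (∫⁻ a, f a ^ 4 ∂μ) ^ 2 ≤ (∫⁻ a, f a ^ 2 ∂μ) * ∫⁻ a, f a ^ 6 ∂μ := by
  have h := lintegral_mul_sq_le hf (hf.pow_const 3)
  simpa only [← pow_mul, ← pow_succ', Nat.reduceMul, Nat.reduceAdd] using h

/-- `∫ f² g² ≤ a b` when `‖f‖₆² ≤ a`, `‖g‖₆² ≤ B`, `∫ g² ≤ C` and `B C ≤ b²`. -/
lemma lintegral_sq_mul_sq_le_of_six {f g : α → ℝ≥0∞} (hf : AEMeasurable f μ)
    (hg : AEMeasurable g μ) {a B C : ℝ≥0∞} (h1 : ∫⁻ x, f x ^ 6 ∂μ ≤ a ^ 3)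
    (h2 : ∫⁻ x, g x ^ 6 ∂μ ≤ B ^ 3) (h3 : ∫⁻ x, g x ^ 2 ∂μ ≤ C) :
    (∫⁻ x, f x ^ 2 * g x ^ 2 ∂μ) ^ 2 ≤ a ^ 2 * B * C := by
  -- The product is split as (f² g) · g, so that only one power of the top-order quantity B appears
  -- in the bound for the square.
  have h4 := lintegral_mul_sq_le ((hf.pow_const 2).mul hg) hg
  have h5 := lintegral_pow_four_mul_sq_le hf hg
  have e : ∀ (x : ℝ≥0∞) (r : ℝ), (x ^ 3) ^ r = x ^ (3 * r) := fun x r => by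
    rw [← ENNReal.rpow_natCast, ← ENNReal.rpow_mul]; norm_num
  calc (∫⁻ x, f x ^ 2 * g x ^ 2 ∂μ) ^ 2
      = (∫⁻ x, (f x ^ 2 * g x) * g x ∂μ) ^ 2 := by
        congr 2; ext x; ring
    _ ≤ (∫⁻ x, f x ^ 4 * g x ^ 2 ∂μ) * ∫⁻ x, g x ^ 2 ∂μ := by
        refine h4.trans (le_of_eq ?_)
        congr 2; ext x; simp only [Pi.mul_apply]; ring
    _ ≤ (a ^ 2 * B) * C := by
        refine mul_le_mul' (h5.trans ?_) h3
        refine (mul_le_mul' (ENNReal.rpow_le_rpow h1 (by norm_num))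
          (ENNReal.rpow_le_rpow h2 (by norm_num))).trans (le_of_eq ?_)
        rw [e, e]; norm_num
        
end Holder

section LConv

/-- Convolution of nonnegative functions. -/
noncomputable def lconv (a b : E3 → ℝ≥0∞) (x : E3) : ℝ≥0∞ := ∫⁻ y, a y * b (x - y)

lemma lconv_comm (a b : E3 → ℝ≥0∞) : lconv a b = lconv b a := by
  ext x
  unfold lconv
  rw [← lintegral_sub_left_eq_self _ x]
  simp only [sub_sub_cancel]
  simp only [mul_comm]

lemma aemeasurable_lconv_integrand {a b : E3 → ℝ≥0∞} (ha : AEMeasurable a volume)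
    (hb : AEMeasurable b volume) :
    AEMeasurable (fun p : E3 × E3 => a p.2 * b (p.1 - p.2)) (volume.prod volume) := by
  refine AEMeasurable.mul (ha.comp_quasiMeasurePreserving Measure.quasiMeasurePreserving_snd) ?_
  exact hb.comp_quasiMeasurePreserving
    (quasiMeasurePreserving_sub_of_right_invariant (volume : Measure E3) (volume : Measure E3))

lemma aemeasurable_lconv_slice {b : E3 → ℝ≥0∞} (hb : AEMeasurable b volume) (x : E3) :
    AEMeasurable (fun y => b (x - y)) volume :=
  hb.comp_quasiMeasurePreserving
    (quasiMeasurePreserving_sub_left_of_right_invariant (volume : Measure E3) x)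

lemma lintegral_lconv {a b : E3 → ℝ≥0∞} (ha : AEMeasurable a volume)
    (hb : AEMeasurable b volume) : ∫⁻ x, lconv a b x = (∫⁻ x, a x) * ∫⁻ x, b x := by
  unfold lconv
  rw [lintegral_lintegral_swap (aemeasurable_lconv_integrand ha hb)]
  have h : ∀ y, ∫⁻ x, a y * b (x - y) = a y * ∫⁻ x, b x := fun y => by
    have hm : AEMeasurable (fun x => b (x - y)) volume := hb.comp_quasiMeasurePreserving
      (measurePreserving_sub_right volume y).quasiMeasurePreserving
    rw [lintegral_const_mul'' _ hm]
    rw [lintegral_sub_right_eq_self b y]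
  simp only [h]
  rw [lintegral_mul_const'' _ ha]

/-- Young's inequality `‖a * b‖₂ ≤ ‖a‖₁ ‖b‖₂`. -/
lemma lintegral_lconv_sq_le {a b : E3 → ℝ≥0∞} (ha : AEMeasurable a volume)
    (hb : AEMeasurable b volume) :
    ∫⁻ x, lconv a b x ^ 2 ≤ (∫⁻ x, a x) ^ 2 * ∫⁻ x, b x ^ 2 := by
  have h1 : ∀ x, lconv a b x ^ 2 ≤ (∫⁻ y, a y) * lconv a (fun z => b z ^ 2) x := fun x =>
    lintegral_mul_sq_le_weighted ha (aemeasurable_lconv_slice hb x)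
  refine (lintegral_mono h1).trans ?_
  have hm : AEMeasurable (lconv a fun z => b z ^ 2) volume :=
    (aemeasurable_lconv_integrand ha (hb.pow_const 2)).lintegral_prod_right'
  rw [lintegral_const_mul'' _ hm, lintegral_lconv ha (hb.pow_const 2), sq, mul_assoc]

lemma lconv_sq_le {a b : E3 → ℝ≥0∞} (ha : AEMeasurable a volume)
    (hb : AEMeasurable b volume) (x : E3) :
    lconv a b x ^ 2 ≤ (∫⁻ x, a x ^ 2) * ∫⁻ x, b x ^ 2 := by
  refine (lintegral_mul_sq_le ha (aemeasurable_lconv_slice hb x)).trans (le_of_eq ?_)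
  rw [lintegral_sub_left_eq_self (fun z => b z ^ 2) x]

lemma lintegral_comp_smul_E3 (f : E3 → ℝ≥0∞) {r : ℝ} (hr : 0 < r) :
    ∫⁻ x, f (r • x) = ENNReal.ofReal (r⁻¹ ^ 3) * ∫⁻ x, f x := by
  have h := Measure.map_addHaar_smul (volume : Measure E3) hr.ne'
  have hemb : MeasurableEmbedding (fun x : E3 => r • x) :=
    (Homeomorph.smulOfNeZero r hr.ne').measurableEmbedding
  rw [← hemb.lintegral_map f, h, lintegral_smul_measure]
  have hd : Module.finrank ℝ E3 = 3 := by simp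
  rw [hd, abs_of_pos (by positivity), inv_pow]
  rfl

end LConv

end LiquidCrystal

/-! ### Convolution of a scalar kernel with a vector field, and the mollifier at scale `R`. -/

namespace LiquidCrystal

/-- Convolution of a scalar kernel with a vector field. -/
noncomputable def conv (k : E3 → ℝ) (f : E3 → E3) (x : E3) : E3 := ∫ y, k y • f (x - y)

lemma conv_eq (k : E3 → ℝ) (f : E3 → E3) :
    conv k f = convolution k f (ContinuousLinearMap.lsmul ℝ ℝ) volume := rfl

section

variable {k : E3 → ℝ} {f g : E3 → E3}

lemma contDiff_conv (hk : ContDiff ℝ ∞ k) (hs : HasCompactSupport k)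
    (hf : LocallyIntegrable f volume) : ContDiff ℝ ∞ (conv k f) := by
  rw [conv_eq]
  exact hs.contDiff_convolution_left _ hk hf

lemma contDiff_one_of_top {F : Type*} [NormedAddCommGroup F] [NormedSpace ℝ F] {k : E3 → F}
    (hk : ContDiff ℝ ∞ k) : ContDiff ℝ 1 k :=
  hk.of_le (by exact_mod_cast le_top)

lemma partialD_conv (hk : ContDiff ℝ ∞ k) (hs : HasCompactSupport k)
    (hf : LocallyIntegrable f volume) (i : Fin 3) :
    partialD i (conv k f) = conv (fun y => fderiv ℝ k y (e i)) f := by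
  ext1 x
  have hk1 := contDiff_one_of_top hk
  have h := hs.hasFDerivAt_convolution_left (ContinuousLinearMap.lsmul ℝ ℝ) hk1 hf x
  have hex : ConvolutionExistsAt (fderiv ℝ k) f x
      ((ContinuousLinearMap.lsmul ℝ ℝ : ℝ →L[ℝ] E3 →L[ℝ] E3).precompL E3) volume :=
    (hs.fderiv ℝ).convolutionExists_left _ (hk1.continuous_fderiv one_ne_zero) hf x
  unfold partialD
  rw [conv_eq, h.fderiv, convolution_def, ContinuousLinearMap.integral_apply hex]
  rfl

lemma contDiff_fderiv_apply (hk : ContDiff ℝ ∞ k) (v : E3) :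
    ContDiff ℝ ∞ (fun y => fderiv ℝ k y v) :=
  (hk.fderiv_right (m := ∞) (by simp)).clm_apply contDiff_const

/-- The weak derivative is tested against z ↦ k (x - z); the sign from the chain rule cancels the
sign in the definition of weak derivative. -/
lemma conv_partial_eq (hk : ContDiff ℝ ∞ k) (hs : HasCompactSupport k) {i : Fin 3}
    (hfg : IsWeakPartial i f g) : conv (fun y => fderiv ℝ k y (e i)) f = conv k g := by
  ext1 x
  have hφ : ContDiff ℝ ∞ (fun z => k (x - z)) := hk.comp (contDiff_const.sub contDiff_id)
  have hφs : HasCompactSupport (fun z => k (x - z)) :=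
    hs.comp_homeomorph (Homeomorph.subLeft x)
  have h := hfg.2.2 _ hφ hφs
  have hd : ∀ z, fderiv ℝ (fun z => k (x - z)) z (e i) = - fderiv ℝ k (x - z) (e i) := by
    intro z
    have h1 : HasFDerivAt (fun z : E3 => x - z) (-ContinuousLinearMap.id ℝ E3) z := by
      exact (hasFDerivAt_id z).const_sub x
    have h2 : HasFDerivAt k (fderiv ℝ k (x - z)) (x - z) :=
      ((contDiff_one_of_top hk).differentiable one_ne_zero _).hasFDerivAt
    have h3 : HasFDerivAt (fun z => k (x - z))
        ((fderiv ℝ k (x - z)).comp (-ContinuousLinearMap.id ℝ E3)) z := h2.comp z h1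
    rw [h3.fderiv]
    simp
  simp only [hd, neg_smul, integral_neg, neg_inj] at h
  unfold conv
  rw [← integral_sub_left_eq_self _ volume x, ← integral_sub_left_eq_self (fun y => k y • _) volume x]
  simpa only [sub_sub_cancel] using h

lemma enorm_conv_le (k : E3 → ℝ) (f : E3 → E3) (x : E3) :
    ‖conv k f x‖ₑ ≤ lconv (fun y => ‖k y‖ₑ) (fun y => ‖f y‖ₑ) x := by
  refine (enorm_integral_le_lintegral_enorm _).trans (le_of_eq ?_)
  simp only [enorm_smul]; rfl

lemma nsq_conv_le (hk : Continuous k) (hf : AEStronglyMeasurable f volume) :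
    nsq (conv k f) ≤ (∫⁻ y, ‖k y‖ₑ) ^ 2 * nsq f :=
  (lintegral_mono fun x => pow_le_pow_left₀ zero_le (enorm_conv_le k f x) 2).trans
    (lintegral_lconv_sq_le hk.enorm.aemeasurable hf.enorm)

lemma nsq_conv_le_L1 (hk : Continuous k) (hf : AEStronglyMeasurable f volume) :
    nsq (conv k f) ≤ (∫⁻ y, ‖f y‖ₑ) ^ 2 * ∫⁻ y, ‖k y‖ₑ ^ 2 := by
  refine (lintegral_mono fun x => pow_le_pow_left₀ zero_le (enorm_conv_le k f x) 2).trans ?_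
  rw [lconv_comm]
  exact lintegral_lconv_sq_le hf.enorm hk.enorm.aemeasurable

lemma enorm_conv_sq_le (hk : Continuous k) (hf : AEStronglyMeasurable f volume) (x : E3) :
    ‖conv k f x‖ₑ ^ 2 ≤ (∫⁻ y, ‖k y‖ₑ ^ 2) * nsq f :=
  (pow_le_pow_left₀ zero_le (enorm_conv_le k f x) 2).trans
    (lconv_sq_le hk.enorm.aemeasurable hf.enorm x)

lemma conv_sub (hk : Continuous k) (hs : HasCompactSupport k) (hf : LocallyIntegrable f volume)
    (hg : LocallyIntegrable g volume) (x : E3) :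
    conv k (fun y => f y - g y) x = conv k f x - conv k g x := by
  unfold conv
  simp only [smul_sub]
  exact integral_sub
    (hs.convolutionExists_left (ContinuousLinearMap.lsmul ℝ ℝ : ℝ →L[ℝ] E3 →L[ℝ] E3) hk hf x)
    (hs.convolutionExists_left (ContinuousLinearMap.lsmul ℝ ℝ : ℝ →L[ℝ] E3 →L[ℝ] E3) hk hg x)

lemma memLp_two_iff_nsq : MemLp f 2 volume ↔ AEStronglyMeasurable f volume ∧ nsq f < ⊤ := by
  unfold MemLp
  rw [← eLpNorm_two_sq]
  simp

lemma locallyIntegrable_of_memLp_two (hf : MemLp f 2 volume) : LocallyIntegrable f volume :=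
  hf.locallyIntegrable (by norm_num)

lemma memLp_conv (hk : Continuous k) (hs : HasCompactSupport k) (hf : MemLp f 2 volume) :
    MemLp (conv k f) 2 volume := by
  have hc : Continuous (conv k f) := by
    rw [conv_eq]
    exact hs.continuous_convolution_left _ hk (locallyIntegrable_of_memLp_two hf)
  refine memLp_two_iff_nsq.2 ⟨hc.aestronglyMeasurable, (nsq_conv_le hk hf.1).trans_lt ?_⟩
  have hk1 : ∫⁻ y, ‖k y‖ₑ < ⊤ := (hk.integrable_of_hasCompactSupport hs).2
  exact ENNReal.mul_lt_top (ENNReal.pow_lt_top hk1) (memLp_two_iff_nsq.1 hf).2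

/-- Evenness of the kernel makes convolution self-adjoint on L². Fubini is justified by Young's
inequality for |k| * |f| followed by Cauchy-Schwarz against |g|. -/
lemma integral_inner_conv (hk : Continuous k) (hs : HasCompactSupport k)
    (heven : ∀ y, k (-y) = k y) (hf : MemLp f 2 volume) (hg : MemLp g 2 volume) :
    ∫ x, inner ℝ (conv k f x) (g x) = ∫ x, inner ℝ (f x) (conv k g x) := by
  have hfi := locallyIntegrable_of_memLp_two hf
  have hgi := locallyIntegrable_of_memLp_two hg
  have hexf : ∀ x, Integrable (fun y => k y • f (x - y)) volume := fun x =>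
    hs.convolutionExists_left (ContinuousLinearMap.lsmul ℝ ℝ : ℝ →L[ℝ] E3 →L[ℝ] E3) hk hfi x
  have hexg : ∀ x, Integrable (fun y => k y • g (x - y)) volume := fun x =>
    hs.convolutionExists_left (ContinuousLinearMap.lsmul ℝ ℝ : ℝ →L[ℝ] E3 →L[ℝ] E3) hk hgi x
  have h1 : ∀ x, inner ℝ (conv k f x) (g x) = ∫ y, k (x - y) * inner ℝ (f y) (g x) := by
    intro x
    unfold conv
    rw [real_inner_comm, ← integral_inner (hexf x), ← integral_sub_left_eq_self _ volume x]
    simp only [sub_sub_cancel, inner_smul_right, real_inner_comm]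
  have h2 : ∀ y, inner ℝ (f y) (conv k g y) = ∫ x, k (x - y) * inner ℝ (f y) (g x) := by
    intro y
    unfold conv
    rw [← integral_inner (hexg y), ← integral_sub_left_eq_self _ volume y]
    refine integral_congr_ae (Eventually.of_forall fun x => ?_)
    simp only [sub_sub_cancel, inner_smul_right]
    rw [← heven (y - x), neg_sub]
  simp only [h1, h2]
  refine integral_integral_swap (f := fun x y => k (x - y) * inner ℝ (f y) (g x)) ?_
  have hm : AEStronglyMeasurable
      (Function.uncurry fun x y => k (x - y) * inner ℝ (f y) (g x)) (volume.prod volume) := by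
    refine AEStronglyMeasurable.mul ?_ ?_
    · exact (hk.comp (continuous_fst.sub continuous_snd)).aestronglyMeasurable
    · exact (hf.1.comp_quasiMeasurePreserving Measure.quasiMeasurePreserving_snd).inner
        (hg.1.comp_quasiMeasurePreserving Measure.quasiMeasurePreserving_fst)
  refine ⟨hm, ?_⟩
  unfold HasFiniteIntegral
  rw [lintegral_prod _ hm.enorm]
  have h3 : ∀ x, ∫⁻ y, ‖k (x - y) * inner ℝ (f y) (g x)‖ₑ
      ≤ lconv (fun y => ‖f y‖ₑ) (fun y => ‖k y‖ₑ) x * ‖g x‖ₑ := by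
    intro x
    unfold lconv
    have hmm : AEMeasurable (fun y => ‖f y‖ₑ * ‖k (x - y)‖ₑ) volume :=
      hf.1.enorm.mul (aemeasurable_lconv_slice hk.enorm.aemeasurable x)
    rw [← lintegral_mul_const'' _ hmm]
    refine lintegral_mono fun y => ?_
    rw [enorm_mul, mul_comm ‖f y‖ₑ, mul_assoc]
    gcongr
    rw [← ofReal_norm, ← ofReal_norm, ← ofReal_norm,
      ← ENNReal.ofReal_mul (norm_nonneg _)]
    exact ENNReal.ofReal_le_ofReal (norm_inner_le_norm _ _)
  refine (lintegral_mono h3).trans_lt ?_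
  have hlm : AEMeasurable (lconv (fun y => ‖f y‖ₑ) (fun y => ‖k y‖ₑ)) volume :=
    (aemeasurable_lconv_integrand hf.1.enorm hk.enorm.aemeasurable).lintegral_prod_right'
  have h4 := lintegral_mul_sq_le hlm hg.1.enorm
  have h5 : ∫⁻ x, lconv (fun y => ‖f y‖ₑ) (fun y => ‖k y‖ₑ) x ^ 2 < ⊤ := by
    rw [lconv_comm]
    refine (lintegral_lconv_sq_le hk.enorm.aemeasurable hf.1.enorm).trans_lt ?_
    exact ENNReal.mul_lt_top (ENNReal.pow_lt_top (hk.integrable_of_hasCompactSupport hs).2)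
      (memLp_two_iff_nsq.1 hf).2
  have h6 := h4.trans_lt (ENNReal.mul_lt_top h5 (memLp_two_iff_nsq.1 hg).2)
  exact (ENNReal.pow_lt_top_iff.1 h6).resolve_right (by norm_num)

end

/-! ### The standard mollifier at scale `R` -/

/-- A fixed smooth even probability density supported in the unit ball. -/
noncomputable def bump (x : E3) : ℝ :=
  ContDiffBump.normed (⟨1 / 2, 1, by norm_num, by norm_num⟩ : ContDiffBump (0 : E3)) volume x

/-- The density `bump` rescaled to the ball of radius `R`. -/
noncomputable def moll (R : ℝ) (x : E3) : ℝ := R⁻¹ ^ 3 * bump (R⁻¹ • x)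

lemma contDiff_bump : ContDiff ℝ ∞ bump := ContDiffBump.contDiff_normed _

lemma hasCompactSupport_bump : HasCompactSupport bump := ContDiffBump.hasCompactSupport_normed _

lemma contDiff_moll (R : ℝ) : ContDiff ℝ ∞ (moll R) :=
  contDiff_const.mul (contDiff_bump.comp (contDiff_const_smul _))

lemma continuous_moll (R : ℝ) : Continuous (moll R) := (contDiff_moll R).continuous

variable {R : ℝ}

lemma hasCompactSupport_moll (hR : 0 < R) : HasCompactSupport (moll R) :=
  (hasCompactSupport_bump.comp_homeomorph (Homeomorph.smulOfNeZero R⁻¹ (inv_ne_zero hR.ne'))).mul_left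

lemma moll_nonneg (hR : 0 < R) (x : E3) : 0 ≤ moll R x :=
  mul_nonneg (by positivity) (ContDiffBump.nonneg_normed _ _)

lemma moll_neg (x : E3) : moll R (-x) = moll R x := by
  unfold moll bump
  rw [smul_neg, ContDiffBump.normed_neg]

lemma moll_eq_zero (hR : 0 < R) {x : E3} (hx : R ≤ ‖x‖) : moll R x = 0 := by
  unfold moll bump
  have : R⁻¹ • x ∉ Function.support (ContDiffBump.normed
      (⟨1 / 2, 1, by norm_num, by norm_num⟩ : ContDiffBump (0 : E3)) volume) := by
    rw [ContDiffBump.support_normed_eq]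
    simp only [Metric.mem_ball, dist_zero_right, norm_smul, norm_inv, Real.norm_eq_abs,
      abs_of_pos hR, not_lt]
    rw [← div_eq_inv_mul, le_div_iff₀ hR]; simpa using hx
  rw [Function.notMem_support.1 this, mul_zero]

lemma integral_moll (hR : 0 < R) : ∫ x, moll R x = 1 := by
  unfold moll
  rw [integral_const_mul, Measure.integral_comp_smul]
  have hd : Module.finrank ℝ E3 = 3 := by simp
  have hb : ∫ x, bump x = 1 := ContDiffBump.integral_normed _
  rw [hd, hb, abs_of_pos (by positivity)]
  field_simp
  simp

lemma lintegral_moll (hR : 0 < R) : ∫⁻ x, ‖moll R x‖ₑ = 1 := by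
  have hi := (continuous_moll R).integrable_of_hasCompactSupport (hasCompactSupport_moll hR)
    (μ := volume)
  have h : ∀ x, ‖moll R x‖ₑ = ENNReal.ofReal (moll R x) := fun x =>
    Real.enorm_of_nonneg (moll_nonneg hR x)
  simp only [h]
  rw [← ofReal_integral_eq_lintegral_ofReal hi (Eventually.of_forall (moll_nonneg hR)),
    integral_moll hR, ENNReal.ofReal_one]

end LiquidCrystal

/-! ### Mollification errors and Nash's inequality. -/

namespace LiquidCrystal

variable {R : ℝ} {f g : E3 → E3}

/-- The density has height of order R⁻³ on a ball of volume of order R³, which gives R⁻⁶ · R³. Each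
derivative contributes a further factor R⁻² to the squared norm, hence the power 5 in the gradient
version. -/
lemma lintegral_moll_sq (hR : 0 < R) :
    ∫⁻ x, ‖moll R x‖ₑ ^ 2 = ENNReal.ofReal (R⁻¹ ^ 3) * ∫⁻ x, ‖bump x‖ₑ ^ 2 := by
  have h : ∀ x, ‖moll R x‖ₑ ^ 2 = ENNReal.ofReal (R⁻¹ ^ 6) * ‖bump (R⁻¹ • x)‖ₑ ^ 2 := fun x => by
    rw [moll, enorm_mul, mul_pow, Real.enorm_of_nonneg (by positivity),
      ← ENNReal.ofReal_pow (by positivity)]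
    ring_nf
  simp only [h]
  rw [lintegral_const_mul' _ _ ENNReal.ofReal_ne_top,
    lintegral_comp_smul_E3 (fun x => ‖bump x‖ₑ ^ 2) (inv_pos.2 hR), ← mul_assoc,
    ← ENNReal.ofReal_mul (by positivity)]
  congr 2
  field_simp

lemma fderiv_moll (x : E3) (i : Fin 3) :
    fderiv ℝ (moll R) x (e i) = R⁻¹ ^ 4 * fderiv ℝ bump (R⁻¹ • x) (e i) := by
  have h1 : HasFDerivAt bump (fderiv ℝ bump (R⁻¹ • x)) (R⁻¹ • x) :=
    ((contDiff_one_of_top contDiff_bump).differentiable one_ne_zero _).hasFDerivAt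
  have h2 : HasFDerivAt (fun x : E3 => R⁻¹ • x) (R⁻¹ • ContinuousLinearMap.id ℝ E3) x :=
    (hasFDerivAt_id x).const_smul R⁻¹
  have h3 : HasFDerivAt (fun x => R⁻¹ ^ 3 * bump (R⁻¹ • x))
      (R⁻¹ ^ 3 • (fderiv ℝ bump (R⁻¹ • x)).comp (R⁻¹ • ContinuousLinearMap.id ℝ E3)) x :=
    (h1.comp x h2).const_mul _
  have h4 : moll R = fun x => R⁻¹ ^ 3 * bump (R⁻¹ • x) := rfl
  rw [h4, h3.fderiv]
  simp
  ring

lemma lintegral_fderiv_moll_sq (hR : 0 < R) (i : Fin 3) :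
    ∫⁻ x, ‖fderiv ℝ (moll R) x (e i)‖ₑ ^ 2
      = ENNReal.ofReal (R⁻¹ ^ 5) * ∫⁻ x, ‖fderiv ℝ bump x (e i)‖ₑ ^ 2 := by
  have h : ∀ x, ‖fderiv ℝ (moll R) x (e i)‖ₑ ^ 2
      = ENNReal.ofReal (R⁻¹ ^ 8) * ‖fderiv ℝ bump (R⁻¹ • x) (e i)‖ₑ ^ 2 := fun x => by
    rw [fderiv_moll, enorm_mul, mul_pow, Real.enorm_of_nonneg (by positivity),
      ← ENNReal.ofReal_pow (by positivity)]
    ring_nf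
  simp only [h]
  rw [lintegral_const_mul' _ _ ENNReal.ofReal_ne_top,
    lintegral_comp_smul_E3 (fun x => ‖fderiv ℝ bump x (e i)‖ₑ ^ 2) (inv_pos.2 hR), ← mul_assoc,
    ← ENNReal.ofReal_mul (by positivity)]
  congr 2
  field_simp

/-- A constant bounding the `L²` norms of `bump` and of its partial derivatives. -/
noncomputable def bumpConst : ℝ :=
  (∫⁻ x, ‖bump x‖ₑ ^ 2).toReal + ∑ i, (∫⁻ x, ‖fderiv ℝ bump x (e i)‖ₑ ^ 2).toReal

lemma bumpConst_nonneg : 0 ≤ bumpConst := by unfold bumpConst; positivity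

lemma lintegral_enorm_sq_lt_top {k : E3 → ℝ} (hk : Continuous k) (hs : HasCompactSupport k) :
    ∫⁻ x, ‖k x‖ₑ ^ 2 < ⊤ := by
  have h2 : HasCompactSupport (fun x => k x * k x) := hs.mul_left
  have h := ((hk.mul hk).integrable_of_hasCompactSupport (μ := volume) h2).2
  have e1 : ∀ x, ‖k x‖ₑ ^ 2 = ‖k x * k x‖ₑ := fun x => by rw [enorm_mul, sq]
  simp only [e1]
  exact h

lemma lintegral_moll_sq_le (hR : 0 < R) :
    ∫⁻ x, ‖moll R x‖ₑ ^ 2 ≤ ENNReal.ofReal (bumpConst * R⁻¹ ^ 3) := by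
  rw [lintegral_moll_sq hR, mul_comm bumpConst, ENNReal.ofReal_mul (by positivity)]
  gcongr
  refine ENNReal.le_ofReal_iff_toReal_le ?_ bumpConst_nonneg |>.2 ?_
  · exact (lintegral_enorm_sq_lt_top contDiff_bump.continuous hasCompactSupport_bump).ne
  · unfold bumpConst
    exact le_add_of_nonneg_right (by positivity)

lemma lintegral_fderiv_moll_sq_le (hR : 0 < R) (i : Fin 3) :
    ∫⁻ x, ‖fderiv ℝ (moll R) x (e i)‖ₑ ^ 2 ≤ ENNReal.ofReal (bumpConst * R⁻¹ ^ 5) := by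
  rw [lintegral_fderiv_moll_sq hR, mul_comm bumpConst, ENNReal.ofReal_mul (by positivity)]
  gcongr
  refine ENNReal.le_ofReal_iff_toReal_le ?_ bumpConst_nonneg |>.2 ?_
  · exact (lintegral_enorm_sq_lt_top (contDiff_fderiv_apply contDiff_bump _).continuous
      (hasCompactSupport_bump.fderiv_apply ℝ (e i))).ne
  · unfold bumpConst
    refine le_add_of_nonneg_of_le (by positivity) ?_
    exact Finset.single_le_sum (f := fun i => (∫⁻ x, ‖fderiv ℝ bump x (e i)‖ₑ ^ 2).toReal)
      (fun _ _ => by positivity) (Finset.mem_univ i)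

lemma nsq_conv_moll_le (hR : 0 < R) (hf : AEStronglyMeasurable f volume) :
    nsq (conv (moll R) f) ≤ nsq f := by
  have := nsq_conv_le (continuous_moll R) hf
  rwa [lintegral_moll hR, one_pow, one_mul] at this

lemma sum_smul_e (y : E3) : ∑ i, y i • e i = y := by
  have := (EuclideanSpace.basisFun (Fin 3) ℝ).sum_repr y
  simpa [e] using this

lemma enorm_fderiv_apply_sq_le (x y : E3) :
    ‖fderiv ℝ f x y‖ₑ ^ 2 ≤ ‖y‖ₑ ^ 2 * ∑ i, ‖partialD i f x‖ₑ ^ 2 := by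
  have h1 : fderiv ℝ f x y = ∑ i, y i • partialD i f x := by
    conv_lhs => rw [← sum_smul_e y]
    simp [partialD]
  have h2 : ‖fderiv ℝ f x y‖ ^ 2 ≤ ‖y‖ ^ 2 * ∑ i, ‖partialD i f x‖ ^ 2 := by
    rw [h1, EuclideanSpace.norm_sq_eq y]
    calc ‖∑ i, y i • partialD i f x‖ ^ 2 ≤ (∑ i, ‖y i‖ * ‖partialD i f x‖) ^ 2 := by
          gcongr
          refine (norm_sum_le _ _).trans (le_of_eq ?_)
          simp only [norm_smul]
      _ ≤ _ := Finset.sum_mul_sq_le_sq_mul_sq _ _ _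
  simp only [← ofReal_norm, ← ENNReal.ofReal_pow (norm_nonneg _)]
  rw [← ENNReal.ofReal_sum_of_nonneg (fun _ _ => by positivity),
    ← ENNReal.ofReal_mul (by positivity)]
  exact ENNReal.ofReal_le_ofReal h2

lemma gsq_eq_lintegral (hf : ContDiff ℝ 1 f) :
    gsq f = ∫⁻ x, ∑ i, ‖partialD i f x‖ₑ ^ 2 := by
  unfold gsq nsq
  rw [lintegral_finsetSum]
  intro i _
  exact (continuous_partialD hf i).enorm.measurable.pow_const 2

/-- The increment is the integral of the derivative along the segment from x - y to x; Jensen on the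
unit interval and translation invariance of Lebesgue measure give the bound. -/
lemma nsq_sub_translate_le (hf : ContDiff ℝ 1 f) (y : E3) :
    ∫⁻ x, ‖f x - f (x - y)‖ₑ ^ 2 ≤ ‖y‖ₑ ^ 2 * gsq f := by
  have hfc := hf.continuous_fderiv one_ne_zero
  have h1 : ∀ x, f x - f (x - y) = ∫ θ in (0 : ℝ)..1, fderiv ℝ f (x - y + θ • y) y := by
    intro x
    have hd : ∀ θ ∈ Set.uIcc (0 : ℝ) 1,
        HasDerivAt (fun θ : ℝ => f (x - y + θ • y)) (fderiv ℝ f (x - y + θ • y) y) θ := by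
      intro θ _
      have h2 : HasDerivAt (fun θ : ℝ => x - y + θ • y) y θ := by
        simpa using ((hasDerivAt_id θ).smul_const y).const_add (x - y)
      exact ((hf.differentiable one_ne_zero _).hasFDerivAt).comp_hasDerivAt θ h2
    rw [intervalIntegral.integral_eq_sub_of_hasDerivAt hd]
    · simp
    · refine Continuous.intervalIntegrable ?_ _ _
      exact (hfc.comp (by fun_prop)).clm_apply continuous_const
  have h2 : ∀ x, ‖f x - f (x - y)‖ₑ ^ 2
      ≤ ∫⁻ θ in Set.Ioc (0 : ℝ) 1, ‖y‖ₑ ^ 2 * ∑ i, ‖partialD i f (x - y + θ • y)‖ₑ ^ 2 := by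
    intro x
    rw [h1, intervalIntegral.integral_of_le zero_le_one]
    have hm : AEMeasurable (fun θ : ℝ => ‖fderiv ℝ f (x - y + θ • y) y‖ₑ)
        (volume.restrict (Set.Ioc 0 1)) := by
      have : Continuous (fun θ : ℝ => fderiv ℝ f (x - y + θ • y) y) :=
        (hfc.comp (by fun_prop)).clm_apply continuous_const
      exact this.enorm.aemeasurable
    calc _ ≤ (∫⁻ θ in Set.Ioc (0 : ℝ) 1, 1 * ‖fderiv ℝ f (x - y + θ • y) y‖ₑ) ^ 2 := by
          simp only [one_mul]
          exact pow_le_pow_left₀ zero_le (enorm_integral_le_lintegral_enorm _) 2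
      _ ≤ _ := by
          refine (lintegral_mul_sq_le_weighted aemeasurable_const hm).trans ?_
          simp only [lintegral_const, MeasurableSet.univ, Measure.restrict_apply, Set.univ_inter,
            Real.volume_Ioc, sub_zero, ENNReal.ofReal_one, one_mul]
          exact lintegral_mono fun θ => enorm_fderiv_apply_sq_le _ _
  refine (lintegral_mono h2).trans ?_
  have hc : Measurable (fun p : E3 × ℝ => ∑ i, ‖partialD i f (p.1 - y + p.2 • y)‖ₑ ^ 2) := by
    refine Finset.measurable_sum _ fun i _ => ?_
    exact ((continuous_partialD hf i).comp (by fun_prop)).enorm.measurable.pow_const 2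
  rw [lintegral_lintegral_swap (f := fun x θ => ‖y‖ₑ ^ 2 * ∑ i, ‖partialD i f (x - y + θ • y)‖ₑ ^ 2)
    (hc.const_mul _).aemeasurable]
  have h3 : ∀ θ : ℝ, ∫⁻ x, ‖y‖ₑ ^ 2 * ∑ i, ‖partialD i f (x - y + θ • y)‖ₑ ^ 2
      = ‖y‖ₑ ^ 2 * gsq f := by
    intro θ
    rw [lintegral_const_mul' _ _ (by simp), gsq_eq_lintegral hf]
    congr 1
    have := lintegral_add_right_eq_self (μ := (volume : Measure E3))
      (fun x => ∑ i, ‖partialD i f x‖ₑ ^ 2) (-y + θ • y)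
    simpa only [← add_assoc, ← sub_eq_add_neg] using this
  simp only [h3]
  simp

lemma conv_moll_sub (hR : 0 < R) (hf : LocallyIntegrable f volume) (x : E3) :
    f x - conv (moll R) f x = ∫ y, moll R y • (f x - f (x - y)) := by
  have hi : Integrable (fun y => moll R y • f (x - y)) volume :=
    (hasCompactSupport_moll hR).convolutionExists_left
      (ContinuousLinearMap.lsmul ℝ ℝ : ℝ →L[ℝ] E3 →L[ℝ] E3) (continuous_moll R) hf x
  have hm : Integrable (moll R) volume :=
    (continuous_moll R).integrable_of_hasCompactSupport (hasCompactSupport_moll hR)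
  simp only [smul_sub]
  rw [integral_sub (hm.smul_const _) hi, integral_smul_const, integral_moll hR, one_smul]
  rfl

/-- The difference is an average of f x - f (x - y) against a probability density living on |y| < R,
so the translation estimate applies with |y| ≤ R. -/
lemma nsq_sub_conv_moll_le (hR : 0 < R) (hf : ContDiff ℝ 1 f) :
    nsq (fun x => f x - conv (moll R) f x) ≤ ENNReal.ofReal (R ^ 2) * gsq f := by
  have h1 : ∀ x, ‖f x - conv (moll R) f x‖ₑ ^ 2
      ≤ ∫⁻ y, ‖moll R y‖ₑ * ‖f x - f (x - y)‖ₑ ^ 2 := by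
    intro x
    rw [conv_moll_sub hR hf.continuous.locallyIntegrable]
    have hm : AEMeasurable (fun y => ‖f x - f (x - y)‖ₑ) volume :=
      (continuous_const.sub (hf.continuous.comp (by fun_prop))).enorm.aemeasurable
    calc _ ≤ (∫⁻ y, ‖moll R y‖ₑ * ‖f x - f (x - y)‖ₑ) ^ 2 := by
          refine pow_le_pow_left₀ zero_le ((enorm_integral_le_lintegral_enorm _).trans
            (le_of_eq ?_)) 2
          simp only [enorm_smul]
      _ ≤ _ := by
          refine (lintegral_mul_sq_le_weighted (continuous_moll R).enorm.aemeasurable hm).trans ?_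
          rw [lintegral_moll hR, one_mul]
  unfold nsq
  refine (lintegral_mono h1).trans ?_
  have hc : Measurable (fun p : E3 × E3 => ‖moll R p.2‖ₑ * ‖f p.1 - f (p.1 - p.2)‖ₑ ^ 2) := by
    have h1 : Continuous (fun p : E3 × E3 => ‖moll R p.2‖ₑ) :=
      ((continuous_moll R).comp continuous_snd).enorm
    have h2 : Continuous (fun p : E3 × E3 => ‖f p.1 - f (p.1 - p.2)‖ₑ) :=
      ((hf.continuous.comp continuous_fst).sub
        (hf.continuous.comp (continuous_fst.sub continuous_snd))).enorm
    exact h1.measurable.mul (h2.measurable.pow_const 2)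
  rw [lintegral_lintegral_swap (f := fun x y => ‖moll R y‖ₑ * ‖f x - f (x - y)‖ₑ ^ 2)
    hc.aemeasurable]
  have h3 : ∀ y, ∫⁻ x, ‖moll R y‖ₑ * ‖f x - f (x - y)‖ₑ ^ 2
      ≤ ‖moll R y‖ₑ * (ENNReal.ofReal (R ^ 2) * gsq f) := by
    intro y
    rw [lintegral_const_mul' _ _ (by simp)]
    by_cases hy : R ≤ ‖y‖
    · simp [moll_eq_zero hR hy]
    · gcongr
      refine (nsq_sub_translate_le hf y).trans ?_
      gcongr
      rw [← ofReal_norm, ← ENNReal.ofReal_pow (norm_nonneg _)]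
      exact ENNReal.ofReal_le_ofReal (by gcongr; exact (not_le.1 hy).le)
  refine (lintegral_mono h3).trans ?_
  rw [lintegral_mul_const _ (continuous_moll R).enorm.measurable, lintegral_moll hR, one_mul]

lemma enorm_add_sq_le {V : Type*} [SeminormedAddCommGroup V] (a b : V) :
    ‖a + b‖ₑ ^ 2 ≤ 2 * ‖a‖ₑ ^ 2 + 2 * ‖b‖ₑ ^ 2 := by
  have h : ‖a + b‖ ^ 2 ≤ 2 * ‖a‖ ^ 2 + 2 * ‖b‖ ^ 2 := by
    have := pow_le_pow_left₀ (norm_nonneg _) (norm_add_le a b) 2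
    nlinarith [sq_nonneg (‖a‖ - ‖b‖)]
  have e2 : (2 : ℝ≥0∞) = ENNReal.ofReal 2 := by simp
  simp only [← ofReal_norm, ← ENNReal.ofReal_pow (norm_nonneg _), e2]
  rw [← ENNReal.ofReal_mul (by norm_num), ← ENNReal.ofReal_mul (by norm_num),
    ← ENNReal.ofReal_add (by positivity) (by positivity)]
  exact ENNReal.ofReal_le_ofReal h

lemma nsq_add_le (hf : AEStronglyMeasurable f volume) :
    nsq (fun x => f x + g x) ≤ 2 * nsq f + 2 * nsq g := by
  unfold nsq
  have hm : AEMeasurable (fun x => 2 * ‖f x‖ₑ ^ 2) volume := (hf.enorm.pow_const 2).const_mul 2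
  rw [← lintegral_const_mul' _ _ (by simp), ← lintegral_const_mul' _ _ (by simp),
    ← lintegral_add_left' hm]
  exact lintegral_mono fun x => enorm_add_sq_le _ _

/-- Physical-space substitute for splitting the Fourier transform at frequency 1/R: the high
frequencies cost R² ‖∇f‖², the low ones are represented by the mollified field. Both Nash's
inequality and the decay of the velocity rest on it. -/
lemma nsq_le_conv_moll (hR : 0 < R) (hf : ContDiff ℝ 1 f) :
    nsq f ≤ ENNReal.ofReal (2 * R ^ 2) * gsq f + 2 * nsq (conv (moll R) f) := by
  have hc : Continuous (conv (moll R) f) := (contDiff_conv (contDiff_moll R)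
    (hasCompactSupport_moll hR) hf.continuous.locallyIntegrable).continuous
  have h := nsq_add_le (f := fun x => f x - conv (moll R) f x) (g := conv (moll R) f)
    (hf.continuous.sub hc).aestronglyMeasurable
  simp only [sub_add_cancel] at h
  refine h.trans (add_le_add ?_ le_rfl)
  rw [ENNReal.ofReal_mul (by norm_num), mul_assoc]
  have := nsq_sub_conv_moll_le hR hf
  simpa using mul_le_mul_right this 2

lemma nsq_conv_moll_le_L1 (hR : 0 < R) (hf : AEStronglyMeasurable f volume) :
    nsq (conv (moll R) f) ≤ ENNReal.ofReal (bumpConst * R⁻¹ ^ 3) * (∫⁻ y, ‖f y‖ₑ) ^ 2 := by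
  rw [mul_comm]
  exact (nsq_conv_le_L1 (continuous_moll R) hf).trans
    (mul_le_mul_right (lintegral_moll_sq_le hR) _)

/-- Nash's inequality with a free scale `R`. -/
lemma nash (hR : 0 < R) (hf : ContDiff ℝ 1 f) :
    nsq f ≤ ENNReal.ofReal (2 * R ^ 2) * gsq f
      + ENNReal.ofReal (2 * bumpConst * R⁻¹ ^ 3) * (∫⁻ y, ‖f y‖ₑ) ^ 2 := by
  refine (nsq_le_conv_moll hR hf).trans (add_le_add le_rfl ?_)
  rw [mul_assoc, ENNReal.ofReal_mul (by norm_num), mul_assoc]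
  have := nsq_conv_moll_le_L1 hR hf.continuous.aestronglyMeasurable
  simpa using mul_le_mul_right this 2

end LiquidCrystal

namespace LiquidCrystal

/-! ### Cutoff functions -/

/-- A fixed smooth function equal to `1` on the unit ball and supported in the ball of radius 2. -/
noncomputable def unitCut (x : E3) : ℝ :=
  (⟨1, 2, by norm_num, by norm_num⟩ : ContDiffBump (0 : E3)) x

/-- The cutoff at scale `R`. -/
noncomputable def cut (R : ℝ) (x : E3) : ℝ := unitCut (R⁻¹ • x)

lemma contDiff_unitCut : ContDiff ℝ ∞ unitCut := ContDiffBump.contDiff _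

lemma hasCompactSupport_unitCut : HasCompactSupport unitCut := ContDiffBump.hasCompactSupport _

lemma contDiff_cut (R : ℝ) : ContDiff ℝ ∞ (cut R) :=
  contDiff_unitCut.comp (contDiff_const_smul _)

lemma continuous_cut (R : ℝ) : Continuous (cut R) := (contDiff_cut R).continuous

lemma cut_nonneg (R : ℝ) (x : E3) : 0 ≤ cut R x := ContDiffBump.nonneg _

lemma cut_le_one (R : ℝ) (x : E3) : cut R x ≤ 1 := ContDiffBump.le_one _

variable {R : ℝ} {f g : E3 → E3}

lemma hasCompactSupport_cut (hR : 0 < R) : HasCompactSupport (cut R) :=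
  hasCompactSupport_unitCut.comp_homeomorph (Homeomorph.smulOfNeZero R⁻¹ (inv_ne_zero hR.ne'))

lemma cut_eq_one (hR : 0 < R) {x : E3} (hx : ‖x‖ ≤ R) : cut R x = 1 := by
  refine ContDiffBump.one_of_mem_closedBall _ ?_
  simp only [Metric.mem_closedBall, dist_zero_right, norm_smul, norm_inv, Real.norm_eq_abs,
    abs_of_pos hR]
  rw [← div_eq_inv_mul, div_le_one hR]; exact hx

lemma cut_eq_zero (hR : 0 < R) {x : E3} (hx : 2 * R ≤ ‖x‖) : cut R x = 0 := by
  refine ContDiffBump.zero_of_le_dist _ ?_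
  simp only [dist_zero_right, norm_smul, norm_inv, Real.norm_eq_abs, abs_of_pos hR]
  rw [← div_eq_inv_mul, le_div_iff₀ hR]; exact hx

/-- The partial derivative of the cutoff. -/
noncomputable def cut' (R : ℝ) (i : Fin 3) (x : E3) : ℝ := fderiv ℝ (cut R) x (e i)

/-- The pure second partial derivative of the cutoff. -/
noncomputable def cut'' (R : ℝ) (i : Fin 3) (x : E3) : ℝ := fderiv ℝ (cut' R i) x (e i)

lemma contDiff_cut' (R : ℝ) (i : Fin 3) : ContDiff ℝ ∞ (cut' R i) :=
  contDiff_fderiv_apply (contDiff_cut R) _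

lemma contDiff_cut'' (R : ℝ) (i : Fin 3) : ContDiff ℝ ∞ (cut'' R i) :=
  contDiff_fderiv_apply (contDiff_cut' R i) _

lemma hasFDerivAt_comp_smul {k : E3 → ℝ} (hk : ContDiff ℝ ∞ k) (r : ℝ) (x : E3) :
    HasFDerivAt (fun x => k (r • x)) (r • fderiv ℝ k (r • x)) x := by
  have h1 : HasFDerivAt k (fderiv ℝ k (r • x)) (r • x) :=
    ((contDiff_one_of_top hk).differentiable one_ne_zero _).hasFDerivAt
  have h2 : HasFDerivAt (fun x : E3 => r • x) (r • ContinuousLinearMap.id ℝ E3) x :=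
    (hasFDerivAt_id x).const_smul r
  have h3 : HasFDerivAt (fun x => k (r • x))
      ((fderiv ℝ k (r • x)).comp (r • ContinuousLinearMap.id ℝ E3)) x := h1.comp x h2
  convert h3 using 1
  ext y; simp

lemma fderiv_cut (R : ℝ) (x : E3) : fderiv ℝ (cut R) x = R⁻¹ • fderiv ℝ unitCut (R⁻¹ • x) :=
  (hasFDerivAt_comp_smul contDiff_unitCut R⁻¹ x).fderiv

lemma cut'_eq (R : ℝ) (i : Fin 3) (x : E3) :
    cut' R i x = R⁻¹ * fderiv ℝ unitCut (R⁻¹ • x) (e i) := by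
  rw [cut', fderiv_cut]; rfl

lemma cut''_eq (R : ℝ) (i : Fin 3) (x : E3) :
    cut'' R i x = R⁻¹ ^ 2 * fderiv ℝ (fun y => fderiv ℝ unitCut y (e i)) (R⁻¹ • x) (e i) := by
  have h1 : cut' R i = fun x => R⁻¹ * fderiv ℝ unitCut (R⁻¹ • x) (e i) :=
    funext fun x => cut'_eq R i x
  have h2 := (hasFDerivAt_comp_smul (contDiff_fderiv_apply contDiff_unitCut (e i))
    R⁻¹ x).const_mul R⁻¹
  rw [cut'', h1, h2.fderiv]
  simp
  ring

lemma exists_bound_of_compactSupport {F : Type*} [NormedAddCommGroup F] {k : E3 → F}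
    (hk : Continuous k) (hs : HasCompactSupport k) : ∃ C : ℝ, 0 ≤ C ∧ ∀ x, ‖k x‖ ≤ C := by
  obtain ⟨C, hC⟩ := hs.exists_bound_of_continuous hk
  exact ⟨C, (norm_nonneg _).trans (hC 0), hC⟩

lemma exists_cut_bound : ∃ K : ℝ, 0 ≤ K ∧ ∀ R : ℝ, 0 < R → ∀ x,
    ‖fderiv ℝ (cut R) x‖ ≤ K * R⁻¹ ∧ (∀ i, |cut' R i x| ≤ K * R⁻¹) ∧
      ∀ i, |cut'' R i x| ≤ K * R⁻¹ ^ 2 := by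
  have h0 := contDiff_one_of_top contDiff_unitCut
  obtain ⟨C, hC0, hC⟩ := exists_bound_of_compactSupport (h0.continuous_fderiv one_ne_zero)
    (hasCompactSupport_unitCut.fderiv ℝ)
  have h1 : ∀ i : Fin 3, ∃ C : ℝ, 0 ≤ C ∧
      ∀ x, ‖fderiv ℝ (fun y => fderiv ℝ unitCut y (e i)) x (e i)‖ ≤ C := fun i =>
    exists_bound_of_compactSupport
      (contDiff_fderiv_apply (contDiff_fderiv_apply contDiff_unitCut _) _).continuous
      ((hasCompactSupport_unitCut.fderiv_apply ℝ (e i)).fderiv_apply ℝ (e i))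
  choose D hD0 hD using h1
  have hDs : 0 ≤ ∑ i, D i := Finset.sum_nonneg fun i _ => hD0 i
  refine ⟨C + ∑ i, D i, by positivity, fun R hR x => ⟨?_, fun i => ?_, fun i => ?_⟩⟩
  · rw [fderiv_cut, norm_smul, norm_inv, Real.norm_eq_abs, abs_of_pos hR, mul_comm]
    gcongr
    linarith [hC (R⁻¹ • x)]
  · rw [cut'_eq, abs_mul, abs_of_pos (inv_pos.2 hR), mul_comm]
    gcongr
    have := (fderiv ℝ unitCut (R⁻¹ • x)).le_opNorm (e i)
    simp only [e, PiLp.norm_single, norm_one, mul_one] at this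
    have h2 := hC (R⁻¹ • x)
    rw [Real.norm_eq_abs] at this
    simp only [e]
    linarith
  · rw [cut''_eq, abs_mul, abs_of_pos (by positivity), mul_comm]
    gcongr
    have h2 := hD i (R⁻¹ • x)
    have h3 := Finset.single_le_sum (f := D) (fun i _ => hD0 i) (Finset.mem_univ i)
    rw [Real.norm_eq_abs] at h2
    linarith

/-- A constant bounding the scaled derivatives of the cutoffs. -/
noncomputable def cutConst : ℝ := exists_cut_bound.choose

lemma cutConst_nonneg : 0 ≤ cutConst := exists_cut_bound.choose_spec.1

lemma norm_fderiv_cut_le (hR : 0 < R) (x : E3) : ‖fderiv ℝ (cut R) x‖ ≤ cutConst * R⁻¹ :=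
  (exists_cut_bound.choose_spec.2 R hR x).1

lemma abs_cut'_le (hR : 0 < R) (i : Fin 3) (x : E3) : |cut' R i x| ≤ cutConst * R⁻¹ :=
  (exists_cut_bound.choose_spec.2 R hR x).2.1 i

lemma abs_cut''_le (hR : 0 < R) (i : Fin 3) (x : E3) : |cut'' R i x| ≤ cutConst * R⁻¹ ^ 2 :=
  (exists_cut_bound.choose_spec.2 R hR x).2.2 i

lemma hasCompactSupport_cut' (hR : 0 < R) (i : Fin 3) : HasCompactSupport (cut' R i) :=
  (hasCompactSupport_cut hR).fderiv_apply ℝ (e i)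

lemma hasCompactSupport_cut'' (hR : 0 < R) (i : Fin 3) : HasCompactSupport (cut'' R i) :=
  (hasCompactSupport_cut' hR i).fderiv_apply ℝ (e i)

lemma tsupport_cut_subset (hR : 0 < R) : tsupport (cut R) ⊆ Metric.closedBall 0 (2 * R) := by
  refine closure_minimal (fun x hx => ?_) Metric.isClosed_closedBall
  simp only [Metric.mem_closedBall, dist_zero_right]
  by_contra h
  exact hx (cut_eq_zero hR (not_le.1 h).le)

lemma cut'_eq_zero_of_lt (hR : 0 < R) (i : Fin 3) {x : E3} (hx : 2 * R < ‖x‖) :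
    cut' R i x = 0 := by
  have h : x ∉ tsupport (cut R) := fun h => by
    have := tsupport_cut_subset hR h
    simp only [Metric.mem_closedBall, dist_zero_right] at this
    linarith
  have h2 : fderiv ℝ (cut R) x = 0 := by
    by_contra h3
    exact h (support_fderiv_subset ℝ h3)
  rw [cut', h2]; rfl

lemma cut''_eq_zero_of_lt (hR : 0 < R) (i : Fin 3) {x : E3} (hx : 2 * R < ‖x‖) :
    cut'' R i x = 0 := by
  have h : x ∉ tsupport (cut' R i) := fun h => by
    have h1 : tsupport (cut' R i) ⊆ tsupport (cut R) := by
      refine closure_minimal (fun y hy => ?_) (isClosed_tsupport _)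
      refine support_fderiv_subset ℝ (f := cut R) ?_
      intro h3
      exact hy (by simp [cut', h3])
    have := tsupport_cut_subset hR (h1 h)
    simp only [Metric.mem_closedBall, dist_zero_right] at this
    linarith
  have h2 : fderiv ℝ (cut' R i) x = 0 := by
    by_contra h3
    exact h (support_fderiv_subset ℝ h3)
  rw [cut'', h2]; rfl

lemma cut'_eq_zero_of_norm_lt (hR : 0 < R) (i : Fin 3) {x : E3} (hx : ‖x‖ < R) :
    cut' R i x = 0 := by
  have h : cut R =ᶠ[𝓝 x] fun _ => 1 := by
    filter_upwards [(isOpen_lt continuous_norm continuous_const).mem_nhds hx] with y hy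
    exact cut_eq_one hR (le_of_lt hy)
  rw [cut', h.fderiv_eq]
  simp

lemma tendsto_cut (x : E3) : Tendsto (fun n : ℕ => cut ((n : ℝ) + 1) x) atTop (𝓝 1) := by
  refine tendsto_const_nhds.congr' ?_
  obtain ⟨N, hN⟩ := exists_nat_ge ‖x‖
  filter_upwards [eventually_ge_atTop N] with n hn
  have : (N : ℝ) ≤ n := by exact_mod_cast hn
  exact (cut_eq_one (by positivity) (by linarith)).symm

/-! ### The Sobolev inequality -/

/-- The constant of the inequality `‖f‖₆² ≤ C ‖∇f‖₂²`. -/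
noncomputable def sobConst : ℝ≥0∞ :=
  ((SNormLESNormFDerivOfEqConst E3 (volume : Measure E3) 2 : NNReal) : ℝ≥0∞) ^ 2 + 1

lemma sobConst_ne_top : sobConst ≠ ⊤ := by
  unfold sobConst
  exact ENNReal.add_ne_top.2 ⟨ENNReal.pow_ne_top ENNReal.coe_ne_top, ENNReal.one_ne_top⟩

lemma sobConst_ne_zero : sobConst ≠ 0 := by
  unfold sobConst; simp

lemma enorm_fderiv_sq_le (f : E3 → E3) (x : E3) :
    ‖fderiv ℝ f x‖ₑ ^ 2 ≤ ∑ i, ‖partialD i f x‖ₑ ^ 2 := by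
  have h : ‖fderiv ℝ f x‖ ≤ Real.sqrt (∑ i, ‖partialD i f x‖ ^ 2) := by
    refine ContinuousLinearMap.opNorm_le_bound _ (Real.sqrt_nonneg _) fun y => ?_
    have h1 := enorm_fderiv_apply_sq_le (f := f) x y
    simp only [← ofReal_norm, ← ENNReal.ofReal_pow (norm_nonneg _)] at h1
    rw [← ENNReal.ofReal_sum_of_nonneg (fun _ _ => by positivity),
      ← ENNReal.ofReal_mul (by positivity), ENNReal.ofReal_le_ofReal_iff (by positivity)] at h1
    refine abs_le_of_sq_le_sq' ?_ (by positivity) |>.2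
    rw [mul_pow, Real.sq_sqrt (by positivity)]
    linarith
  simp only [← ofReal_norm, ← ENNReal.ofReal_pow (norm_nonneg _)]
  rw [← ENNReal.ofReal_sum_of_nonneg (fun _ _ => by positivity)]
  refine ENNReal.ofReal_le_ofReal ?_
  calc _ ≤ (Real.sqrt (∑ i, ‖partialD i f x‖ ^ 2)) ^ 2 := by gcongr
    _ = _ := Real.sq_sqrt (by positivity)

lemma eLpNorm_fderiv_sq_le (hf : ContDiff ℝ 1 f) :
    eLpNorm (fderiv ℝ f) 2 volume ^ 2 ≤ gsq f := by
  rw [gsq_eq_lintegral hf, eLpNorm_eq_lintegral_rpow_enorm_toReal (by norm_num) (by norm_num),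
    ← ENNReal.rpow_natCast, ← ENNReal.rpow_mul]
  norm_num
  exact lintegral_mono fun x => enorm_fderiv_sq_le f x

/-- The Sobolev inequality for compactly supported functions, with 1/6 = 1/2 - 1/3, is applied to
the truncated field. The derivative of the cutoff contributes O(1/n) ‖f‖₂, which vanishes in the
limit, and Fatou recovers f. -/
lemma eLpNorm_six_le (hf : ContDiff ℝ 1 f) (h2 : nsq f < ⊤) :
    eLpNorm f 6 volume ≤ (SNormLESNormFDerivOfEqConst E3 (volume : Measure E3) 2 : NNReal) *
      eLpNorm (fderiv ℝ f) 2 volume := by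
  set C := (SNormLESNormFDerivOfEqConst E3 (volume : Measure E3) 2 : NNReal)
  have hf2 : eLpNorm f 2 volume < ⊤ :=
    (memLp_two_iff_nsq.2 ⟨hf.continuous.aestronglyMeasurable, h2⟩).2
  have hlim : ∀ᵐ x ∂(volume : Measure E3), Tendsto (fun n : ℕ => cut ((n : ℝ) + 1) x • f x) atTop
      (𝓝 (f x)) := Eventually.of_forall fun x => by
    simpa using (tendsto_cut x).smul_const (f x)
  have hcd : ∀ n : ℕ, ContDiff ℝ 1 (fun x => cut ((n : ℝ) + 1) x • f x) := fun n =>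
    (contDiff_one_of_top (contDiff_cut _)).smul hf
  refine (Lp.eLpNorm_lim_le_liminf_eLpNorm (fun n => (hcd n).continuous.aestronglyMeasurable)
    f hlim).trans ?_
  have hb : ∀ n : ℕ, eLpNorm (fun x => cut ((n : ℝ) + 1) x • f x) 6 volume
      ≤ C * (eLpNorm (fderiv ℝ f) 2 volume
        + ENNReal.ofReal (cutConst * ((n : ℝ) + 1)⁻¹) * eLpNorm f 2 volume) := by
    intro n
    have hn : (0 : ℝ) < (n : ℝ) + 1 := by positivity
    have hg := eLpNorm_le_eLpNorm_fderiv_of_eq (μ := (volume : Measure E3)) (p := 2) (p' := 6)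
      (hcd n) (hasCompactSupport_cut hn).smul_right (by norm_num) (by simp)
      (by simp; norm_num)
    refine hg.trans ?_
    have hpt : ∀ x, ‖fderiv ℝ (fun x => cut ((n : ℝ) + 1) x • f x) x‖
        ≤ ‖‖fderiv ℝ f x‖ + (cutConst * ((n : ℝ) + 1)⁻¹) * ‖f x‖‖ := by
      intro x
      have hd1 : DifferentiableAt ℝ (cut ((n : ℝ) + 1)) x :=
        (contDiff_one_of_top (contDiff_cut _)).differentiable one_ne_zero x
      have hd2 : DifferentiableAt ℝ f x := hf.differentiable one_ne_zero x
      rw [fderiv_fun_smul hd1 hd2, Real.norm_of_nonneg (by have := cutConst_nonneg; positivity)]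
      refine (norm_add_le _ _).trans (add_le_add ?_ ?_)
      · rw [norm_smul, Real.norm_of_nonneg (cut_nonneg _ _)]
        exact mul_le_of_le_one_left (norm_nonneg _) (cut_le_one _ _)
      · rw [ContinuousLinearMap.norm_smulRight_apply]
        gcongr
        exact norm_fderiv_cut_le hn x
    have h1 : eLpNorm (fderiv ℝ fun x => cut ((n : ℝ) + 1) x • f x) 2 volume
        ≤ eLpNorm (fderiv ℝ f) 2 volume
        + ENNReal.ofReal (cutConst * ((n : ℝ) + 1)⁻¹) * eLpNorm f 2 volume := by
      refine (eLpNorm_mono hpt).trans ((eLpNorm_add_le (f := fun x => ‖fderiv ℝ f x‖)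
        (g := fun x => (cutConst * ((n : ℝ) + 1)⁻¹) * ‖f x‖) ?_ ?_ (by norm_num)).trans ?_)
      · exact (hf.continuous_fderiv one_ne_zero).norm.aestronglyMeasurable
      · exact (continuous_const.mul hf.continuous.norm).aestronglyMeasurable
      · refine add_le_add (eLpNorm_norm _).le ?_
        have : (fun x => (cutConst * ((n : ℝ) + 1)⁻¹) * ‖f x‖)
            = (cutConst * ((n : ℝ) + 1)⁻¹) • fun x => ‖f x‖ := rfl
        rw [this, eLpNorm_const_smul, eLpNorm_norm,
          Real.enorm_of_nonneg (by have := cutConst_nonneg; positivity)]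
    exact mul_le_mul_right h1 _
  have ht : Tendsto (fun n : ℕ => (C : ℝ≥0∞) * (eLpNorm (fderiv ℝ f) 2 volume
        + ENNReal.ofReal (cutConst * ((n : ℝ) + 1)⁻¹) * eLpNorm f 2 volume)) atTop
      (𝓝 (C * (eLpNorm (fderiv ℝ f) 2 volume + 0 * eLpNorm f 2 volume))) := by
    refine ENNReal.Tendsto.const_mul ?_ (Or.inr ENNReal.coe_ne_top)
    refine tendsto_const_nhds.add (ENNReal.Tendsto.mul_const ?_ (Or.inr hf2.ne))
    have h0 : Tendsto (fun n : ℕ => cutConst * ((n : ℝ) + 1)⁻¹) atTop (𝓝 0) := by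
      simpa using (tendsto_one_div_add_atTop_nhds_zero_nat (𝕜 := ℝ)).const_mul cutConst
    simpa using ENNReal.tendsto_ofReal h0
  rw [zero_mul, add_zero] at ht
  exact (liminf_le_liminf (Eventually.of_forall hb)).trans ht.liminf_eq.le

lemma lintegral_six_eq (f : E3 → E3) : ∫⁻ x, ‖f x‖ₑ ^ 6 = eLpNorm f 6 volume ^ 6 := by
  rw [eLpNorm_eq_lintegral_rpow_enorm_toReal (by norm_num) (by norm_num), ← ENNReal.rpow_natCast,
    ← ENNReal.rpow_mul]
  norm_num

lemma lintegral_six_le (hf : ContDiff ℝ 1 f) (h2 : nsq f < ⊤) :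
    ∫⁻ x, ‖f x‖ₑ ^ 6 ≤ (sobConst * gsq f) ^ 3 := by
  rw [lintegral_six_eq]
  calc eLpNorm f 6 volume ^ 6 = (eLpNorm f 6 volume ^ 2) ^ 3 := by ring
    _ ≤ _ := by
      refine pow_le_pow_left₀ zero_le ?_ 3
      refine (pow_le_pow_left₀ zero_le (eLpNorm_six_le hf h2) 2).trans ?_
      rw [mul_pow]
      exact mul_le_mul' le_self_add (eLpNorm_fderiv_sq_le hf)

lemma tendsto_conv_moll (hf : Continuous f) (x : E3) :
    Tendsto (fun n : ℕ => conv (moll (1 / ((n : ℝ) + 1))) f x) atTop (𝓝 (f x)) := by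
  rw [Metric.tendsto_atTop]
  intro ε hε
  obtain ⟨δ, hδ, hδ'⟩ := Metric.continuous_iff.1 hf x (ε / 2) (by positivity)
  obtain ⟨N, hN⟩ := exists_nat_one_div_lt hδ
  refine ⟨N, fun n hn => ?_⟩
  have hR : (0 : ℝ) < 1 / ((n : ℝ) + 1) := by positivity
  have hRδ : 1 / ((n : ℝ) + 1) < δ := by
    refine lt_of_le_of_lt ?_ hN
    have : (N : ℝ) ≤ n := by exact_mod_cast hn
    gcongr
  rw [dist_comm, dist_eq_norm, conv_moll_sub hR hf.locallyIntegrable]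
  have hb : ∀ y, ‖moll (1 / ((n : ℝ) + 1)) y • (f x - f (x - y))‖
      ≤ moll (1 / ((n : ℝ) + 1)) y * (ε / 2) := by
    intro y
    rw [norm_smul, Real.norm_of_nonneg (moll_nonneg hR y)]
    by_cases hy : 1 / ((n : ℝ) + 1) ≤ ‖y‖
    · rw [moll_eq_zero hR hy]; simp
    · refine mul_le_mul_of_nonneg_left ?_ (moll_nonneg hR y)
      have := hδ' (x - y) (by rw [dist_eq_norm]; simpa using (not_le.1 hy).trans hRδ)
      rw [dist_comm, dist_eq_norm] at this
      exact this.le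
  have hi : Integrable (fun y => moll (1 / ((n : ℝ) + 1)) y * (ε / 2)) volume :=
    ((continuous_moll _).integrable_of_hasCompactSupport (hasCompactSupport_moll hR)).mul_const _
  refine (norm_integral_le_of_norm_le hi (Eventually.of_forall hb)).trans_lt ?_
  rw [integral_mul_const, integral_moll hR]
  linarith

/-- Intended for the second derivatives of the director, which are continuous but have only weak
derivatives. Mollification reduces to the smooth case without increasing the gradient norm, and
Fatou removes it. -/
lemma lintegral_six_le_sobolevSq (hf : Continuous f) :
    ∫⁻ x, ‖f x‖ₑ ^ 6 ≤ (sobConst * sobolevSq 1 f) ^ 3 := by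
  by_cases htop : sobolevSq 1 f = ⊤
  · rw [htop, ENNReal.mul_top sobConst_ne_zero]; simp
  have h1 : ∀ i : Fin 3, ∃ g, IsWeakPartial i f g ∧
      nsq g ≤ ⨅ (g : E3 → E3) (_ : IsWeakPartial i f g), sobolevSq 0 g := by
    intro i
    have hlt : (⨅ (g : E3 → E3) (_ : IsWeakPartial i f g), sobolevSq 0 g) < ⊤ := by
      refine lt_of_le_of_lt ?_ (lt_top_iff_ne_top.2 htop)
      simp only [sobolevSq]
      exact (Finset.single_le_sum (f := fun i => ⨅ (g : E3 → E3) (_ : IsWeakPartial i f g),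
        eLpNorm g 2 volume ^ 2) (fun _ _ => zero_le) (Finset.mem_univ i)).trans le_add_self
    obtain ⟨g, hg⟩ := iInf_lt_iff.1 hlt
    obtain ⟨hg, _⟩ := iInf_lt_iff.1 hg
    refine ⟨g, hg, le_iInf₂ fun g' hg' => ?_⟩
    rw [← sobolevSq_zero]
    exact (sobolevSq_congr 0 (hg.ae_eq hg')).le
  choose g hg hgle using h1
  have hsum : ∑ i, nsq (g i) ≤ sobolevSq 1 f := by
    refine (Finset.sum_le_sum fun i _ => hgle i).trans ?_
    simp only [sobolevSq]
    exact le_add_self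
  have hnf : nsq f < ⊤ := (nsq_le_sobolevSq 1 f).trans_lt (lt_top_iff_ne_top.2 htop)
  have hb : ∀ n : ℕ, ∫⁻ x, ‖conv (moll (1 / ((n : ℝ) + 1))) f x‖ₑ ^ 6
      ≤ (sobConst * sobolevSq 1 f) ^ 3 := by
    intro n
    have hR : (0 : ℝ) < 1 / ((n : ℝ) + 1) := by positivity
    have hk := contDiff_moll (1 / ((n : ℝ) + 1))
    have hs := hasCompactSupport_moll hR
    refine (lintegral_six_le (contDiff_one_of_top (contDiff_conv hk hs hf.locallyIntegrable))
      ((nsq_conv_moll_le hR hf.aestronglyMeasurable).trans_lt hnf)).trans ?_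
    gcongr
    refine le_trans (Finset.sum_le_sum fun i _ => ?_) hsum
    rw [partialD_conv hk hs hf.locallyIntegrable, conv_partial_eq hk hs (hg i)]
    exact nsq_conv_moll_le hR (hg i).2.1.aestronglyMeasurable
  have hfat := lintegral_liminf_le' (μ := (volume : Measure E3)) (u := atTop)
    (f := fun (n : ℕ) x => ‖conv (moll (1 / ((n : ℝ) + 1))) f x‖ₑ ^ 6) (fun n => by
      have hR : (0 : ℝ) < 1 / ((n : ℝ) + 1) := by positivity
      exact ((contDiff_conv (contDiff_moll _) (hasCompactSupport_moll hR)
        hf.locallyIntegrable).continuous.enorm.measurable.pow_const 6).aemeasurable)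
  have hl : ∀ x, liminf (fun n : ℕ => ‖conv (moll (1 / ((n : ℝ) + 1))) f x‖ₑ ^ 6) atTop
      = ‖f x‖ₑ ^ 6 := fun x =>
    (((ENNReal.continuous_pow 6).tendsto _).comp
      ((continuous_enorm.tendsto _).comp (tendsto_conv_moll hf x))).liminf_eq
  simp only [hl] at hfat
  refine hfat.trans ?_
  exact (liminf_le_liminf (Eventually.of_forall hb)).trans (by simp)

end LiquidCrystal

namespace LiquidCrystal

/-! ### Space-time functions continuous for positive times -/

/-- Joint continuity on `(0,∞) × ℝ³`. -/
def Cts {V : Type*} [TopologicalSpace V] (F : ℝ → E3 → V) : Prop :=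
  ContinuousOn (fun q : ℝ × E3 => F q.1 q.2) (Set.Ioi 0 ×ˢ Set.univ)

section Cts

variable {V : Type*} [NormedAddCommGroup V]

lemma Cts.slice {V : Type*} [TopologicalSpace V] {F : ℝ → E3 → V} (h : Cts F) {t : ℝ}
    (ht : 0 < t) : Continuous (F t) :=
  h.comp_continuous (f := fun x : E3 => (t, x)) (by fun_prop) (fun x => ⟨ht, trivial⟩)

lemma Cts.time {V : Type*} [TopologicalSpace V] {F : ℝ → E3 → V} (h : Cts F) (x : E3) :
    ContinuousOn (fun r => F r x) (Set.Ioi 0) :=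
  ContinuousOn.comp h (f := fun r : ℝ => (r, x)) (by fun_prop) (fun r hr => ⟨hr, trivial⟩)

lemma Cts.of_space {V : Type*} [TopologicalSpace V] {f : E3 → V} (hf : Continuous f) :
    Cts (fun _ => f) :=
  (hf.comp continuous_snd).continuousOn

lemma prod_restrict_Ioc (s t : ℝ) :
    ((volume : Measure ℝ).restrict (Set.Ioc s t)).prod (volume : Measure E3)
      = ((volume : Measure ℝ).prod (volume : Measure E3)).restrict (Set.Ioc s t ×ˢ Set.univ) := by
  rw [← Measure.prod_restrict, Measure.restrict_univ]

lemma Cts.aestronglyMeasurable {F : ℝ → E3 → V} (h : Cts F) {s : ℝ} (hs : 0 ≤ s) (t : ℝ) :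
    AEStronglyMeasurable (fun q : ℝ × E3 => F q.1 q.2)
      (((volume : Measure ℝ).restrict (Set.Ioc s t)).prod (volume : Measure E3)) := by
  rw [prod_restrict_Ioc]
  refine ContinuousOn.aestronglyMeasurable (h.mono ?_)
    (measurableSet_Ioc.prod MeasurableSet.univ)
  exact Set.prod_mono (fun r hr => lt_of_le_of_lt hs hr.1) subset_rfl

lemma Cts.integrable {F : ℝ → E3 → V} (h : Cts F) {s : ℝ} (hs : 0 < s) (t : ℝ) {ρ : ℝ}
    (h0 : ∀ r x, ρ < ‖x‖ → F r x = 0) :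
    Integrable (fun q : ℝ × E3 => F q.1 q.2)
      (((volume : Measure ℝ).restrict (Set.Ioc s t)).prod (volume : Measure E3)) := by
  rw [prod_restrict_Ioc]
  have hc : IsCompact (Set.Icc s t ×ˢ Metric.closedBall (0 : E3) ρ) :=
    isCompact_Icc.prod (isCompact_closedBall _ _)
  have h1 : IntegrableOn (fun q : ℝ × E3 => F q.1 q.2)
      (Set.Icc s t ×ˢ Metric.closedBall (0 : E3) ρ) (volume.prod volume) := by
    refine ContinuousOn.integrableOn_compact hc (h.mono ?_)
    exact Set.prod_mono (fun r hr => lt_of_lt_of_le hs hr.1) (Set.subset_univ _)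
  refine IntegrableOn.of_forall_sdiff_eq_zero h1 (measurableSet_Ioc.prod MeasurableSet.univ) ?_
  rintro ⟨r, x⟩ ⟨hx1, hx2⟩
  refine h0 r x ?_
  by_contra hle
  refine hx2 ⟨⟨hx1.1.1.le, hx1.1.2⟩, ?_⟩
  simpa using not_lt.1 hle

end Cts

/-- Integrated form of a pointwise time derivative, against a compactly supported weight. -/
lemma integral_weight_sub {ψ ψt : ℝ → E3 → ℝ} {χ : E3 → ℝ} {ρ : ℝ}
    (hd : ∀ t, 0 < t → ∀ x, HasDerivAt (fun s => ψ s x) (ψt t x) t) (hc : Cts ψ) (hct : Cts ψt)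
    (hχ : Continuous χ) (hχ0 : ∀ x, ρ < ‖x‖ → χ x = 0) {s t : ℝ} (hs : 0 < s) (hst : s ≤ t) :
    (∫ x, χ x * ψ t x) - ∫ x, χ x * ψ s x
      = ∫ r in Set.Ioc s t, ∫ x, χ x * ψt r x := by
  have hcs : HasCompactSupport χ := by
    refine HasCompactSupport.intro (isCompact_closedBall (0 : E3) ρ) fun x hx => hχ0 x ?_
    simpa using hx
  have hint : ∀ r, 0 < r → Integrable (fun x => χ x * ψ r x) volume := fun r hr =>
    (hχ.mul (hc.slice hr)).integrable_of_hasCompactSupport hcs.mul_right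
  rw [← integral_sub (hint t (hs.trans_le hst)) (hint s hs)]
  have h1 : ∀ x, χ x * ψ t x - χ x * ψ s x = ∫ r in Set.Ioc s t, χ x * ψt r x := by
    intro x
    rw [integral_const_mul, ← intervalIntegral.integral_of_le hst, ← mul_sub]
    congr 1
    refine (intervalIntegral.integral_eq_sub_of_hasDerivAt (f := fun r => ψ r x)
      (fun r hr => ?_) ?_).symm
    · rw [Set.uIcc_of_le hst] at hr
      exact hd r (hs.trans_le hr.1) x
    · refine ContinuousOn.intervalIntegrable ((hct.time x).mono ?_)
      rw [Set.uIcc_of_le hst]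
      exact fun r hr => hs.trans_le hr.1
  simp only [h1]
  refine integral_integral_swap (f := fun x r => χ x * ψt r x) ?_
  have hF : Cts (fun r x => χ x * ψt r x) := (Cts.of_space hχ).mul hct
  exact (hF.integrable (ρ := ρ) hs t (fun r x hx => by simp [hχ0 x hx])).swap

/-! ### Scalar subsolutions of the transport-diffusion equation -/

/-- `ψ` is of class `C^{1,2}` for positive times, with the given time derivative and the given pure
space derivatives of order one and two. -/
structure HasC12 (ψ ψt : ℝ → E3 → ℝ) (ψ₁ ψ₂ : Fin 3 → ℝ → E3 → ℝ) : Prop where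
  time : ∀ t, 0 < t → ∀ x, HasDerivAt (fun s => ψ s x) (ψt t x) t
  space₁ : ∀ i t, 0 < t → ∀ x, HasLineDerivAt ℝ (ψ t) (ψ₁ i t x) x (e i)
  space₂ : ∀ i t, 0 < t → ∀ x, HasLineDerivAt ℝ (ψ₁ i t) (ψ₂ i t x) x (e i)
  cts : Cts ψ
  cts_time : Cts ψt
  cts_space₁ : ∀ i, Cts (ψ₁ i)
  cts_space₂ : ∀ i, Cts (ψ₂ i)

/-- A divergence-free `C^{1,2}` drift, locally bounded in time with values in `L²`. -/
structure IsDrift (u : ℝ → E3 → E3) : Prop where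
  reg : IsC12 u
  div : ∀ t, 0 < t → ∀ x, divergence (u t) x = 0
  bound : ∀ T : ℝ, 0 < T → ∃ M : ℝ, 0 ≤ M ∧ ∀ t ∈ Set.Ioo 0 T, nsq (u t) ≤ ENNReal.ofReal M

/-- `ψ ≥ 0` satisfies `ψ_t + u·∇ψ ≤ Δψ - P + N` and is locally bounded in time with values
in `L²`. -/
structure IsSubsol (u : ℝ → E3 → E3) (ψ P N : ℝ → E3 → ℝ) : Prop where
  ineq : ∃ ψt ψ₁ ψ₂, HasC12 ψ ψt ψ₁ ψ₂ ∧ ∀ t, 0 < t → ∀ x,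
    P t x - N t x ≤ ∑ i, ψ₂ i t x - ψt t x - ∑ i, u t x i * ψ₁ i t x
  nonneg : ∀ t, 0 < t → ∀ x, 0 ≤ ψ t x
  P_nonneg : ∀ t, 0 < t → ∀ x, 0 ≤ P t x
  N_nonneg : ∀ t, 0 < t → ∀ x, 0 ≤ N t x
  P_cts : Cts P
  N_cts : Cts N
  bound : ∀ T : ℝ, 0 < T → ∃ M : ℝ, 0 ≤ M ∧
    ∀ t ∈ Set.Ioo 0 T, ∫⁻ x, ENNReal.ofReal (ψ t x ^ 2) ≤ ENNReal.ofReal M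

lemma integral_mul_hasLineDerivAt {f f' g g' : E3 → ℝ} {v : E3} (hf : Continuous f)
    (hf' : Continuous f') (hs : HasCompactSupport f) (hs' : HasCompactSupport f')
    (hg : Continuous g) (hg' : Continuous g')
    (hfd : ∀ x, HasLineDerivAt ℝ f (f' x) x v) (hgd : ∀ x, HasLineDerivAt ℝ g (g' x) x v) :
    ∫ x, f x * g' x = - ∫ x, f' x * g x :=
  integral_bilinear_hasLineDerivAt_right_eq_neg_left_of_integrable (μ := (volume : Measure E3))
    (B := ContinuousLinearMap.mul ℝ ℝ)
    ((hf'.mul hg).integrable_of_hasCompactSupport hs'.mul_right)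
    ((hf.mul hg').integrable_of_hasCompactSupport hs.mul_right)
    ((hf.mul hg).integrable_of_hasCompactSupport hs.mul_right)
    (fun x _ => hfd x) (fun x _ => hgd x)

lemma hasLineDerivAt_cut (R : ℝ) (i : Fin 3) (x : E3) :
    HasLineDerivAt ℝ (cut R) (cut' R i x) x (e i) :=
  ((contDiff_one_of_top (contDiff_cut R)).differentiable one_ne_zero x).hasFDerivAt.hasLineDerivAt _

lemma hasLineDerivAt_cut' (R : ℝ) (i : Fin 3) (x : E3) :
    HasLineDerivAt ℝ (cut' R i) (cut'' R i x) x (e i) :=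
  ((contDiff_one_of_top (contDiff_cut' R i)).differentiable
    one_ne_zero x).hasFDerivAt.hasLineDerivAt _

lemma hasFDerivAt_coord {v : E3 → E3} (hv : ContDiff ℝ 1 v) (j : Fin 3) (x : E3) :
    HasFDerivAt (fun y => v y j) ((EuclideanSpace.proj j).comp (fderiv ℝ v x)) x :=
  (EuclideanSpace.proj (𝕜 := ℝ) j).hasFDerivAt.comp x
    (hv.differentiable one_ne_zero x).hasFDerivAt

lemma hasLineDerivAt_coord {v : E3 → E3} (hv : ContDiff ℝ 1 v) (i j : Fin 3) (x : E3) :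
    HasLineDerivAt ℝ (fun y => v y j) (partialD i v x j) x (e i) :=
  (hasFDerivAt_coord hv j x).hasLineDerivAt (e i)

lemma hasLineDerivAt_mul {f g : E3 → ℝ} {f' g' : ℝ} {x v : E3} (hf : HasLineDerivAt ℝ f f' x v)
    (hg : HasLineDerivAt ℝ g g' x v) :
    HasLineDerivAt ℝ (fun y => f y * g y) (f' * g x + f x * g') x v := by
  have h := HasDerivAt.mul (𝕜 := ℝ) hf hg
  unfold HasLineDerivAt
  convert! h using 1
  simp

lemma continuous_coord {v : E3 → E3} (hv : Continuous v) (j : Fin 3) :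
    Continuous (fun x => v x j) :=
  (EuclideanSpace.proj (𝕜 := ℝ) j).continuous.comp hv

/-- The weak form of a transport-diffusion equation at a fixed time. -/
lemma integral_cut_transport {v : E3 → E3} (hv : ContDiff ℝ 1 v) (hdiv : ∀ x, divergence v x = 0)
    {R : ℝ} (hR : 0 < R) {ψ : E3 → ℝ} {ψ₁ ψ₂ : Fin 3 → E3 → ℝ} (hc : Continuous ψ)
    (hc₁ : ∀ i, Continuous (ψ₁ i)) (hc₂ : ∀ i, Continuous (ψ₂ i))
    (h₁ : ∀ i x, HasLineDerivAt ℝ ψ (ψ₁ i x) x (e i))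
    (h₂ : ∀ i x, HasLineDerivAt ℝ (ψ₁ i) (ψ₂ i x) x (e i)) :
    ∫ x, cut R x * (∑ i, ψ₂ i x - ∑ i, v x i * ψ₁ i x)
      = ∫ x, (∑ i, cut'' R i x + ∑ i, v x i * cut' R i x) * ψ x := by
  have hχ := continuous_cut R
  have hχs := hasCompactSupport_cut hR
  have hχ' := fun i => (contDiff_cut' R i).continuous
  have hχ's := hasCompactSupport_cut' hR
  have hχ'' := fun i => (contDiff_cut'' R i).continuous
  have hχ''s := hasCompactSupport_cut'' hR
  have hvc : ∀ i, Continuous (fun x => v x i) := continuous_coord hv.continuous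
  have hvd : ∀ i, Continuous (fun x => partialD i v x i) := fun i =>
    continuous_coord (continuous_partialD hv i) i
  have A : ∀ i, ∫ x, cut R x * ψ₂ i x = ∫ x, cut'' R i x * ψ x := fun i => by
    rw [integral_mul_hasLineDerivAt hχ (hχ' i) hχs (hχ's i) (hc₁ i) (hc₂ i)
      (hasLineDerivAt_cut R i) (h₂ i), integral_mul_hasLineDerivAt (hχ' i) (hχ'' i) (hχ's i)
      (hχ''s i) hc (hc₁ i) (hasLineDerivAt_cut' R i) (h₁ i), neg_neg]
  have B : ∀ i, ∫ x, cut R x * (v x i * ψ₁ i x)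
      = - ∫ x, (cut' R i x * v x i + cut R x * partialD i v x i) * ψ x := fun i => by
    rw [← integral_mul_hasLineDerivAt (f := fun x => cut R x * v x i)
      (f' := fun x => cut' R i x * v x i + cut R x * partialD i v x i) (g' := ψ₁ i) (v := e i)
      (hχ.mul (hvc i)) (((hχ' i).mul (hvc i)).add (hχ.mul (hvd i))) hχs.mul_right
      ((hχ's i).mul_right.add hχs.mul_right) hc (hc₁ i)
      (fun x => hasLineDerivAt_mul (hasLineDerivAt_cut R i x) (hasLineDerivAt_coord hv i i x))
      (h₁ i)]
    simp only [mul_assoc]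
  have i1 : ∀ i, Integrable (fun x => cut R x * ψ₂ i x) volume := fun i =>
    (hχ.mul (hc₂ i)).integrable_of_hasCompactSupport hχs.mul_right
  have i2 : ∀ i, Integrable (fun x => cut R x * (v x i * ψ₁ i x)) volume := fun i =>
    (hχ.mul ((hvc i).mul (hc₁ i))).integrable_of_hasCompactSupport hχs.mul_right
  have i3 : ∀ i, Integrable (fun x => cut'' R i x * ψ x) volume := fun i =>
    ((hχ'' i).mul hc).integrable_of_hasCompactSupport (hχ''s i).mul_right
  have i4 : ∀ i, Integrable
      (fun x => (cut' R i x * v x i + cut R x * partialD i v x i) * ψ x) volume := fun i =>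
    ((((hχ' i).mul (hvc i)).add (hχ.mul (hvd i))).mul hc).integrable_of_hasCompactSupport
      ((hχ's i).mul_right.add hχs.mul_right).mul_right
  have e1 : ∀ x, cut R x * (∑ i, ψ₂ i x - ∑ i, v x i * ψ₁ i x)
      = ∑ i, (cut R x * ψ₂ i x - cut R x * (v x i * ψ₁ i x)) := fun x => by
    rw [Finset.sum_sub_distrib, mul_sub, Finset.mul_sum, Finset.mul_sum]
  have e2 : ∀ x, (∑ i, cut'' R i x + ∑ i, v x i * cut' R i x) * ψ x
      = ∑ i, (cut'' R i x * ψ x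
        + (cut' R i x * v x i + cut R x * partialD i v x i) * ψ x) := fun x => by
    have h3 : ∑ i, cut R x * partialD i v x i = 0 := by
      rw [← Finset.mul_sum]
      have := hdiv x
      unfold divergence at this
      rw [this, mul_zero]
    rw [Finset.sum_add_distrib, ← Finset.sum_mul, ← Finset.sum_mul, Finset.sum_add_distrib, h3]
    simp only [mul_comm (cut' R _ x), add_zero]
    ring
  simp only [e1, e2]
  have i5 : ∀ i, Integrable (fun x => cut R x * ψ₂ i x - cut R x * (v x i * ψ₁ i x)) volume :=
    fun i => (i1 i).sub (i2 i)
  have i6 : ∀ i, Integrable (fun x => cut'' R i x * ψ x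
      + (cut' R i x * v x i + cut R x * partialD i v x i) * ψ x) volume :=
    fun i => (i3 i).add (i4 i)
  rw [integral_finsetSum _ (fun i _ => i5 i), integral_finsetSum _ (fun i _ => i6 i)]
  refine Finset.sum_congr rfl fun i _ => ?_
  rw [integral_sub (i1 i) (i2 i), integral_add (i3 i) (i4 i), A, B, sub_neg_eq_add]

end LiquidCrystal

/-! ### Integrated inequality for subsolutions: removal of the cutoff and of the positive initial
time. -/

namespace LiquidCrystal

lemma liminf_add_liminf_le (a b : ℕ → ℝ≥0∞) :
    liminf a atTop + liminf b atTop ≤ liminf (fun n => a n + b n) atTop := by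
  simp only [liminf_eq_iSup_iInf_of_nat]
  have hm : ∀ c : ℕ → ℝ≥0∞, Monotone fun n => ⨅ i ≥ n, c i := fun c n m hnm =>
    le_iInf₂ fun i hi => iInf₂_le i (hnm.trans hi)
  rw [ENNReal.iSup_add_iSup_of_monotone (hm a) (hm b)]
  exact iSup_mono fun n => le_iInf₂ fun i hi => add_le_add (iInf₂_le i hi) (iInf₂_le i hi)

lemma integrable_of_lintegral_ofReal_le {g : E3 → ℝ} (hg : Continuous g) (h0 : ∀ x, 0 ≤ g x)
    {M : ℝ} (hM : 0 ≤ M) (h : ∫⁻ x, ENNReal.ofReal (g x) ≤ ENNReal.ofReal M) :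
    Integrable g volume ∧ ∫ x, g x ≤ M := by
  have hi : Integrable g volume := by
    refine ⟨hg.aestronglyMeasurable, ?_⟩
    rw [hasFiniteIntegral_iff_ofReal (Eventually.of_forall h0)]
    exact h.trans_lt ENNReal.ofReal_lt_top
  refine ⟨hi, ?_⟩
  rw [← ofReal_integral_eq_lintegral_ofReal hi (Eventually.of_forall h0)] at h
  exact (ENNReal.ofReal_le_ofReal_iff hM).1 h

lemma enorm_sq_eq_ofReal {V : Type*} [SeminormedAddCommGroup V] (v : V) :
    ‖v‖ₑ ^ 2 = ENNReal.ofReal (‖v‖ ^ 2) := by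
  rw [← ofReal_norm, ENNReal.ofReal_pow (norm_nonneg _)]

lemma abs_coord_le (v : E3) (i : Fin 3) : |v i| ≤ ‖v‖ := by
  simpa using PiLp.norm_apply_le v i

/-- The volume of the unit ball. -/
noncomputable def ballVol : ℝ := (volume : Measure E3).real (Metric.closedBall 0 1)

/-- The cutoff radius is m², so first derivatives of the cutoff are O(m⁻²), second ones O(m⁻⁴), on a
ball of volume O(m⁶). Both errors are O(m⁻¹) using only L² bounds on the drift and on ψ; no
integrability of ψ itself is needed. -/
lemma integral_cut_error_le {v : E3 → E3} {ψ : E3 → ℝ} (hv : Continuous v) (hψ : Continuous ψ)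
    {M₁ M₂ : ℝ} (hM₁ : 0 ≤ M₁) (hM₂ : 0 ≤ M₂) (h₁ : nsq v ≤ ENNReal.ofReal M₁)
    (h₂ : ∫⁻ x, ENNReal.ofReal (ψ x ^ 2) ≤ ENNReal.ofReal M₂) {m : ℝ} (hm : 1 ≤ m) :
    ∫ x, (∑ i, cut'' (m ^ 2) i x + ∑ i, v x i * cut' (m ^ 2) i x) * ψ x
      ≤ 3 * cutConst * (8 * ballVol + M₁ + 2 * M₂) * m⁻¹ := by
  have hm0 : 0 < m := by linarith
  have hR : 0 < m ^ 2 := by positivity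
  have hK := cutConst_nonneg
  have hp0 : 0 ≤ m⁻¹ := by positivity
  have hp1 : m⁻¹ ≤ 1 := inv_le_one_of_one_le₀ hm
  simp only [nsq, enorm_sq_eq_ofReal] at h₁
  obtain ⟨i1, b1⟩ := integrable_of_lintegral_ofReal_le (g := fun x => ‖v x‖ ^ 2) (by fun_prop)
    (fun x => by positivity) hM₁ h₁
  obtain ⟨i2, b2⟩ := integrable_of_lintegral_ofReal_le (g := fun x => ψ x ^ 2) (by fun_prop)
    (fun x => by positivity) hM₂ h₂
  have hBm : MeasurableSet (Metric.closedBall (0 : E3) (2 * m ^ 2)) :=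
    Metric.isClosed_closedBall.measurableSet
  have i3 : Integrable ((Metric.closedBall (0 : E3) (2 * m ^ 2)).indicator
      fun _ => m⁻¹ ^ 7) volume := by
    rw [integrable_indicator_iff hBm]
    exact integrableOn_const (isCompact_closedBall _ _).measure_lt_top.ne
  have b3 : ∫ x, (Metric.closedBall (0 : E3) (2 * m ^ 2)).indicator (fun _ => m⁻¹ ^ 7) x
      = 8 * ballVol * m⁻¹ := by
    rw [integral_indicator hBm, setIntegral_const, smul_eq_mul, ballVol,
      Measure.addHaar_real_closedBall' _ _ (by positivity)]
    have : Module.finrank ℝ E3 = 3 := by simp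
    rw [this]
    field_simp
    ring
  set G : E3 → ℝ := fun x => 3 * cutConst * ((Metric.closedBall (0 : E3) (2 * m ^ 2)).indicator
      (fun _ => m⁻¹ ^ 7) x + m⁻¹ * ‖v x‖ ^ 2 + 2 * m⁻¹ * ψ x ^ 2) with hG
  have hGi : Integrable G volume :=
    ((i3.add (i1.const_mul _)).add (i2.const_mul _)).const_mul _
  have hpt : ∀ x, (∑ i, cut'' (m ^ 2) i x + ∑ i, v x i * cut' (m ^ 2) i x) * ψ x ≤ G x := by
    intro x
    have hind : 0 ≤ (Metric.closedBall (0 : E3) (2 * m ^ 2)).indicator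
        (fun _ => m⁻¹ ^ 7) x := Set.indicator_nonneg (fun _ _ => by positivity) _
    refine (le_abs_self _).trans ?_
    rw [abs_mul]
    by_cases hx : 2 * m ^ 2 < ‖x‖
    · simp only [cut'_eq_zero_of_lt hR _ hx, cut''_eq_zero_of_lt hR _ hx, mul_zero,
        Finset.sum_const_zero, add_zero, abs_zero, zero_mul, hG]
      positivity
    · have hxB : x ∈ Metric.closedBall (0 : E3) (2 * m ^ 2) := by simpa using not_lt.1 hx
      simp only [hG, Set.indicator_of_mem hxB]
      have a1 : |∑ i, cut'' (m ^ 2) i x| ≤ 3 * (cutConst * m⁻¹ ^ 4) := by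
        refine (Finset.abs_sum_le_sum_abs _ _).trans ?_
        refine (Finset.sum_le_sum fun i _ => abs_cut''_le hR i x).trans (le_of_eq ?_)
        simp only [Finset.sum_const, Finset.card_univ, Fintype.card_fin, nsmul_eq_mul]
        push_cast; ring
      have a2 : |∑ i, v x i * cut' (m ^ 2) i x| ≤ 3 * (‖v x‖ * (cutConst * m⁻¹ ^ 2)) := by
        refine (Finset.abs_sum_le_sum_abs _ _).trans ?_
        refine (Finset.sum_le_sum (g := fun _ => ‖v x‖ * (cutConst * m⁻¹ ^ 2))
          fun i _ => ?_).trans (le_of_eq ?_)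
        · rw [abs_mul]
          refine mul_le_mul (abs_coord_le _ _) ?_ (abs_nonneg _) (norm_nonneg _)
          simpa using abs_cut'_le hR i x
        · simp
      have a3 : |∑ i, cut'' (m ^ 2) i x + ∑ i, v x i * cut' (m ^ 2) i x|
          ≤ 3 * cutConst * (m⁻¹ ^ 4 + m⁻¹ ^ 2 * ‖v x‖) :=
        (abs_add_le _ _).trans (by linarith)
      refine (mul_le_mul_of_nonneg_right a3 (abs_nonneg _)).trans ?_
      rw [mul_assoc]
      refine mul_le_mul_of_nonneg_left ?_ (by positivity)
      have hψ2 : |ψ x| ^ 2 = ψ x ^ 2 := sq_abs _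
      -- Young's inequality between m⁻³ and |ψ|. The power 7 is the one that, multiplied by the
      -- volume of a ball of radius 2m², leaves m⁻¹.
      have c1 : m⁻¹ ^ 4 * |ψ x| ≤ m⁻¹ ^ 7 + m⁻¹ * ψ x ^ 2 := by
        have : m⁻¹ ^ 4 * |ψ x| ≤ m⁻¹ * ((m⁻¹ ^ 3) ^ 2 + |ψ x| ^ 2) := by
          have h5 := mul_nonneg hp0 (sq_nonneg (m⁻¹ ^ 3 - |ψ x|))
          have h6 : 0 ≤ m⁻¹ * (m⁻¹ ^ 3 * |ψ x|) := by positivity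
          nlinarith
        rw [hψ2] at this
        linarith [this, (by ring : m⁻¹ * ((m⁻¹ ^ 3) ^ 2 + ψ x ^ 2) = m⁻¹ ^ 7 + m⁻¹ * ψ x ^ 2)]
      have c2 : m⁻¹ ^ 2 * ‖v x‖ * |ψ x| ≤ m⁻¹ * ‖v x‖ ^ 2 + m⁻¹ * ψ x ^ 2 := by
        rw [← hψ2]
        have h7 : m⁻¹ ^ 2 ≤ m⁻¹ := by nlinarith
        have h8 : ‖v x‖ * |ψ x| ≤ ‖v x‖ ^ 2 + |ψ x| ^ 2 := by
          nlinarith [sq_nonneg (‖v x‖ - |ψ x|), norm_nonneg (v x), abs_nonneg (ψ x)]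
        calc m⁻¹ ^ 2 * ‖v x‖ * |ψ x| = m⁻¹ ^ 2 * (‖v x‖ * |ψ x|) := by ring
          _ ≤ m⁻¹ * (‖v x‖ ^ 2 + |ψ x| ^ 2) :=
            mul_le_mul h7 h8 (by positivity) hp0
          _ = _ := by ring
      linarith
  have hF : Integrable (fun x => (∑ i, cut'' (m ^ 2) i x
      + ∑ i, v x i * cut' (m ^ 2) i x) * ψ x) volume := by
    refine Continuous.integrable_of_hasCompactSupport ?_ ?_
    · refine Continuous.mul (Continuous.add ?_ ?_) hψ
      · exact continuous_finsetSum _ fun i _ => (contDiff_cut'' _ i).continuous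
      · exact continuous_finsetSum _ fun i _ =>
          (continuous_coord hv i).mul (contDiff_cut' _ i).continuous
    · refine HasCompactSupport.intro (isCompact_closedBall (0 : E3) (2 * m ^ 2)) fun x hx => ?_
      have hx' : 2 * m ^ 2 < ‖x‖ := by simpa using hx
      simp [cut'_eq_zero_of_lt hR _ hx', cut''_eq_zero_of_lt hR _ hx']
  refine (integral_mono hF hGi hpt).trans ?_
  have hGe : ∫ x, G x = 3 * cutConst * (8 * ballVol * m⁻¹ + m⁻¹ * (∫ x, ‖v x‖ ^ 2)
      + 2 * m⁻¹ * ∫ x, ψ x ^ 2) := by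
    have i4 : Integrable (fun x => (Metric.closedBall (0 : E3) (2 * m ^ 2)).indicator
      (fun _ => m⁻¹ ^ 7) x + m⁻¹ * ‖v x‖ ^ 2) volume := i3.add (i1.const_mul _)
    rw [hG, integral_const_mul, integral_add i4 (i2.const_mul _),
      integral_add i3 (i1.const_mul _), integral_const_mul, integral_const_mul, b3]
  rw [hGe, mul_assoc (3 * cutConst)]
  refine mul_le_mul_of_nonneg_left ?_ (by positivity)
  nlinarith

lemma Cts.add' {f g : ℝ → E3 → ℝ} (hf : Cts f) (hg : Cts g) : Cts fun t x => f t x + g t x :=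
  ContinuousOn.add hf hg

lemma Cts.mul' {f g : ℝ → E3 → ℝ} (hf : Cts f) (hg : Cts g) : Cts fun t x => f t x * g t x :=
  ContinuousOn.mul hf hg

lemma IsC12.cts {v : ℝ → E3 → E3} (h : IsC12 v) : Cts v := h.cont

variable {u : ℝ → E3 → E3} {ψ P N : ℝ → E3 → ℝ}

lemma HasC12.integral_cut_time_le {ψt : ℝ → E3 → ℝ} {ψ₁ ψ₂ : Fin 3 → ℝ → E3 → ℝ}
    (hu : IsDrift u) (h : IsSubsol u ψ P N) (hψ : HasC12 ψ ψt ψ₁ ψ₂)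
    (hineq : ∀ t, 0 < t → ∀ x,
      P t x - N t x ≤ ∑ i, ψ₂ i t x - ψt t x - ∑ i, u t x i * ψ₁ i t x)
    {M₁ M₂ : ℝ} (hM₁ : 0 ≤ M₁) (hM₂ : 0 ≤ M₂) {m : ℝ} (hm : 1 ≤ m) {r : ℝ} (hr : 0 < r)
    (h₁ : nsq (u r) ≤ ENNReal.ofReal M₁)
    (h₂ : ∫⁻ x, ENNReal.ofReal (ψ r x ^ 2) ≤ ENNReal.ofReal M₂) :
    (∫ x, cut (m ^ 2) x * ψt r x) + ∫ x, cut (m ^ 2) x * P r x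
      ≤ (∫ x, cut (m ^ 2) x * N r x) + 3 * cutConst * (8 * ballVol + M₁ + 2 * M₂) * m⁻¹ := by
  have hR : 0 < m ^ 2 := by positivity
  have hcs := hasCompactSupport_cut hR
  have hint : ∀ {F : E3 → ℝ}, Continuous F → Integrable (fun x => cut (m ^ 2) x * F x) volume :=
    fun hF => ((continuous_cut _).mul hF).integrable_of_hasCompactSupport hcs.mul_right
  have hu1 : ContDiff ℝ 1 (u r) := (hu.reg.diff_space r hr).of_le (by norm_num)
  have hT := integral_cut_transport hu1 (hu.div r hr) hR (hψ.cts.slice hr)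
    (fun i => (hψ.cts_space₁ i).slice hr) (fun i => (hψ.cts_space₂ i).slice hr)
    (fun i x => hψ.space₁ i r hr x) (fun i x => hψ.space₂ i r hr x)
  have hE := integral_cut_error_le hu1.continuous (hψ.cts.slice hr) hM₁ hM₂ h₁ h₂ hm
  rw [← hT] at hE
  have hc : Continuous (fun x => ∑ i, ψ₂ i r x - ∑ i, u r x i * ψ₁ i r x) := by
    refine Continuous.sub (continuous_finsetSum _ fun i _ => (hψ.cts_space₂ i).slice hr)
      (continuous_finsetSum _ fun i _ => ?_)
    exact (continuous_coord hu1.continuous i).mul ((hψ.cts_space₁ i).slice hr)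
  have hPi := hint (h.P_cts.slice hr)
  have hNi := hint (h.N_cts.slice hr)
  have hti := hint (hψ.cts_time.slice hr)
  have hci := hint hc
  have hmono : ∫ x, (cut (m ^ 2) x * ψt r x + cut (m ^ 2) x * P r x)
      ≤ ∫ x, (cut (m ^ 2) x * N r x
        + cut (m ^ 2) x * (∑ i, ψ₂ i r x - ∑ i, u r x i * ψ₁ i r x)) := by
    refine integral_mono (hti.add hPi) (hNi.add hci) fun x => ?_
    have h3 := mul_le_mul_of_nonneg_left (hineq r hr x) (cut_nonneg (m ^ 2) x)
    simp only
    linarith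
  rw [integral_add hti hPi, integral_add hNi hci] at hmono
  linarith

lemma transport_cut_le (hu : IsDrift u) (h : IsSubsol u ψ P N) {T : ℝ} (hT : 0 < T) :
    ∃ C : ℝ, 0 ≤ C ∧ ∀ m : ℝ, 1 ≤ m → ∀ s t, 0 < s → s ≤ t → t < T →
      (∫ x, cut (m ^ 2) x * ψ t x) + ∫ r in Set.Ioc s t, ∫ x, cut (m ^ 2) x * P r x
        ≤ (∫ x, cut (m ^ 2) x * ψ s x) + (∫ r in Set.Ioc s t, ∫ x, cut (m ^ 2) x * N r x)
          + C * m⁻¹ := by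
  obtain ⟨M₁, hM₁, hb₁⟩ := hu.bound T hT
  obtain ⟨M₂, hM₂, hb₂⟩ := h.bound T hT
  obtain ⟨ψt, ψ₁, ψ₂, hψ, hineq⟩ := h.ineq
  have hK := cutConst_nonneg
  have hbv : 0 ≤ ballVol := measureReal_nonneg
  refine ⟨T * (3 * cutConst * (8 * ballVol + M₁ + 2 * M₂)), by positivity,
    fun m hm s t hs hst htT => ?_⟩
  have hR : 0 < m ^ 2 := by positivity
  have hint : ∀ {F : ℝ → E3 → ℝ}, Cts F →
      IntegrableOn (fun r => ∫ x, cut (m ^ 2) x * F r x) (Set.Ioc s t) volume := fun hF =>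
    (((Cts.of_space (continuous_cut (m ^ 2))).mul' hF).integrable (ρ := 2 * m ^ 2) hs t
      (fun r x hx => by simp [cut_eq_zero hR hx.le])).integral_prod_left
  have hF := integral_weight_sub (ρ := 2 * m ^ 2) hψ.time hψ.cts hψ.cts_time
    (continuous_cut (m ^ 2)) (fun x hx => cut_eq_zero hR hx.le) hs hst
  set E := 3 * cutConst * (8 * ballVol + M₁ + 2 * M₂) * m⁻¹ with hE
  have hE0 : 0 ≤ E := by positivity
  have hconst : IntegrableOn (fun _ : ℝ => E) (Set.Ioc s t) volume :=
    integrableOn_const (by simp)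
  have hmono : ∫ r in Set.Ioc s t, ((∫ x, cut (m ^ 2) x * ψt r x) + ∫ x, cut (m ^ 2) x * P r x)
      ≤ ∫ r in Set.Ioc s t, ((∫ x, cut (m ^ 2) x * N r x) + E) := by
    refine setIntegral_mono_on ((hint hψ.cts_time).add (hint h.P_cts))
      ((hint h.N_cts).add hconst) measurableSet_Ioc fun r hr => ?_
    have hr0 : 0 < r := hs.trans hr.1
    have hrT : r < T := hr.2.trans_lt htT
    exact hψ.integral_cut_time_le hu h hineq hM₁ hM₂ hm hr0 (hb₁ r ⟨hr0, hrT⟩) (hb₂ r ⟨hr0, hrT⟩)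
  rw [integral_add (hint hψ.cts_time) (hint h.P_cts), integral_add (hint h.N_cts) hconst,
    ← hF] at hmono
  have hEc : ∫ _ in Set.Ioc s t, E = (t - s) * E := by simp [hst]
  rw [hEc] at hmono
  have : (t - s) * E ≤ T * E := mul_le_mul_of_nonneg_right (by linarith) hE0
  have hfin : T * (3 * cutConst * (8 * ballVol + M₁ + 2 * M₂)) * m⁻¹ = T * E := by rw [hE]; ring
  rw [hfin]
  linarith

lemma aemeasurable_ofReal_cts {F : ℝ → E3 → ℝ} (hF : Cts F) {s : ℝ} (hs : 0 ≤ s) (t : ℝ) :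
    AEMeasurable (fun q : ℝ × E3 => ENNReal.ofReal (F q.1 q.2))
      (((volume : Measure ℝ).restrict (Set.Ioc s t)).prod (volume : Measure E3)) :=
  (hF.aestronglyMeasurable hs t).aemeasurable.ennreal_ofReal

lemma ofReal_integral_cut {F : E3 → ℝ} (hF : Continuous F) (h0 : ∀ x, 0 ≤ F x) {R : ℝ}
    (hR : 0 < R) :
    ENNReal.ofReal (∫ x, cut R x * F x) = ∫⁻ x, ENNReal.ofReal (cut R x * F x) :=
  ofReal_integral_eq_lintegral_ofReal
    (((continuous_cut _).mul hF).integrable_of_hasCompactSupport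
      (hasCompactSupport_cut hR).mul_right)
    (Eventually.of_forall fun x => mul_nonneg (cut_nonneg R x) (h0 x))

lemma ofReal_integral_integral_cut {F : ℝ → E3 → ℝ} (hF : Cts F)
    (h0 : ∀ t, 0 < t → ∀ x, 0 ≤ F t x) {R : ℝ} (hR : 0 < R) {s : ℝ} (hs : 0 < s) (t : ℝ) :
    ENNReal.ofReal (∫ r in Set.Ioc s t, ∫ x, cut R x * F r x)
      = ∫⁻ r in Set.Ioc s t, ∫⁻ x, ENNReal.ofReal (cut R x * F r x) := by
  have hi := ((Cts.of_space (continuous_cut R)).mul' hF).integrable (ρ := 2 * R) hs t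
      (fun r x hx => by simp [cut_eq_zero hR hx.le])
  rw [ofReal_integral_eq_lintegral_ofReal hi.integral_prod_left]
  · refine setLIntegral_congr_fun measurableSet_Ioc fun r hr => ?_
    exact ofReal_integral_cut (hF.slice (hs.trans hr.1)) (h0 r (hs.trans hr.1)) hR
  · refine (ae_restrict_iff' measurableSet_Ioc).2 (Eventually.of_forall fun r hr => ?_)
    exact integral_nonneg fun x => mul_nonneg (cut_nonneg R x) (h0 r (hs.trans hr.1) x)

/-- The transport inequality with a cutoff, in `ℝ≥0∞`. -/
lemma transport_cut_lintegral_le (hu : IsDrift u) (h : IsSubsol u ψ P N) {T : ℝ} (hT : 0 < T) :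
    ∃ C : ℝ, 0 ≤ C ∧ ∀ m : ℝ, 1 ≤ m → ∀ s t, 0 < s → s ≤ t → t < T →
      (∫⁻ x, ENNReal.ofReal (cut (m ^ 2) x * ψ t x))
          + ∫⁻ r in Set.Ioc s t, ∫⁻ x, ENNReal.ofReal (cut (m ^ 2) x * P r x)
        ≤ (∫⁻ x, ENNReal.ofReal (cut (m ^ 2) x * ψ s x))
          + (∫⁻ r in Set.Ioc s t, ∫⁻ x, ENNReal.ofReal (N r x)) + ENNReal.ofReal (C * m⁻¹) := by
  obtain ⟨C, hC, hle⟩ := transport_cut_le hu h hT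
  refine ⟨C, hC, fun m hm s t hs hst htT => ?_⟩
  have hR : 0 < m ^ 2 := by positivity
  have hψc : Cts ψ := by obtain ⟨ψt, ψ₁, ψ₂, hψ, _⟩ := h.ineq; exact hψ.cts
  have ht : 0 < t := hs.trans_le hst
  have hN : ∫⁻ r in Set.Ioc s t, ∫⁻ x, ENNReal.ofReal (cut (m ^ 2) x * N r x)
      ≤ ∫⁻ r in Set.Ioc s t, ∫⁻ x, ENNReal.ofReal (N r x) := by
    refine setLIntegral_mono' measurableSet_Ioc fun r hr => lintegral_mono fun x => ?_
    exact ENNReal.ofReal_le_ofReal (mul_le_of_le_one_left (h.N_nonneg r (hs.trans hr.1) x)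
      (cut_le_one _ _))
  refine le_trans ?_ (add_le_add (add_le_add le_rfl hN) le_rfl)
  rw [← ofReal_integral_cut (hψc.slice ht) (h.nonneg t ht) hR,
    ← ofReal_integral_cut (hψc.slice hs) (h.nonneg s hs) hR,
    ← ofReal_integral_integral_cut h.P_cts h.P_nonneg hR hs,
    ← ofReal_integral_integral_cut h.N_cts h.N_nonneg hR hs]
  have n1 : ∀ {F : E3 → ℝ}, (∀ x, 0 ≤ F x) → 0 ≤ ∫ x, cut (m ^ 2) x * F x := fun hF =>
    integral_nonneg fun x => mul_nonneg (cut_nonneg _ x) (hF x)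
  have n2 : ∀ {F : ℝ → E3 → ℝ}, (∀ t, 0 < t → ∀ x, 0 ≤ F t x) →
      0 ≤ ∫ r in Set.Ioc s t, ∫ x, cut (m ^ 2) x * F r x := fun hF =>
    setIntegral_nonneg measurableSet_Ioc fun r hr => n1 (hF r (hs.trans hr.1))
  rw [← ENNReal.ofReal_add (n1 (h.nonneg t ht)) (n2 h.P_nonneg),
    ← ENNReal.ofReal_add (n1 (h.nonneg s hs)) (n2 h.N_nonneg),
    ← ENNReal.ofReal_add (add_nonneg (n1 (h.nonneg s hs)) (n2 h.N_nonneg)) (by positivity)]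
  exact ENNReal.ofReal_le_ofReal (hle m hm s t hs hst htT)

lemma tendsto_cut_sq (x : E3) :
    Tendsto (fun n : ℕ => cut (((n : ℝ) + 1) ^ 2) x) atTop (𝓝 1) := by
  refine tendsto_const_nhds.congr' ?_
  obtain ⟨K, hK⟩ := exists_nat_ge ‖x‖
  filter_upwards [eventually_ge_atTop K] with n hn
  have h1 : (K : ℝ) ≤ n := by exact_mod_cast hn
  refine (cut_eq_one (by positivity) ?_).symm
  nlinarith [(Nat.cast_nonneg n : (0 : ℝ) ≤ n)]

lemma lintegral_le_liminf_cut {F : E3 → ℝ} (hF : Continuous F) :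
    ∫⁻ x, ENNReal.ofReal (F x)
      ≤ liminf (fun n : ℕ => ∫⁻ x, ENNReal.ofReal (cut (((n : ℝ) + 1) ^ 2) x * F x)) atTop := by
  refine le_trans (le_of_eq ?_) (lintegral_liminf_le' (u := atTop) fun n =>
    (((continuous_cut _).mul hF).measurable.ennreal_ofReal).aemeasurable)
  refine lintegral_congr fun x => ?_
  have := ENNReal.tendsto_ofReal ((tendsto_cut_sq x).mul_const (F x))
  rw [one_mul] at this
  exact this.liminf_eq.symm

lemma lintegral_lintegral_le_liminf_cut {F : ℝ → E3 → ℝ} (hF : Cts F) {s : ℝ} (hs : 0 ≤ s)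
    (t : ℝ) :
    ∫⁻ r in Set.Ioc s t, ∫⁻ x, ENNReal.ofReal (F r x)
      ≤ liminf (fun n : ℕ => ∫⁻ r in Set.Ioc s t, ∫⁻ x,
        ENNReal.ofReal (cut (((n : ℝ) + 1) ^ 2) x * F r x)) atTop := by
  have hm : ∀ n : ℕ, AEMeasurable (fun r => ∫⁻ x,
      ENNReal.ofReal (cut (((n : ℝ) + 1) ^ 2) x * F r x)) (volume.restrict (Set.Ioc s t)) :=
    fun n => (aemeasurable_ofReal_cts ((Cts.of_space (continuous_cut _)).mul' hF)
      hs t).lintegral_prod_right'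
  refine le_trans ?_ (lintegral_liminf_le' (u := atTop) hm)
  refine setLIntegral_mono' measurableSet_Ioc fun r hr => ?_
  exact lintegral_le_liminf_cut (hF.slice (hs.trans_lt hr.1))

lemma tendsto_const_mul_inv_ofReal (C : ℝ) :
    Tendsto (fun n : ℕ => ENNReal.ofReal (C * ((n : ℝ) + 1)⁻¹)) atTop (𝓝 0) := by
  have h0 : Tendsto (fun n : ℕ => C * ((n : ℝ) + 1)⁻¹) atTop (𝓝 0) := by
    simpa using (tendsto_one_div_add_atTop_nhds_zero_nat (𝕜 := ℝ)).const_mul C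
  simpa using ENNReal.tendsto_ofReal h0

lemma IsSubsol.cts (h : IsSubsol u ψ P N) : Cts ψ := by
  obtain ⟨ψt, ψ₁, ψ₂, hψ, _⟩ := h.ineq; exact hψ.cts

/-- Fatou is used for the two terms on the left only, so integrability of ψ at time t and of the
dissipation P comes out as a conclusion instead of being assumed. -/
lemma transport_fatou (h : IsSubsol u ψ P N) {s t : ℝ} (hs : 0 < s) (hst : s ≤ t)
    {A : ℝ≥0∞} {C : ℝ}
    (hle : ∀ n : ℕ, (∫⁻ x, ENNReal.ofReal (cut (((n : ℝ) + 1) ^ 2) x * ψ t x))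
      + ∫⁻ r in Set.Ioc s t, ∫⁻ x, ENNReal.ofReal (cut (((n : ℝ) + 1) ^ 2) x * P r x)
        ≤ A + ENNReal.ofReal (C * ((n : ℝ) + 1)⁻¹)) :
    (∫⁻ x, ENNReal.ofReal (ψ t x)) + ∫⁻ r in Set.Ioc s t, ∫⁻ x, ENNReal.ofReal (P r x) ≤ A := by
  refine (add_le_add (lintegral_le_liminf_cut (h.cts.slice (hs.trans_le hst)))
    (lintegral_lintegral_le_liminf_cut h.P_cts hs.le t)).trans ?_
  refine (liminf_add_liminf_le _ _).trans ?_
  refine (liminf_le_liminf (Eventually.of_forall hle)).trans ?_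
  have := (tendsto_const_mul_inv_ofReal C).const_add A
  rw [add_zero] at this
  exact this.liminf_eq.le

theorem transport_le (hu : IsDrift u) (h : IsSubsol u ψ P N) {s t : ℝ} (hs : 0 < s)
    (hst : s ≤ t) :
    (∫⁻ x, ENNReal.ofReal (ψ t x)) + ∫⁻ r in Set.Ioc s t, ∫⁻ x, ENNReal.ofReal (P r x)
      ≤ (∫⁻ x, ENNReal.ofReal (ψ s x)) + ∫⁻ r in Set.Ioc s t, ∫⁻ x, ENNReal.ofReal (N r x) := by
  obtain ⟨C, hC, hle⟩ := transport_cut_lintegral_le hu h (T := t + 1) (by linarith)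
  refine transport_fatou h hs hst (C := C) fun n => ?_
  refine (hle (n + 1) (by linarith [(Nat.cast_nonneg n : (0 : ℝ) ≤ n)]) s t hs hst
    (by linarith)).trans ?_
  refine add_le_add (add_le_add (lintegral_mono fun x => ?_) le_rfl) le_rfl
  exact ENNReal.ofReal_le_ofReal (mul_le_of_le_one_left (h.nonneg s hs x) (cut_le_one _ _))

/-- Monotone convergence along the intervals (t/(n+1), t], which exhaust (0, t]. -/
lemma setLIntegral_Ioc_zero_le {G : ℝ → ℝ≥0∞} {t : ℝ} {A B : ℝ≥0∞}
    (h : ∀ s, 0 < s → s ≤ t → B + ∫⁻ r in Set.Ioc s t, G r ≤ A) (ht : 0 < t) :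
    B + ∫⁻ r in Set.Ioc 0 t, G r ≤ A := by
  have hU : Set.Ioc 0 t = ⋃ n : ℕ, Set.Ioc (t / ((n : ℝ) + 1)) t := by
    ext r
    simp only [Set.mem_Ioc, Set.mem_iUnion]
    constructor
    · rintro ⟨h1, h2⟩
      obtain ⟨n, hn⟩ := exists_nat_gt (t / r)
      refine ⟨n, ?_, h2⟩
      rw [div_lt_iff₀ (by positivity)]
      rw [div_lt_iff₀ h1] at hn
      nlinarith
    · rintro ⟨n, h1, h2⟩
      exact ⟨lt_trans (by positivity) h1, h2⟩
  have hd : Directed (· ⊆ ·) fun n : ℕ => Set.Ioc (t / ((n : ℝ) + 1)) t := by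
    refine Monotone.directed_le fun n m hnm => Set.Ioc_subset_Ioc_left ?_
    have : (n : ℝ) ≤ m := by exact_mod_cast hnm
    gcongr
  rw [hU, setLIntegral_iUnion_of_directed _ hd, ENNReal.add_iSup]
  refine iSup_le fun n => h _ (by positivity) ?_
  exact div_le_self ht.le (by linarith [(Nat.cast_nonneg n : (0 : ℝ) ≤ n)])

/-- The transport inequality from the initial time. -/
theorem transport_zero_le (hu : IsDrift u) (h : IsSubsol u ψ P N) {ψ₀ : E3 → ℝ≥0∞}
    {δ : ℝ → E3 → E3} (hδm : ∀ s, 0 < s → AEStronglyMeasurable (δ s) volume)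
    (hδ : Tendsto (fun s => nsq (δ s)) (𝓝[>] 0) (𝓝 0)) (hψ₀ : AEMeasurable ψ₀ volume)
    (hle₀ : ∀ s, 0 < s → ∀ᵐ x, ENNReal.ofReal (ψ s x) ≤ ψ₀ x + (4 * ‖δ s x‖ₑ + ‖δ s x‖ₑ ^ 2))
    {t : ℝ} (ht : 0 < t) :
    (∫⁻ x, ENNReal.ofReal (ψ t x)) + ∫⁻ r in Set.Ioc 0 t, ∫⁻ x, ENNReal.ofReal (P r x)
      ≤ (∫⁻ x, ψ₀ x) + ∫⁻ r in Set.Ioc 0 t, ∫⁻ x, ENNReal.ofReal (N r x) := by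
  obtain ⟨C, hC, hle⟩ := transport_cut_lintegral_le hu h (T := t + 1) (by linarith)
  -- The dissipation is kept on a fixed interval (s₀, t] while the starting time s ≤ s₀ tends to
  -- zero; s₀ is released last.
  refine setLIntegral_Ioc_zero_le (fun s₀ hs₀ hs₀t => ?_) ht
  refine transport_fatou h hs₀ hs₀t (C := C) fun n => ?_
  have hm1 : (1 : ℝ) ≤ (n : ℝ) + 1 := by linarith [(Nat.cast_nonneg n : (0 : ℝ) ≤ n)]
  set m : ℝ := (n : ℝ) + 1
  have hR : 0 < m ^ 2 := by positivity
  set K : ℝ≥0∞ := ∫⁻ x, ‖cut (m ^ 2) x‖ₑ ^ 2 with hKdef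
  have hK : K < ⊤ := lintegral_enorm_sq_lt_top (continuous_cut _) (hasCompactSupport_cut hR)
  have hK' : K ^ (1 / 2 : ℝ) ≠ ⊤ := ENNReal.rpow_ne_top_of_nonneg (by norm_num) hK.ne
  set N₀ := ∫⁻ r in Set.Ioc 0 t, ∫⁻ x, ENNReal.ofReal (N r x)
  -- The limit s → 0 is taken with the cutoff frozen: the term linear in δ is only known in L², so
  -- it is paired with the cutoff, whose L² norm `K` is finite for each fixed radius.
  have hlim : Tendsto (fun s => (∫⁻ x, ψ₀ x)
      + (4 * (K ^ (1 / 2 : ℝ) * nsq (δ s) ^ (1 / 2 : ℝ)) + nsq (δ s)) + N₀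
      + ENNReal.ofReal (C * m⁻¹)) (𝓝[>] 0)
      (𝓝 ((∫⁻ x, ψ₀ x) + (4 * (K ^ (1 / 2 : ℝ) * 0 ^ (1 / 2 : ℝ)) + 0) + N₀
        + ENNReal.ofReal (C * m⁻¹))) := by
    refine ((tendsto_const_nhds.add ((ENNReal.Tendsto.const_mul (ENNReal.Tendsto.const_mul
      (hδ.ennrpow_const _) (Or.inr hK')) (Or.inr (by simp))).add hδ)).add_const _).add_const _
  have hz : (0 : ℝ≥0∞) ^ (1 / 2 : ℝ) = 0 := by simp
  rw [hz, mul_zero, mul_zero, add_zero, add_zero] at hlim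
  refine ge_of_tendsto hlim ?_
  filter_upwards [Ioo_mem_nhdsGT hs₀] with s hs
  have hs0 : 0 < s := hs.1
  have h1 := hle m hm1 s t hs0 (hs.2.le.trans hs₀t) (by linarith)
  refine le_trans (add_le_add le_rfl (lintegral_mono' (Measure.restrict_mono
    (Set.Ioc_subset_Ioc_left hs.2.le) le_rfl) le_rfl)) (h1.trans ?_)
  refine add_le_add (add_le_add ?_ ?_) le_rfl
  · have hcs := lintegral_mul_sq_le (μ := volume) (continuous_cut (m ^ 2)).enorm.aemeasurable
      (hδm s hs0).enorm
    have hcs' : ∫⁻ x, ‖cut (m ^ 2) x‖ₑ * ‖δ s x‖ₑ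
        ≤ K ^ (1 / 2 : ℝ) * nsq (δ s) ^ (1 / 2 : ℝ) := by
      rw [← ENNReal.mul_rpow_of_nonneg _ _ (by norm_num)]
      have := ENNReal.rpow_le_rpow hcs (z := 1 / 2) (by norm_num)
      rw [← ENNReal.rpow_natCast, ← ENNReal.rpow_mul] at this
      norm_num at this
      norm_num
      exact this
    have hpt : ∀ᵐ x, ENNReal.ofReal (cut (m ^ 2) x * ψ s x)
        ≤ ψ₀ x + (4 * (‖cut (m ^ 2) x‖ₑ * ‖δ s x‖ₑ) + ‖δ s x‖ₑ ^ 2) := by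
      filter_upwards [hle₀ s hs0] with x hx
      rw [ENNReal.ofReal_mul (cut_nonneg _ _), Real.enorm_of_nonneg (cut_nonneg _ _)]
      have hc1 : ENNReal.ofReal (cut (m ^ 2) x) ≤ 1 := by
        simpa using ENNReal.ofReal_le_ofReal (cut_le_one (m ^ 2) x)
      refine (mul_le_mul_right hx _).trans ?_
      rw [mul_add, mul_add]
      refine add_le_add (mul_le_of_le_one_left zero_le hc1) (add_le_add (le_of_eq (by ring)) ?_)
      exact mul_le_of_le_one_left zero_le hc1
    refine (lintegral_mono_ae hpt).trans ?_
    have hmm : AEMeasurable (fun x => 4 * (‖cut (m ^ 2) x‖ₑ * ‖δ s x‖ₑ)) volume :=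
      ((continuous_cut (m ^ 2)).enorm.aemeasurable.mul (hδm s hs0).enorm).const_mul _
    rw [lintegral_add_left' hψ₀, lintegral_add_left' hmm,
      lintegral_const_mul' _ _ (by simp)]
    gcongr
    exact le_rfl
  · exact lintegral_mono' (Measure.restrict_mono (Set.Ioc_subset_Ioc_left hs0.le) le_rfl) le_rfl

end LiquidCrystal

namespace LiquidCrystal

/-! ### Scalar functions of a director field -/

lemma IsC12.cts_time {v : ℝ → E3 → E3} (h : IsC12 v) :
    Cts (fun t x => deriv (fun s => v s x) t) := h.cont_time

lemma IsC12.contDiff_one {v : ℝ → E3 → E3} (h : IsC12 v) {t : ℝ} (ht : 0 < t) :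
    ContDiff ℝ 1 (v t) := (h.diff_space t ht).of_le (by norm_num)

lemma IsC12.cts_partialD {v : ℝ → E3 → E3} (h : IsC12 v) (i : Fin 3) :
    Cts (fun t x => partialD i (v t) x) :=
  h.cont_fderiv.clm_apply continuousOn_const

lemma IsC12.cts_partialD_partialD {v : ℝ → E3 → E3} (h : IsC12 v) (i j : Fin 3) :
    Cts (fun t x => partialD i (partialD j (v t)) x) := by
  refine ((h.cont_fderiv2.clm_apply continuousOn_const).clm_apply continuousOn_const :
    ContinuousOn (fun q : ℝ × E3 => fderiv ℝ (fderiv ℝ (v q.1)) q.2 (e i) (e j)) _).congr ?_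
  rintro ⟨t, x⟩ ⟨ht, -⟩
  exact partialD_partialD (h.diff_space t ht) i j x

lemma hasLineDerivAt_partialD {f : E3 → E3} (hf : ContDiff ℝ 1 f) (i : Fin 3) (x : E3) :
    HasLineDerivAt ℝ f (partialD i f x) x (e i) :=
  (hf.differentiable one_ne_zero x).hasFDerivAt.hasLineDerivAt _

lemma HasLineDerivAt.inner' {f g : E3 → E3} {f' g' x v : E3} (hf : HasLineDerivAt ℝ f f' x v)
    (hg : HasLineDerivAt ℝ g g' x v) :
    HasLineDerivAt ℝ (fun y => inner ℝ (f y) (g y))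
      (inner ℝ (f x) g' + inner ℝ f' (g x)) x v := by
  have h := HasDerivAt.inner ℝ hf hg
  unfold HasLineDerivAt
  convert! h using 1
  simp

lemma Cts.inner' {f g : ℝ → E3 → E3} (hf : Cts f) (hg : Cts g) :
    Cts (fun t x => inner ℝ (f t x) (g t x)) :=
  ContinuousOn.inner hf hg

lemma Cts.sub_const {f : ℝ → E3 → E3} (hf : Cts f) (c : E3) : Cts (fun t x => f t x - c) :=
  ContinuousOn.sub hf continuousOn_const

lemma Cts.const_mul' {f : ℝ → E3 → ℝ} (hf : Cts f) (c : ℝ) : Cts (fun t x => c * f t x) :=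
  ContinuousOn.mul continuousOn_const hf

lemma Cts.sum {ι : Type*} {s : Finset ι} {f : ι → ℝ → E3 → ℝ} (hf : ∀ i, Cts (f i)) :
    Cts (fun t x => ∑ i ∈ s, f i t x) :=
  continuousOn_finsetSum _ fun i _ => hf i

lemma Cts.comp_on {f : ℝ → E3 → ℝ} (hf : Cts f) {b : ℝ → ℝ} {s : Set ℝ} (hb : ContinuousOn b s)
    (h : ∀ t, 0 < t → ∀ x, f t x ∈ s) : Cts (fun t x => b (f t x)) :=
  ContinuousOn.comp hb hf fun _ hq => h _ hq.1 _

/-- The squared distance `|d - c|²` is `C^{1,2}` when `d` is. -/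
lemma IsC12.hasC12_norm_sub_sq {d : ℝ → E3 → E3} (h : IsC12 d) (c : E3) :
    HasC12 (fun t x => ‖d t x - c‖ ^ 2)
      (fun t x => 2 * inner ℝ (d t x - c) (deriv (fun s => d s x) t))
      (fun i t x => 2 * inner ℝ (d t x - c) (partialD i (d t) x))
      (fun i t x => 2 * (inner ℝ (d t x - c) (partialD i (partialD i (d t)) x)
        + ‖partialD i (d t) x‖ ^ 2)) where
  time t ht x := ((h.diff_time t ht x).hasDerivAt.sub_const c).norm_sq
  space₁ i t ht x := by
    have h1 := (hasLineDerivAt_partialD (h.contDiff_one ht) i x)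
    unfold HasLineDerivAt at h1 ⊢
    simpa using (h1.sub_const c).norm_sq
  space₂ i t ht x := by
    have h1 : HasLineDerivAt ℝ (fun y => d t y - c) (partialD i (d t) x) x (e i) := by
      have h1 := (hasLineDerivAt_partialD (h.contDiff_one ht) i x)
      unfold HasLineDerivAt at h1 ⊢
      exact h1.sub_const c
    have h2 := hasLineDerivAt_partialD (f := partialD i (d t))
      (contDiff_partialD (n := 1) (h.diff_space t ht) i) i x
    have h3 := HasLineDerivAt.inner' h1 h2
    rw [real_inner_self_eq_norm_sq] at h3
    unfold HasLineDerivAt at h3 ⊢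
    exact h3.const_mul 2
  cts := by
    have := (h.cts.sub_const c).inner' (h.cts.sub_const c)
    simpa only [real_inner_self_eq_norm_sq] using this
  cts_time := ((h.cts.sub_const c).inner' h.cts_time).const_mul' 2
  cts_space₁ i := ((h.cts.sub_const c).inner' (h.cts_partialD i)).const_mul' 2
  cts_space₂ i := by
    refine Cts.const_mul' (Cts.add' ((h.cts.sub_const c).inner' (h.cts_partialD_partialD i i)) ?_) 2
    have := (h.cts_partialD i).inner' (h.cts_partialD i)
    simpa only [real_inner_self_eq_norm_sq] using this

/-- The chain rule for `b ∘ ψ`. -/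
lemma HasC12.comp {ψ ψt : ℝ → E3 → ℝ} {ψ₁ ψ₂ : Fin 3 → ℝ → E3 → ℝ} (h : HasC12 ψ ψt ψ₁ ψ₂)
    {b b' b'' : ℝ → ℝ} {s : Set ℝ} (hs : ∀ t, 0 < t → ∀ x, ψ t x ∈ s)
    (hb : ∀ y ∈ s, HasDerivAt b (b' y) y) (hb' : ∀ y ∈ s, HasDerivAt b' (b'' y) y)
    (hb'' : ContinuousOn b'' s) :
    HasC12 (fun t x => b (ψ t x)) (fun t x => b' (ψ t x) * ψt t x)
      (fun i t x => b' (ψ t x) * ψ₁ i t x)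
      (fun i t x => b'' (ψ t x) * ψ₁ i t x ^ 2 + b' (ψ t x) * ψ₂ i t x) where
  time t ht x := (hb _ (hs t ht x)).comp t (h.time t ht x)
  space₁ i t ht x := by
    have h1 := h.space₁ i t ht x
    unfold HasLineDerivAt at h1 ⊢
    have h2 := hb _ (hs t ht x)
    exact HasDerivAt.comp (h₂ := b) 0 (by simpa using h2) h1
  space₂ i t ht x := by
    have h1 := h.space₁ i t ht x
    have h3 : HasLineDerivAt ℝ (fun y => b' (ψ t y)) (b'' (ψ t x) * ψ₁ i t x) x (e i) := by
      unfold HasLineDerivAt at h1 ⊢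
      have h2 := hb' _ (hs t ht x)
      exact HasDerivAt.comp (h₂ := b') 0 (by simpa using h2) h1
    have := hasLineDerivAt_mul h3 (h.space₂ i t ht x)
    convert this using 1
    ring
  cts := h.cts.comp_on (fun y hy => (hb y hy).continuousAt.continuousWithinAt) hs
  cts_time := (h.cts.comp_on (fun y hy => (hb' y hy).continuousAt.continuousWithinAt) hs).mul'
    h.cts_time
  cts_space₁ i := (h.cts.comp_on (fun y hy => (hb' y hy).continuousAt.continuousWithinAt) hs).mul'
    (h.cts_space₁ i)
  cts_space₂ i := by
    refine Cts.add' (Cts.mul' (h.cts.comp_on hb'' hs) ?_) (Cts.mul' (h.cts.comp_on (fun y hy =>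
      (hb' y hy).continuousAt.continuousWithinAt) hs) (h.cts_space₂ i))
    have := (h.cts_space₁ i).mul' (h.cts_space₁ i)
    simpa only [← sq] using this

section Solution

variable {η : ℝ} {w₀ : E3} {u₀ d₀ : E3 → E3} {u d : ℝ → E3 → E3} {π : ℝ → E3 → ℝ}

lemma IsSolution.isDrift (h : IsSolution η w₀ u₀ d₀ u π d) : IsDrift u where
  reg := h.u_reg
  div := h.incompressible
  bound T hT := by
    obtain ⟨M, hM⟩ := h.u_bound T hT
    refine ⟨max M 0, le_max_right _ _, fun t ht => (nsq_le_sobolevSq 1 _).trans ((hM t ht).trans ?_)⟩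
    exact ENNReal.ofReal_le_ofReal (le_max_left _ _)

lemma fderiv_eq_sum_coord {f : E3 → E3} (x v : E3) :
    fderiv ℝ f x v = ∑ i, v i • partialD i f x := by
  conv_lhs => rw [← sum_smul_e v]
  rw [map_sum]
  simp [partialD]

/-- The equation of `b(|d - c|²)`. -/
lemma IsSolution.director_comp (h : IsSolution η w₀ u₀ d₀ u π d) (c : E3) (b' b'' : ℝ) {t : ℝ}
    (ht : 0 < t) (x : E3) :
    ∑ i, (b'' * (2 * inner ℝ (d t x - c) (partialD i (d t) x)) ^ 2
        + b' * (2 * (inner ℝ (d t x - c) (partialD i (partialD i (d t)) x)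
          + ‖partialD i (d t) x‖ ^ 2)))
      - b' * (2 * inner ℝ (d t x - c) (deriv (fun s => d s x) t))
      - ∑ i, u t x i * (b' * (2 * inner ℝ (d t x - c) (partialD i (d t) x)))
    = 4 * b'' * ∑ i, inner ℝ (d t x - c) (partialD i (d t) x) ^ 2
      + b' * (2 * ∑ i, ‖partialD i (d t) x‖ ^ 2
        + 2 * inner ℝ (d t x - c) (glForce η (d t x))) := by
  have h1 := congrArg (fun z => inner ℝ (d t x - c) z) (h.director t ht x)
  simp only [laplacian_eq_sum_partialD (h.d_reg.diff_space t ht), fderiv_eq_sum_coord, inner_add_right,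
    inner_sub_right, inner_sum, real_inner_smul_right] at h1
  simp only [Fin.sum_univ_three] at h1 ⊢
  linear_combination (-2) * b' * h1

lemma two_mul_inner_glForce {w d : E3} (hw : ‖w‖ = 1) :
    2 * inner ℝ (d - w) (glForce η d)
      = 1 / η ^ 2 * ((‖d‖ ^ 2 - 1) ^ 2 + (‖d‖ ^ 2 - 1) * ‖d - w‖ ^ 2) := by
  have h1 : ‖d - w‖ ^ 2 = ‖d‖ ^ 2 - 2 * inner ℝ d w + 1 := by rw [norm_sub_sq_real, hw]; ring
  have h2 : (inner ℝ (d - w) d : ℝ) = ‖d‖ ^ 2 - inner ℝ d w := by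
    rw [inner_sub_left, real_inner_self_eq_norm_sq, real_inner_comm]
  rw [glForce, real_inner_smul_right, h1, h2]
  ring

end Solution

end LiquidCrystal

/-! ### The maximum principle for the director. -/

namespace LiquidCrystal

/-- The two one-sided derivatives agree at the origin because g' vanishes there. Applied to
`barrier` and again to `barrier'`, this makes the barrier of the positive part twice differentiable.
-/
lemma hasDerivAt_comp_max {g g' : ℝ → ℝ} (hg : ∀ y, 0 ≤ y → HasDerivAt g (g' y) y) (h0 : g' 0 = 0)
    (x : ℝ) : HasDerivAt (fun x => g (max x 0)) (g' (max x 0)) x := by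
  rcases lt_trichotomy x 0 with hx | hx | hx
  · rw [max_eq_right hx.le, h0]
    refine (hasDerivAt_const x (g 0)).congr_of_eventuallyEq ?_
    filter_upwards [Iio_mem_nhds hx] with y hy
    rw [max_eq_right (le_of_lt hy)]
  · subst hx
    rw [max_self, h0, ← hasDerivWithinAt_univ, ← Set.Iic_union_Ici (a := (0 : ℝ))]
    refine HasDerivWithinAt.union ?_ ?_
    · refine (hasDerivWithinAt_const (0 : ℝ) _ (g 0)).congr (fun y hy => ?_) (by simp)
      rw [max_eq_right hy]
    · have := (hg 0 le_rfl).hasDerivWithinAt (s := Set.Ici 0)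
      rw [h0] at this
      refine this.congr (fun y hy => ?_) (by simp)
      rw [max_eq_left hy]
  · rw [max_eq_left hx.le]
    refine (hg x hx.le).congr_of_eventuallyEq ?_
    filter_upwards [Ioi_mem_nhds hx] with y hy
    rw [max_eq_left (le_of_lt hy)]

/-- Trades a square root for an affine bound, in places where only finiteness matters. -/
lemma le_add_one_of_sq_le {X K : ℝ≥0∞} (h : X ^ 2 ≤ K) : X ≤ K + 1 := by
  rcases le_total X 1 with h1 | h1
  · exact h1.trans le_add_self
  · refine le_trans ?_ (h.trans le_self_add)
    calc X = X * 1 := (mul_one X).symm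
      _ ≤ X * X := mul_le_mul_right h1 X
      _ = X ^ 2 := (sq X).symm

section Solution

variable {η : ℝ} {w₀ : E3} {u₀ d₀ : E3 → E3} {u d : ℝ → E3 → E3} {π : ℝ → E3 → ℝ}

lemma IsSolution.isSubsol_comp (h : IsSolution η w₀ u₀ d₀ u π d) (c : E3) {b b' b'' : ℝ → ℝ}
    (hb : ∀ y, 0 ≤ y → HasDerivAt b (b' y) y) (hb' : ∀ y, 0 ≤ y → HasDerivAt b' (b'' y) y)
    (hb'' : ContinuousOn b'' (Set.Ici 0)) (hb0 : ∀ y, 0 ≤ y → 0 ≤ b y) {P N : ℝ → E3 → ℝ}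
    (hP : ∀ t, 0 < t → ∀ x, 0 ≤ P t x) (hN : ∀ t, 0 < t → ∀ x, 0 ≤ N t x) (hPc : Cts P)
    (hNc : Cts N)
    (hPN : ∀ t, 0 < t → ∀ x, P t x - N t x
      ≤ 4 * b'' (‖d t x - c‖ ^ 2) * ∑ i, inner ℝ (d t x - c) (partialD i (d t) x) ^ 2
        + b' (‖d t x - c‖ ^ 2) * (2 * ∑ i, ‖partialD i (d t) x‖ ^ 2
          + 2 * inner ℝ (d t x - c) (glForce η (d t x))))
    (hbd : ∀ T : ℝ, 0 < T → ∃ M : ℝ, 0 ≤ M ∧ ∀ t ∈ Set.Ioo 0 T,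
      ∫⁻ x, ENNReal.ofReal (b (‖d t x - c‖ ^ 2) ^ 2) ≤ ENNReal.ofReal M) :
    IsSubsol u (fun t x => b (‖d t x - c‖ ^ 2)) P N where
  ineq := by
    refine ⟨_, _, _, (h.d_reg.hasC12_norm_sub_sq c).comp (s := Set.Ici 0)
      (fun t _ x => sq_nonneg ‖d t x - c‖) hb hb' hb'', fun t ht x => ?_⟩
    rw [h.director_comp c _ _ ht x]
    exact hPN t ht x
  nonneg t ht x := hb0 _ (sq_nonneg _)
  P_nonneg := hP
  N_nonneg := hN
  P_cts := hPc
  N_cts := hNc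
  bound := hbd

lemma IsSolution.contDiff_sub (h : IsSolution η w₀ u₀ d₀ u π d) (c : E3) {t : ℝ} (ht : 0 < t) :
    ContDiff ℝ 2 (fun x => d t x - c) := (h.d_reg.diff_space t ht).sub contDiff_const

lemma IsSolution.continuous_sub (h : IsSolution η w₀ u₀ d₀ u π d) (c : E3) {t : ℝ} (ht : 0 < t) :
    Continuous (fun x => d t x - c) := (h.contDiff_sub c ht).continuous

lemma IsSolution.exists_nsq_bound (h : IsSolution η w₀ u₀ d₀ u π d) {T : ℝ} (hT : 0 < T) :
    ∃ M : ℝ, 0 ≤ M ∧ ∀ t ∈ Set.Ioo 0 T, nsq (fun x => d t x - w₀) ≤ ENNReal.ofReal M ∧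
      gsq (fun x => d t x - w₀) ≤ ENNReal.ofReal M ∧
      ∫⁻ x, ‖d t x - w₀‖ₑ ^ 4 ≤ ENNReal.ofReal M := by
  obtain ⟨M, hM⟩ := h.d_bound T hT
  have hfin : ENNReal.ofReal M * (sobConst * ENNReal.ofReal M) ^ 3 + 1 ≠ ⊤ :=
    ENNReal.add_ne_top.2 ⟨ENNReal.mul_ne_top ENNReal.ofReal_ne_top
      (ENNReal.pow_ne_top (ENNReal.mul_ne_top sobConst_ne_top ENNReal.ofReal_ne_top)), by simp⟩
  refine ⟨max M (ENNReal.ofReal M * (sobConst * ENNReal.ofReal M) ^ 3 + 1).toReal,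
    le_max_of_le_right ENNReal.toReal_nonneg, fun t ht => ?_⟩
  have hc := h.contDiff_sub w₀ ht.1
  have h1 : nsq (fun x => d t x - w₀) ≤ ENNReal.ofReal M :=
    (nsq_le_sobolevSq 2 _).trans (hM t ht)
  have h2 : gsq (fun x => d t x - w₀) ≤ ENNReal.ofReal M :=
    (gsq_le_sobolevSq 1 (hc.of_le (by norm_num))).trans (hM t ht)
  refine ⟨h1.trans (ENNReal.ofReal_le_ofReal (le_max_left _ _)),
    h2.trans (ENNReal.ofReal_le_ofReal (le_max_left _ _)), ?_⟩
  refine le_trans ?_ (ENNReal.ofReal_le_ofReal (le_max_right _ _))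
  rw [ENNReal.ofReal_toReal hfin]
  refine le_add_one_of_sq_le
    ((lintegral_pow_four_sq_le hc.continuous.enorm.aemeasurable).trans ?_)
  refine mul_le_mul' h1 ((lintegral_six_le (hc.of_le (by norm_num))
    (h1.trans_lt ENNReal.ofReal_lt_top)).trans ?_)
  gcongr

lemma enorm_pow_eq_ofReal {V : Type*} [SeminormedAddCommGroup V] (v : V) (n : ℕ) :
    ‖v‖ₑ ^ n = ENNReal.ofReal (‖v‖ ^ n) := by
  rw [← ofReal_norm, ENNReal.ofReal_pow (norm_nonneg _)]

lemma norm_sq_sub_one {w d : E3} (hw : ‖w‖ = 1) :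
    ‖d‖ ^ 2 - 1 = ‖d - w‖ ^ 2 + 2 * inner ℝ (d - w) w := by
  rw [norm_sub_sq_real, hw, inner_sub_left, real_inner_self_eq_norm_sq, hw]; ring

lemma norm_sq_sub_one_le {w d : E3} (hw : ‖w‖ = 1) :
    ‖d‖ ^ 2 - 1 ≤ ‖d - w‖ ^ 2 + 2 * ‖d - w‖ := by
  rw [norm_sq_sub_one hw]
  have := real_inner_le_norm (d - w) w
  rw [hw, mul_one] at this
  linarith

lemma lintegral_ofReal_le_of_four_two {v : E3 → E3} (hv : Continuous v) {F : E3 → ℝ} {a b M : ℝ}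
    (ha : 0 ≤ a) (hb : 0 ≤ b) (hF : ∀ x, F x ≤ a * ‖v x‖ ^ 4 + b * ‖v x‖ ^ 2)
    (h4 : ∫⁻ x, ‖v x‖ₑ ^ 4 ≤ ENNReal.ofReal M) (h2 : nsq v ≤ ENNReal.ofReal M) (hM : 0 ≤ M) :
    ∫⁻ x, ENNReal.ofReal (F x) ≤ ENNReal.ofReal ((a + b) * M) := by
  have hpt : ∀ x, ENNReal.ofReal (F x)
      ≤ ENNReal.ofReal a * ‖v x‖ₑ ^ 4 + ENNReal.ofReal b * ‖v x‖ₑ ^ 2 := fun x => by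
    rw [enorm_pow_eq_ofReal, enorm_pow_eq_ofReal, ← ENNReal.ofReal_mul ha, ← ENNReal.ofReal_mul hb,
      ← ENNReal.ofReal_add (mul_nonneg ha (by positivity)) (mul_nonneg hb (by positivity))]
    exact ENNReal.ofReal_le_ofReal (hF x)
  refine (lintegral_mono hpt).trans ?_
  rw [lintegral_add_left' ((hv.enorm.measurable.pow_const 4).const_mul _).aemeasurable,
    lintegral_const_mul' _ _ ENNReal.ofReal_ne_top, lintegral_const_mul' _ _ ENNReal.ofReal_ne_top,
    add_mul, ENNReal.ofReal_add (mul_nonneg ha hM) (mul_nonneg hb hM), ENNReal.ofReal_mul ha,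
    ENNReal.ofReal_mul hb]
  exact add_le_add (mul_le_mul_right h4 _) (mul_le_mul_right h2 _)

lemma IsData.aestronglyMeasurable (hD : IsData w₀ u₀ d₀) : AEStronglyMeasurable d₀ volume := by
  have := hD.d₀_mem.1.add (aestronglyMeasurable_const (b := w₀))
  refine this.congr (Eventually.of_forall fun x => ?_)
  simp

lemma IsSolution.tendsto_nsq_sub (h : IsSolution η w₀ u₀ d₀ u π d) :
    Tendsto (fun s => nsq (fun x => d s x - d₀ x)) (𝓝[>] 0) (𝓝 0) := by
  have := ENNReal.Tendsto.pow (n := 2) h.d_initial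
  simpa only [eLpNorm_two_sq, zero_pow two_ne_zero] using this

/-- A convex barrier vanishing up to second order at the origin. -/
noncomputable def barrier (y : ℝ) : ℝ := y ^ 3 / (1 + y) ^ 2

/-- The derivative of `barrier`. -/
noncomputable def barrier' (y : ℝ) : ℝ := (y ^ 3 + 3 * y ^ 2) / (1 + y) ^ 3

/-- The second derivative of `barrier`. -/
noncomputable def barrier'' (y : ℝ) : ℝ := 6 * y / (1 + y) ^ 4

lemma hasDerivAt_barrier {y : ℝ} (hy : 0 ≤ y) : HasDerivAt barrier (barrier' y) y := by
  have h1 : (1 + y) ≠ 0 := by positivity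
  have := ((hasDerivAt_id y).fun_pow 3).fun_div (((hasDerivAt_id y).const_add 1).fun_pow 2)
    (pow_ne_zero 2 h1)
  convert! this using 1
  simp only [barrier', id]
  field_simp
  push_cast
  ring

lemma hasDerivAt_barrier' {y : ℝ} (hy : 0 ≤ y) : HasDerivAt barrier' (barrier'' y) y := by
  have h1 : (1 + y) ≠ 0 := by positivity
  have := (((hasDerivAt_id y).fun_pow 3).fun_add (((hasDerivAt_id y).fun_pow 2).const_mul 3)).fun_div
    (((hasDerivAt_id y).const_add 1).fun_pow 3) (pow_ne_zero 3 h1)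
  convert! this using 1
  simp only [barrier'', id]
  field_simp
  push_cast
  ring

lemma barrier_nonneg {y : ℝ} (hy : 0 ≤ y) : 0 ≤ barrier y := by unfold barrier; positivity

lemma barrier'_nonneg {y : ℝ} (hy : 0 ≤ y) : 0 ≤ barrier' y := by unfold barrier'; positivity

lemma barrier''_nonneg {y : ℝ} (hy : 0 ≤ y) : 0 ≤ barrier'' y := by unfold barrier''; positivity

lemma barrier_pos {y : ℝ} (hy : 0 < y) : 0 < barrier y := by unfold barrier; positivity

lemma barrier_le {y : ℝ} (hy : 0 ≤ y) : barrier y ≤ y := by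
  rw [barrier, div_le_iff₀ (by positivity)]
  nlinarith [mul_nonneg hy hy]

/-- Where |d| > 1 the force points outwards, d·f(d) ≥ 0, and elsewhere the barrier is locally
inactive, so there is no source. The cubic vanishing of the barrier gives two continuous
derivatives; its linear growth bounds the square of ψ by |d - w₀|⁴ and |d - w₀|², which is the L²
control a subsolution must have. -/
lemma IsSolution.isSubsol_barrier (hD : IsData w₀ u₀ d₀) (h : IsSolution η w₀ u₀ d₀ u π d) :
    IsSubsol u (fun t x => barrier (max (‖d t x - 0‖ ^ 2 - 1) 0)) (fun _ _ => 0)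
      (fun _ _ => 0) := by
  have hm : ∀ y : ℝ, 0 ≤ max (y - 1) 0 := fun y => le_max_right _ _
  have hb := fun y => (hasDerivAt_comp_max (fun _ => hasDerivAt_barrier) (by simp [barrier'])
    (y - 1)).comp_sub_const y 1
  have hb' := fun y => (hasDerivAt_comp_max (fun _ => hasDerivAt_barrier') (by simp [barrier''])
    (y - 1)).comp_sub_const y 1
  have hb'' : Continuous (fun y : ℝ => barrier'' (max (y - 1) 0)) := by
    simp only [barrier'']
    refine Continuous.div (by fun_prop) (by fun_prop) fun y => ?_
    have := hm y
    positivity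
  refine h.isSubsol_comp 0 (b := fun y => barrier (max (y - 1) 0)) (fun y _ => hb y)
    (fun y _ => hb' y) hb''.continuousOn (fun y _ => barrier_nonneg (hm y)) (fun _ _ _ => le_rfl)
    (fun _ _ _ => le_rfl) continuousOn_const continuousOn_const (fun t ht x => ?_) fun T hT => ?_
  · simp only [sub_zero]
    have h1 := hm (‖d t x‖ ^ 2)
    have h2 := barrier''_nonneg h1
    have hs1 : 0 ≤ ∑ i, ‖partialD i (d t) x‖ ^ 2 := Finset.sum_nonneg fun i _ => sq_nonneg _
    have hs2 : 0 ≤ ∑ i, inner ℝ (d t x) (partialD i (d t) x) ^ 2 :=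
      Finset.sum_nonneg fun i _ => sq_nonneg _
    refine add_nonneg (mul_nonneg (mul_nonneg (by norm_num) h2) hs2) ?_
    rcases le_total (‖d t x‖ ^ 2) 1 with h4 | h4
    · rw [max_eq_right (by linarith)]
      simp [barrier']
    · refine mul_nonneg (barrier'_nonneg h1) (add_nonneg (mul_nonneg zero_le_two hs1) ?_)
      rw [glForce, real_inner_smul_right, real_inner_self_eq_norm_sq]
      have : 0 ≤ ‖d t x‖ ^ 2 - 1 := by linarith
      positivity
  · obtain ⟨M, hM0, hM⟩ := h.exists_nsq_bound hT
    refine ⟨(2 + 8) * M, by positivity, fun t ht => ?_⟩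
    obtain ⟨h1, -, h4⟩ := hM t ht
    refine lintegral_ofReal_le_of_four_two (a := 2) (b := 8) (v := fun x => d t x - w₀)
      (h.continuous_sub w₀ ht.1) (by norm_num) (by norm_num) (fun x => ?_) h4 h1 hM0
    have k0 := barrier_nonneg (hm (‖d t x - 0‖ ^ 2))
    have k1 := barrier_le (hm (‖d t x - 0‖ ^ 2))
    have k2 : max (‖d t x - 0‖ ^ 2 - 1) 0 ≤ ‖d t x - w₀‖ ^ 2 + 2 * ‖d t x - w₀‖ := by
      rw [sub_zero]
      exact max_le (norm_sq_sub_one_le hD.norm_w₀) (by positivity)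
    refine (pow_le_pow_left₀ k0 (k1.trans k2) 2).trans ?_
    nlinarith [sq_nonneg (‖d t x - w₀‖ ^ 2 - 2 * ‖d t x - w₀‖)]

/-- The maximum principle `|d| ≤ 1`. -/
theorem IsSolution.norm_le_one (hD : IsData w₀ u₀ d₀) (h : IsSolution η w₀ u₀ d₀ u π d) {t : ℝ}
    (ht : 0 < t) (x : E3) : ‖d t x‖ ≤ 1 := by
  have hm : ∀ y : ℝ, 0 ≤ max (y - 1) 0 := fun y => le_max_right _ _
  have hsub := h.isSubsol_barrier hD
  -- Since |d₀| = 1 almost everywhere, the barrier starts from zero. Its integral therefore remains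
  -- zero, and continuity turns this into a pointwise bound.
  have hle := transport_zero_le h.isDrift hsub (ψ₀ := 0) (δ := fun s x => d s x - d₀ x)
    (fun s hs => (h.d_reg.cts.slice hs).aestronglyMeasurable.sub hD.aestronglyMeasurable)
    h.tendsto_nsq_sub aemeasurable_const ?_ ht
  · simp only [Pi.zero_apply, ENNReal.ofReal_zero, lintegral_zero, add_zero,
      nonpos_iff_eq_zero] at hle
    have hcont : Continuous (fun x => ENNReal.ofReal (barrier (max (‖d t x - 0‖ ^ 2 - 1) 0))) :=
      ENNReal.continuous_ofReal.comp (hsub.cts.slice ht)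
    rw [lintegral_eq_zero_iff hcont.measurable] at hle
    have h0 := (Continuous.ae_eq_iff_eq volume hcont continuous_const).1 hle
    have h1 := congrFun h0 x
    simp only [sub_zero] at h1
    replace h1 := ENNReal.ofReal_eq_zero.1 h1
    by_contra hlt
    have h2 : 0 < max (‖d t x‖ ^ 2 - 1) 0 := by
      refine lt_max_of_lt_left ?_
      nlinarith
    exact absurd (barrier_pos h2) (not_lt.2 h1)
  · intro s hs
    filter_upwards [hD.d₀_norm] with x hx
    have e1 : (4 : ℝ≥0∞) = ENNReal.ofReal 4 := by simp
    rw [Pi.zero_apply, zero_add, enorm_sq_eq_ofReal, ← ofReal_norm, e1,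
      ← ENNReal.ofReal_mul (by norm_num), ← ENNReal.ofReal_add (by positivity) (by positivity)]
    refine ENNReal.ofReal_le_ofReal ((barrier_le (hm _)).trans (max_le ?_ (by positivity)))
    rw [sub_zero]
    have h1 : ‖d s x‖ ≤ ‖d s x - d₀ x‖ + 1 := by
      have := norm_add_le (d s x - d₀ x) (d₀ x)
      rwa [sub_add_cancel, hx] at this
    nlinarith [norm_nonneg (d s x), norm_nonneg (d s x - d₀ x)]

lemma IsSolution.norm_sub_le_two (hD : IsData w₀ u₀ d₀) (h : IsSolution η w₀ u₀ d₀ u π d) {t : ℝ}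
    (ht : 0 < t) (x : E3) : ‖d t x - w₀‖ ≤ 2 := by
  have h1 := h.norm_le_one hD ht x
  have h2 := norm_sub_le (d t x) w₀
  rw [hD.norm_w₀] at h2
  linarith

end Solution

end LiquidCrystal

namespace LiquidCrystal

/-! ### Decay from a dissipation inequality -/

/-- Tonelli on the triangle s < r < q ≤ t. -/
lemma setLIntegral_mul_setLIntegral_Ioc {D W' : ℝ → ℝ≥0∞} {s t : ℝ}
    (hD : AEMeasurable D (volume.restrict (Set.Ioc s t))) (hW' : Measurable W') :
    ∫⁻ r in Set.Ioc s t, W' r * ∫⁻ q in Set.Ioc r t, D q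
      = ∫⁻ q in Set.Ioc s t, (∫⁻ r in Set.Ioc s q, W' r) * D q := by
  set f : ℝ → ℝ → ℝ≥0∞ := fun r q => Set.indicator {z : ℝ × ℝ | z.1 < z.2}
    (fun z => W' z.1 * D z.2) (r, q) with hf
  have hm : MeasurableSet {z : ℝ × ℝ | z.1 < z.2} := measurableSet_lt measurable_fst measurable_snd
  have e1 : ∀ r ∈ Set.Ioc s t, W' r * ∫⁻ q in Set.Ioc r t, D q
      = ∫⁻ q in Set.Ioc s t, f r q := fun r hr => by
    have h1 : ∀ q, f r q = W' r * (Set.Ioi r).indicator D q := fun q => by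
      by_cases h : r < q <;> simp [hf, Set.indicator, h]
    simp only [h1]
    rw [lintegral_const_mul'' _ (hD.indicator measurableSet_Ioi), lintegral_indicator measurableSet_Ioi,
      Measure.restrict_restrict measurableSet_Ioi]
    congr 3
    ext q
    simp only [Set.mem_Ioc, Set.mem_inter_iff, Set.mem_Ioi]
    exact ⟨fun h => ⟨h.1, hr.1.trans h.1, h.2⟩, fun h => ⟨h.1, h.2.2⟩⟩
  have e2 : ∀ q ∈ Set.Ioc s t, (∫⁻ r in Set.Ioc s q, W' r) * D q
      = ∫⁻ r in Set.Ioc s t, f r q := fun q hq => by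
    have h1 : ∀ r, f r q = (Set.Iio q).indicator W' r * D q := fun r => by
      by_cases h : r < q <;> simp [hf, Set.indicator, h]
    simp only [h1]
    rw [lintegral_mul_const _ (hW'.indicator measurableSet_Iio), lintegral_indicator measurableSet_Iio,
      Measure.restrict_restrict measurableSet_Iio]
    congr 1
    rw [setLIntegral_congr Ioo_ae_eq_Ioc.symm]
    congr 2
    ext r
    simp only [Set.mem_Ioo, Set.mem_Ioc, Set.mem_inter_iff, Set.mem_Iio]
    exact ⟨fun h => ⟨h.2, h.1, h.2.le.trans hq.2⟩, fun h => ⟨h.2.1, h.1⟩⟩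
  rw [setLIntegral_congr_fun measurableSet_Ioc e1, setLIntegral_congr_fun measurableSet_Ioc e2]
  refine lintegral_lintegral_swap ?_
  exact ((hW'.comp measurable_fst).aemeasurable.mul hD.comp_snd).indicator hm

/-- A dissipation inequality, multiplied by an increasing weight. -/
lemma weighted_energy {X D W' : ℝ → ℝ≥0∞} {w : ℝ≥0∞} {s t : ℝ} (hst : s ≤ t)
    (hD : AEMeasurable D (volume.restrict (Set.Ioc s t))) (hW' : Measurable W')
    (h : ∀ r ∈ Set.Icc s t, X t + ∫⁻ q in Set.Ioc r t, D q ≤ X r) :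
    (w + ∫⁻ r in Set.Ioc s t, W' r) * X t
        + ∫⁻ q in Set.Ioc s t, (w + ∫⁻ r in Set.Ioc s q, W' r) * D q
      ≤ w * X s + ∫⁻ r in Set.Ioc s t, W' r * X r := by
  have h1 := mul_le_mul_right (h s ⟨le_rfl, hst⟩) w
  -- The inequality on [r, t] is averaged against W'(r) dr. This replaces the product rule, so X is
  -- never differentiated.
  have h2 : ∫⁻ r in Set.Ioc s t, W' r * (X t + ∫⁻ q in Set.Ioc r t, D q)
      ≤ ∫⁻ r in Set.Ioc s t, W' r * X r :=
    setLIntegral_mono' measurableSet_Ioc fun r hr => mul_le_mul_right (h r ⟨hr.1.le, hr.2⟩) _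
  simp only [mul_add] at h1 h2
  rw [lintegral_add_left (hW'.mul_const _), lintegral_mul_const _ hW',
    setLIntegral_mul_setLIntegral_Ioc hD hW'] at h2
  simp only [add_mul]
  rw [lintegral_add_left' (hD.const_mul _), lintegral_const_mul'' _ hD]
  calc _ = (w * X t + w * ∫⁻ q in Set.Ioc s t, D q) + ((∫⁻ r in Set.Ioc s t, W' r) * X t
        + ∫⁻ q in Set.Ioc s t, (∫⁻ r in Set.Ioc s q, W' r) * D q) := by ring
    _ ≤ _ := add_le_add h1 h2

lemma ofReal_eq_add_setLIntegral_deriv {W W' : ℝ → ℝ} {s t : ℝ} (hst : s ≤ t) (hs : 0 ≤ W s)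
    (hW : ∀ r ∈ Set.Icc s t, HasDerivAt W (W' r) r) (hc : ContinuousOn W' (Set.Icc s t))
    (h0 : ∀ r ∈ Set.Icc s t, 0 ≤ W' r) :
    ENNReal.ofReal (W t)
      = ENNReal.ofReal (W s) + ∫⁻ r in Set.Ioc s t, ENNReal.ofReal (W' r) := by
  have hi : IntervalIntegrable W' volume s t := by
    refine ContinuousOn.intervalIntegrable ?_
    rwa [Set.uIcc_of_le hst]
  have h1 := intervalIntegral.integral_eq_sub_of_hasDerivAt (f := W) (f' := W') (a := s) (b := t)
    (fun r hr => hW r (by rwa [Set.uIcc_of_le hst] at hr)) hi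
  rw [intervalIntegral.integral_of_le hst] at h1
  have h2 := ofReal_integral_eq_lintegral_ofReal
    ((intervalIntegrable_iff_integrableOn_Ioc_of_le hst).1 hi)
    (ae_restrict_of_forall_mem measurableSet_Ioc fun r hr => h0 r ⟨hr.1.le, hr.2⟩)
  rw [← h2, ← ENNReal.ofReal_add hs, h1]
  · congr 1; ring
  · exact setIntegral_nonneg measurableSet_Ioc fun r hr => h0 r ⟨hr.1.le, hr.2⟩

lemma hasDerivAt_one_add_pow (N : ℕ) (r : ℝ) :
    HasDerivAt (fun r : ℝ => (1 + r) ^ N) (N * (1 + r) ^ (N - 1)) r := by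
  simpa using ((hasDerivAt_id r).const_add 1).fun_pow N

/-- The dissipation inequality with weight `(1 + r) ^ N`. -/
lemma weighted_energy_pow {X D : ℝ → ℝ≥0∞} {s t : ℝ} (hs : 0 ≤ s) (hst : s ≤ t)
    (hD : AEMeasurable D (volume.restrict (Set.Ioc s t)))
    (h : ∀ r ∈ Set.Icc s t, X t + ∫⁻ q in Set.Ioc r t, D q ≤ X r) (N : ℕ) :
    ENNReal.ofReal ((1 + t) ^ N) * X t
        + ∫⁻ q in Set.Ioc s t, ENNReal.ofReal ((1 + q) ^ N) * D q
      ≤ ENNReal.ofReal ((1 + s) ^ N) * X s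
        + ∫⁻ r in Set.Ioc s t, ENNReal.ofReal (N * (1 + r) ^ (N - 1)) * X r := by
  have hW : ∀ q ∈ Set.Icc s t, ENNReal.ofReal ((1 + q) ^ N) = ENNReal.ofReal ((1 + s) ^ N)
      + ∫⁻ r in Set.Ioc s q, ENNReal.ofReal (N * (1 + r) ^ (N - 1)) := fun q hq =>
    ofReal_eq_add_setLIntegral_deriv (W := fun r => (1 + r) ^ N) hq.1 (by positivity)
      (fun r _ => hasDerivAt_one_add_pow N r) (by fun_prop)
      (fun r hr => by have : 0 ≤ r := hs.trans hr.1; positivity)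
  have h1 := weighted_energy (w := ENNReal.ofReal ((1 + s) ^ N))
    (W' := fun r => ENNReal.ofReal (N * (1 + r) ^ (N - 1))) hst hD
    (Measurable.ennreal_ofReal (by fun_prop)) h
  rw [← hW t ⟨hst, le_rfl⟩] at h1
  rw [setLIntegral_congr_fun measurableSet_Ioc fun q hq => by
    rw [hW q ⟨hq.1.le, hq.2⟩]]
  exact h1

lemma setLIntegral_rpow_neg_half_le {s t : ℝ} (hs : 0 ≤ s) (hst : s ≤ t) :
    ∫⁻ r in Set.Ioc s t, ENNReal.ofReal ((1 + r) ^ (-(1 / 2) : ℝ))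
      ≤ ENNReal.ofReal (2 * (1 + t) ^ (1 / 2 : ℝ)) := by
  have h := ofReal_eq_add_setLIntegral_deriv (W := fun r => 2 * (1 + r) ^ (1 / 2 : ℝ))
    (W' := fun r => (1 + r) ^ (-(1 / 2) : ℝ)) hst (by positivity) (fun r hr => ?_) ?_ ?_
  · rw [h]; exact le_add_self
  · have h0 : 0 < 1 + r := by linarith [hr.1]
    have := (((hasDerivAt_id r).const_add 1).rpow_const (p := 1 / 2) (Or.inl h0.ne')).const_mul 2
    convert! this using 1
    norm_num
    ring
  · exact ContinuousOn.rpow_const (by fun_prop) fun r hr => Or.inl (by linarith [hr.1])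
  · exact fun r hr => Real.rpow_nonneg (by linarith [hr.1]) _

/-- Algebraic decay from a dissipation inequality and a Nash-type inequality. -/
lemma decay_of_nash {a b M T₀ : ℝ} (ha : 0 < a) (hb : 0 ≤ b) (hM : 0 ≤ M) (hT₀ : 0 ≤ T₀) (β : ℕ) :
    ∃ C : ℝ, 0 < C ∧ ∀ X D : ℝ → ℝ≥0∞,
      (∀ t, AEMeasurable D (volume.restrict (Set.Ioc T₀ t))) →
      (∀ s t, T₀ ≤ s → s ≤ t → X t + ∫⁻ q in Set.Ioc s t, D q ≤ X s) →
      X T₀ ≤ ENNReal.ofReal M →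
      (∀ r, T₀ < r → ∀ R : ℝ, 0 < R → X r ≤ ENNReal.ofReal (a * R ^ 2) * D r
        + ENNReal.ofReal (b * R⁻¹ ^ 3 * ((1 + r) ^ β)⁻¹)) →
      ∀ t, T₀ ≤ t → X t ≤ ENNReal.ofReal (C * (1 + t) ^ (-(β + 3 / 2) : ℝ)) := by
  -- The weight exponent exceeds the expected rate β + 3/2 by 1/2: the Nash remainder, multiplied by
  -- the derivative of the weight, is then of order (1 + r)^(-1/2), whose integral grows like (1 +
  -- t)^(1/2).
  set N : ℕ := β + 2 with hN
  -- With R² = (1 + r) / κ the gradient term of the Nash inequality, times N (1 + r)^(N - 1), is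
  -- exactly half of the weighted dissipation.
  set κ : ℝ := 2 * a * N with hκ
  have hN0 : (0 : ℝ) < N := by rw [hN]; positivity
  have hκ0 : 0 < κ := by positivity
  set K : ℝ := N * b * κ ^ (3 / 2 : ℝ) with hK
  have hK0 : 0 ≤ K := by positivity
  refine ⟨(1 + T₀) ^ N * M + 2 * K + 1, by positivity, fun X D hD hXD hX0 hnash t ht => ?_⟩
  have hw := weighted_energy_pow hT₀ ht (hD t)
    (fun r hr => hXD r t hr.1 hr.2) N
  set J := ∫⁻ q in Set.Ioc T₀ t, ENNReal.ofReal ((1 + q) ^ N) * D q with hJ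
  -- Finiteness of the weighted dissipation permits cancelling it from both sides in `ℝ≥0∞`.
  have hJtop : J ≠ ⊤ := by
    have h1 : J ≤ ENNReal.ofReal ((1 + t) ^ N) * ∫⁻ q in Set.Ioc T₀ t, D q := by
      rw [← lintegral_const_mul' _ _ ENNReal.ofReal_ne_top]
      refine setLIntegral_mono' measurableSet_Ioc fun q hq => ?_
      gcongr
      · linarith [hq.1]
      · exact hq.2
    refine ne_top_of_le_ne_top ?_ h1
    refine ENNReal.mul_ne_top ENNReal.ofReal_ne_top ?_
    exact ne_top_of_le_ne_top ENNReal.ofReal_ne_top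
      ((le_add_self.trans (hXD T₀ t le_rfl ht)).trans hX0)
  have hpt : ∀ r ∈ Set.Ioc T₀ t, ENNReal.ofReal (N * (1 + r) ^ (N - 1)) * X r
      ≤ ENNReal.ofReal (1 / 2) * (ENNReal.ofReal ((1 + r) ^ N) * D r)
        + ENNReal.ofReal K * ENNReal.ofReal ((1 + r) ^ (-(1 / 2) : ℝ)) := fun r hr => by
    have h1r : 0 < 1 + r := by linarith [hr.1]
    set R : ℝ := ((1 + r) / κ) ^ (1 / 2 : ℝ) with hR
    have hR0 : 0 < R := by positivity
    have hR2 : R ^ 2 = (1 + r) / κ := by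
      rw [hR, ← Real.rpow_natCast, ← Real.rpow_mul (by positivity)]; norm_num
    have hR3 : R⁻¹ ^ 3 = κ ^ (3 / 2 : ℝ) * (1 + r) ^ (-(3 / 2) : ℝ) := by
      rw [hR, ← Real.rpow_neg (by positivity), ← Real.rpow_natCast,
        ← Real.rpow_mul (by positivity), Real.div_rpow h1r.le hκ0.le, mul_comm, div_eq_mul_inv,
        ← Real.rpow_neg hκ0.le]
      norm_num
      ring
    refine (mul_le_mul_right (hnash r hr.1 R hR0) _).trans (le_of_eq ?_)
    rw [mul_add, ← mul_assoc, ← mul_assoc, ← ENNReal.ofReal_mul (by positivity),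
      ← ENNReal.ofReal_mul (by positivity), ← ENNReal.ofReal_mul (p := 1 / 2) (by positivity),
      ← ENNReal.ofReal_mul hK0]
    have hNN : (1 + r) ^ N = (1 + r) ^ (N - 1) * (1 + r) := by
      rw [← pow_succ]; congr 1
    refine congrArg₂ (· + ·) (congrArg (fun z => ENNReal.ofReal z * D r) ?_)
      (congrArg ENNReal.ofReal ?_)
    · rw [hR2, hNN, hκ]
      field_simp
    · rw [hR3, hK]
      have e1 : (1 + r) ^ (N - 1) = (1 + r) ^ β * (1 + r) := by
        rw [← pow_succ]; congr 1
      have e2 : (1 + r) * (1 + r) ^ (-(3 / 2) : ℝ) = (1 + r) ^ (-(1 / 2) : ℝ) := by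
        nth_rewrite 1 [← Real.rpow_one (1 + r)]
        rw [← Real.rpow_add h1r]; norm_num
      rw [e1, ← e2]
      field_simp
  have hint : ∫⁻ r in Set.Ioc T₀ t, ENNReal.ofReal (N * (1 + r) ^ (N - 1)) * X r
      ≤ ENNReal.ofReal (1 / 2) * J + ENNReal.ofReal K * ENNReal.ofReal (2 * (1 + t) ^ (1 / 2 : ℝ)) := by
    refine (setLIntegral_mono' measurableSet_Ioc hpt).trans ?_
    rw [lintegral_add_right _ (by fun_prop), lintegral_const_mul' _ _ ENNReal.ofReal_ne_top,
      lintegral_const_mul' _ _ ENNReal.ofReal_ne_top]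
    gcongr
    exact setLIntegral_rpow_neg_half_le hT₀ ht
  have h1t : 0 < 1 + t := by linarith
  have hhalf : ENNReal.ofReal (1 / 2) * J ≤ J := by
    refine mul_le_of_le_one_left zero_le ?_
    rw [ENNReal.ofReal_le_one]; norm_num
  have h3 : ENNReal.ofReal ((1 + t) ^ N) * X t + J
      ≤ (ENNReal.ofReal ((1 + T₀) ^ N * M) + ENNReal.ofReal (K * (2 * (1 + t) ^ (1 / 2 : ℝ)))) + J := by
    refine (hw.trans (add_le_add (mul_le_mul_right hX0 _) hint)).trans ?_
    rw [← ENNReal.ofReal_mul (by positivity), ← ENNReal.ofReal_mul hK0, add_assoc,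
      add_comm (ENNReal.ofReal (K * _)) J]
    gcongr
  have h4 := (ENNReal.add_le_add_iff_right hJtop).1 h3
  have h5 : X t ≤ ENNReal.ofReal (((1 + t) ^ N)⁻¹ *
      ((1 + T₀) ^ N * M + K * (2 * (1 + t) ^ (1 / 2 : ℝ)))) := by
    rw [← ENNReal.ofReal_add (by positivity) (by positivity)] at h4
    rw [ENNReal.ofReal_mul (by positivity), ENNReal.ofReal_inv_of_pos (by positivity)]
    rw [← ENNReal.div_eq_inv_mul, ENNReal.le_div_iff_mul_le (Or.inl (by simp; positivity))
      (Or.inl ENNReal.ofReal_ne_top), mul_comm]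
    exact h4
  refine h5.trans (ENNReal.ofReal_le_ofReal ?_)
  have e1 : ((1 + t) ^ N)⁻¹ * (1 + t) ^ (1 / 2 : ℝ) = (1 + t) ^ (-(β + 3 / 2) : ℝ) := by
    rw [← Real.rpow_natCast, ← Real.rpow_neg h1t.le, ← Real.rpow_add h1t, hN]
    congr 1; push_cast; ring
  have e2 : 1 ≤ (1 + t) ^ (1 / 2 : ℝ) := Real.one_le_rpow (by linarith) (by norm_num)
  rw [← e1]
  have h6 : (1 + T₀) ^ N * M + K * (2 * (1 + t) ^ (1 / 2 : ℝ))
      ≤ ((1 + T₀) ^ N * M + 2 * K + 1) * (1 + t) ^ (1 / 2 : ℝ) := by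
    have : 0 ≤ (1 + T₀) ^ N * M := by positivity
    nlinarith
  calc _ ≤ ((1 + t) ^ N)⁻¹ * (((1 + T₀) ^ N * M + 2 * K + 1) * (1 + t) ^ (1 / 2 : ℝ)) := by gcongr
    _ = _ := by ring

end LiquidCrystal

namespace LiquidCrystal

/-! ### The `L²` estimate of the director -/

lemma gsq_sub_const (f : E3 → E3) (c : E3) : gsq (fun x => f x - c) = gsq f := by
  simp only [gsq, partialD_sub_const]

lemma gsq_eq_ofReal {f : E3 → E3} (hf : ContDiff ℝ 1 f) :
    gsq f = ∫⁻ x, ENNReal.ofReal (∑ i, ‖partialD i f x‖ ^ 2) := by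
  rw [gsq_eq_lintegral hf]
  refine lintegral_congr fun x => ?_
  rw [ENNReal.ofReal_sum_of_nonneg fun i _ => sq_nonneg _]
  simp only [enorm_sq_eq_ofReal]

lemma aemeasurable_lintegral_cts {F : ℝ → E3 → ℝ} (hF : Cts F) {s : ℝ} (hs : 0 ≤ s) (t : ℝ) :
    AEMeasurable (fun r => ∫⁻ x, ENNReal.ofReal (F r x)) (volume.restrict (Set.Ioc s t)) :=
  (aemeasurable_ofReal_cts hF hs t).lintegral_prod_right'

lemma aemeasurable_restrict_Ioc_congr {f g : ℝ → ℝ≥0∞} {s t : ℝ} (hs : 0 ≤ s)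
    (h : ∀ r, 0 < r → f r = g r) (hg : AEMeasurable g (volume.restrict (Set.Ioc s t))) :
    AEMeasurable f (volume.restrict (Set.Ioc s t)) := by
  refine hg.congr ?_
  filter_upwards [ae_restrict_mem measurableSet_Ioc] with r hr
  exact (h r (hs.trans_lt hr.1)).symm

lemma Cts.pow' {f : ℝ → E3 → ℝ} (hf : Cts f) (n : ℕ) : Cts (fun t x => f t x ^ n) :=
  ContinuousOn.pow hf n

lemma Cts.norm' {f : ℝ → E3 → E3} (hf : Cts f) : Cts (fun t x => ‖f t x‖) :=
  ContinuousOn.norm hf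

lemma Cts.sub_const' {f : ℝ → E3 → ℝ} (hf : Cts f) (c : ℝ) : Cts (fun t x => f t x - c) :=
  ContinuousOn.sub hf continuousOn_const

lemma Cts.norm_sq {f : ℝ → E3 → E3} (hf : Cts f) : Cts (fun t x => ‖f t x‖ ^ 2) :=
  ContinuousOn.pow (ContinuousOn.norm hf) 2

lemma IsC12.cts_sum_partialD {v : ℝ → E3 → E3} (h : IsC12 v) :
    Cts (fun t x => ∑ i, ‖partialD i (v t) x‖ ^ 2) :=
  Cts.sum fun i => (h.cts_partialD i).norm_sq

lemma IsC12.aemeasurable_gsq {v : ℝ → E3 → E3} (h : IsC12 v) {s : ℝ} (hs : 0 ≤ s) (t : ℝ) :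
    AEMeasurable (fun r => gsq (v r)) (volume.restrict (Set.Ioc s t)) :=
  aemeasurable_restrict_Ioc_congr hs (fun _ hr => gsq_eq_ofReal (h.contDiff_one hr))
    (aemeasurable_lintegral_cts h.cts_sum_partialD hs t)

/-- The potential energy `∫ η⁻² (|d|² - 1)² / 2`. -/
noncomputable def potential (η : ℝ) (d : E3 → E3) : ℝ≥0∞ :=
  ∫⁻ x, ENNReal.ofReal (1 / (2 * η ^ 2) * (‖d x‖ ^ 2 - 1) ^ 2)

lemma Cts.potential {d : ℝ → E3 → E3} (h : Cts d) (η : ℝ) :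
    Cts (fun t x => 1 / (2 * η ^ 2) * (‖d t x‖ ^ 2 - 1) ^ 2) :=
  ((h.norm_sq.sub_const' 1).pow' 2).const_mul' _

/-- The squared distance to `w₀` in `L²`, at time zero that of the initial datum. -/
noncomputable def sqDist (w₀ : E3) (d₀ : E3 → E3) (d : ℝ → E3 → E3) : ℝ → ℝ≥0∞ :=
  Function.update (fun r => nsq (fun x => d r x - w₀)) 0 (nsq (fun x => d₀ x - w₀))

section Solution

variable {η : ℝ} {w₀ : E3} {u₀ d₀ : E3 → E3} {u d : ℝ → E3 → E3} {π : ℝ → E3 → ℝ}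

lemma sqDist_of_pos {r : ℝ} (hr : 0 < r) :
    sqDist w₀ d₀ d r = nsq (fun x => d r x - w₀) := by simp [sqDist, hr.ne']

lemma sqDist_zero : sqDist w₀ d₀ d 0 = nsq (fun x => d₀ x - w₀) := by simp [sqDist]

lemma lintegral_add_ofReal {f g : E3 → ℝ} (hf : Continuous f) (h0 : ∀ x, 0 ≤ f x)
    (h1 : ∀ x, 0 ≤ g x) :
    ∫⁻ x, ENNReal.ofReal (f x + g x)
      = (∫⁻ x, ENNReal.ofReal (f x)) + ∫⁻ x, ENNReal.ofReal (g x) := by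
  rw [← lintegral_add_left' hf.measurable.ennreal_ofReal.aemeasurable]
  exact lintegral_congr fun x => ENNReal.ofReal_add (h0 x) (h1 x)

/-- With ρ = |d|² - 1 and h = |d - w₀|, ρ² + ρ h² = ρ²/2 + (ρ + h²)²/2 - h⁴/2. The first term is
kept as potential dissipation, the second is dropped, the third is the source. -/
lemma IsSolution.isSubsol_sq (hη : η ≠ 0) (hD : IsData w₀ u₀ d₀)
    (h : IsSolution η w₀ u₀ d₀ u π d) :
    IsSubsol u (fun t x => ‖d t x - w₀‖ ^ 2)
      (fun t x => 2 * ∑ i, ‖partialD i (d t) x‖ ^ 2 + 1 / (2 * η ^ 2) * (‖d t x‖ ^ 2 - 1) ^ 2)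
      (fun t x => 1 / (2 * η ^ 2) * ‖d t x - w₀‖ ^ 4) := by
  refine h.isSubsol_comp w₀ (b := fun y => y) (b' := fun _ => 1) (b'' := fun _ => 0)
    (fun y _ => hasDerivAt_id y) (fun y _ => hasDerivAt_const y 1) continuousOn_const
    (fun y hy => hy) (fun t _ x => ?_) (fun t _ x => by positivity)
    ((h.d_reg.cts_sum_partialD.const_mul' 2).add' (h.d_reg.cts.potential η))
    (((h.d_reg.cts.sub_const w₀).norm'.pow' 4).const_mul' _)
    (fun t ht x => ?_) fun T hT => ?_
  · have : 0 ≤ ∑ i, ‖partialD i (d t) x‖ ^ 2 := Finset.sum_nonneg fun i _ => sq_nonneg _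
    positivity
  · rw [two_mul_inner_glForce hD.norm_w₀]
    have h1 : (1 : ℝ) / (2 * η ^ 2) = 1 / 2 * (1 / η ^ 2) := by field_simp
    rw [h1]
    have h2 : 0 ≤ 1 / η ^ 2 := by positivity
    nlinarith [mul_nonneg h2 (sq_nonneg (‖d t x‖ ^ 2 - 1 + ‖d t x - w₀‖ ^ 2))]
  · obtain ⟨M, hM0, hM⟩ := h.exists_nsq_bound hT
    refine ⟨M, hM0, fun t ht => ?_⟩
    refine le_trans (le_of_eq ?_) (hM t ht).2.2
    refine lintegral_congr fun x => ?_
    rw [enorm_pow_eq_ofReal]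
    congr 1; ring

lemma IsSolution.sqDist_add_le (hη : η ≠ 0) (hD : IsData w₀ u₀ d₀)
    (h : IsSolution η w₀ u₀ d₀ u π d) {s t : ℝ} (hs : 0 ≤ s) (hst : s ≤ t) :
    sqDist w₀ d₀ d t + ∫⁻ r in Set.Ioc s t, (2 * gsq (d r) + potential η (d r))
      ≤ sqDist w₀ d₀ d s + ∫⁻ r in Set.Ioc s t,
        ENNReal.ofReal (1 / (2 * η ^ 2)) * ∫⁻ x, ‖d r x - w₀‖ₑ ^ 4 := by
  rcases hst.eq_or_lt with rfl | hst'
  · simp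
  have ht : 0 < t := hs.trans_lt hst'
  have hsub := h.isSubsol_sq hη hD
  have e1 : ∫⁻ r in Set.Ioc s t, (2 * gsq (d r) + potential η (d r))
      = ∫⁻ r in Set.Ioc s t, ∫⁻ x, ENNReal.ofReal (2 * ∑ i, ‖partialD i (d r) x‖ ^ 2
        + 1 / (2 * η ^ 2) * (‖d r x‖ ^ 2 - 1) ^ 2) := by
    refine setLIntegral_congr_fun measurableSet_Ioc fun r hr => ?_
    have hr0 : 0 < r := hs.trans_lt hr.1
    have hs1 : ∀ x, 0 ≤ ∑ i, ‖partialD i (d r) x‖ ^ 2 :=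
      fun x => Finset.sum_nonneg fun i _ => sq_nonneg _
    rw [lintegral_add_ofReal ((h.d_reg.cts_sum_partialD.const_mul' 2).slice hr0)
      (fun x => mul_nonneg zero_le_two (hs1 x)) (fun x => by positivity), potential,
      gsq_eq_ofReal (h.d_reg.contDiff_one hr0), ← lintegral_const_mul' _ _ (by simp)]
    congr 2
    ext x
    rw [ENNReal.ofReal_mul (by norm_num)]
    simp
  have e2 : ∫⁻ r in Set.Ioc s t, ENNReal.ofReal (1 / (2 * η ^ 2)) * ∫⁻ x, ‖d r x - w₀‖ₑ ^ 4
      = ∫⁻ r in Set.Ioc s t, ∫⁻ x, ENNReal.ofReal (1 / (2 * η ^ 2) * ‖d r x - w₀‖ ^ 4) := by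
    refine lintegral_congr fun r => ?_
    rw [← lintegral_const_mul' _ _ ENNReal.ofReal_ne_top]
    refine lintegral_congr fun x => ?_
    rw [ENNReal.ofReal_mul (by positivity), enorm_pow_eq_ofReal]
  have e3 : sqDist w₀ d₀ d t = ∫⁻ x, ENNReal.ofReal (‖d t x - w₀‖ ^ 2) := by
    rw [sqDist_of_pos ht, nsq]
    simp only [enorm_sq_eq_ofReal]
  rw [e1, e2, e3]
  rcases hs.eq_or_lt with rfl | hs'
  · rw [sqDist_zero]
    refine transport_zero_le h.isDrift hsub (δ := fun s x => d s x - d₀ x)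
      (fun s hs => (h.d_reg.cts.slice hs).aestronglyMeasurable.sub hD.aestronglyMeasurable)
      h.tendsto_nsq_sub (hD.d₀_mem.1.enorm.pow_const 2) ?_ ht
    intro s hs
    filter_upwards [hD.d₀_norm] with x hx
    have e1 : (4 : ℝ≥0∞) = ENNReal.ofReal 4 := by simp
    rw [enorm_sq_eq_ofReal, enorm_sq_eq_ofReal, ← ofReal_norm, e1,
      ← ENNReal.ofReal_mul (by norm_num), ← ENNReal.ofReal_add (by positivity) (by positivity),
      ← ENNReal.ofReal_add (by positivity) (by positivity)]
    -- Expanding |(d₀ - w₀) + δ|² with |d₀ - w₀| ≤ 2 produces the coefficient 4 of the linear term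
    -- in δ.
    refine ENNReal.ofReal_le_ofReal ?_
    have h1 := norm_add_le (d s x - d₀ x) (d₀ x - w₀)
    rw [sub_add_sub_cancel] at h1
    have h2 := norm_sub_le (d₀ x) w₀
    rw [hx, hD.norm_w₀] at h2
    nlinarith [norm_nonneg (d s x - w₀), norm_nonneg (d₀ x - w₀), norm_nonneg (d s x - d₀ x)]
  · rw [sqDist_of_pos hs', nsq]
    simp only [enorm_sq_eq_ofReal]
    exact transport_le h.isDrift hsub hs' hst

/-- Below this value of `‖d - w₀‖²` in `L²` the Ginzburg-Landau term is absorbed. -/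
noncomputable def smallness (η : ℝ) : ℝ :=
  1 / 2 * ((ENNReal.ofReal (1 / (2 * η ^ 2)) * sobConst).toReal + 1) ^ (-(3 / 2) : ℝ)

lemma smallness_pos (η : ℝ) : 0 < smallness η := by
  have : 0 ≤ (ENNReal.ofReal (1 / (2 * η ^ 2)) * sobConst).toReal := ENNReal.toReal_nonneg
  unfold smallness
  positivity

/-- With S the product of the first two factors, twice the smallness threshold is (S + 1)^(-3/2);
its power 2/3 is (S + 1)⁻¹, and S / (S + 1) ≤ 1. -/
lemma mul_smallness_rpow_le (η : ℝ) :
    ENNReal.ofReal (1 / (2 * η ^ 2)) * sobConst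
      * (2 * ENNReal.ofReal (smallness η)) ^ (2 / 3 : ℝ) ≤ 1 := by
  set S := ENNReal.ofReal (1 / (2 * η ^ 2)) * sobConst with hS
  have hStop : S ≠ ⊤ := ENNReal.mul_ne_top ENNReal.ofReal_ne_top sobConst_ne_top
  have h0 : 0 ≤ S.toReal := ENNReal.toReal_nonneg
  have e2 : (2 : ℝ≥0∞) = ENNReal.ofReal 2 := by simp
  rw [← ENNReal.ofReal_toReal hStop, e2, ← ENNReal.ofReal_mul (by norm_num), smallness, ← hS,
    ← mul_assoc, show (2 : ℝ) * (1 / 2) = 1 by norm_num, one_mul,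
    ENNReal.ofReal_rpow_of_nonneg (by positivity) (by norm_num), ← Real.rpow_mul (by positivity),
    ← ENNReal.ofReal_mul h0, ENNReal.ofReal_le_one]
  norm_num
  rw [Real.rpow_neg_one, ← div_eq_mul_inv, div_le_one (by positivity)]
  linarith

lemma lintegral_pow_le_of_norm_le {v : E3 → E3} {B : ℝ} (hv : ∀ x, ‖v x‖ ≤ B)
    (m k : ℕ) :
    ∫⁻ x, ‖v x‖ₑ ^ (m + k) ≤ ENNReal.ofReal (B ^ k) * ∫⁻ x, ‖v x‖ₑ ^ m := by
  rw [← lintegral_const_mul' _ _ ENNReal.ofReal_ne_top]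
  refine lintegral_mono fun x => ?_
  rw [pow_add, mul_comm]
  refine mul_le_mul_left ?_ _
  rw [enorm_pow_eq_ofReal]
  exact ENNReal.ofReal_le_ofReal (pow_le_pow_left₀ (norm_nonneg _) (hv x) k)

lemma IsSolution.lintegral_cube_le (hD : IsData w₀ u₀ d₀) (h : IsSolution η w₀ u₀ d₀ u π d) {t : ℝ}
    (ht : 0 < t) : ∫⁻ x, ‖d t x - w₀‖ₑ ^ 3 ≤ 2 * nsq (fun x => d t x - w₀) := by
  simpa [nsq] using lintegral_pow_le_of_norm_le (v := fun x => d t x - w₀)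
    (h.norm_sub_le_two hD ht) 2 1

lemma IsSolution.nsq_sub_lt_top (h : IsSolution η w₀ u₀ d₀ u π d) {t : ℝ} (ht : 0 < t) :
    nsq (fun x => d t x - w₀) < ⊤ := by
  obtain ⟨M, -, hM⟩ := h.exists_nsq_bound (T := t + 1) (by linarith)
  exact (hM t ⟨ht, by linarith⟩).1.trans_lt ENNReal.ofReal_lt_top

lemma IsSolution.lintegral_six_le (h : IsSolution η w₀ u₀ d₀ u π d) {t : ℝ} (ht : 0 < t) :
    ∫⁻ x, ‖d t x - w₀‖ₑ ^ 6 ≤ (sobConst * gsq (d t)) ^ 3 := by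
  have := LiquidCrystal.lintegral_six_le ((h.contDiff_sub w₀ ht).of_le (by norm_num))
    (h.nsq_sub_lt_top ht)
  rwa [gsq_sub_const] at this

lemma pow_three_rpow_third (a : ℝ≥0∞) : (a ^ 3) ^ (1 / 3 : ℝ) = a := by
  rw [← ENNReal.rpow_natCast, ← ENNReal.rpow_mul]; norm_num

/-- Hölder on h² · h² with h in L³ and in L⁶. The maximum principle bounds ∫ h³ by 2 ∫ h², and
Sobolev bounds the L⁶ factor by the Dirichlet energy, so the source is a small multiple of the
dissipation. -/
lemma IsSolution.lintegral_pow_four_le (hD : IsData w₀ u₀ d₀) (h : IsSolution η w₀ u₀ d₀ u π d)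
    {t : ℝ} (ht : 0 < t) :
    ∫⁻ x, ‖d t x - w₀‖ₑ ^ 4
      ≤ (2 * nsq (fun x => d t x - w₀)) ^ (2 / 3 : ℝ) * (sobConst * gsq (d t)) := by
  have hm := (h.continuous_sub w₀ ht).enorm.aemeasurable (μ := volume)
  have h1 := lintegral_sq_mul_sq_le hm hm
  simp only [← pow_add, Nat.reduceAdd] at h1
  refine h1.trans (mul_le_mul' ?_ ?_)
  · exact ENNReal.rpow_le_rpow (h.lintegral_cube_le hD ht) (by norm_num)
  · rw [← pow_three_rpow_third (sobConst * gsq (d t))]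
    exact ENNReal.rpow_le_rpow (h.lintegral_six_le ht) (by norm_num)

lemma IsSolution.setLIntegral_gsq_lt_top (h : IsSolution η w₀ u₀ d₀ u π d) {t : ℝ} (ht : 0 ≤ t)
    (s : ℝ) (hs : 0 ≤ s) : ∫⁻ r in Set.Ioc s t, gsq (d r) < ⊤ := by
  obtain ⟨M, -, hM⟩ := h.exists_nsq_bound (T := t + 1) (by linarith)
  calc ∫⁻ r in Set.Ioc s t, gsq (d r) ≤ ∫⁻ r in Set.Ioc s t, ENNReal.ofReal M := by
        refine setLIntegral_mono' measurableSet_Ioc fun r hr => ?_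
        have := (hM r ⟨hs.trans_lt hr.1, by linarith [hr.2]⟩).2.1
        rwa [gsq_sub_const] at this
    _ < ⊤ := by
        rw [setLIntegral_const, Real.volume_Ioc]
        exact ENNReal.mul_lt_top ENNReal.ofReal_lt_top ENNReal.ofReal_lt_top

/-- The `L²` dissipation inequality while `‖d - w₀‖²` is small. -/
lemma IsSolution.sqDist_add_le_of_small (hη : η ≠ 0) (hD : IsData w₀ u₀ d₀)
    (h : IsSolution η w₀ u₀ d₀ u π d) {s t : ℝ} (hs : 0 ≤ s) (hst : s ≤ t)
    (hsm : ∀ r ∈ Set.Ioc s t, sqDist w₀ d₀ d r ≤ ENNReal.ofReal (smallness η)) :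
    sqDist w₀ d₀ d t + ∫⁻ r in Set.Ioc s t, (gsq (d r) + potential η (d r))
      ≤ sqDist w₀ d₀ d s := by
  have h1 := h.sqDist_add_le hη hD hs hst
  have h2 : ∫⁻ r in Set.Ioc s t, ENNReal.ofReal (1 / (2 * η ^ 2)) * ∫⁻ x, ‖d r x - w₀‖ₑ ^ 4
      ≤ ∫⁻ r in Set.Ioc s t, gsq (d r) := by
    refine setLIntegral_mono' measurableSet_Ioc fun r hr => ?_
    have hr0 : 0 < r := hs.trans_lt hr.1
    refine (mul_le_mul_right (h.lintegral_pow_four_le hD hr0) _).trans ?_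
    have h3 := hsm r hr
    rw [sqDist_of_pos hr0] at h3
    calc _ = ENNReal.ofReal (1 / (2 * η ^ 2)) * sobConst
          * (2 * nsq (fun x => d r x - w₀)) ^ (2 / 3 : ℝ) * gsq (d r) := by ring
      _ ≤ ENNReal.ofReal (1 / (2 * η ^ 2)) * sobConst
          * (2 * ENNReal.ofReal (smallness η)) ^ (2 / 3 : ℝ) * gsq (d r) := by
        gcongr
      _ ≤ 1 * gsq (d r) := mul_le_mul_left (mul_smallness_rpow_le η) _
      _ = gsq (d r) := one_mul _
  have hG := h.setLIntegral_gsq_lt_top (hs.trans hst) s hs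
  have e1 : ∫⁻ r in Set.Ioc s t, (2 * gsq (d r) + potential η (d r))
      = (∫⁻ r in Set.Ioc s t, (gsq (d r) + potential η (d r)))
        + ∫⁻ r in Set.Ioc s t, gsq (d r) := by
    rw [← lintegral_add_right' _ (h.d_reg.aemeasurable_gsq hs t)]
    refine lintegral_congr fun r => by ring
  rw [e1, ← add_assoc] at h1
  exact (ENNReal.add_le_add_iff_right hG.ne).1 (h1.trans (add_le_add le_rfl h2))

/-- Continuation in time steps of fixed length τ. By the crude bound 4M for ∫ h⁴, the squared
distance rises by at most half the threshold during one step, so smallness survives the step; the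
dissipation inequality from time zero is then available on the longer interval and restores the
initial bound. -/
lemma IsSolution.sqDist_le (hη : η ≠ 0) (hD : IsData w₀ u₀ d₀)
    (h : IsSolution η w₀ u₀ d₀ u π d)
    (hsm : nsq (fun x => d₀ x - w₀) ≤ ENNReal.ofReal (smallness η / 2)) {t : ℝ} (ht : 0 ≤ t) :
    sqDist w₀ d₀ d t ≤ nsq (fun x => d₀ x - w₀) := by
  obtain ⟨M, hM0, hM⟩ := h.exists_nsq_bound (T := t + 1) (by linarith)
  have hδ := smallness_pos η
  set κ : ℝ := 1 / (2 * η ^ 2) with hκ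
  have hκ0 : 0 ≤ κ := by positivity
  have hstep : ∀ s r, 0 ≤ s → s ≤ r → r ≤ t →
      sqDist w₀ d₀ d r ≤ sqDist w₀ d₀ d s + ENNReal.ofReal (κ * (4 * M) * (r - s)) := by
    intro s r hs hsr hrt
    refine (le_self_add.trans (h.sqDist_add_le hη hD hs hsr)).trans ?_
    gcongr
    calc _ ≤ ∫⁻ q in Set.Ioc s r, ENNReal.ofReal (κ * (4 * M)) := by
          refine setLIntegral_mono' measurableSet_Ioc fun q hq => ?_
          have hq0 : 0 < q := hs.trans_lt hq.1
          rw [ENNReal.ofReal_mul hκ0, ENNReal.ofReal_mul (by norm_num)]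
          refine mul_le_mul_right ?_ _
          refine (lintegral_pow_le_of_norm_le (v := fun x => d q x - w₀)
            (h.norm_sub_le_two hD hq0) 2 2).trans ?_
          rw [show (2 : ℝ) ^ 2 = 4 by norm_num]
          exact mul_le_mul_right (hM q ⟨hq0, by linarith [hq.2]⟩).1 _
      _ = _ := by
          rw [setLIntegral_const, Real.volume_Ioc, ← ENNReal.ofReal_mul (by positivity)]
  obtain ⟨τ, hτ0, hτ⟩ : ∃ τ : ℝ, 0 < τ ∧ κ * (4 * M) * τ ≤ smallness η / 2 := by
    refine ⟨smallness η / 2 / (κ * (4 * M) + 1), by positivity, ?_⟩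
    rw [mul_div_assoc', div_le_iff₀ (by positivity)]
    nlinarith
  have hind : ∀ n : ℕ, ∀ r, 0 ≤ r → r ≤ n * τ → r ≤ t →
      sqDist w₀ d₀ d r ≤ nsq (fun x => d₀ x - w₀) := by
    intro n
    induction n with
    | zero =>
      intro r hr0 hr _
      have : r = 0 := le_antisymm (by simpa using hr) hr0
      rw [this, sqDist_zero]
    | succ n ih =>
      intro r hr0 hr hrt
      rcases le_total r (n * τ) with hle | hle
      · exact ih r hr0 hle hrt
      push_cast at hr
      have hn0 : 0 ≤ n * τ := by positivity
      have h1 : ∀ q ∈ Set.Ioc 0 r, sqDist w₀ d₀ d q ≤ ENNReal.ofReal (smallness η) := by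
        intro q hq
        rcases le_total q (n * τ) with hq' | hq'
        · refine (ih q hq.1.le hq' (hq.2.trans hrt)).trans (hsm.trans ?_)
          exact ENNReal.ofReal_le_ofReal (by linarith)
        · refine (hstep (n * τ) q hn0 hq' (hq.2.trans hrt)).trans ?_
          refine (add_le_add ((ih _ hn0 le_rfl (hle.trans hrt)).trans hsm) le_rfl).trans ?_
          rw [← ENNReal.ofReal_add (by positivity)
            (mul_nonneg (by positivity) (by linarith))]
          refine ENNReal.ofReal_le_ofReal ?_
          have : κ * (4 * M) * (q - n * τ) ≤ κ * (4 * M) * τ := by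
            refine mul_le_mul_of_nonneg_left ?_ (by positivity)
            linarith [hq.2]
          linarith
      have h2 := h.sqDist_add_le_of_small hη hD le_rfl hr0 h1
      rw [sqDist_zero] at h2
      exact le_self_add.trans h2
  obtain ⟨n, hn⟩ := exists_nat_gt (t / τ)
  refine hind n t ht ?_ le_rfl
  rw [div_lt_iff₀ hτ0] at hn
  exact hn.le

/-- The `L²` dissipation inequality for small initial data. -/
theorem IsSolution.sqDist_dissipation (hη : η ≠ 0) (hD : IsData w₀ u₀ d₀)
    (h : IsSolution η w₀ u₀ d₀ u π d)
    (hsm : nsq (fun x => d₀ x - w₀) ≤ ENNReal.ofReal (smallness η / 2)) {s t : ℝ} (hs : 0 ≤ s)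
    (hst : s ≤ t) :
    sqDist w₀ d₀ d t + ∫⁻ r in Set.Ioc s t, (gsq (d r) + potential η (d r))
      ≤ sqDist w₀ d₀ d s := by
  refine h.sqDist_add_le_of_small hη hD hs hst fun r hr => ?_
  refine ((h.sqDist_le hη hD hsm (hs.trans hr.1.le)).trans hsm).trans ?_
  exact ENNReal.ofReal_le_ofReal (by linarith [smallness_pos η])

end Solution

end LiquidCrystal

namespace LiquidCrystal

/-! ### The `L¹` estimate of the director -/

lemma le_add_of_sq_le_mul {x a b : ℝ≥0∞} (h : x ^ 2 ≤ a * b) {θ : ℝ} (hθ : 0 < θ) :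
    x ≤ ENNReal.ofReal θ * a + ENNReal.ofReal θ⁻¹ * b := by
  refine (ENNReal.pow_le_pow_left_iff two_ne_zero).1 (h.trans ?_)
  have h1 : a * b = (ENNReal.ofReal θ * a) * (ENNReal.ofReal θ⁻¹ * b) := by
    have : ENNReal.ofReal θ * ENNReal.ofReal θ⁻¹ = 1 := by
      rw [← ENNReal.ofReal_mul hθ.le, mul_inv_cancel₀ hθ.ne', ENNReal.ofReal_one]
    calc a * b = (ENNReal.ofReal θ * ENNReal.ofReal θ⁻¹) * (a * b) := by rw [this, one_mul]
      _ = _ := by ring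
  rw [h1, sq]
  exact mul_le_mul' le_self_add le_add_self

lemma lintegral_cube_sq_le {α : Type*} [MeasurableSpace α] {μ : Measure α} {f : α → ℝ≥0∞}
    (hf : AEMeasurable f μ) :
    (∫⁻ a, f a ^ 3 ∂μ) ^ 2 ≤ (∫⁻ a, f a ∂μ) * ∫⁻ a, f a ^ 5 ∂μ := by
  have h := lintegral_mul_sq_le (hf.pow_const (1 / 2 : ℝ)) (hf.pow_const (5 / 2 : ℝ))
  have e1 : ∀ x : ℝ≥0∞, x ^ (1 / 2 : ℝ) * x ^ (5 / 2 : ℝ) = x ^ 3 := fun x => by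
    rw [← ENNReal.rpow_add_of_nonneg _ _ (by norm_num) (by norm_num), ← ENNReal.rpow_natCast]
    norm_num
  have e2 : ∀ x : ℝ≥0∞, (x ^ (1 / 2 : ℝ)) ^ 2 = x := fun x => by
    rw [← ENNReal.rpow_natCast, ← ENNReal.rpow_mul]; norm_num
  have e3 : ∀ x : ℝ≥0∞, (x ^ (5 / 2 : ℝ)) ^ 2 = x ^ 5 := fun x => by
    rw [← ENNReal.rpow_natCast, ← ENNReal.rpow_natCast, ← ENNReal.rpow_mul]; norm_num
  simpa only [e1, e2, e3] using h

section Solution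

variable {η : ℝ} {w₀ : E3} {u₀ d₀ : E3 → E3} {u d : ℝ → E3 → E3} {π : ℝ → E3 → ℝ}

lemma sq_add_mul_ge (ρ h : ℝ) : -(h ^ 2 / 4) ≤ ρ ^ 2 + ρ * h := by
  nlinarith [sq_nonneg (ρ + h / 2)]

/-- Kato's inequality: the concavity of the square root costs S⁻³ Q, which is at most the gain S⁻¹ G
because Q ≤ H² G and H ≤ S. The reaction term is bounded below by -κ S⁻¹ H⁴ / 8, and one factor H /
S ≤ 1 reduces the power to H³. -/
lemma sqrt_subsol_aux {H ρ G Q S κ : ℝ} (hS : 0 < S) (hH : 0 ≤ H) (hSH : H ≤ S) (hG : 0 ≤ G)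
    (hQ : Q ≤ H ^ 2 * G) (hκ : 0 ≤ κ) :
    0 - 1 / 8 * κ * H ^ 3
      ≤ 4 * (-(1 / 4) * S⁻¹ ^ 3) * Q + 1 / 2 * S⁻¹ * (2 * G + κ * (ρ ^ 2 + ρ * H ^ 2)) := by
  have hI : 0 < S⁻¹ := inv_pos.2 hS
  have h1 : H * S⁻¹ ≤ 1 := by
    rw [← div_eq_mul_inv, div_le_one hS]; exact hSH
  have hHI : (H * S⁻¹) ^ 2 ≤ 1 := pow_le_one₀ (by positivity) h1
  have t1 : S⁻¹ ^ 3 * Q ≤ S⁻¹ * G := by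
    calc S⁻¹ ^ 3 * Q ≤ S⁻¹ ^ 3 * (H ^ 2 * G) := by gcongr
      _ = (H * S⁻¹) ^ 2 * (S⁻¹ * G) := by ring
      _ ≤ 1 * (S⁻¹ * G) := mul_le_mul_of_nonneg_right hHI (by positivity)
      _ = _ := one_mul _
  have t2 : S⁻¹ * κ * H ^ 4 ≤ κ * H ^ 3 := by
    calc S⁻¹ * κ * H ^ 4 = (H * S⁻¹) * (κ * H ^ 3) := by ring
      _ ≤ 1 * (κ * H ^ 3) := mul_le_mul_of_nonneg_right h1 (by positivity)
      _ = _ := one_mul _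
  have t3 := mul_le_mul_of_nonneg_left (sq_add_mul_ge ρ (H ^ 2)) (mul_nonneg hI.le hκ)
  linarith

/-- Regularised modulus of d - w₀. Subtracting ε keeps it between 0 and |d - w₀|, so that it
inherits the L² bound; the source does not depend on ε. -/
lemma IsSolution.isSubsol_sqrt (hη : η ≠ 0) (hD : IsData w₀ u₀ d₀)
    (h : IsSolution η w₀ u₀ d₀ u π d) {ε : ℝ} (hε : 0 < ε) :
    IsSubsol u (fun t x => √(‖d t x - w₀‖ ^ 2 + ε ^ 2) - ε) (fun _ _ => 0)
      (fun t x => 1 / (8 * η ^ 2) * ‖d t x - w₀‖ ^ 3) := by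
  have hpos : ∀ y : ℝ, 0 ≤ y → 0 < √(y + ε ^ 2) := fun y hy => Real.sqrt_pos.2 (by positivity)
  have hbd : ∀ y : ℝ, 0 ≤ y → ε ≤ √(y + ε ^ 2) := fun y hy =>
    Real.le_sqrt_of_sq_le (by linarith)
  have hb : ∀ y : ℝ, 0 ≤ y →
      HasDerivAt (fun y => √(y + ε ^ 2) - ε) (1 / 2 * (√(y + ε ^ 2))⁻¹) y := fun y hy => by
    have h1 := ((hasDerivAt_id y).add_const (ε ^ 2)).sqrt (by simp only [id]; positivity)
    convert! h1.sub_const ε using 1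
    simp only [id]
    field_simp
  have hb' : ∀ y : ℝ, 0 ≤ y → HasDerivAt (fun y => 1 / 2 * (√(y + ε ^ 2))⁻¹)
      (-(1 / 4) * (√(y + ε ^ 2))⁻¹ ^ 3) y := fun y hy => by
    have h1 := ((hasDerivAt_id y).add_const (ε ^ 2)).sqrt (by simp only [id]; positivity)
    have h2 := (h1.fun_inv (hpos y hy).ne').const_mul (1 / 2)
    convert! h2 using 1
    simp only [id]
    have := (hpos y hy).ne'
    field_simp
    ring
  refine h.isSubsol_comp w₀ hb hb' ?_ (fun y hy => by linarith [hbd y hy]) (fun _ _ _ => le_rfl)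
    (fun t _ x => by positivity) continuousOn_const
    (((h.d_reg.cts.sub_const w₀).norm'.pow' 3).const_mul' _) (fun t ht x => ?_) fun T hT => ?_
  · refine ContinuousOn.mul continuousOn_const (ContinuousOn.pow (ContinuousOn.inv₀ ?_ ?_) 3)
    · fun_prop
    · exact fun y hy => (hpos y hy).ne'
  · rw [two_mul_inner_glForce hD.norm_w₀]
    set H := ‖d t x - w₀‖ with hH
    set ρ := ‖d t x‖ ^ 2 - 1
    set G := ∑ i, ‖partialD i (d t) x‖ ^ 2 with hG
    set Q := ∑ i, inner ℝ (d t x - w₀) (partialD i (d t) x) ^ 2 with hQdef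
    have hH0 : 0 ≤ H := norm_nonneg _
    have hG0 : 0 ≤ G := Finset.sum_nonneg fun i _ => sq_nonneg _
    have hQ : Q ≤ H ^ 2 * G := by
      rw [hQdef, hG, Finset.mul_sum]
      refine Finset.sum_le_sum fun i _ => ?_
      rw [← mul_pow, ← sq_abs]
      exact pow_le_pow_left₀ (abs_nonneg _) (abs_real_inner_le_norm _ _) 2
    have e8 : 1 / (8 * η ^ 2) = 1 / 8 * (1 / η ^ 2) := by field_simp
    rw [e8]
    exact sqrt_subsol_aux (hpos (H ^ 2) (sq_nonneg _)) hH0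
      (Real.le_sqrt_of_sq_le (le_add_of_nonneg_right (sq_nonneg ε))) hG0 hQ
      (one_div_nonneg.2 (sq_nonneg η))
  · obtain ⟨M, hM0, hM⟩ := h.exists_nsq_bound hT
    refine ⟨(0 + 1) * M, by positivity, fun t ht => ?_⟩
    obtain ⟨h1, -, h4⟩ := hM t ht
    refine lintegral_ofReal_le_of_four_two (a := 0) (b := 1) (v := fun x => d t x - w₀)
      (h.continuous_sub w₀ ht.1) le_rfl zero_le_one (fun x => ?_) h4 h1 hM0
    have k1 := hbd (‖d t x - w₀‖ ^ 2) (sq_nonneg _)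
    have k2 := Real.sq_sqrt (show 0 ≤ ‖d t x - w₀‖ ^ 2 + ε ^ 2 by positivity)
    nlinarith

lemma sqrt_add_sq_sub_le {a ε : ℝ} (ha : 0 ≤ a) (hε : 0 ≤ ε) : √(a ^ 2 + ε ^ 2) - ε ≤ a := by
  rw [sub_le_iff_le_add]
  exact Real.sqrt_le_iff.2 ⟨by positivity, by nlinarith [mul_nonneg ha hε]⟩

/-- The regularisation parameter 1/(n+1) tends to zero: Fatou on the left, while the right side is
independent of n. -/
lemma IsSolution.lintegral_norm_le_add (hη : η ≠ 0) (hD : IsData w₀ u₀ d₀)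
    (h : IsSolution η w₀ u₀ d₀ u π d) {t : ℝ} (ht : 0 < t) :
    ∫⁻ x, ‖d t x - w₀‖ₑ ≤ (∫⁻ x, ‖d₀ x - w₀‖ₑ) + ∫⁻ r in Set.Ioc 0 t,
      ENNReal.ofReal (1 / (8 * η ^ 2)) * ∫⁻ x, ‖d r x - w₀‖ₑ ^ 3 := by
  have e2 : ∀ r, ENNReal.ofReal (1 / (8 * η ^ 2)) * ∫⁻ x, ‖d r x - w₀‖ₑ ^ 3
      = ∫⁻ x, ENNReal.ofReal (1 / (8 * η ^ 2) * ‖d r x - w₀‖ ^ 3) := by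
    refine fun r => ?_
    rw [← lintegral_const_mul' _ _ ENNReal.ofReal_ne_top]
    refine lintegral_congr fun x => ?_
    rw [ENNReal.ofReal_mul (by positivity), enorm_pow_eq_ofReal]
  simp only [e2]
  have hε : ∀ n : ℕ, (0 : ℝ) < 1 / ((n : ℝ) + 1) := fun n => by positivity
  have hle : ∀ n : ℕ, ∫⁻ x, ENNReal.ofReal
      (√(‖d t x - w₀‖ ^ 2 + (1 / ((n : ℝ) + 1)) ^ 2) - 1 / ((n : ℝ) + 1))
      ≤ (∫⁻ x, ‖d₀ x - w₀‖ₑ) + ∫⁻ r in Set.Ioc 0 t,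
        ∫⁻ x, ENNReal.ofReal (1 / (8 * η ^ 2) * ‖d r x - w₀‖ ^ 3) := by
    intro n
    refine le_self_add.trans (transport_zero_le h.isDrift (h.isSubsol_sqrt hη hD (hε n))
      (δ := fun s x => d s x - d₀ x)
      (fun s hs => (h.d_reg.cts.slice hs).aestronglyMeasurable.sub hD.aestronglyMeasurable)
      h.tendsto_nsq_sub hD.d₀_mem.1.enorm ?_ ht)
    intro s hs
    refine Eventually.of_forall fun x => ?_
    refine (ENNReal.ofReal_le_ofReal (sqrt_add_sq_sub_le (norm_nonneg _) (hε n).le)).trans ?_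
    rw [ofReal_norm]
    calc ‖d s x - w₀‖ₑ = ‖(d₀ x - w₀) + (d s x - d₀ x)‖ₑ := by congr 1; abel
      _ ≤ ‖d₀ x - w₀‖ₑ + ‖d s x - d₀ x‖ₑ := enorm_add_le _ _
      _ ≤ _ := by
        refine add_le_add le_rfl (le_trans ?_ le_self_add)
        exact le_mul_of_one_le_left zero_le (by norm_num)
  have hlim : ∀ x, Tendsto (fun n : ℕ => ENNReal.ofReal
      (√(‖d t x - w₀‖ ^ 2 + (1 / ((n : ℝ) + 1)) ^ 2) - 1 / ((n : ℝ) + 1))) atTop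
      (𝓝 ‖d t x - w₀‖ₑ) := fun x => by
    rw [← ofReal_norm]
    refine (ENNReal.continuous_ofReal.tendsto _).comp ?_
    have h0 := tendsto_one_div_add_atTop_nhds_zero_nat (𝕜 := ℝ)
    have := ((((h0.pow 2).const_add (‖d t x - w₀‖ ^ 2)).sqrt).sub h0)
    simpa using this
  have hF := lintegral_liminf_le' (u := atTop) (μ := (volume : Measure E3)) (f := fun (n : ℕ) x =>
    ENNReal.ofReal (√(‖d t x - w₀‖ ^ 2 + (1 / ((n : ℝ) + 1)) ^ 2) - 1 / ((n : ℝ) + 1)))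
    fun n => by
      have := h.continuous_sub w₀ ht
      have hc : Continuous fun x => ENNReal.ofReal
          (√(‖d t x - w₀‖ ^ 2 + (1 / ((n : ℝ) + 1)) ^ 2) - 1 / ((n : ℝ) + 1)) :=
        ENNReal.continuous_ofReal.comp (by fun_prop)
      exact hc.measurable.aemeasurable
  simp only [(hlim _).liminf_eq] at hF
  refine hF.trans ?_
  refine (liminf_le_liminf (Eventually.of_forall hle)).trans ?_
  simp

/-- Cauchy-Schwarz on h² · h³. The quadratic dependence on the Dirichlet energy is what makes ∫ h³ ≤
(∫ h)^(1/2) (∫ h⁵)^(1/2) linear in it, hence integrable in time. -/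
lemma IsSolution.lintegral_pow_five_le (hD : IsData w₀ u₀ d₀) (h : IsSolution η w₀ u₀ d₀ u π d)
    {t : ℝ} (ht : 0 < t) :
    ∫⁻ x, ‖d t x - w₀‖ₑ ^ 5
      ≤ ((2 * nsq (fun x => d t x - w₀)) ^ (2 / 3 : ℝ) * sobConst ^ 4) ^ (1 / 2 : ℝ)
        * gsq (d t) ^ 2 := by
  have hm := (h.continuous_sub w₀ ht).enorm.aemeasurable (μ := volume)
  have h1 := lintegral_mul_sq_le (hm.pow_const 2) (hm.pow_const 3)
  simp only [← pow_add, ← pow_mul, Nat.reduceAdd, Nat.reduceMul] at h1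
  have h2 := h1.trans (mul_le_mul' (h.lintegral_pow_four_le hD ht) (h.lintegral_six_le ht))
  refine (ENNReal.pow_le_pow_left_iff two_ne_zero).1 (h2.trans (le_of_eq ?_))
  have e1 : ∀ x : ℝ≥0∞, (x ^ (1 / 2 : ℝ)) ^ 2 = x := fun x => by
    rw [← ENNReal.rpow_natCast, ← ENNReal.rpow_mul]; norm_num
  rw [mul_pow _ (gsq (d t) ^ 2), e1]
  ring

/-- Let Z be the supremum of the L¹ norm up to time t. The source is at most (θ Z + θ⁻¹ K) times the
Dirichlet energy, whose time integral is at most the initial squared L² distance. For small θ this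
gives Z ≤ A + Z/2 with A depending on the data only. -/
lemma IsSolution.exists_lintegral_norm_le (hη : η ≠ 0) (hD : IsData w₀ u₀ d₀)
    (hsm : nsq (fun x => d₀ x - w₀) ≤ ENNReal.ofReal (smallness η / 2)) :
    ∃ C : ℝ, 0 < C ∧ ∀ u π d, IsSolution η w₀ u₀ d₀ u π d → ∀ t, 0 < t →
      ∫⁻ x, ‖d t x - w₀‖ₑ ≤ ENNReal.ofReal C := by
  set X₀ := nsq (fun x => d₀ x - w₀) with hX₀
  set I₁ := ∫⁻ x, ‖d₀ x - w₀‖ₑ with hI₁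
  have hI₁top : I₁ ≠ ⊤ := by
    have := hD.d₀_L1.eLpNorm_lt_top
    rw [eLpNorm_one_eq_lintegral_enorm] at this
    exact this.ne
  have hX₀top : X₀ ≠ ⊤ := ne_top_of_le_ne_top ENNReal.ofReal_ne_top hsm
  set K := ((2 * X₀) ^ (2 / 3 : ℝ) * sobConst ^ 4) ^ (1 / 2 : ℝ) with hK
  have hKtop : K ≠ ⊤ := by
    refine ENNReal.rpow_ne_top_of_nonneg (by norm_num) (ENNReal.mul_ne_top ?_
      (ENNReal.pow_ne_top sobConst_ne_top))
    exact ENNReal.rpow_ne_top_of_nonneg (by norm_num) (ENNReal.mul_ne_top (by simp) hX₀top)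
  set κ : ℝ := 1 / (8 * η ^ 2) with hκ
  have hκ0 : 0 ≤ κ := by positivity
  set x₀ := X₀.toReal with hx₀
  have hx0 : 0 ≤ x₀ := ENNReal.toReal_nonneg
  -- This choice makes the coefficient κ θ X₀ of Z at most 1/2.
  set θ : ℝ := 1 / (2 * (κ * x₀ + 1)) with hθ
  have hθ0 : 0 < θ := by positivity
  have hθ1 : ENNReal.ofReal κ * (ENNReal.ofReal θ * X₀) ≤ ENNReal.ofReal (1 / 2) := by
    rw [← ENNReal.ofReal_toReal hX₀top, ← ENNReal.ofReal_mul hθ0.le, ← ENNReal.ofReal_mul hκ0]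
    refine ENNReal.ofReal_le_ofReal ?_
    rw [← hx₀, hθ, ← mul_assoc, mul_one_div, div_mul_eq_mul_div, div_le_div_iff₀ (by positivity) (by norm_num)]
    nlinarith [mul_nonneg hκ0 hx0]
  set A := I₁ + ENNReal.ofReal κ * (ENNReal.ofReal θ⁻¹ * K * X₀) with hA
  have hAtop : A ≠ ⊤ := by
    refine ENNReal.add_ne_top.2 ⟨hI₁top, ENNReal.mul_ne_top ENNReal.ofReal_ne_top
      (ENNReal.mul_ne_top (ENNReal.mul_ne_top ENNReal.ofReal_ne_top hKtop) hX₀top)⟩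
  refine ⟨2 * A.toReal + 1, by positivity, fun u π d h t ht => ?_⟩
  obtain ⟨M, hM0, hM⟩ := h.exists_nsq_bound (T := t + 1) (by linarith)
  set Z := ⨆ r ∈ Set.Ioc (0 : ℝ) t, ∫⁻ x, ‖d r x - w₀‖ₑ with hZ
  have hXle : ∀ r, 0 < r → nsq (fun x => d r x - w₀) ≤ X₀ := fun r hr => by
    have := h.sqDist_le hη hD hsm hr.le
    rwa [sqDist_of_pos hr] at this
  -- A bound growing with t, from ∫ h³ ≤ 2 ∫ h², suffices here; finiteness is needed only to absorb
  -- Z/2.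
  have hZtop : Z ≠ ⊤ := by
    refine ne_top_of_le_ne_top (b := I₁ + ENNReal.ofReal κ * (2 * X₀) * ENNReal.ofReal t) ?_ ?_
    · exact ENNReal.add_ne_top.2 ⟨hI₁top, ENNReal.mul_ne_top (ENNReal.mul_ne_top
        ENNReal.ofReal_ne_top (ENNReal.mul_ne_top (by simp) hX₀top)) ENNReal.ofReal_ne_top⟩
    · refine iSup₂_le fun r hr => (h.lintegral_norm_le_add hη hD hr.1).trans ?_
      refine add_le_add le_rfl ?_
      calc _ ≤ ∫⁻ q in Set.Ioc 0 r, ENNReal.ofReal κ * (2 * X₀) := by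
            refine setLIntegral_mono' measurableSet_Ioc fun q hq => mul_le_mul_right ?_ _
            exact (h.lintegral_cube_le hD hq.1).trans (mul_le_mul_right (hXle q hq.1) _)
        _ ≤ _ := by
            rw [setLIntegral_const, Real.volume_Ioc, sub_zero]
            exact mul_le_mul_right (ENNReal.ofReal_le_ofReal hr.2) _
  have hG : ∫⁻ r in Set.Ioc 0 t, gsq (d r) ≤ X₀ := by
    have := h.sqDist_dissipation hη hD hsm le_rfl ht.le
    rw [sqDist_zero] at this
    exact (lintegral_mono fun r => le_self_add).trans (le_add_self.trans this)
  have hcube : ∀ r ∈ Set.Ioc 0 t, ∫⁻ x, ‖d r x - w₀‖ₑ ^ 3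
      ≤ (ENNReal.ofReal θ * Z + ENNReal.ofReal θ⁻¹ * K) * gsq (d r) := by
    intro r hr
    have h1 := lintegral_cube_sq_le ((h.continuous_sub w₀ hr.1).enorm.aemeasurable (μ := volume))
    have h2 : ∫⁻ x, ‖d r x - w₀‖ₑ ≤ Z := le_iSup₂ (f := fun r _ => ∫⁻ x, ‖d r x - w₀‖ₑ) r hr
    have h3 : ∫⁻ x, ‖d r x - w₀‖ₑ ^ 5 ≤ K * gsq (d r) ^ 2 := by
      refine (h.lintegral_pow_five_le hD hr.1).trans ?_
      have := hXle r hr.1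
      rw [hK]
      gcongr
    have h4 : (∫⁻ x, ‖d r x - w₀‖ₑ ^ 3) ^ 2 ≤ (Z * gsq (d r)) * (K * gsq (d r)) :=
      (h1.trans (mul_le_mul' h2 h3)).trans (le_of_eq (by ring))
    refine (le_add_of_sq_le_mul h4 hθ0).trans (le_of_eq (by ring))
  have hZle : Z ≤ A + ENNReal.ofReal (1 / 2) * Z := by
    refine iSup₂_le fun r hr => (h.lintegral_norm_le_add hη hD hr.1).trans ?_
    have h5 : ∫⁻ q in Set.Ioc 0 r, ENNReal.ofReal κ * ∫⁻ x, ‖d q x - w₀‖ₑ ^ 3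
        ≤ ENNReal.ofReal κ * ((ENNReal.ofReal θ * Z + ENNReal.ofReal θ⁻¹ * K) * X₀) := by
      refine (setLIntegral_mono' measurableSet_Ioc fun q hq => mul_le_mul_right
        (hcube q ⟨hq.1, hq.2.trans hr.2⟩) _).trans ?_
      rw [lintegral_const_mul' _ _ ENNReal.ofReal_ne_top, lintegral_const_mul']
      · refine mul_le_mul_right (mul_le_mul_right ?_ _) _
        refine le_trans (lintegral_mono' (Measure.restrict_mono
          (Set.Ioc_subset_Ioc_right hr.2) le_rfl) le_rfl) hG
      · exact ENNReal.add_ne_top.2 ⟨ENNReal.mul_ne_top ENNReal.ofReal_ne_top hZtop,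
          ENNReal.mul_ne_top ENNReal.ofReal_ne_top hKtop⟩
    refine (add_le_add le_rfl h5).trans ?_
    calc _ = A + (ENNReal.ofReal κ * (ENNReal.ofReal θ * X₀)) * Z := by rw [hA]; ring
      _ ≤ _ := by gcongr
  have hIt : ∫⁻ x, ‖d t x - w₀‖ₑ ≤ Z :=
    le_iSup₂ (f := fun r _ => ∫⁻ x, ‖d r x - w₀‖ₑ) t ⟨ht, le_rfl⟩
  refine hIt.trans ?_
  rw [← ENNReal.ofReal_toReal hZtop] at hZle ⊢
  rw [← ENNReal.ofReal_toReal hAtop, ← ENNReal.ofReal_mul (by norm_num),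
    ← ENNReal.ofReal_add ENNReal.toReal_nonneg (by positivity),
    ENNReal.ofReal_le_ofReal_iff (by positivity)] at hZle
  exact ENNReal.ofReal_le_ofReal (by linarith)

end Solution

end LiquidCrystal

namespace LiquidCrystal

/-! ### Decay of the director in `L²` -/

section Solution

variable {η : ℝ} {w₀ : E3} {u₀ d₀ : E3 → E3} {u d : ℝ → E3 → E3} {π : ℝ → E3 → ℝ}

lemma IsC12.aemeasurable_potential {d : ℝ → E3 → E3} (h : IsC12 d) (η : ℝ) {s : ℝ} (hs : 0 ≤ s)
    (t : ℝ) : AEMeasurable (fun r => potential η (d r)) (volume.restrict (Set.Ioc s t)) :=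
  aemeasurable_lintegral_cts (h.cts.potential η) hs t

/-- Nash's inequality with the uniform L¹ bound, that is, with no decay in the remainder (β = 0),
yields the heat rate 3/2. -/
lemma IsSolution.exists_nsq_decay (hη : η ≠ 0) (hD : IsData w₀ u₀ d₀)
    (hsm : nsq (fun x => d₀ x - w₀) ≤ ENNReal.ofReal (smallness η / 2)) :
    ∃ C : ℝ, 0 < C ∧ ∀ u π d, IsSolution η w₀ u₀ d₀ u π d → ∀ t, 0 ≤ t →
      sqDist w₀ d₀ d t ≤ ENNReal.ofReal (C * (1 + t) ^ (-(3 / 2) : ℝ)) := by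
  obtain ⟨C₁, hC₁, h₁⟩ := IsSolution.exists_lintegral_norm_le hη hD hsm
  obtain ⟨C, hC, hC'⟩ := decay_of_nash (a := 2) (b := 2 * bumpConst * C₁ ^ 2) (M := smallness η / 2)
    (T₀ := 0) two_pos (by have := bumpConst_nonneg; positivity)
    (by have := smallness_pos η; positivity) le_rfl 0
  refine ⟨C, hC, fun u π d h t ht => ?_⟩
  have hB := bumpConst_nonneg
  have := hC' (sqDist w₀ d₀ d) (fun r => gsq (d r) + potential η (d r))
    (fun t => (h.d_reg.aemeasurable_gsq le_rfl t).add (h.d_reg.aemeasurable_potential η le_rfl t))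
    (fun s t hs hst => h.sqDist_dissipation hη hD hsm hs hst) (by rwa [sqDist_zero]) ?_ t ht
  · simpa using this
  intro r hr R hR
  have hn := nash hR ((h.contDiff_sub w₀ hr).of_le (by norm_num))
  rw [gsq_sub_const] at hn
  rw [sqDist_of_pos hr]
  refine hn.trans (add_le_add (mul_le_mul_right le_self_add _) ?_)
  refine (mul_le_mul_right (pow_le_pow_left₀ zero_le (h₁ u π d h r hr) 2) _).trans ?_
  rw [← ENNReal.ofReal_pow hC₁.le, ← ENNReal.ofReal_mul (by positivity)]
  refine ENNReal.ofReal_le_ofReal (le_of_eq ?_)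
  simp
  ring

lemma setLIntegral_rpow_neg_three_halves_le {t : ℝ} (ht : 0 ≤ t) :
    ∫⁻ r in Set.Ioc 0 t, ENNReal.ofReal ((1 + r) ^ (-(3 / 2) : ℝ)) ≤ ENNReal.ofReal 2 := by
  have h := ofReal_eq_add_setLIntegral_deriv (W := fun r => 2 - 2 * (1 + r) ^ (-(1 / 2) : ℝ))
    (W' := fun r => (1 + r) ^ (-(3 / 2) : ℝ)) ht (by simp) (fun r hr => ?_) ?_ ?_
  · refine (le_add_self.trans h.ge).trans (ENNReal.ofReal_le_ofReal ?_)
    have : 0 ≤ (1 + t) ^ (-(1 / 2) : ℝ) := by positivity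
    linarith
  · have h0 : 0 < 1 + r := by linarith [hr.1]
    have := ((((hasDerivAt_id r).const_add 1).rpow_const (p := -(1 / 2))
      (Or.inl h0.ne')).const_mul 2).const_sub 2
    convert! this using 1
    norm_num
    ring
  · exact ContinuousOn.rpow_const (by fun_prop) fun r hr => Or.inl (by linarith [hr.1])
  · exact fun r hr => Real.rpow_nonneg (by linarith [hr.1]) _

/-- The dissipation of the director is integrable in time with weight `1 + t`. -/
lemma IsSolution.exists_weighted_dissipation (hη : η ≠ 0) (hD : IsData w₀ u₀ d₀)
    (hsm : nsq (fun x => d₀ x - w₀) ≤ ENNReal.ofReal (smallness η / 2)) :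
    ∃ C : ℝ, 0 < C ∧ ∀ u π d, IsSolution η w₀ u₀ d₀ u π d → ∀ t, 0 ≤ t →
      ∫⁻ r in Set.Ioc 0 t, ENNReal.ofReal (1 + r) * (gsq (d r) + potential η (d r))
        ≤ ENNReal.ofReal C := by
  obtain ⟨C, hC, hC'⟩ := IsSolution.exists_nsq_decay hη hD hsm
  have hδ := smallness_pos η
  refine ⟨smallness η / 2 + C * 2, by positivity, fun u π d h t ht => ?_⟩
  have hw := weighted_energy_pow (X := sqDist w₀ d₀ d)
    (D := fun r => gsq (d r) + potential η (d r)) le_rfl ht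
    ((h.d_reg.aemeasurable_gsq le_rfl t).add (h.d_reg.aemeasurable_potential η le_rfl t))
    (fun r hr => h.sqDist_dissipation hη hD hsm hr.1 hr.2) 1
  simp only [pow_one, Nat.cast_one, tsub_self, pow_zero, mul_one, ENNReal.ofReal_one, one_mul,
    add_zero, sqDist_zero] at hw
  refine (le_add_self.trans hw).trans ?_
  rw [ENNReal.ofReal_add (by positivity) (by positivity)]
  refine add_le_add hsm ?_
  calc _ ≤ ∫⁻ r in Set.Ioc 0 t, ENNReal.ofReal C * ENNReal.ofReal ((1 + r) ^ (-(3 / 2) : ℝ)) := by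
        refine setLIntegral_mono' measurableSet_Ioc fun r hr => ?_
        rw [← ENNReal.ofReal_mul hC.le]
        exact hC' u π d h r hr.1.le
    _ ≤ _ := by
        rw [lintegral_const_mul' _ _ ENNReal.ofReal_ne_top, ENNReal.ofReal_mul hC.le]
        exact mul_le_mul_right (setLIntegral_rpow_neg_three_halves_le ht) _

end Solution

end LiquidCrystal

namespace LiquidCrystal

/-! ### Decay of the director in `L^p` -/

section Solution

variable {η : ℝ} {w₀ : E3} {u₀ d₀ : E3 → E3} {u d : ℝ → E3 → E3} {π : ℝ → E3 → ℝ}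

/-- The density of `∫ |∇ |d - w₀|^{2l}|²`. -/
noncomputable def powGrad (w₀ : E3) (l : ℕ) (d : E3 → E3) (x : E3) : ℝ :=
  ∑ i, (2 * l * (‖d x - w₀‖ ^ 2) ^ (l - 1) * inner ℝ (d x - w₀) (partialD i d x)) ^ 2

lemma powGrad_le {l : ℕ} (hl : 1 ≤ l) (d : E3 → E3) (x : E3) :
    powGrad w₀ l d x ≤ 4 * (l : ℝ) ^ 2 * (‖d x - w₀‖ ^ 2) ^ (2 * l - 1)
      * ∑ i, ‖partialD i d x‖ ^ 2 := by
  rw [powGrad, Finset.mul_sum]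
  refine Finset.sum_le_sum fun i _ => ?_
  have h1 : (inner ℝ (d x - w₀) (partialD i d x)) ^ 2 ≤ ‖d x - w₀‖ ^ 2 * ‖partialD i d x‖ ^ 2 := by
    rw [← mul_pow, ← sq_abs]
    exact pow_le_pow_left₀ (abs_nonneg _) (abs_real_inner_le_norm _ _) 2
  have e1 : 2 * l - 1 = (l - 1) + (l - 1) + 1 := by omega
  rw [e1, pow_succ, pow_add]
  set A := (‖d x - w₀‖ ^ 2) ^ (l - 1)
  calc (2 * l * A * inner ℝ (d x - w₀) (partialD i d x)) ^ 2
      = 4 * (l : ℝ) ^ 2 * (A * A) * (inner ℝ (d x - w₀) (partialD i d x)) ^ 2 := by ring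
    _ ≤ 4 * (l : ℝ) ^ 2 * (A * A) * (‖d x - w₀‖ ^ 2 * ‖partialD i d x‖ ^ 2) := by
        refine mul_le_mul_of_nonneg_left h1 ?_
        have := mul_self_nonneg A
        positivity
    _ = _ := by ring

lemma IsC12.cts_powGrad {d : ℝ → E3 → E3} (h : IsC12 d) (w₀ : E3) (l : ℕ) :
    Cts (fun t x => powGrad w₀ l (d t) x) := by
  refine Cts.sum fun i => Cts.pow' (Cts.mul' ?_ ((h.cts.sub_const w₀).inner' (h.cts_partialD i))) 2
  exact Cts.const_mul' ((h.cts.sub_const w₀).norm_sq.pow' (l - 1)) _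

/-- The vector field `|d - w₀|^{2l} w₀`. -/
noncomputable def powField (w₀ : E3) (l : ℕ) (d : E3 → E3) (x : E3) : E3 :=
  ((‖d x - w₀‖ ^ 2) ^ l) • w₀

lemma contDiff_powField {d : E3 → E3} (hd : ContDiff ℝ 1 d) (w₀ : E3) (l : ℕ) :
    ContDiff ℝ 1 (powField w₀ l d) :=
  (((hd.sub contDiff_const).norm_sq ℝ).pow l).smul contDiff_const

/-- Multiplication by the unit vector w₀ only converts the scalar |d - w₀|^(2l) into a vector field,
the form in which Nash's and Sobolev's inequalities are stated; norms are unchanged. -/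
lemma gsq_powField {d : E3 → E3} (hd : ContDiff ℝ 1 d) (hw : ‖w₀‖ = 1) (l : ℕ) :
    gsq (powField w₀ l d) = ∫⁻ x, ENNReal.ofReal (powGrad w₀ l d x) := by
  rw [gsq_eq_ofReal (contDiff_powField hd w₀ l)]
  refine lintegral_congr fun x => ?_
  congr 1
  refine Finset.sum_congr rfl fun i _ => ?_
  have h1 := hasLineDerivAt_partialD hd i x
  have h2 : HasLineDerivAt ℝ (powField w₀ l d)
      ((2 * l * (‖d x - w₀‖ ^ 2) ^ (l - 1) * inner ℝ (d x - w₀) (partialD i d x)) • w₀) x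
      (e i) := by
    unfold HasLineDerivAt at h1 ⊢
    have := (((h1.sub_const w₀).norm_sq).fun_pow l).smul_const w₀
    convert! this using 2
    simp
    ring
  have h3 := (hasLineDerivAt_partialD (contDiff_powField hd w₀ l) i x).unique h2
  rw [h3, norm_smul, hw, mul_one, Real.norm_eq_abs, sq_abs]

lemma enorm_powField (hw : ‖w₀‖ = 1) (l : ℕ) (d : E3 → E3) (x : E3) :
    ‖powField w₀ l d x‖ₑ = ‖d x - w₀‖ₑ ^ (2 * l) := by
  rw [powField, enorm_smul, ← ofReal_norm w₀, hw, ENNReal.ofReal_one, mul_one,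
    Real.enorm_of_nonneg (by positivity), enorm_pow_eq_ofReal, pow_mul]

/-- For the convex power y^m the second-derivative term is nonnegative and is dropped. Completing
the square in ρ bounds the reaction below by -h⁴ / (4η²) times m h^(2(m-1)). -/
lemma IsSolution.isSubsol_pow (hη : η ≠ 0) (hD : IsData w₀ u₀ d₀)
    (h : IsSolution η w₀ u₀ d₀ u π d) {m : ℕ} (hm : 1 ≤ m) :
    IsSubsol u (fun t x => (‖d t x - w₀‖ ^ 2) ^ m)
      (fun t x => 2 * m * ((‖d t x - w₀‖ ^ 2) ^ (m - 1) * ∑ i, ‖partialD i (d t) x‖ ^ 2))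
      (fun t x => m / (4 * η ^ 2) * (‖d t x - w₀‖ ^ 2) ^ (m + 1)) := by
  have hs : ∀ t x, 0 ≤ ∑ i, ‖partialD i (d t) x‖ ^ 2 :=
    fun t x => Finset.sum_nonneg fun i _ => sq_nonneg _
  refine h.isSubsol_comp w₀ (b := fun y => y ^ m) (b' := fun y => m * y ^ (m - 1))
    (b'' := fun y => m * ((m - 1 : ℕ) * y ^ (m - 1 - 1)))
    (fun y _ => hasDerivAt_pow m y) (fun y _ => (hasDerivAt_pow (m - 1) y).const_mul _)
    (Continuous.continuousOn (by fun_prop)) (fun y hy => pow_nonneg hy m)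
    (fun t _ x => by have := hs t x; positivity) (fun t _ x => by positivity)
    ((((h.d_reg.cts.sub_const w₀).norm_sq.pow' (m - 1)).mul' h.d_reg.cts_sum_partialD).const_mul' _)
    (((h.d_reg.cts.sub_const w₀).norm_sq.pow' (m + 1)).const_mul' _) (fun t ht x => ?_)
    fun T hT => ?_
  · rw [two_mul_inner_glForce hD.norm_w₀]
    have hq : 0 ≤ ∑ i, inner ℝ (d t x - w₀) (partialD i (d t) x) ^ 2 :=
      Finset.sum_nonneg fun i _ => sq_nonneg _
    set H := ‖d t x - w₀‖ ^ 2 with hH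
    have hH0 : 0 ≤ H := sq_nonneg _
    set ρ := ‖d t x‖ ^ 2 - 1
    set G := ∑ i, ‖partialD i (d t) x‖ ^ 2
    have e8 : (m : ℝ) / (4 * η ^ 2) = m * (1 / 4) * (1 / η ^ 2) := by field_simp
    have e9 : H ^ (m + 1) = H ^ (m - 1) * H ^ 2 := by rw [← pow_add]; congr 1; omega
    rw [e8, e9]
    have hη2 : 0 ≤ 1 / η ^ 2 := by positivity
    have hA : 0 ≤ (m : ℝ) * H ^ (m - 1) := by positivity
    have t1 := mul_le_mul_of_nonneg_left (sq_add_mul_ge ρ H) (mul_nonneg hA hη2)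
    have t2 : 0 ≤ 4 * ((m : ℝ) * ((m - 1 : ℕ) * H ^ (m - 1 - 1)))
        * ∑ i, inner ℝ (d t x - w₀) (partialD i (d t) x) ^ 2 := by positivity
    linarith
  · obtain ⟨M, hM0, hM⟩ := h.exists_nsq_bound hT
    refine ⟨(0 + 2 ^ (4 * m - 2)) * M, by positivity, fun t ht => ?_⟩
    obtain ⟨h1, -, h4⟩ := hM t ht
    refine lintegral_ofReal_le_of_four_two (a := 0) (b := 2 ^ (4 * m - 2))
      (v := fun x => d t x - w₀)
      (h.continuous_sub w₀ ht.1) le_rfl (by positivity) (fun x => ?_) h4 h1 hM0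
    have e1 : ((‖d t x - w₀‖ ^ 2) ^ m) ^ 2 = ‖d t x - w₀‖ ^ (4 * m - 2) * ‖d t x - w₀‖ ^ 2 := by
      rw [← pow_add, ← pow_mul, ← pow_mul]; congr 1; omega
    rw [e1, zero_mul, zero_add]
    have := pow_le_pow_left₀ (norm_nonneg _) (h.norm_sub_le_two hD ht.1 x) (4 * m - 2)
    gcongr

/-- The `L^{4l}` dissipation inequality once `‖d - w₀‖²` is small. -/
lemma IsSolution.lintegral_pow_add_le (hη : η ≠ 0) (hD : IsData w₀ u₀ d₀)
    (h : IsSolution η w₀ u₀ d₀ u π d) {l : ℕ} (hl : 1 ≤ l) {s t : ℝ} (hs : 0 < s) (hst : s ≤ t)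
    (hsm : ∀ r ∈ Set.Ioc s t, ENNReal.ofReal ((2 * l : ℕ) / (4 * η ^ 2))
      * (2 * nsq (fun x => d r x - w₀)) ^ (2 / 3 : ℝ) * sobConst ≤ ENNReal.ofReal (1 / (2 * l))) :
    (∫⁻ x, ‖d t x - w₀‖ₑ ^ (4 * l)) + ∫⁻ r in Set.Ioc s t,
        ENNReal.ofReal (1 / (2 * l)) * ∫⁻ x, ENNReal.ofReal (powGrad w₀ l (d r) x)
      ≤ ∫⁻ x, ‖d s x - w₀‖ₑ ^ (4 * l) := by
  have hl0 : (0 : ℝ) < l := by exact_mod_cast hl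
  have h1 := transport_le h.isDrift (h.isSubsol_pow hη hD (m := 2 * l) (by omega)) hs hst
  have e1 : ∀ r, ∫⁻ x, ENNReal.ofReal ((‖d r x - w₀‖ ^ 2) ^ (2 * l))
      = ∫⁻ x, ‖d r x - w₀‖ₑ ^ (4 * l) := fun r => by
    refine lintegral_congr fun x => ?_
    rw [enorm_pow_eq_ofReal, ← pow_mul]
    congr 2; ring
  simp only [e1] at h1
  set g : ℝ → ℝ≥0∞ := fun r => ∫⁻ x, ENNReal.ofReal (powGrad w₀ l (d r) x) with hg
  set c : ℝ≥0∞ := ENNReal.ofReal (1 / (2 * l)) with hc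
  have hgm : AEMeasurable (fun r => c * g r) (volume.restrict (Set.Ioc s t)) :=
    (aemeasurable_lintegral_cts (h.d_reg.cts_powGrad w₀ l) hs.le t).const_mul _
  -- The full dissipation contains two copies of c g: one is kept in the conclusion, the other pays
  -- for the source.
  have hP : ∀ r ∈ Set.Ioc s t, 2 * (c * g r) ≤ ∫⁻ x, ENNReal.ofReal (2 * (2 * l : ℕ) *
      ((‖d r x - w₀‖ ^ 2) ^ (2 * l - 1) * ∑ i, ‖partialD i (d r) x‖ ^ 2)) := by
    intro r hr
    rw [hg, ← mul_assoc, hc, ← lintegral_const_mul' _ _ (ENNReal.mul_ne_top (by simp)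
      ENNReal.ofReal_ne_top)]
    refine lintegral_mono fun x => ?_
    have e2 : 2 * ENNReal.ofReal (1 / (2 * (l : ℝ))) = ENNReal.ofReal (2 * (1 / (2 * l))) := by
      rw [ENNReal.ofReal_mul (by norm_num)]; simp
    rw [e2, ← ENNReal.ofReal_mul (by positivity)]
    refine ENNReal.ofReal_le_ofReal ?_
    refine (mul_le_mul_of_nonneg_left (powGrad_le hl (d r) x) (by positivity)).trans (le_of_eq ?_)
    push_cast
    field_simp
    ring
  -- The source density is h^(4l+2) = h² · (h^(2l))²: Hölder with h in L³, which is small, and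
  -- h^(2l) in L⁶, controlled through Sobolev by its own gradient.
  have hN : ∀ r ∈ Set.Ioc s t, ∫⁻ x, ENNReal.ofReal ((2 * l : ℕ) / (4 * η ^ 2)
      * (‖d r x - w₀‖ ^ 2) ^ (2 * l + 1)) ≤ c * g r := by
    intro r hr
    have hr0 : 0 < r := hs.trans hr.1
    have hC1 : ContDiff ℝ 1 (d r) := h.d_reg.contDiff_one hr0
    have hnG : nsq (powField w₀ l (d r)) < ⊤ := by
      simp only [nsq, enorm_powField hD.norm_w₀, ← pow_mul]
      have e3 : 2 * l * 2 = 2 + (4 * l - 2) := by omega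
      rw [e3]
      refine (lintegral_pow_le_of_norm_le (v := fun x => d r x - w₀)
        (h.norm_sub_le_two hD hr0) 2 (4 * l - 2)).trans_lt ?_
      exact ENNReal.mul_lt_top ENNReal.ofReal_lt_top (h.nsq_sub_lt_top hr0)
    have h6 := LiquidCrystal.lintegral_six_le (contDiff_powField hC1 w₀ l) hnG
    rw [gsq_powField hC1 hD.norm_w₀] at h6
    have h3 := lintegral_sq_mul_sq_le (μ := volume) (h.continuous_sub w₀ hr0).enorm.aemeasurable
      (contDiff_powField hC1 w₀ l).continuous.enorm.aemeasurable
    have e4 : ∫⁻ x, ENNReal.ofReal ((2 * l : ℕ) / (4 * η ^ 2) * (‖d r x - w₀‖ ^ 2) ^ (2 * l + 1))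
        = ENNReal.ofReal ((2 * l : ℕ) / (4 * η ^ 2))
          * ∫⁻ x, ‖d r x - w₀‖ₑ ^ 2 * ‖powField w₀ l (d r) x‖ₑ ^ 2 := by
      rw [← lintegral_const_mul' _ _ ENNReal.ofReal_ne_top]
      refine lintegral_congr fun x => ?_
      rw [ENNReal.ofReal_mul (by positivity), enorm_powField hD.norm_w₀, ← pow_mul ‖d r x - w₀‖ₑ,
        ← pow_add, enorm_pow_eq_ofReal, ← pow_mul]
      congr 3; ring
    rw [e4]
    calc _ ≤ ENNReal.ofReal ((2 * l : ℕ) / (4 * η ^ 2)) *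
          ((2 * nsq (fun x => d r x - w₀)) ^ (2 / 3 : ℝ) * (sobConst * g r)) := by
          refine mul_le_mul_right (h3.trans (mul_le_mul' ?_ ?_)) _
          · exact ENNReal.rpow_le_rpow (h.lintegral_cube_le hD hr0) (by norm_num)
          · rw [← pow_three_rpow_third (sobConst * g r)]
            exact ENNReal.rpow_le_rpow h6 (by norm_num)
      _ = (ENNReal.ofReal ((2 * l : ℕ) / (4 * η ^ 2)) *
          (2 * nsq (fun x => d r x - w₀)) ^ (2 / 3 : ℝ) * sobConst) * g r := by ring
      _ ≤ _ := mul_le_mul_left (hsm r hr) _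
  -- Since h ≤ 2, the density is at most a constant times |∇d|², so the absorbed copy is finite and
  -- can be cancelled.
  have hfin : ∫⁻ r in Set.Ioc s t, c * g r ≠ ⊤ := by
    rw [lintegral_const_mul' _ _ ENNReal.ofReal_ne_top]
    refine ENNReal.mul_ne_top ENNReal.ofReal_ne_top ?_
    have h4 : ∀ r ∈ Set.Ioc s t, g r ≤ ENNReal.ofReal (4 * (l : ℝ) ^ 2 * 4 ^ (2 * l - 1))
        * gsq (d r) := by
      intro r hr
      have hr0 : 0 < r := hs.trans hr.1
      rw [hg, gsq_eq_ofReal (h.d_reg.contDiff_one hr0),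
        ← lintegral_const_mul' _ _ ENNReal.ofReal_ne_top]
      refine lintegral_mono fun x => ?_
      rw [← ENNReal.ofReal_mul (by positivity)]
      refine ENNReal.ofReal_le_ofReal ((powGrad_le hl (d r) x).trans ?_)
      have h5 : ‖d r x - w₀‖ ^ 2 ≤ 4 := by
        have := pow_le_pow_left₀ (norm_nonneg _) (h.norm_sub_le_two hD hr0 x) 2
        linarith
      have h6 := pow_le_pow_left₀ (sq_nonneg _) h5 (2 * l - 1)
      have : 0 ≤ ∑ i, ‖partialD i (d r) x‖ ^ 2 := Finset.sum_nonneg fun i _ => sq_nonneg _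
      gcongr
    refine ne_top_of_le_ne_top ?_ (setLIntegral_mono' measurableSet_Ioc h4)
    rw [lintegral_const_mul' _ _ ENNReal.ofReal_ne_top]
    exact ENNReal.mul_ne_top ENNReal.ofReal_ne_top
      (h.setLIntegral_gsq_lt_top (hs.le.trans hst) s hs.le).ne
  have h2 : (∫⁻ x, ‖d t x - w₀‖ₑ ^ (4 * l)) + (∫⁻ r in Set.Ioc s t, c * g r)
      + ∫⁻ r in Set.Ioc s t, c * g r
      ≤ (∫⁻ x, ‖d s x - w₀‖ₑ ^ (4 * l)) + ∫⁻ r in Set.Ioc s t, c * g r := by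
    refine le_trans ?_ (h1.trans (add_le_add le_rfl (setLIntegral_mono' measurableSet_Ioc hN)))
    rw [add_assoc]
    refine add_le_add le_rfl ?_
    rw [← lintegral_add_left' hgm]
    refine setLIntegral_mono' measurableSet_Ioc fun r hr => ?_
    rw [← two_mul]
    exact hP r hr
  exact (ENNReal.add_le_add_iff_right hfin).1 h2

end Solution

end LiquidCrystal

/-! ### Doubling of the exponent and decay for all finite p. -/

namespace LiquidCrystal

section Solution

variable {η : ℝ} {w₀ : E3} {u₀ d₀ : E3 → E3} {u d : ℝ → E3 → E3} {π : ℝ → E3 → ℝ}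

/-- From decay of `∫ |d - w₀|^{2l}` to decay of `∫ |d - w₀|^{4l}`. -/
lemma IsSolution.exists_decay_double (hη : η ≠ 0) (hD : IsData w₀ u₀ d₀)
    (hsm : nsq (fun x => d₀ x - w₀) ≤ ENNReal.ofReal (smallness η / 2)) {l : ℕ} (hl : 1 ≤ l)
    {A : ℝ} (hA : 0 < A) (hdec : ∀ u π d, IsSolution η w₀ u₀ d₀ u π d → ∀ t, 0 < t →
      ∫⁻ x, ‖d t x - w₀‖ₑ ^ (2 * l)
        ≤ ENNReal.ofReal (A * (1 + t) ^ (-(3 / 2) * ((2 * l : ℕ) - 1) : ℝ))) :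
    ∃ C : ℝ, 0 < C ∧ ∀ u π d, IsSolution η w₀ u₀ d₀ u π d → ∀ t, 0 < t →
      ∫⁻ x, ‖d t x - w₀‖ₑ ^ (4 * l)
        ≤ ENNReal.ofReal (C * (1 + t) ^ (-(3 / 2) * ((4 * l : ℕ) - 1) : ℝ)) := by
  have hl0 : (0 : ℝ) < l := by exact_mod_cast hl
  have hB := bumpConst_nonneg
  have hδ := smallness_pos η
  obtain ⟨C₂, hC₂, h₂⟩ := IsSolution.exists_nsq_decay hη hD hsm
  set κ : ℝ := (2 * l : ℕ) / (4 * η ^ 2) with hκ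
  have hκ0 : 0 ≤ κ := by positivity
  set S : ℝ := sobConst.toReal with hS
  have hS0 : 0 ≤ S := ENNReal.toReal_nonneg
  -- The squared L² distance decays like (1 + r)^(-3/2), so its power 2/3 decays like (1 + r)⁻¹;
  -- after this time the source is absorbed. The waiting time depends on l and on the data, not on
  -- the solution.
  set T₀ : ℝ := κ * (2 * C₂) ^ (2 / 3 : ℝ) * S * (2 * l) + 1 with hT₀
  have hT₀1 : 0 < T₀ := by positivity
  set M : ℝ := 2 ^ (4 * l - 2) * (smallness η / 2) with hM
  have hM0 : 0 ≤ M := by positivity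
  -- The factor 2l in `a` compensates the coefficient 1/(2l) of the dissipation. The exponent β = 3
  -- (2l - 1) is twice the assumed rate, as the L¹ norm of h^(2l) enters Nash's inequality squared.
  obtain ⟨C, hC, hC'⟩ := decay_of_nash (a := 2 * (2 * l)) (b := 2 * bumpConst * A ^ 2) (M := M)
    (T₀ := T₀) (by positivity) (by positivity) hM0 hT₀1.le (3 * (2 * l - 1))
  set α : ℝ := -(3 / 2) * ((4 * l : ℕ) - 1) with hα
  have hαe : (-(((3 * (2 * l - 1) : ℕ) : ℝ) + 3 / 2) : ℝ) = α := by
    rw [hα]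
    push_cast [Nat.cast_sub (show 1 ≤ 2 * l by omega)]
    ring
  have hα0 : α ≤ 0 := by
    have : (1 : ℝ) ≤ (4 * l : ℕ) := by exact_mod_cast (by omega : 1 ≤ 4 * l)
    rw [hα]; nlinarith
  -- The second entry covers the times before `T₀`, where mere boundedness by `M` is used.
  set C' : ℝ := max C (M / (1 + T₀) ^ α) with hC'def
  refine ⟨C', lt_max_of_lt_left hC, fun u π d h t ht => ?_⟩
  have hX : ∀ r, 0 < r → nsq (fun x => d r x - w₀) ≤ ENNReal.ofReal (smallness η / 2) :=
    fun r hr => by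
      have := (h.sqDist_le hη hD hsm hr.le).trans hsm
      rwa [sqDist_of_pos hr] at this
  have hXM : ∀ r, 0 < r → ∫⁻ x, ‖d r x - w₀‖ₑ ^ (4 * l) ≤ ENNReal.ofReal M := fun r hr => by
    have e3 : 4 * l = 2 + (4 * l - 2) := by omega
    rw [e3, hM, ENNReal.ofReal_mul (by positivity)]
    exact (lintegral_pow_le_of_norm_le (v := fun x => d r x - w₀)
      (h.norm_sub_le_two hD hr) 2 (4 * l - 2)).trans (mul_le_mul_right (hX r hr) _)
  rcases le_total t T₀ with htT | htT
  · refine (hXM t ht).trans (ENNReal.ofReal_le_ofReal ?_)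
    have h1 : (1 + T₀) ^ α ≤ (1 + t) ^ α :=
      Real.rpow_le_rpow_of_nonpos (by linarith) (by linarith) hα0
    have h2 : 0 < (1 + T₀) ^ α := by positivity
    calc M = M / (1 + T₀) ^ α * (1 + T₀) ^ α := by field_simp
      _ ≤ C' * (1 + t) ^ α := mul_le_mul (le_max_right _ _) h1 h2.le
          (hC.le.trans (le_max_left _ _))
  have hsmall : ∀ r, T₀ < r → ENNReal.ofReal κ
      * (2 * nsq (fun x => d r x - w₀)) ^ (2 / 3 : ℝ) * sobConst
        ≤ ENNReal.ofReal (1 / (2 * l)) := by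
    intro r hr
    have hr0 : 0 < r := hT₀1.trans hr
    have h1 := h₂ u π d h r hr0.le
    rw [sqDist_of_pos hr0] at h1
    have e2 : (2 : ℝ≥0∞) = ENNReal.ofReal 2 := by simp
    calc _ ≤ ENNReal.ofReal κ * (ENNReal.ofReal 2 * ENNReal.ofReal (C₂ * (1 + r) ^ (-(3 / 2) : ℝ)))
          ^ (2 / 3 : ℝ) * sobConst := by rw [← e2]; gcongr
      _ = ENNReal.ofReal (κ * (2 * C₂) ^ (2 / 3 : ℝ) * S * (1 + r)⁻¹) := by
          rw [← ENNReal.ofReal_mul (by norm_num), ENNReal.ofReal_rpow_of_nonneg (by positivity)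
            (by norm_num), ← ENNReal.ofReal_toReal sobConst_ne_top, ← ENNReal.ofReal_mul hκ0,
            ← ENNReal.ofReal_mul (by positivity), ← mul_assoc,
            Real.mul_rpow (by positivity) (by positivity), ← Real.rpow_mul (by positivity), ← hS]
          norm_num
          rw [Real.rpow_neg_one]
          congr 1; ring
      _ ≤ _ := by
          refine ENNReal.ofReal_le_ofReal ?_
          rw [← div_eq_mul_inv, div_le_div_iff₀ (by linarith) (by positivity)]
          rw [hT₀] at hr
          linarith
  have hfin := hC' (fun r => ∫⁻ x, ‖d r x - w₀‖ₑ ^ (4 * l))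
    (fun r => ENNReal.ofReal (1 / (2 * l)) * ∫⁻ x, ENNReal.ofReal (powGrad w₀ l (d r) x))
    (fun t => (aemeasurable_lintegral_cts (h.d_reg.cts_powGrad w₀ l) hT₀1.le t).const_mul _)
    (fun s t hs hst => h.lintegral_pow_add_le hη hD hl (hT₀1.trans_le hs) hst
      fun r hr => hsmall r (hs.trans_lt hr.1)) (hXM T₀ hT₀1) ?_ t htT
  · rw [hαe] at hfin
    refine hfin.trans (ENNReal.ofReal_le_ofReal ?_)
    gcongr
    exact le_max_left _ _
  intro r hr R hR
  have hr0 : 0 < r := hT₀1.trans hr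
  have hC1 := h.d_reg.contDiff_one hr0
  have hn := nash hR (contDiff_powField hC1 w₀ l)
  rw [gsq_powField hC1 hD.norm_w₀] at hn
  simp only [nsq, enorm_powField hD.norm_w₀, ← pow_mul] at hn
  have e1 : 2 * l * 2 = 4 * l := by ring
  rw [e1] at hn
  refine hn.trans (add_le_add ?_ ?_)
  · rw [← mul_assoc, ← ENNReal.ofReal_mul (by positivity)]
    refine mul_le_mul_left (ENNReal.ofReal_le_ofReal (le_of_eq ?_)) _
    field_simp
  · refine (mul_le_mul_right (pow_le_pow_left₀ zero_le (hdec u π d h r hr0) 2) _).trans ?_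
    have h1r : 0 < 1 + r := by linarith
    rw [← ENNReal.ofReal_pow (by positivity), ← ENNReal.ofReal_mul (by positivity)]
    refine ENNReal.ofReal_le_ofReal (le_of_eq ?_)
    have e2 : ((1 + r) ^ (-(3 / 2) * ((2 * l : ℕ) - 1) : ℝ)) ^ 2
        = ((1 + r) ^ (3 * (2 * l - 1)))⁻¹ := by
      rw [← Real.rpow_natCast, ← Real.rpow_natCast, ← Real.rpow_mul h1r.le, ← Real.rpow_neg h1r.le]
      congr 1
      push_cast [Nat.cast_sub (show 1 ≤ 2 * l by omega)]
      ring
    rw [mul_pow, e2]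
    ring

lemma IsSolution.exists_decay_two_pow (hη : η ≠ 0) (hD : IsData w₀ u₀ d₀)
    (hsm : nsq (fun x => d₀ x - w₀) ≤ ENNReal.ofReal (smallness η / 2)) (k : ℕ) :
    ∃ C : ℝ, 0 < C ∧ ∀ u π d, IsSolution η w₀ u₀ d₀ u π d → ∀ t, 0 < t →
      ∫⁻ x, ‖d t x - w₀‖ₑ ^ (2 ^ (k + 1))
        ≤ ENNReal.ofReal (C * (1 + t) ^ (-(3 / 2) * ((2 ^ (k + 1) : ℕ) - 1) : ℝ)) := by
  induction k with
  | zero =>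
    obtain ⟨C, hC, h⟩ := IsSolution.exists_nsq_decay hη hD hsm
    refine ⟨C, hC, fun u π d hs t ht => ?_⟩
    have := h u π d hs t ht.le
    rw [sqDist_of_pos ht, nsq] at this
    norm_num
    exact this
  | succ k ih =>
    obtain ⟨A, hA, hdec⟩ := ih
    have e1 : 2 ^ (k + 1) = 2 * 2 ^ k := by ring
    have e2 : 2 ^ (k + 1 + 1) = 4 * 2 ^ k := by ring
    rw [e1] at hdec
    rw [e2]
    exact IsSolution.exists_decay_double hη hD hsm Nat.one_le_two_pow hA hdec

/-- Interpolation of a decay rate between `L¹` and `L^q`. -/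
lemma lintegral_rpow_decay_le {f : E3 → ℝ≥0∞} (hf : AEMeasurable f volume) {A B t : ℝ} (hA : 0 ≤ A)
    (hB : 0 ≤ B) (ht : 0 < t) {q : ℕ} (hq : 1 < q) {p : ℝ} (hp : 1 ≤ p) (hpq : p ≤ q)
    (h1 : ∫⁻ x, f x ≤ ENNReal.ofReal A)
    (h2 : ∫⁻ x, f x ^ q ≤ ENNReal.ofReal (B * (1 + t) ^ (-(3 / 2) * (q - 1) : ℝ))) :
    ∫⁻ x, f x ^ p ≤ ENNReal.ofReal (A ^ ((q - p) / (q - 1)) * B ^ ((p - 1) / (q - 1))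
      * (1 + t) ^ (-(3 / 2) * (p - 1))) := by
  have hq' : (1 : ℝ) < q := by exact_mod_cast hq
  have hq0 : (0 : ℝ) < q - 1 := by linarith
  set a : ℝ := (q - p) / (q - 1) with ha
  set b : ℝ := (p - 1) / (q - 1) with hb
  have ha0 : 0 ≤ a := div_nonneg (by linarith) hq0.le
  have hb0 : 0 ≤ b := div_nonneg (by linarith) hq0.le
  have hab : a + b = 1 := by rw [ha, hb]; field_simp; ring
  have hpe : a + q * b = p := by rw [ha, hb]; field_simp; ring
  have h3 := ENNReal.lintegral_mul_norm_pow_le hf (hf.pow_const q) ha0 hb0 hab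
  have e1 : ∀ x, f x ^ a * (f x ^ q) ^ b = f x ^ p := fun x => by
    rw [← ENNReal.rpow_natCast, ← ENNReal.rpow_mul,
      ← ENNReal.rpow_add_of_nonneg _ _ ha0 (by positivity), hpe]
  simp only [e1] at h3
  refine h3.trans ((mul_le_mul' (ENNReal.rpow_le_rpow h1 ha0)
    (ENNReal.rpow_le_rpow h2 hb0)).trans (le_of_eq ?_))
  rw [ENNReal.ofReal_rpow_of_nonneg hA ha0, ENNReal.ofReal_rpow_of_nonneg (by positivity) hb0,
    ← ENNReal.ofReal_mul (by positivity), Real.mul_rpow hB (by positivity),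
    ← Real.rpow_mul (by positivity), ← mul_assoc]
  congr 3
  rw [hb]
  field_simp

/-- Interpolation gives the rate with a constant depending on the data; the factor ‖d₀ - w₀‖_p is
produced by dividing by it. If it vanishes, the L² estimate forces d = w₀ at all later times. -/
theorem IsSolution.exists_eLpNorm_decay (hη : η ≠ 0) (hD : IsData w₀ u₀ d₀)
    (hsm : nsq (fun x => d₀ x - w₀) ≤ ENNReal.ofReal (smallness η / 2)) {p : ℝ} (hp : 1 ≤ p) :
    ∃ C : ℝ, 0 < C ∧ ∀ u π d, IsSolution η w₀ u₀ d₀ u π d → ∀ t, 0 < t →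
      eLpNorm (fun x => d t x - w₀) (ENNReal.ofReal p) volume
        ≤ ENNReal.ofReal C * eLpNorm (fun x => d₀ x - w₀) (ENNReal.ofReal p) volume
          * ENNReal.ofReal ((1 + t) ^ (-(3 / 2 : ℝ) * (1 - 1 / p))) := by
  have hp0 : 0 < p := by linarith
  have hpe : ENNReal.ofReal p ≠ 0 := by simpa using hp0
  obtain ⟨A, hA, h₁⟩ := IsSolution.exists_lintegral_norm_le hη hD hsm
  obtain ⟨k, hk⟩ := pow_unbounded_of_one_lt p (one_lt_two)
  obtain ⟨B, hB, h₂⟩ := IsSolution.exists_decay_two_pow hη hD hsm k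
  set q : ℕ := 2 ^ (k + 1) with hq
  have hq1 : 1 < q := Nat.one_lt_two_pow (by omega)
  have hpq : p ≤ q := by
    refine hk.le.trans ?_
    rw [hq]; push_cast
    exact pow_le_pow_right₀ one_le_two (by omega)
  set K : ℝ := A ^ ((q - p) / (q - 1)) * B ^ ((p - 1) / (q - 1)) with hK
  have hK0 : 0 < K := by positivity
  have key : ∀ u π d, IsSolution η w₀ u₀ d₀ u π d → ∀ t, 0 < t →
      eLpNorm (fun x => d t x - w₀) (ENNReal.ofReal p) volume
        ≤ ENNReal.ofReal (K ^ (1 / p)) * ENNReal.ofReal ((1 + t) ^ (-(3 / 2 : ℝ) * (1 - 1 / p))) := by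
    intro u π d h t ht
    have h3 := lintegral_rpow_decay_le (h.continuous_sub w₀ ht).enorm.aemeasurable hA.le hB.le ht
      hq1 hp hpq (h₁ u π d h t ht) (h₂ u π d h t ht)
    rw [eLpNorm_eq_lintegral_rpow_enorm_toReal hpe ENNReal.ofReal_ne_top,
      ENNReal.toReal_ofReal hp0.le]
    refine (ENNReal.rpow_le_rpow h3 (by positivity)).trans (le_of_eq ?_)
    rw [ENNReal.ofReal_rpow_of_nonneg (by positivity) (by positivity), ← hK,
      Real.mul_rpow hK0.le (by positivity), ← Real.rpow_mul (by positivity),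
      ENNReal.ofReal_mul (by positivity)]
    congr 3
    field_simp
  set N₀ := eLpNorm (fun x => d₀ x - w₀) (ENNReal.ofReal p) volume with hN₀
  rcases eq_or_ne N₀ 0 with h0 | h0
  · refine ⟨1, one_pos, fun u π d h t ht => ?_⟩
    have h4 := (eLpNorm_eq_zero_iff hD.d₀_mem.1 hpe).1 h0
    have h5 : nsq (fun x => d₀ x - w₀) = 0 := by
      rw [← eLpNorm_two_sq, eLpNorm_congr_ae h4]; simp
    have h6 := h.sqDist_le hη hD hsm ht.le
    rw [sqDist_of_pos ht, h5, nonpos_iff_eq_zero, ← eLpNorm_two_sq, sq_eq_zero_iff,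
      eLpNorm_eq_zero_iff (h.continuous_sub w₀ ht).aestronglyMeasurable two_ne_zero] at h6
    rw [eLpNorm_congr_ae h6]
    simp
  rcases eq_or_ne N₀ ⊤ with htop | htop
  · refine ⟨1, one_pos, fun u π d h t ht => ?_⟩
    have : ENNReal.ofReal ((1 + t) ^ (-(3 / 2 : ℝ) * (1 - 1 / p))) ≠ 0 := by
      simp only [ne_eq, ENNReal.ofReal_eq_zero, not_le]; positivity
    rw [htop, ENNReal.mul_top (by simp), ENNReal.top_mul this]
    exact le_top
  · have hN : 0 < N₀.toReal := ENNReal.toReal_pos h0 htop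
    refine ⟨K ^ (1 / p) / N₀.toReal, by positivity, fun u π d h t ht => ?_⟩
    refine (key u π d h t ht).trans (le_of_eq ?_)
    congr 1
    nth_rewrite 2 [← ENNReal.ofReal_toReal htop]
    rw [← ENNReal.ofReal_mul (by positivity)]
    congr 1
    field_simp

end Solution

end LiquidCrystal

namespace LiquidCrystal

/-! ### Orthogonality of solenoidal and gradient fields in `L²` -/

/-- The squared `L²` norm as a real number. -/
noncomputable def sqn {V : Type*} [NormedAddCommGroup V] (f : E3 → V) : ℝ := ∫ x, ‖f x‖ ^ 2

section L2

variable {V : Type*} [NormedAddCommGroup V]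

lemma sqn_nonneg (f : E3 → V) : 0 ≤ sqn f := integral_nonneg fun _ => sq_nonneg _

lemma integrable_norm_sq {f : E3 → V} (hf : AEStronglyMeasurable f volume)
    (h : ∫⁻ x, ‖f x‖ₑ ^ 2 < ⊤) : Integrable (fun x => ‖f x‖ ^ 2) volume := by
  refine ⟨hf.norm.pow 2, ?_⟩
  rw [hasFiniteIntegral_iff_ofReal (Eventually.of_forall fun x => sq_nonneg _)]
  simpa only [enorm_sq_eq_ofReal] using h

lemma ofReal_sqn {f : E3 → V} (hf : AEStronglyMeasurable f volume)
    (h : ∫⁻ x, ‖f x‖ₑ ^ 2 < ⊤) : ENNReal.ofReal (sqn f) = ∫⁻ x, ‖f x‖ₑ ^ 2 := by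
  rw [sqn, ofReal_integral_eq_lintegral_ofReal (integrable_norm_sq hf h)
    (Eventually.of_forall fun x => sq_nonneg _)]
  simp only [enorm_sq_eq_ofReal]

lemma integrable_norm_mul_norm {W : Type*} [NormedAddCommGroup W] {f : E3 → V} {g : E3 → W}
    (hf : AEStronglyMeasurable f volume) (hf2 : ∫⁻ x, ‖f x‖ₑ ^ 2 < ⊤)
    (hg : AEStronglyMeasurable g volume) (hg2 : ∫⁻ x, ‖g x‖ₑ ^ 2 < ⊤) :
    Integrable (fun x => ‖f x‖ * ‖g x‖) volume := by
  have h : Integrable (fun x => ‖f x‖ ^ 2 + ‖g x‖ ^ 2) volume :=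
    (integrable_norm_sq hf hf2).add (integrable_norm_sq hg hg2)
  refine h.mono' (hf.norm.mul hg.norm) (Eventually.of_forall fun x => ?_)
  rw [Real.norm_of_nonneg (by positivity)]
  nlinarith [sq_nonneg (‖f x‖ - ‖g x‖), sq_nonneg ‖f x‖, sq_nonneg ‖g x‖]

lemma integrable_inner_of_nsq {f g : E3 → E3} (hf : AEStronglyMeasurable f volume)
    (hf2 : nsq f < ⊤) (hg : AEStronglyMeasurable g volume) (hg2 : nsq g < ⊤) :
    Integrable (fun x => (inner ℝ (f x) (g x) : ℝ)) volume :=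
  (integrable_norm_mul_norm hf hf2 hg hg2).mono' (hf.inner hg)
    (Eventually.of_forall fun _ => norm_inner_le_norm _ _)

lemma abs_integral_inner_le {f g : E3 → E3} (hf : AEStronglyMeasurable f volume)
    (hf2 : nsq f < ⊤) (hg : AEStronglyMeasurable g volume) (hg2 : nsq g < ⊤) {θ : ℝ} (hθ : 0 < θ) :
    |∫ x, (inner ℝ (f x) (g x) : ℝ)| ≤ (θ * sqn f + θ⁻¹ * sqn g) / 2 := by
  have i1 := (integrable_norm_sq hf hf2).const_mul θ
  have i2 := (integrable_norm_sq hg hg2).const_mul θ⁻¹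
  have i3 : Integrable (fun x => (θ * ‖f x‖ ^ 2 + θ⁻¹ * ‖g x‖ ^ 2) / 2) volume :=
    (i1.add i2).div_const 2
  have h1 : ∫ x, (θ * ‖f x‖ ^ 2 + θ⁻¹ * ‖g x‖ ^ 2) / 2 = (θ * sqn f + θ⁻¹ * sqn g) / 2 := by
    rw [integral_div, integral_add i1 i2, integral_const_mul, integral_const_mul, sqn, sqn]
  rw [← h1, ← Real.norm_eq_abs]
  refine norm_integral_le_of_norm_le i3 (Eventually.of_forall fun x => ?_)
  refine (norm_inner_le_norm _ _).trans ?_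
  have h2 : θ * θ⁻¹ = 1 := mul_inv_cancel₀ hθ.ne'
  have h3 : 0 ≤ θ⁻¹ * (θ * ‖f x‖ - ‖g x‖) ^ 2 := by positivity
  have h4 : θ⁻¹ * (θ * ‖f x‖ - ‖g x‖) ^ 2
      = θ * ‖f x‖ ^ 2 * (θ * θ⁻¹) - 2 * (‖f x‖ * ‖g x‖) * (θ * θ⁻¹) + θ⁻¹ * ‖g x‖ ^ 2 := by ring
  rw [h4, h2] at h3
  linarith

end L2

lemma sum_coord_mul_fderiv {Q : E3 → ℝ} (x w : E3) :
    ∑ i, w i * fderiv ℝ Q x (e i) = fderiv ℝ Q x w := by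
  conv_rhs => rw [← sum_smul_e w]
  simp

lemma integral_cut_mul_fderiv {v : E3 → E3} (hv : ContDiff ℝ 1 v)
    (hdiv : ∀ x, divergence v x = 0) {R : ℝ} (hR : 0 < R) {Q : E3 → ℝ} (hQ : ContDiff ℝ 1 Q) :
    ∫ x, cut R x * fderiv ℝ Q x (v x) = - ∫ x, (∑ i, v x i * cut' R i x) * Q x := by
  have hχ := continuous_cut R
  have hχs := hasCompactSupport_cut hR
  have hχ' := fun i => (contDiff_cut' R i).continuous
  have hχ's := hasCompactSupport_cut' hR
  have hvc : ∀ i, Continuous (fun x => v x i) := continuous_coord hv.continuous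
  have hvd : ∀ i, Continuous (fun x => partialD i v x i) := fun i =>
    continuous_coord (continuous_partialD hv i) i
  have hQd : ∀ i, Continuous (fun x => fderiv ℝ Q x (e i)) := fun i =>
    (hQ.continuous_fderiv one_ne_zero).clm_apply continuous_const
  have B : ∀ i, ∫ x, cut R x * v x i * fderiv ℝ Q x (e i)
      = - ∫ x, (cut' R i x * v x i + cut R x * partialD i v x i) * Q x := fun i =>
    integral_mul_hasLineDerivAt (f := fun x => cut R x * v x i)
      (f' := fun x => cut' R i x * v x i + cut R x * partialD i v x i) (v := e i)
      (hχ.mul (hvc i)) (((hχ' i).mul (hvc i)).add (hχ.mul (hvd i))) hχs.mul_right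
      ((hχ's i).mul_right.add hχs.mul_right) hQ.continuous (hQd i)
      (fun x => hasLineDerivAt_mul (hasLineDerivAt_cut R i x) (hasLineDerivAt_coord hv i i x))
      (fun x => (hQ.differentiable one_ne_zero x).hasFDerivAt.hasLineDerivAt (e i))
  have i2 : ∀ i, Integrable (fun x => cut R x * v x i * fderiv ℝ Q x (e i)) volume := fun i =>
    ((hχ.mul (hvc i)).mul (hQd i)).integrable_of_hasCompactSupport hχs.mul_right.mul_right
  have i4 : ∀ i, Integrable
      (fun x => (cut' R i x * v x i + cut R x * partialD i v x i) * Q x) volume := fun i =>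
    ((((hχ' i).mul (hvc i)).add (hχ.mul (hvd i))).mul hQ.continuous).integrable_of_hasCompactSupport
      ((hχ's i).mul_right.add hχs.mul_right).mul_right
  have e1 : ∀ x, cut R x * fderiv ℝ Q x (v x)
      = ∑ i, cut R x * v x i * fderiv ℝ Q x (e i) := fun x => by
    rw [← sum_coord_mul_fderiv x (v x), Finset.mul_sum]
    simp only [mul_assoc]
  have e2 : ∀ x, (∑ i, v x i * cut' R i x) * Q x
      = ∑ i, (cut' R i x * v x i + cut R x * partialD i v x i) * Q x := fun x => by
    have h3 : ∑ i, cut R x * partialD i v x i = 0 := by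
      rw [← Finset.mul_sum]
      have := hdiv x
      unfold divergence at this
      rw [this, mul_zero]
    rw [← Finset.sum_mul, Finset.sum_add_distrib, h3]
    simp only [mul_comm (cut' R _ x), add_zero]
  simp only [e1, e2]
  rw [integral_finsetSum _ (fun i _ => i2 i), integral_finsetSum _ (fun i _ => i4 i),
    ← Finset.sum_neg_distrib]
  exact Finset.sum_congr rfl fun i _ => B i

lemma continuous_gradient {Q : E3 → ℝ} (hQ : ContDiff ℝ 1 Q) : Continuous (gradient Q) :=
  (InnerProductSpace.toDual ℝ E3).symm.continuous.comp (hQ.continuous_fderiv one_ne_zero)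

lemma fderiv_eq_inner_gradient (Q : E3 → ℝ) (x w : E3) :
    fderiv ℝ Q x w = inner ℝ (gradient Q x) w := by
  simp [gradient]

lemma abs_sum_coord_mul_cut'_le {R : ℝ} (hR : 0 < R) (w x : E3) :
    |∑ i, w i * cut' R i x| ≤ 3 * cutConst * R⁻¹ * ‖w‖ := by
  refine (Finset.abs_sum_le_sum_abs _ _).trans ?_
  calc ∑ i, |w i * cut' R i x| ≤ ∑ _i : Fin 3, ‖w‖ * (cutConst * R⁻¹) := by
        refine Finset.sum_le_sum fun i _ => ?_
        rw [abs_mul]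
        exact mul_le_mul (abs_coord_le w i) (abs_cut'_le hR i x) (abs_nonneg _) (norm_nonneg _)
    _ = _ := by rw [Finset.sum_const, Finset.card_univ, Fintype.card_fin]; simp; ring

/-- The radial average `∫_1^Λ |G(θ x)| dθ`. -/
noncomputable def radialAvg (G : E3 → E3) (Λ : ℝ) (x : E3) : ℝ :=
  ∫ θ in (1 : ℝ)..Λ, ‖G (θ • x)‖

lemma continuous_radialAvg {G : E3 → E3} (hG : Continuous G) (Λ : ℝ) :
    Continuous (radialAvg G Λ) :=
  intervalIntegral.continuous_parametric_intervalIntegral_of_continuous'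
    (f := fun x θ => ‖G (θ • x)‖) (by fun_prop) 1 Λ

/-- Cauchy-Schwarz in θ, then the change of variables x ↦ θ x, whose factor θ⁻³ is at most one for θ
≥ 1. -/
lemma nsq_radialAvg_lt_top {G : E3 → E3} (hG : Continuous G) (hG2 : nsq G < ⊤) {Λ : ℝ}
    (hΛ : 1 ≤ Λ) : ∫⁻ x, ‖radialAvg G Λ x‖ₑ ^ 2 < ⊤ := by
  have h1 : ∀ x, ‖radialAvg G Λ x‖ₑ = ∫⁻ θ in Set.Ioc 1 Λ, ‖G (θ • x)‖ₑ := fun x => by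
    have hc : Continuous fun θ : ℝ => ‖G (θ • x)‖ := by fun_prop
    rw [radialAvg, intervalIntegral.integral_of_le hΛ, Real.enorm_of_nonneg
      (integral_nonneg fun θ => norm_nonneg _), ofReal_integral_eq_lintegral_ofReal
      ((hc.integrableOn_Icc).mono_set Set.Ioc_subset_Icc_self)
      (Eventually.of_forall fun θ => norm_nonneg _)]
    simp only [ofReal_norm]
  have h2 : ∀ x, ‖radialAvg G Λ x‖ₑ ^ 2
      ≤ ENNReal.ofReal (Λ - 1) * ∫⁻ θ in Set.Ioc 1 Λ, ‖G (θ • x)‖ₑ ^ 2 := fun x => by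
    have hc : Continuous fun θ : ℝ => ‖G (θ • x)‖ₑ := by fun_prop
    have := lintegral_mul_sq_le (μ := (volume : Measure ℝ).restrict (Set.Ioc 1 Λ))
      (f := fun _ => 1) (g := fun θ => ‖G (θ • x)‖ₑ) aemeasurable_const hc.aemeasurable
    simpa [h1] using this
  refine (lintegral_mono h2).trans_lt ?_
  rw [lintegral_const_mul' _ _ ENNReal.ofReal_ne_top, lintegral_lintegral_swap]
  · refine ENNReal.mul_lt_top ENNReal.ofReal_lt_top ?_
    calc _ ≤ ∫⁻ θ in Set.Ioc 1 Λ, nsq G := by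
          refine setLIntegral_mono' measurableSet_Ioc fun θ hθ => ?_
          have hθ0 : 0 < θ := one_pos.trans hθ.1
          rw [lintegral_comp_smul_E3 (fun y => ‖G y‖ₑ ^ 2) hθ0]
          refine mul_le_of_le_one_left zero_le ?_
          rw [ENNReal.ofReal_le_one]
          exact pow_le_one₀ (by positivity) (inv_le_one_of_one_le₀ hθ.1.le)
      _ < ⊤ := by
          rw [setLIntegral_const, Real.volume_Ioc]
          exact ENNReal.mul_lt_top hG2 ENNReal.ofReal_lt_top
  · have hc : Continuous (fun q : E3 × ℝ => G (q.2 • q.1)) := by fun_prop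
    exact (hc.enorm.measurable.pow_const 2).aemeasurable

lemma abs_sub_comp_smul_le {Q : E3 → ℝ} (hQ : ContDiff ℝ 1 Q) {Λ : ℝ} (hΛ : 1 ≤ Λ) (x : E3) :
    |Q x - Q (Λ • x)| ≤ ‖x‖ * radialAvg (gradient Q) Λ x := by
  have hd : ∀ θ : ℝ, HasDerivAt (fun θ : ℝ => Q (θ • x)) (inner ℝ (gradient Q (θ • x)) x) θ :=
    fun θ => by
      rw [← fderiv_eq_inner_gradient]
      have h1 : HasDerivAt (fun θ : ℝ => θ • x) x θ := by
        simpa using (hasDerivAt_id θ).smul_const x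
      exact (hQ.differentiable one_ne_zero (θ • x)).hasFDerivAt.comp_hasDerivAt θ h1
  have hG := continuous_gradient hQ
  have hc : Continuous fun θ : ℝ => (inner ℝ (gradient Q (θ • x)) x : ℝ) := by fun_prop
  have h1 := intervalIntegral.integral_eq_sub_of_hasDerivAt (a := 1) (b := Λ)
    (fun θ _ => hd θ) (hc.intervalIntegrable _ _)
  rw [one_smul] at h1
  rw [abs_sub_comm, ← h1, radialAvg, ← intervalIntegral.integral_const_mul, ← Real.norm_eq_abs]
  refine intervalIntegral.norm_integral_le_of_norm_le hΛ (Eventually.of_forall fun θ _ => ?_) ?_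
  · refine (norm_inner_le_norm _ _).trans (le_of_eq (mul_comm _ _))
  · exact Continuous.intervalIntegrable (by fun_prop) _ _

lemma tendsto_integral_cut {f : E3 → ℝ} (hf : Integrable f volume) :
    Tendsto (fun n : ℕ => ∫ x, cut ((n : ℝ) + 1) x * f x) atTop (𝓝 (∫ x, f x)) := by
  refine tendsto_integral_of_dominated_convergence (fun x => ‖f x‖) (fun n => ?_) hf.norm
    (fun n => Eventually.of_forall fun x => ?_) (Eventually.of_forall fun x => ?_)
  · exact (continuous_cut _).aestronglyMeasurable.mul hf.1
  · rw [norm_mul, Real.norm_of_nonneg (cut_nonneg _ _)]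
    exact mul_le_of_le_one_left (norm_nonneg _) (cut_le_one _ _)
  · refine tendsto_const_nhds.congr' ?_
    obtain ⟨N, hN⟩ := exists_nat_ge ‖x‖
    filter_upwards [eventually_ge_atTop N] with n hn
    rw [cut_eq_one (by positivity), one_mul]
    have : (N : ℝ) ≤ n := by exact_mod_cast hn
    linarith

/-- A solenoidal `C¹` field in `L²` is orthogonal to gradients in `L²`. -/
theorem integral_inner_gradient_eq_zero {v : E3 → E3} (hv : ContDiff ℝ 1 v)
    (hdiv : ∀ x, divergence v x = 0) (hv2 : nsq v < ⊤) {Q : E3 → ℝ} (hQ : ContDiff ℝ 1 Q)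
    (hQ2 : nsq (gradient Q) < ⊤) : ∫ x, (inner ℝ (v x) (gradient Q x) : ℝ) = 0 := by
  have hG := continuous_gradient hQ
  have hK := cutConst_nonneg
  have hvm := hv.continuous.aestronglyMeasurable (μ := (volume : Measure E3))
  have hi : Integrable (fun x => (inner ℝ (v x) (gradient Q x) : ℝ)) volume :=
    integrable_inner_of_nsq hvm hv2 hG.aestronglyMeasurable hQ2
  -- With a cutoff of radius R the error R⁻¹ |v| |Q| is out of control, as Q may grow. The
  -- difference of Q and its dilate Q(Λ·) is at most |x| times an L² function, and |x| is
  -- compensated by R⁻¹; hence v has the same pairing with both gradients. The dilated gradient has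
  -- squared norm Λ² Λ⁻³ ‖∇Q‖² = m⁻² ‖∇Q‖², which tends to zero.
  have key : ∀ m : ℝ, 1 ≤ m → |∫ x, (inner ℝ (v x) (gradient Q x) : ℝ)|
      ≤ m⁻¹ * ((sqn v + sqn (gradient Q)) / 2) := by
    intro m hm
    have hm0 : 0 < m := by linarith
    set Λ : ℝ := m ^ 2 with hΛ
    have hΛ1 : 1 ≤ Λ := one_le_pow₀ hm
    have hΛ0 : 0 < Λ := by positivity
    set QΛ : E3 → ℝ := fun x => Q (Λ • x) with hQΛ
    have hQΛc : ContDiff ℝ 1 QΛ := hQ.comp (contDiff_const_smul Λ)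
    have hdΛ : ∀ x w, fderiv ℝ QΛ x w = Λ * inner ℝ (gradient Q (Λ • x)) w := fun x w => by
      have h1 : HasFDerivAt (fun x : E3 => Λ • x) (Λ • ContinuousLinearMap.id ℝ E3) x :=
        (hasFDerivAt_id x).const_smul Λ
      have h2 := (hQ.differentiable one_ne_zero (Λ • x)).hasFDerivAt.comp x h1
      rw [hQΛ, (show (fun x => Q (Λ • x)) = Q ∘ fun x : E3 => Λ • x from rfl), h2.fderiv]
      rw [ContinuousLinearMap.comp_apply, _root_.smul_apply,
        ContinuousLinearMap.id_apply, map_smul, fderiv_eq_inner_gradient, smul_eq_mul]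
    set GΛ : E3 → E3 := fun x => Λ • gradient Q (Λ • x) with hGΛ
    have hGΛc : Continuous GΛ := by fun_prop
    have hGΛ2 : nsq GΛ = ENNReal.ofReal m⁻¹ ^ 2 * nsq (gradient Q) := by
      have h1 : ∀ x, ‖GΛ x‖ₑ ^ 2 = ENNReal.ofReal (Λ ^ 2) * ‖gradient Q (Λ • x)‖ₑ ^ 2 := fun x => by
        rw [hGΛ]
        simp only
        rw [enorm_smul, mul_pow, Real.enorm_of_nonneg hΛ0.le, ENNReal.ofReal_pow hΛ0.le]
      simp only [nsq, h1]
      rw [lintegral_const_mul' _ _ ENNReal.ofReal_ne_top,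
        lintegral_comp_smul_E3 (fun y => ‖gradient Q y‖ₑ ^ 2) hΛ0, ← mul_assoc,
        ← ENNReal.ofReal_mul (by positivity), ← ENNReal.ofReal_pow (by positivity)]
      congr 2
      rw [hΛ]; field_simp
    have hGΛt : nsq GΛ < ⊤ := by
      rw [hGΛ2]
      exact ENNReal.mul_lt_top (ENNReal.pow_lt_top ENNReal.ofReal_lt_top) hQ2
    have hGΛs : sqn GΛ = m⁻¹ ^ 2 * sqn (gradient Q) := by
      have h1 := ofReal_sqn hGΛc.aestronglyMeasurable hGΛt
      have h2 := ofReal_sqn hG.aestronglyMeasurable hQ2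
      unfold nsq at hGΛ2
      rw [hGΛ2, ← h2, ← ENNReal.ofReal_pow (by positivity), ← ENNReal.ofReal_mul (by positivity)] at h1
      exact (ENNReal.ofReal_eq_ofReal_iff (sqn_nonneg _)
        (mul_nonneg (by positivity) (sqn_nonneg _))).1 h1
    have hiΛ : Integrable (fun x => (inner ℝ (v x) (GΛ x) : ℝ)) volume :=
      integrable_inner_of_nsq hvm hv2 hGΛc.aestronglyMeasurable hGΛt
    have hid : ∀ n : ℕ, (∫ x, cut ((n : ℝ) + 1) x * inner ℝ (v x) (gradient Q x))
        - ∫ x, cut ((n : ℝ) + 1) x * inner ℝ (v x) (GΛ x)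
        = - ∫ x, (∑ i, v x i * cut' ((n : ℝ) + 1) i x) * (Q x - Q (Λ • x)) := by
      intro n
      have hR : (0 : ℝ) < (n : ℝ) + 1 := by positivity
      have h1 := integral_cut_mul_fderiv hv hdiv hR (hQ.sub hQΛc)
      rw [← h1, ← integral_sub]
      · refine integral_congr_ae (Eventually.of_forall fun x => ?_)
        simp only
        rw [fderiv_fun_sub (hQ.differentiable one_ne_zero x) (hQΛc.differentiable one_ne_zero x),
          sub_apply, hdΛ, fderiv_eq_inner_gradient, hGΛ]
        simp only
        rw [real_inner_smul_right, real_inner_comm (v x), real_inner_comm (v x)]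
        ring
      · exact hi.bdd_mul (c := 1) (continuous_cut _).aestronglyMeasurable
          (Eventually.of_forall fun x => by
            rw [Real.norm_of_nonneg (cut_nonneg _ _)]; exact cut_le_one _ _)
      · exact hiΛ.bdd_mul (c := 1) (continuous_cut _).aestronglyMeasurable
          (Eventually.of_forall fun x => by
            rw [Real.norm_of_nonneg (cut_nonneg _ _)]; exact cut_le_one _ _)
    -- The derivative of the cutoff vanishes for |x| < n + 1, so the integrand is eventually zero at
    -- each point; it is dominated because |x| ≤ 2 (n + 1) on its support.
    have hrem : Tendsto (fun n : ℕ => ∫ x, (∑ i, v x i * cut' ((n : ℝ) + 1) i x)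
        * (Q x - Q (Λ • x))) atTop (𝓝 (∫ _x : E3, (0 : ℝ))) := by
      refine tendsto_integral_of_dominated_convergence
        (fun x => 6 * cutConst * (‖v x‖ * ‖radialAvg (gradient Q) Λ x‖)) (fun n => ?_) ?_
        (fun n => Eventually.of_forall fun x => ?_) (Eventually.of_forall fun x => ?_)
      · have h1 : Continuous fun x => (∑ i, v x i * cut' ((n : ℝ) + 1) i x) * (Q x - Q (Λ • x)) :=
          (continuous_finsetSum _ fun i _ => (continuous_coord hv.continuous i).mul
            (contDiff_cut' _ i).continuous).mul (hQ.continuous.sub hQΛc.continuous)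
        exact h1.aestronglyMeasurable
      · exact (integrable_norm_mul_norm hvm hv2 (continuous_radialAvg hG Λ).aestronglyMeasurable
          (nsq_radialAvg_lt_top hG hQ2 hΛ1)).const_mul _
      · have hR : (0 : ℝ) < (n : ℝ) + 1 := by positivity
        rw [norm_mul, Real.norm_eq_abs, Real.norm_eq_abs]
        rcases lt_or_ge (2 * ((n : ℝ) + 1)) ‖x‖ with hx | hx
        · simp only [fun i => cut'_eq_zero_of_lt hR i hx, mul_zero, Finset.sum_const_zero, abs_zero, zero_mul]
          positivity
        · have h1 := abs_sum_coord_mul_cut'_le hR (v x) x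
          have h2 := abs_sub_comp_smul_le hQ hΛ1 x
          have h3 : 0 ≤ radialAvg (gradient Q) Λ x :=
            intervalIntegral.integral_nonneg hΛ1 fun θ _ => norm_nonneg _
          have h4 : ((n : ℝ) + 1)⁻¹ * ‖x‖ ≤ 2 := by
            rw [inv_mul_le_iff₀ hR]; linarith
          rw [Real.norm_of_nonneg h3]
          calc _ ≤ (3 * cutConst * ((n : ℝ) + 1)⁻¹ * ‖v x‖)
                * (‖x‖ * radialAvg (gradient Q) Λ x) :=
                mul_le_mul h1 h2 (abs_nonneg _) (by positivity)
            _ = (((n : ℝ) + 1)⁻¹ * ‖x‖) * (3 * cutConst * (‖v x‖ * radialAvg (gradient Q) Λ x)) := by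
                ring
            _ ≤ 2 * (3 * cutConst * (‖v x‖ * radialAvg (gradient Q) Λ x)) :=
                mul_le_mul_of_nonneg_right h4 (by positivity)
            _ = _ := by ring
      · refine tendsto_const_nhds.congr' ?_
        obtain ⟨N, hN⟩ := exists_nat_ge ‖x‖
        filter_upwards [eventually_ge_atTop N] with n hn
        have h1 : (N : ℝ) ≤ n := by exact_mod_cast hn
        simp only [fun i => cut'_eq_zero_of_norm_lt (show (0 : ℝ) < (n : ℝ) + 1 by positivity) i
          (show ‖x‖ < (n : ℝ) + 1 by linarith), mul_zero, Finset.sum_const_zero, zero_mul]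
    have hlim := (tendsto_integral_cut hi).sub (tendsto_integral_cut hiΛ)
    simp only [hid] at hlim
    have hun := tendsto_nhds_unique hlim hrem.neg
    rw [integral_zero, neg_zero, sub_eq_zero] at hun
    rw [hun]
    refine (abs_integral_inner_le hvm hv2 hGΛc.aestronglyMeasurable hGΛt
      (θ := m⁻¹) (by positivity)).trans (le_of_eq ?_)
    rw [hGΛs]
    field_simp
  by_contra hne
  have hpos : 0 < |∫ x, (inner ℝ (v x) (gradient Q x) : ℝ)| := abs_pos.2 hne
  set I := |∫ x, (inner ℝ (v x) (gradient Q x) : ℝ)|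
  set S := (sqn v + sqn (gradient Q)) / 2 with hS
  have hS0 : 0 ≤ S := by have := sqn_nonneg v; have := sqn_nonneg (gradient Q); positivity
  -- For this m the bound reads S + I ≤ S, which is impossible for I > 0.
  have h1 := key (S / I + 1) (by have : 0 ≤ S / I := by positivity
                                 linarith)
  rw [inv_mul_eq_div, le_div_iff₀ (by positivity), mul_add, mul_div_cancel₀ _ hpos.ne'] at h1
  linarith

end LiquidCrystal

namespace LiquidCrystal

/-! ### The force in the momentum equation -/

/-- The convective term `u·∇u`. -/
noncomputable def advect (u f : E3 → E3) (x : E3) : E3 := fderiv ℝ f x (u x)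

/-- The vector Laplacian as a sum of second partial derivatives. -/
noncomputable def lap (f : E3 → E3) (x : E3) : E3 := ∑ i, partialD i (partialD i f) x

/-- The right-hand side `Δu - u·∇u - ∇·(∇d ⊗ ∇d)`. -/
noncomputable def force (u d : E3 → E3) (x : E3) : E3 := lap u x - advect u u x - divStress d x

lemma divStress_apply {d : E3 → E3} (hd : ContDiff ℝ 2 d) (x : E3) (j : Fin 3) :
    divStress d x j = ∑ i, (inner ℝ (partialD i (partialD i d) x) (partialD j d x)
      + inner ℝ (partialD i d x) (partialD i (partialD j d) x)) := by
  have hc : ∀ i, ContDiff ℝ 1 (partialD i d) := fun i => contDiff_partialD (n := 1) hd i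
  simp only [divStress]
  refine Finset.sum_congr rfl fun i _ => ?_
  have h1 := ((hc i).differentiable one_ne_zero x).hasFDerivAt
  have h2 := ((hc j).differentiable one_ne_zero x).hasFDerivAt
  have h3 := h1.inner ℝ h2
  have h4 : stress d i j = fun y => inner ℝ (partialD i d y) (partialD j d y) := rfl
  rw [h4, h3.fderiv]
  simp [partialD, add_comm]

lemma norm_sq_eq_sum_coord (v : E3) : ‖v‖ ^ 2 = ∑ i, v i ^ 2 := by
  rw [EuclideanSpace.norm_sq_eq]; simp

lemma sq_sum_three_le (a : Fin 3 → ℝ) : (∑ i, a i) ^ 2 ≤ 3 * ∑ i, a i ^ 2 := by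
  have := sq_sum_le_card_mul_sum_sq (s := Finset.univ) (f := a)
  simpa using this

lemma norm_sum_sq_le {V : Type*} [NormedAddCommGroup V] (a : Fin 3 → V) :
    ‖∑ i, a i‖ ^ 2 ≤ 3 * ∑ i, ‖a i‖ ^ 2 :=
  (pow_le_pow_left₀ (norm_nonneg _) (norm_sum_le _ _) 2).trans (sq_sum_three_le _)

/-- Each component is at most twice the sum of the |∂d| times the sum of the |∂²d|. The constant is
3 · 2² · 3 · 9: three components, then Cauchy-Schwarz over three first and nine second derivatives.
-/
lemma norm_divStress_sq_le {d : E3 → E3} (hd : ContDiff ℝ 2 d) (x : E3) :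
    ‖divStress d x‖ ^ 2 ≤ 324 * ∑ k, ∑ i, ∑ j,
      ‖partialD k d x‖ ^ 2 * ‖partialD i (partialD j d) x‖ ^ 2 := by
  set a : Fin 3 → ℝ := fun k => ‖partialD k d x‖ with ha
  set b : Fin 3 → Fin 3 → ℝ := fun i j => ‖partialD i (partialD j d) x‖ with hb
  have ha0 : ∀ k, 0 ≤ a k := fun k => norm_nonneg _
  have hb0 : ∀ i j, 0 ≤ b i j := fun i j => norm_nonneg _
  set S₁ := ∑ k, a k with hS₁
  set S₂ := ∑ i, ∑ j, b i j with hS₂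
  have h1 : ∀ k, a k ≤ S₁ := fun k => Finset.single_le_sum (fun k _ => ha0 k) (Finset.mem_univ k)
  have hS₁0 : 0 ≤ S₁ := Finset.sum_nonneg fun k _ => ha0 k
  have hS₂0 : 0 ≤ S₂ := Finset.sum_nonneg fun i _ => Finset.sum_nonneg fun j _ => hb0 i j
  have hrow : ∀ i j, b i j ≤ ∑ j, b i j := fun i j =>
    Finset.single_le_sum (fun j _ => hb0 i j) (Finset.mem_univ j)
  have hj : ∀ j, |divStress d x j| ≤ 2 * (S₁ * S₂) := by
    intro j
    rw [divStress_apply hd]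
    refine (Finset.abs_sum_le_sum_abs _ _).trans ?_
    have h2 : ∀ i, |(inner ℝ (partialD i (partialD i d) x) (partialD j d x)
        + inner ℝ (partialD i d x) (partialD i (partialD j d) x) : ℝ)|
        ≤ 2 * (S₁ * ∑ j, b i j) := by
      intro i
      refine (abs_add_le _ _).trans ?_
      have h3 := abs_real_inner_le_norm (partialD i (partialD i d) x) (partialD j d x)
      have h4 := abs_real_inner_le_norm (partialD i d x) (partialD i (partialD j d) x)
      have h5 : b i i * a j ≤ (∑ j, b i j) * S₁ :=
        mul_le_mul (hrow i i) (h1 j) (ha0 j) (Finset.sum_nonneg fun j _ => hb0 i j)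
      have h6 : a i * b i j ≤ S₁ * ∑ j, b i j := mul_le_mul (h1 i) (hrow i j) (hb0 i j) hS₁0
      linarith
    refine (Finset.sum_le_sum fun i _ => h2 i).trans (le_of_eq ?_)
    rw [← Finset.mul_sum, ← Finset.mul_sum]
  rw [norm_sq_eq_sum_coord]
  have h7 : ∑ j, divStress d x j ^ 2 ≤ ∑ _j : Fin 3, (2 * (S₁ * S₂)) ^ 2 :=
    Finset.sum_le_sum fun j _ => by
      rw [← sq_abs]
      exact pow_le_pow_left₀ (abs_nonneg _) (hj j) 2
  have h8 : S₁ ^ 2 ≤ 3 * ∑ k, a k ^ 2 := sq_sum_three_le a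
  have h9 : S₂ ^ 2 ≤ 9 * ∑ i, ∑ j, b i j ^ 2 := by
    refine (sq_sum_three_le fun i => ∑ j, b i j).trans ?_
    have : ∑ i, (∑ j, b i j) ^ 2 ≤ ∑ i, 3 * ∑ j, b i j ^ 2 :=
      Finset.sum_le_sum fun i _ => sq_sum_three_le _
    rw [← Finset.mul_sum] at this
    linarith
  have h10 : ∑ k, ∑ i, ∑ j, a k ^ 2 * b i j ^ 2 = (∑ k, a k ^ 2) * ∑ i, ∑ j, b i j ^ 2 := by
    rw [Finset.sum_mul]
    simp only [Finset.mul_sum]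
  simp only [Finset.sum_const, Finset.card_univ, Fintype.card_fin, nsmul_eq_mul] at h7
  have h11 : S₁ ^ 2 * S₂ ^ 2 ≤ (3 * ∑ k, a k ^ 2) * (9 * ∑ i, ∑ j, b i j ^ 2) :=
    mul_le_mul h8 h9 (sq_nonneg _)
      (mul_nonneg (by norm_num) (Finset.sum_nonneg fun k _ => sq_nonneg _))
  refine h7.trans ?_
  rw [h10]
  generalize (∑ k, a k ^ 2) = p at h11 ⊢
  generalize (∑ i, ∑ j, b i j ^ 2) = q at h11 ⊢
  push_cast
  nlinarith

lemma norm_advect_sq_le (u f : E3 → E3) (x : E3) :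
    ‖advect u f x‖ ^ 2 ≤ 3 * ∑ i, ‖u x‖ ^ 2 * ‖partialD i f x‖ ^ 2 := by
  rw [advect, fderiv_eq_sum_coord]
  refine (norm_sum_sq_le _).trans ?_
  gcongr with i
  rw [norm_smul, mul_pow]
  have := pow_le_pow_left₀ (abs_nonneg _) (abs_coord_le (u x) i) 2
  rw [Real.norm_eq_abs]
  gcongr

lemma norm_lap_sq_le (f : E3 → E3) (x : E3) :
    ‖lap f x‖ ^ 2 ≤ 3 * ∑ i, ‖partialD i (partialD i f) x‖ ^ 2 := norm_sum_sq_le _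

lemma Cts.vsum {f : Fin 3 → ℝ → E3 → E3} (hf : ∀ i, Cts (f i)) :
    Cts (fun t x => ∑ i, f i t x) :=
  continuousOn_finsetSum _ fun i _ => hf i

lemma IsC12.cts_lap {v : ℝ → E3 → E3} (h : IsC12 v) : Cts (fun t x => lap (v t) x) :=
  Cts.vsum fun i => h.cts_partialD_partialD i i

lemma IsC12.cts_advect {u v : ℝ → E3 → E3} (h : IsC12 v) (hu : Cts u) :
    Cts (fun t x => advect (u t) (v t) x) :=
  ContinuousOn.clm_apply h.cont_fderiv hu

lemma IsC12.cts_divStress {d : ℝ → E3 → E3} (h : IsC12 d) :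
    Cts (fun t x => divStress (d t) x) := by
  have h1 : Cts (fun t x => WithLp.toLp 2 fun j => ∑ i,
      ((inner ℝ (partialD i (partialD i (d t)) x) (partialD j (d t) x) : ℝ)
      + inner ℝ (partialD i (d t) x) (partialD i (partialD j (d t)) x))) := by
    refine (PiLp.continuous_toLp 2 _).comp_continuousOn (continuousOn_pi.2 fun j => ?_)
    exact Cts.sum fun i => ((h.cts_partialD_partialD i i).inner' (h.cts_partialD j)).add'
      ((h.cts_partialD i).inner' (h.cts_partialD_partialD i j))
  refine ContinuousOn.congr h1 ?_
  rintro ⟨t, x⟩ ⟨ht, -⟩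
  ext j
  exact divStress_apply (h.diff_space t ht) x j

lemma IsC12.cts_force {u d : ℝ → E3 → E3} (hu : IsC12 u) (hd : IsC12 d) :
    Cts (fun t x => force (u t) (d t) x) :=
  ContinuousOn.sub (ContinuousOn.sub hu.cts_lap (hu.cts_advect hu.cts)) hd.cts_divStress

lemma Cts.aemeasurable_nsq {F : ℝ → E3 → E3} (hF : Cts F) {s : ℝ} (hs : 0 ≤ s) (t : ℝ) :
    AEMeasurable (fun r => nsq (F r)) (volume.restrict (Set.Ioc s t)) := by
  have := aemeasurable_lintegral_cts hF.norm_sq hs t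
  simpa only [nsq, enorm_sq_eq_ofReal] using this

section Solution

variable {η : ℝ} {w₀ : E3} {u₀ d₀ : E3 → E3} {u d : ℝ → E3 → E3} {π : ℝ → E3 → ℝ}

lemma IsSolution.deriv_eq (h : IsSolution η w₀ u₀ d₀ u π d) {t : ℝ} (ht : 0 < t) (x : E3) :
    deriv (fun s => u s x) t = force (u t) (d t) x - gradient (π t) x := by
  have h1 := h.momentum t ht x
  rw [laplacian_eq_sum_partialD (h.u_reg.diff_space t ht)] at h1
  rw [force, lap, advect, sub_right_comm _ _ (divStress (d t) x), ← h1]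
  abel

lemma IsSolution.exists_u_bound (h : IsSolution η w₀ u₀ d₀ u π d) {T : ℝ} (hT : 0 < T) :
    ∃ M : ℝ, 0 ≤ M ∧ ∀ t ∈ Set.Ioo 0 T, nsq (u t) ≤ ENNReal.ofReal M ∧
      gsq (u t) ≤ ENNReal.ofReal M ∧ ∫⁻ x, ‖u t x‖ₑ ^ 6 ≤ (sobConst * ENNReal.ofReal M) ^ 3 := by
  obtain ⟨M, hM⟩ := h.u_bound T hT
  refine ⟨max M 0, le_max_right _ _, fun t ht => ?_⟩
  have hM' := (hM t ht).trans (ENNReal.ofReal_le_ofReal (le_max_left M 0))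
  have hc := h.u_reg.contDiff_one ht.1
  have h1 := (nsq_le_sobolevSq 1 (u t)).trans hM'
  have h2 := (gsq_le_sobolevSq 0 hc).trans hM'
  refine ⟨h1, h2, (LiquidCrystal.lintegral_six_le hc (h1.trans_lt ENNReal.ofReal_lt_top)).trans ?_⟩
  gcongr

lemma nsq_partialD_le_gsq (f : E3 → E3) (i : Fin 3) : nsq (partialD i f) ≤ gsq f :=
  Finset.single_le_sum (f := fun i => nsq (partialD i f)) (fun _ _ => zero_le) (Finset.mem_univ i)

lemma IsSolution.exists_hessian_bound (h : IsSolution η w₀ u₀ d₀ u π d) {T : ℝ} (hT : 0 < T) :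
    ∃ M : ℝ, 0 ≤ M ∧ ∀ t ∈ Set.Ioo 0 T, ∀ i, nsq (partialD i (d t)) ≤ ENNReal.ofReal M ∧
      gsq (partialD i (d t)) ≤ ENNReal.ofReal M ∧
      ∫⁻ x, ‖partialD i (d t) x‖ₑ ^ 6 ≤ (sobConst * ENNReal.ofReal M) ^ 3 := by
  obtain ⟨M, hM⟩ := h.d_bound T hT
  refine ⟨max M 0, le_max_right _ _, fun t ht i => ?_⟩
  have hM' := (hM t ht).trans (ENNReal.ofReal_le_ofReal (le_max_left M 0))
  have hc := h.contDiff_sub w₀ ht.1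
  have h0 := sobolevSq_partialD_le 1 (hc.of_le (by norm_num)) i
  rw [partialD_sub_const] at h0
  have hc1 : ContDiff ℝ 1 (partialD i (d t)) :=
    contDiff_partialD (n := 1) (h.d_reg.diff_space t ht.1) i
  have h1 := (nsq_le_sobolevSq 1 _).trans (h0.trans hM')
  have h2 := (gsq_le_sobolevSq 0 hc1).trans (h0.trans hM')
  refine ⟨h1, h2, (LiquidCrystal.lintegral_six_le hc1 (h1.trans_lt ENNReal.ofReal_lt_top)).trans ?_⟩
  gcongr

lemma nsq_le_sum_of_norm_sq_le {ι : Type*} [Fintype ι] {f : E3 → E3} {c : ℝ} (hc : 0 ≤ c)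
    {g : ι → E3 → ℝ} (hg : ∀ i, Continuous (g i)) (hg0 : ∀ i x, 0 ≤ g i x)
    (h : ∀ x, ‖f x‖ ^ 2 ≤ c * ∑ i, g i x) :
    nsq f ≤ ENNReal.ofReal c * ∑ i, ∫⁻ x, ENNReal.ofReal (g i x) := by
  rw [← lintegral_finsetSum _ (fun i _ => (hg i).measurable.ennreal_ofReal),
    ← lintegral_const_mul' _ _ ENNReal.ofReal_ne_top]
  refine lintegral_mono fun x => ?_
  rw [enorm_sq_eq_ofReal, ← ENNReal.ofReal_sum_of_nonneg fun i _ => hg0 i x,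
    ← ENNReal.ofReal_mul hc]
  exact ENNReal.ofReal_le_ofReal (h x)

lemma ofReal_sq_mul_sq {V W : Type*} [SeminormedAddCommGroup V] [SeminormedAddCommGroup W] (v : V)
    (w : W) : ENNReal.ofReal (‖v‖ ^ 2 * ‖w‖ ^ 2) = ‖v‖ₑ ^ 2 * ‖w‖ₑ ^ 2 := by
  rw [ENNReal.ofReal_mul (sq_nonneg _), enorm_sq_eq_ofReal, enorm_sq_eq_ofReal]

lemma nsq_advect_le {v f : E3 → E3} (hv : Continuous v) (hf : ContDiff ℝ 1 f) :
    nsq (advect v f) ≤ 3 * ∑ i, ∫⁻ x, ‖v x‖ₑ ^ 2 * ‖partialD i f x‖ₑ ^ 2 := by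
  have h := nsq_le_sum_of_norm_sq_le (f := advect v f) (c := 3) (by norm_num)
    (g := fun i x => ‖v x‖ ^ 2 * ‖partialD i f x‖ ^ 2)
    (fun i => by have := continuous_partialD hf i; fun_prop) (fun i x => by positivity)
    (norm_advect_sq_le v f)
  simpa only [ofReal_sq_mul_sq, ENNReal.ofReal_ofNat] using h

lemma nsq_divStress_le {d : E3 → E3} (hd : ContDiff ℝ 2 d) :
    nsq (divStress d) ≤ 324 * ∑ q : Fin 3 × Fin 3 × Fin 3,
      ∫⁻ x, ‖partialD q.1 d x‖ₑ ^ 2 * ‖partialD q.2.1 (partialD q.2.2 d) x‖ₑ ^ 2 := by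
  have hc : ∀ i, ContDiff ℝ 1 (partialD i d) := fun i => contDiff_partialD (n := 1) hd i
  have h := nsq_le_sum_of_norm_sq_le (f := divStress d) (c := 324) (by norm_num)
    (g := fun (q : Fin 3 × Fin 3 × Fin 3) x =>
      ‖partialD q.1 d x‖ ^ 2 * ‖partialD q.2.1 (partialD q.2.2 d) x‖ ^ 2)
    (fun q => by
      have h1 := (hc q.1).continuous
      have h2 := continuous_partialD (hc q.2.2) q.2.1
      fun_prop) (fun q x => by positivity) (fun x => by
      refine (norm_divStress_sq_le hd x).trans (le_of_eq ?_)
      simp only [Fintype.sum_prod_type])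
  simpa only [ofReal_sq_mul_sq, ENNReal.ofReal_ofNat] using h

lemma nsq_lap_le {f : E3 → E3} (hf : ContDiff ℝ 2 f) :
    nsq (lap f) ≤ 3 * ∑ i, nsq (partialD i (partialD i f)) := by
  have hc : ∀ i, ContDiff ℝ 1 (partialD i f) := fun i => contDiff_partialD (n := 1) hf i
  have h := nsq_le_sum_of_norm_sq_le (f := lap f) (c := 3) (by norm_num)
    (g := fun i x => ‖partialD i (partialD i f) x‖ ^ 2)
    (fun i => by have := continuous_partialD (hc i) i; fun_prop) (fun i x => by positivity)
    (norm_lap_sq_le f)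
  simpa only [nsq, ← enorm_sq_eq_ofReal, ENNReal.ofReal_ofNat] using h

end Solution

end LiquidCrystal

/-! ### Space-time square integrability of the forcing terms. -/

namespace LiquidCrystal

lemma setLIntegral_Ioc_lt_top_of_le {f S : ℝ → ℝ≥0∞} {t : ℝ} {K L : ℝ≥0∞} (hK : K ≠ ⊤)
    (hL : L ≠ ⊤) (h : ∀ r ∈ Set.Ioc 0 t, f r ≤ K * S r + L)
    (hS : ∫⁻ r in Set.Ioo 0 (t + 1), S r < ⊤) : ∫⁻ r in Set.Ioc 0 t, f r < ⊤ := by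
  refine (setLIntegral_mono' measurableSet_Ioc h).trans_lt ?_
  rw [lintegral_add_right _ measurable_const, lintegral_const_mul' _ _ hK, setLIntegral_const,
    Real.volume_Ioc]
  refine ENNReal.add_lt_top.2 ⟨ENNReal.mul_lt_top hK.lt_top (lt_of_le_of_lt ?_ hS),
    ENNReal.mul_lt_top hL.lt_top ENNReal.ofReal_lt_top⟩
  have hsub : Set.Ioc 0 t ⊆ Set.Ioo 0 (t + 1) := fun r hr => ⟨hr.1, by linarith [hr.2]⟩
  exact lintegral_mono' (Measure.restrict_mono hsub le_rfl) le_rfl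

section Solution

variable {η : ℝ} {w₀ : E3} {u₀ d₀ : E3 → E3} {u d : ℝ → E3 → E3} {π : ℝ → E3 → ℝ}

lemma IsSolution.nsq_hessian_le (h : IsSolution η w₀ u₀ d₀ u π d) {t : ℝ} (ht : 0 < t)
    (i j : Fin 3) : nsq (partialD i (partialD j (u t))) ≤ sobolevSq 2 (u t) :=
  (nsq_le_sobolevSq 0 _).trans ((sobolevSq_partialD_le 0
    (contDiff_partialD (n := 1) (h.u_reg.diff_space t ht) j) i).trans
    (sobolevSq_partialD_le 1 (h.u_reg.contDiff_one ht) j))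

lemma IsSolution.setLIntegral_hessian_lt_top (h : IsSolution η w₀ u₀ d₀ u π d) {t : ℝ}
    (ht : 0 < t) (i j : Fin 3) :
    ∫⁻ r in Set.Ioc 0 t, nsq (partialD i (partialD j (u r))) < ⊤ :=
  setLIntegral_Ioc_lt_top_of_le (K := 1) (L := 0) (by simp) (by simp)
    (fun r hr => by simpa using h.nsq_hessian_le hr.1 i j) (h.u_dissipation (t + 1) (by linarith))

lemma IsSolution.setLIntegral_lap_lt_top (h : IsSolution η w₀ u₀ d₀ u π d) {t : ℝ} (ht : 0 < t) :
    ∫⁻ r in Set.Ioc 0 t, nsq (lap (u r)) < ⊤ :=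
  setLIntegral_Ioc_lt_top_of_le (K := 9) (L := 0) (by simp) (by simp)
    (fun r hr => by
      refine (nsq_lap_le (h.u_reg.diff_space r hr.1)).trans ?_
      refine (mul_le_mul_right (Finset.sum_le_sum fun i _ => h.nsq_hessian_le hr.1 i i) _).trans ?_
      rw [Finset.sum_const, Finset.card_univ, Fintype.card_fin, nsmul_eq_mul, ← mul_assoc, add_zero]
      norm_num)
    (h.u_dissipation (t + 1) (by linarith))

/-- Space-time quantities controlled pointwise in time by an integrable norm are a.e. finite. -/
lemma ae_lintegral_lt_top_of_le {F : ℝ → E3 → ℝ} (hF : Cts F) {S : ℝ → ℝ≥0∞} {t : ℝ} {K : ℝ≥0∞}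
    (hK : K ≠ ⊤) (h : ∀ r ∈ Set.Ioc 0 t, ∫⁻ x, ENNReal.ofReal (F r x) ≤ K * S r + 1)
    (hS : ∫⁻ r in Set.Ioo 0 (t + 1), S r < ⊤) :
    ∀ᵐ r ∂(volume.restrict (Set.Ioc 0 t)), ∫⁻ x, ENNReal.ofReal (F r x) < ⊤ :=
  ae_lt_top' (aemeasurable_lintegral_cts hF le_rfl t)
    (setLIntegral_Ioc_lt_top_of_le hK ENNReal.one_ne_top h hS).ne

/-- The velocity and its gradient are bounded in time in L⁶ and L² respectively, and the L⁶ norm of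
the gradient is controlled by the H² norm. The squared H² norm enters the bound at most linearly,
which is what its integrability in time allows. -/
lemma IsSolution.exists_sq_mul_partialD_le (h : IsSolution η w₀ u₀ d₀ u π d) {t : ℝ} (ht : 0 < t) :
    ∃ K : ℝ≥0∞, K ≠ ⊤ ∧ ∀ r ∈ Set.Ioc 0 t, ∀ i,
      ∫⁻ x, ‖u r x‖ₑ ^ 2 * ‖partialD i (u r) x‖ₑ ^ 2 ≤ K * sobolevSq 2 (u r) + 1 := by
  obtain ⟨M, hM0, hM⟩ := h.exists_u_bound (T := t + 1) (by linarith)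
  refine ⟨(sobConst * ENNReal.ofReal M) ^ 2 * sobConst * ENNReal.ofReal M,
    ENNReal.mul_ne_top (ENNReal.mul_ne_top (ENNReal.pow_ne_top
      (ENNReal.mul_ne_top sobConst_ne_top ENNReal.ofReal_ne_top)) sobConst_ne_top)
      ENNReal.ofReal_ne_top, fun r hr i => ?_⟩
  have hc := h.u_reg.contDiff_one hr.1
  obtain ⟨h1, h2, h3⟩ := hM r ⟨hr.1, by linarith [hr.2]⟩
  have hci : ContDiff ℝ 1 (partialD i (u r)) :=
    contDiff_partialD (n := 1) (h.u_reg.diff_space r hr.1) i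
  have hn : nsq (partialD i (u r)) ≤ ENNReal.ofReal M := (nsq_partialD_le_gsq _ i).trans h2
  have h6 := LiquidCrystal.lintegral_six_le hci (hn.trans_lt ENNReal.ofReal_lt_top)
  have h7 : gsq (partialD i (u r)) ≤ sobolevSq 2 (u r) :=
    (gsq_le_sobolevSq 0 hci).trans (sobolevSq_partialD_le 1 hc i)
  have h8 := lintegral_sq_mul_sq_le_of_six (μ := volume) hc.continuous.enorm.aemeasurable
    hci.continuous.enorm.aemeasurable h3
    (h6.trans (pow_le_pow_left₀ zero_le (mul_le_mul_right h7 _) 3)) hn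
  refine (le_add_one_of_sq_le h8).trans (le_of_eq ?_)
  ring

lemma IsSolution.ae_sq_mul_partialD_lt_top (h : IsSolution η w₀ u₀ d₀ u π d) {t : ℝ} (ht : 0 < t)
    (i : Fin 3) : ∀ᵐ r ∂(volume.restrict (Set.Ioc 0 t)),
      ∫⁻ x, ‖u r x‖ₑ ^ 2 * ‖partialD i (u r) x‖ₑ ^ 2 < ⊤ := by
  obtain ⟨K, hK, hle⟩ := h.exists_sq_mul_partialD_le ht
  simp only [← ofReal_sq_mul_sq] at hle ⊢
  exact ae_lintegral_lt_top_of_le (h.u_reg.cts.norm_sq.mul' (h.u_reg.cts_partialD i).norm_sq) hK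
    (fun r hr => hle r hr i) (h.u_dissipation (t + 1) (by linarith))

lemma IsSolution.setLIntegral_advect_lt_top (h : IsSolution η w₀ u₀ d₀ u π d) {t : ℝ}
    (ht : 0 < t) : ∫⁻ r in Set.Ioc 0 t, nsq (advect (u r) (u r)) < ⊤ := by
  obtain ⟨K, hK, hle⟩ := h.exists_sq_mul_partialD_le ht
  refine setLIntegral_Ioc_lt_top_of_le (K := 9 * K) (L := 9) (ENNReal.mul_ne_top (by simp) hK)
    (by simp) (fun r hr => ?_) (h.u_dissipation (t + 1) (by linarith))
  have hc := h.u_reg.contDiff_one hr.1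
  refine (nsq_advect_le hc.continuous hc).trans ?_
  refine (mul_le_mul_right (Finset.sum_le_sum fun i _ => hle r hr i) _).trans (le_of_eq ?_)
  rw [Finset.sum_const, Finset.card_univ, Fintype.card_fin, nsmul_eq_mul]
  push_cast
  ring

lemma IsSolution.exists_partialD_sq_mul_le (h : IsSolution η w₀ u₀ d₀ u π d) {t : ℝ} (ht : 0 < t) :
    ∃ K : ℝ≥0∞, K ≠ ⊤ ∧ ∀ r ∈ Set.Ioc 0 t, ∀ q : Fin 3 × Fin 3 × Fin 3,
      ∫⁻ x, ‖partialD q.1 (d r) x‖ₑ ^ 2 * ‖partialD q.2.1 (partialD q.2.2 (d r)) x‖ₑ ^ 2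
        ≤ K * sobolevSq 3 (fun x => d r x - w₀) + 1 := by
  obtain ⟨M, hM0, hM⟩ := h.exists_hessian_bound (T := t + 1) (by linarith)
  refine ⟨(sobConst * ENNReal.ofReal M) ^ 2 * sobConst * ENNReal.ofReal M,
    ENNReal.mul_ne_top (ENNReal.mul_ne_top (ENNReal.pow_ne_top
      (ENNReal.mul_ne_top sobConst_ne_top ENNReal.ofReal_ne_top)) sobConst_ne_top)
      ENNReal.ofReal_ne_top, ?_⟩
  rintro r hr ⟨k, i, j⟩
  have hr' : r ∈ Set.Ioo 0 (t + 1) := ⟨hr.1, by linarith [hr.2]⟩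
  have hc := h.d_reg.diff_space r hr.1
  have hck : ContDiff ℝ 1 (partialD k (d r)) := contDiff_partialD (n := 1) hc k
  have hcj : ContDiff ℝ 1 (partialD j (d r)) := contDiff_partialD (n := 1) hc j
  have hcij := continuous_partialD hcj i
  -- The third derivatives of the director are only weak, hence the version of Sobolev's inequality
  -- for continuous functions.
  have h6 := lintegral_six_le_sobolevSq hcij
  have h7 : sobolevSq 1 (partialD i (partialD j (d r))) ≤ sobolevSq 3 (fun x => d r x - w₀) := by
    have h9 := sobolevSq_partialD_le 2 ((h.contDiff_sub w₀ hr.1).of_le (by norm_num)) j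
    rw [partialD_sub_const] at h9
    exact (sobolevSq_partialD_le 1 hcj i).trans h9
  have h8 := lintegral_sq_mul_sq_le_of_six (μ := volume) hck.continuous.enorm.aemeasurable
    hcij.enorm.aemeasurable (hM r hr' k).2.2
    (h6.trans (pow_le_pow_left₀ zero_le (mul_le_mul_right h7 _) 3))
    ((nsq_partialD_le_gsq _ i).trans (hM r hr' j).2.1)
  refine (le_add_one_of_sq_le h8).trans (le_of_eq ?_)
  ring

lemma IsSolution.ae_partialD_sq_mul_lt_top (h : IsSolution η w₀ u₀ d₀ u π d) {t : ℝ} (ht : 0 < t)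
    (k i j : Fin 3) : ∀ᵐ r ∂(volume.restrict (Set.Ioc 0 t)),
      ∫⁻ x, ‖partialD k (d r) x‖ₑ ^ 2 * ‖partialD i (partialD j (d r)) x‖ₑ ^ 2 < ⊤ := by
  obtain ⟨K, hK, hle⟩ := h.exists_partialD_sq_mul_le ht
  simp only [← ofReal_sq_mul_sq] at hle ⊢
  exact ae_lintegral_lt_top_of_le ((h.d_reg.cts_partialD k).norm_sq.mul'
    (h.d_reg.cts_partialD_partialD i j).norm_sq) hK (fun r hr => hle r hr (k, i, j))
    (h.d_dissipation (t + 1) (by linarith))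

lemma IsSolution.setLIntegral_divStress_lt_top (h : IsSolution η w₀ u₀ d₀ u π d) {t : ℝ}
    (ht : 0 < t) : ∫⁻ r in Set.Ioc 0 t, nsq (divStress (d r)) < ⊤ := by
  obtain ⟨K, hK, hle⟩ := h.exists_partialD_sq_mul_le ht
  refine setLIntegral_Ioc_lt_top_of_le (K := 324 * 27 * K) (L := 324 * 27)
    (ENNReal.mul_ne_top (by finiteness) hK)
    (by finiteness) (fun r hr => ?_) (h.d_dissipation (t + 1) (by linarith))
  refine (nsq_divStress_le (h.d_reg.diff_space r hr.1)).trans ?_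
  refine (mul_le_mul_right (Finset.sum_le_sum fun q _ => hle r hr q) _).trans (le_of_eq ?_)
  rw [Finset.sum_const, Finset.card_univ, Fintype.card_prod, Fintype.card_prod, Fintype.card_fin,
    nsmul_eq_mul]
  push_cast
  ring

lemma nsq_force_le {u : E3 → E3} (hu : ContDiff ℝ 2 u) (d : E3 → E3) :
    nsq (force u d) ≤ 3 * (nsq (lap u) + nsq (advect u u) + nsq (divStress d)) := by
  have hl : Continuous (lap u) := continuous_finsetSum _ fun i _ =>
    continuous_partialD (contDiff_partialD (n := 1) hu i) i
  have ha : Continuous (advect u u) := (hu.continuous_fderiv (by norm_num)).clm_apply hu.continuous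
  have m1 : AEMeasurable (fun x => ‖lap u x‖ₑ ^ 2) volume :=
    (hl.enorm.measurable.pow_const 2).aemeasurable
  have m2 : AEMeasurable (fun x => ‖lap u x‖ₑ ^ 2 + ‖advect u u x‖ₑ ^ 2) volume :=
    m1.add (ha.enorm.measurable.pow_const 2).aemeasurable
  unfold nsq
  rw [← lintegral_add_left' m1, ← lintegral_add_left' m2, ← lintegral_const_mul' _ _ (by simp)]
  refine lintegral_mono fun x => ?_
  have e3 : (3 : ℝ≥0∞) = ENNReal.ofReal 3 := by simp
  simp only [enorm_sq_eq_ofReal]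
  rw [← ENNReal.ofReal_add (by positivity) (by positivity),
    ← ENNReal.ofReal_add (by positivity) (by positivity), e3, ← ENNReal.ofReal_mul (by norm_num)]
  refine ENNReal.ofReal_le_ofReal ?_
  have h1 : ‖force u d x‖ ≤ ‖lap u x‖ + ‖advect u u x‖ + ‖divStress d x‖ :=
    (norm_sub_le _ _).trans (add_le_add (norm_sub_le _ _) le_rfl)
  refine (pow_le_pow_left₀ (norm_nonneg _) h1 2).trans ?_
  nlinarith [sq_nonneg (‖lap u x‖ - ‖advect u u x‖), sq_nonneg (‖lap u x‖ - ‖divStress d x‖),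
    sq_nonneg (‖advect u u x‖ - ‖divStress d x‖)]

lemma IsSolution.setLIntegral_force_lt_top (h : IsSolution η w₀ u₀ d₀ u π d) {t : ℝ}
    (ht : 0 < t) : ∫⁻ r in Set.Ioc 0 t, nsq (force (u r) (d r)) < ⊤ := by
  have m1 : AEMeasurable (fun r => nsq (lap (u r))) (volume.restrict (Set.Ioc 0 t)) :=
    h.u_reg.cts_lap.aemeasurable_nsq le_rfl t
  have m2 : AEMeasurable (fun r => nsq (lap (u r)) + nsq (advect (u r) (u r)))
      (volume.restrict (Set.Ioc 0 t)) :=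
    m1.add ((h.u_reg.cts_advect h.u_reg.cts).aemeasurable_nsq le_rfl t)
  refine (setLIntegral_mono' measurableSet_Ioc fun r hr =>
    nsq_force_le (h.u_reg.diff_space r hr.1) (d r)).trans_lt ?_
  rw [lintegral_const_mul' _ _ (by simp), lintegral_add_left' m2, lintegral_add_left' m1]
  refine ENNReal.mul_lt_top (by simp) (ENNReal.add_lt_top.2 ⟨ENNReal.add_lt_top.2
    ⟨h.setLIntegral_lap_lt_top ht, h.setLIntegral_advect_lt_top ht⟩,
    h.setLIntegral_divStress_lt_top ht⟩)

end Solution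

end LiquidCrystal

namespace LiquidCrystal

/-! ### Time integrals of space-time fields -/

/-- Only the gradient of Q is assumed continuous in time and space. Normalising Q by its value at
the origin gives a jointly continuous potential, recovered by integrating the gradient along rays,
and its time integral can be differentiated under the integral sign. -/
lemma exists_primitive_integral_gradient {Q : ℝ → E3 → ℝ} (hQ : ∀ r, ContDiff ℝ 1 (Q r))
    (hG : Continuous fun q : ℝ × E3 => gradient (Q q.1) q.2) (s t : ℝ) :
    ∃ P : E3 → ℝ, ContDiff ℝ 1 P ∧ ∀ x, gradient P x = ∫ r in s..t, gradient (Q r) x := by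
  have hdiff : ∀ r x, Q r x - Q r 0 = ∫ θ in (0 : ℝ)..1, inner ℝ (gradient (Q r) (θ • x)) x := by
    intro r x
    have hd : ∀ θ : ℝ, HasDerivAt (fun θ : ℝ => Q r (θ • x))
        (inner ℝ (gradient (Q r) (θ • x)) x) θ := fun θ => by
      rw [← fderiv_eq_inner_gradient]
      have h1 : HasDerivAt (fun θ : ℝ => θ • x) x θ := by
        simpa using (hasDerivAt_id θ).smul_const x
      exact ((hQ r).differentiable one_ne_zero (θ • x)).hasFDerivAt.comp_hasDerivAt θ h1
    have hc : Continuous fun θ : ℝ => (inner ℝ (gradient (Q r) (θ • x)) x : ℝ) := by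
      have : Continuous fun θ : ℝ => gradient (Q r) (θ • x) :=
        hG.comp (f := fun θ : ℝ => (r, θ • x)) (by fun_prop)
      exact this.inner continuous_const
    have := intervalIntegral.integral_eq_sub_of_hasDerivAt (fun θ _ => hd θ)
      (hc.intervalIntegrable 0 1)
    rw [this]; simp
  have hp : Continuous fun q : ℝ × E3 => Q q.1 q.2 - Q q.1 0 := by
    simp only [hdiff]
    refine intervalIntegral.continuous_parametric_intervalIntegral_of_continuous'
      (f := fun (q : ℝ × E3) (θ : ℝ) => (inner ℝ (gradient (Q q.1) (θ • q.2)) q.2 : ℝ)) ?_ 0 1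
    have h1 : Continuous fun a : (ℝ × E3) × ℝ => gradient (Q a.1.1) (a.2 • a.1.2) :=
      hG.comp (f := fun a : (ℝ × E3) × ℝ => (a.1.1, a.2 • a.1.2)) (by fun_prop)
    exact h1.inner (by fun_prop)
  have hcont : Continuous fun x => ∫ r in s..t, gradient (Q r) x :=
    intervalIntegral.continuous_parametric_intervalIntegral_of_continuous'
      (f := fun x r => gradient (Q r) x)
      (hG.comp (f := fun a : E3 × ℝ => (a.2, a.1)) (by fun_prop)) s t
  set D := (InnerProductSpace.toDual ℝ E3)
  have hder : ∀ x, HasFDerivAt (fun x => ∫ r in s..t, (Q r x - Q r 0))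
      (D (∫ r in s..t, gradient (Q r) x)) x := by
    intro x
    obtain ⟨B, hB⟩ := ((isCompact_uIcc (a := s) (b := t)).prod
      (isCompact_closedBall x 1)).exists_bound_of_continuousOn hG.continuousOn
    have hcomm : ∫ r in s..t, D (gradient (Q r) x) = D (∫ r in s..t, gradient (Q r) x) :=
      (D.toContinuousLinearEquiv.toContinuousLinearMap : E3 →L[ℝ] _).intervalIntegral_comp_comm
        ((hG.comp (f := fun r : ℝ => (r, x)) (by fun_prop)).intervalIntegrable s t)
    rw [← hcomm]
    refine intervalIntegral.hasFDerivAt_integral_of_dominated_of_fderiv_le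
      (F := fun x r => Q r x - Q r 0) (F' := fun x r => D (gradient (Q r) x)) (bound := fun _ => B)
      (Metric.ball_mem_nhds x one_pos) (Eventually.of_forall fun y => ?_) ?_ ?_ ?_ ?_ ?_
    · exact (hp.comp (f := fun r : ℝ => (r, y)) (by fun_prop)).aestronglyMeasurable
    · exact (hp.comp (f := fun r : ℝ => (r, x)) (by fun_prop)).intervalIntegrable s t
    · exact (D.continuous.comp
        (hG.comp (f := fun r : ℝ => (r, x)) (by fun_prop))).aestronglyMeasurable
    · refine Eventually.of_forall fun r hr y hy => ?_
      rw [LinearIsometryEquiv.norm_map]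
      exact hB (r, y) ⟨Set.uIoc_subset_uIcc hr, Metric.ball_subset_closedBall hy⟩
    · exact intervalIntegrable_const
    · refine Eventually.of_forall fun r hr y hy => ?_
      have h1 := ((hQ r).differentiable one_ne_zero y).hasFDerivAt
      have h2 : D (gradient (Q r) y) = fderiv ℝ (Q r) y := by simp [gradient, D]
      rw [h2]
      exact h1.sub_const _
  refine ⟨_, contDiff_one_iff_hasFDerivAt.2 ⟨_, D.continuous.comp hcont, hder⟩, fun x => ?_⟩
  rw [gradient, (hder x).fderiv]
  exact D.symm_apply_apply _

section Fubini

variable {F G : ℝ → E3 → E3} {s t : ℝ}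

lemma integrable_prod_norm_sq {V : Type*} [NormedAddCommGroup V] {F : ℝ → E3 → V} (hF : Cts F)
    (hs : 0 ≤ s) (h : ∫⁻ r in Set.Ioc s t, ∫⁻ x, ‖F r x‖ₑ ^ 2 < ⊤) :
    Integrable (fun q : ℝ × E3 => ‖F q.1 q.2‖ ^ 2)
      (((volume : Measure ℝ).restrict (Set.Ioc s t)).prod (volume : Measure E3)) := by
  have hm := hF.aestronglyMeasurable hs t
  have hm2 : AEMeasurable (fun q : ℝ × E3 => ENNReal.ofReal (‖F q.1 q.2‖ ^ 2))
      (((volume : Measure ℝ).restrict (Set.Ioc s t)).prod (volume : Measure E3)) :=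
    (hm.norm.pow 2).aemeasurable.ennreal_ofReal
  refine ⟨hm.norm.pow 2, ?_⟩
  rw [hasFiniteIntegral_iff_ofReal (Eventually.of_forall fun x => sq_nonneg _),
    lintegral_prod _ hm2]
  simpa only [enorm_sq_eq_ofReal] using h

lemma integrable_prod_norm_mul_norm {V W : Type*} [NormedAddCommGroup V] [NormedAddCommGroup W]
    {F : ℝ → E3 → V} {G : ℝ → E3 → W} (hF : Cts F) (hG : Cts G) (hs : 0 ≤ s)
    (hF2 : ∫⁻ r in Set.Ioc s t, ∫⁻ x, ‖F r x‖ₑ ^ 2 < ⊤)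
    (hG2 : ∫⁻ r in Set.Ioc s t, ∫⁻ x, ‖G r x‖ₑ ^ 2 < ⊤) :
    Integrable (fun q : ℝ × E3 => ‖F q.1 q.2‖ * ‖G q.1 q.2‖)
      (((volume : Measure ℝ).restrict (Set.Ioc s t)).prod (volume : Measure E3)) := by
  have h := (integrable_prod_norm_sq hF hs hF2).add (integrable_prod_norm_sq hG hs hG2)
  refine h.mono' ((hF.aestronglyMeasurable hs t).norm.mul (hG.aestronglyMeasurable hs t).norm)
    (Eventually.of_forall fun q => ?_)
  rw [Real.norm_of_nonneg (by positivity), Pi.add_apply]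
  nlinarith [sq_nonneg (‖F q.1 q.2‖ - ‖G q.1 q.2‖), sq_nonneg ‖F q.1 q.2‖, sq_nonneg ‖G q.1 q.2‖]

lemma integrable_prod_inner (hF : Cts F) (hG : Cts G) (hs : 0 ≤ s)
    (hF2 : ∫⁻ r in Set.Ioc s t, nsq (F r) < ⊤) (hG2 : ∫⁻ r in Set.Ioc s t, nsq (G r) < ⊤) :
    Integrable (fun q : ℝ × E3 => (inner ℝ (F q.1 q.2) (G q.1 q.2) : ℝ))
      (((volume : Measure ℝ).restrict (Set.Ioc s t)).prod (volume : Measure E3)) :=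
  (integrable_prod_norm_mul_norm hF hG hs hF2 hG2).mono'
    ((hF.aestronglyMeasurable hs t).inner (hG.aestronglyMeasurable hs t))
    (Eventually.of_forall fun _ => norm_inner_le_norm _ _)

lemma integrableOn_sqn (hF : Cts F) (hs : 0 ≤ s) (hF2 : ∫⁻ r in Set.Ioc s t, nsq (F r) < ⊤) :
    IntegrableOn (fun r => sqn (F r)) (Set.Ioc s t) :=
  (integrable_prod_norm_sq hF hs hF2).integral_prod_left

lemma integrableOn_integral_inner (hF : Cts F) (hG : Cts G) (hs : 0 ≤ s)
    (hF2 : ∫⁻ r in Set.Ioc s t, nsq (F r) < ⊤) (hG2 : ∫⁻ r in Set.Ioc s t, nsq (G r) < ⊤) :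
    IntegrableOn (fun r => ∫ x, (inner ℝ (F r x) (G r x) : ℝ)) (Set.Ioc s t) :=
  (integrable_prod_inner hF hG hs hF2 hG2).integral_prod_left

lemma ae_nsq_lt_top (hF : Cts F) (hs : 0 ≤ s) (hF2 : ∫⁻ r in Set.Ioc s t, nsq (F r) < ⊤) :
    ∀ᵐ r ∂(volume.restrict (Set.Ioc s t)), nsq (F r) < ⊤ :=
  ae_lt_top' (hF.aemeasurable_nsq hs t) hF2.ne

lemma nsq_setIntegral_le (hF : Cts F) (hs : 0 ≤ s) :
    nsq (fun x => ∫ r in Set.Ioc s t, F r x)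
      ≤ ENNReal.ofReal (t - s) * ∫⁻ r in Set.Ioc s t, nsq (F r) := by
  have hm := hF.aestronglyMeasurable hs t
  have hm2 : AEMeasurable (fun q : ℝ × E3 => ‖F q.1 q.2‖ₑ ^ 2)
      (((volume : Measure ℝ).restrict (Set.Ioc s t)).prod (volume : Measure E3)) :=
    hm.enorm.pow_const 2
  have h1 : ∀ x, ‖∫ r in Set.Ioc s t, F r x‖ₑ ^ 2
      ≤ ENNReal.ofReal (t - s) * ∫⁻ r in Set.Ioc s t, ‖F r x‖ₑ ^ 2 := fun x => by
    have h2 : AEMeasurable (fun r => ‖F r x‖ₑ) (volume.restrict (Set.Ioc s t)) :=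
      (((hF.time x).mono fun r hr => lt_of_le_of_lt hs hr.1).aestronglyMeasurable
        measurableSet_Ioc).enorm
    have h3 := lintegral_mul_sq_le (aemeasurable_const (b := (1 : ℝ≥0∞))) h2
    simp only [one_mul, one_pow, lintegral_one, Measure.restrict_apply_univ, Real.volume_Ioc] at h3
    exact (pow_le_pow_left' (enorm_integral_le_lintegral_enorm _) 2).trans h3
  refine (lintegral_mono h1).trans ?_
  rw [lintegral_const_mul' _ _ ENNReal.ofReal_ne_top]
  refine mul_le_mul_right (le_of_eq ?_) _
  exact lintegral_lintegral_swap hm2.prod_swap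

lemma Cts.intervalIntegrable {F : ℝ → E3 → E3} (hF : Cts F) {s t : ℝ} (hs : 0 < s) (hst : s ≤ t)
    (x : E3) : IntervalIntegrable (fun r => F r x) volume s t :=
  ContinuousOn.intervalIntegrable_of_Icc hst
    ((hF.time x).mono fun _ hr => lt_of_lt_of_le hs hr.1)

lemma setLIntegral_const_lt_top {c : ℝ≥0∞} (hc : c < ⊤) (s t : ℝ) :
    ∫⁻ _ in Set.Ioc s t, c < ⊤ := by
  rw [setLIntegral_const, Real.volume_Ioc]
  exact ENNReal.mul_lt_top hc ENNReal.ofReal_lt_top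

lemma integral_inner_setIntegral {v : E3 → E3} (hv : Continuous v) (hv2 : nsq v < ⊤) (hF : Cts F)
    (hs : 0 < s) (hst : s ≤ t) (hF2 : ∫⁻ r in Set.Ioc s t, nsq (F r) < ⊤) :
    ∫ x, (inner ℝ (v x) (∫ r in Set.Ioc s t, F r x) : ℝ)
      = ∫ r in Set.Ioc s t, ∫ x, (inner ℝ (v x) (F r x) : ℝ) := by
  have e3 : ∀ x, (inner ℝ (v x) (∫ r in Set.Ioc s t, F r x) : ℝ)
      = ∫ r in Set.Ioc s t, inner ℝ (v x) (F r x) := fun x => by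
    have := hF.intervalIntegrable hs hst x
    rw [intervalIntegrable_iff_integrableOn_Ioc_of_le hst] at this
    exact (integral_inner this (v x)).symm
  simp only [e3]
  exact (integral_integral_swap (integrable_prod_inner (F := fun _ => v) (Cts.of_space hv)
    hF hs.le (setLIntegral_const_lt_top hv2 s t) hF2)).symm

end Fubini

section Solution

variable {η : ℝ} {w₀ : E3} {u₀ d₀ : E3 → E3} {u d : ℝ → E3 → E3} {π : ℝ → E3 → ℝ}

lemma IsSolution.exists_pressure (h : IsSolution η w₀ u₀ d₀ u π d) {s t : ℝ} (hs : 0 < s)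
    (hst : s ≤ t) : ∃ P : E3 → ℝ, ContDiff ℝ 1 P ∧
      ∀ x, u t x - u s x = (∫ r in Set.Ioc s t, force (u r) (d r) x) - gradient P x := by
  -- The truncation in time extends the pressure to all real times without changing it on [s, t].
  obtain ⟨P, hP, hP'⟩ := exists_primitive_integral_gradient (Q := fun r => π (max r s))
    (fun r => h.π_diff _ (lt_max_of_lt_right hs))
    (h.π_cont.comp_continuous (f := fun q : ℝ × E3 => (max q.1 s, q.2)) (by fun_prop)
      fun q => ⟨lt_max_of_lt_right hs, trivial⟩) s t
  refine ⟨P, hP, fun x => ?_⟩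
  have hπ : Cts fun r x => gradient (π r) x := h.π_cont
  have hF := h.u_reg.cts_force h.d_reg
  have h1 : ∫ r in s..t, deriv (fun s => u s x) r = u t x - u s x := by
    refine intervalIntegral.integral_deriv_eq_sub (f := fun s => u s x) (fun r hr => ?_)
      (h.u_reg.cts_time.intervalIntegrable hs hst x)
    rw [Set.uIcc_of_le hst] at hr
    exact h.u_reg.diff_time r (lt_of_lt_of_le hs hr.1) x
  have h2 : ∫ r in s..t, deriv (fun s => u s x) r
      = ∫ r in s..t, (force (u r) (d r) x - gradient (π r) x) := by
    refine intervalIntegral.integral_congr fun r hr => ?_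
    rw [Set.uIcc_of_le hst] at hr
    exact h.deriv_eq (lt_of_lt_of_le hs hr.1) x
  have h3 : ∫ r in s..t, gradient (π (max r s)) x = ∫ r in s..t, gradient (π r) x := by
    refine intervalIntegral.integral_congr fun r hr => ?_
    rw [Set.uIcc_of_le hst] at hr
    simp only [max_eq_left hr.1]
  rw [← h1, h2, intervalIntegral.integral_sub (hF.intervalIntegrable hs hst x)
    (hπ.intervalIntegrable hs hst x), hP', h3, intervalIntegral.integral_of_le hst]

lemma IsSolution.nsq_lt_top (h : IsSolution η w₀ u₀ d₀ u π d) {t : ℝ} (ht : 0 < t) :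
    nsq (u t) < ⊤ := by
  obtain ⟨M, -, hM⟩ := h.exists_u_bound (T := t + 1) (by linarith)
  exact (hM t ⟨ht, by linarith⟩).1.trans_lt ENNReal.ofReal_lt_top

lemma IsSolution.setLIntegral_force_lt_top' (h : IsSolution η w₀ u₀ d₀ u π d) {s t : ℝ}
    (hs : 0 < s) (hst : s ≤ t) : ∫⁻ r in Set.Ioc s t, nsq (force (u r) (d r)) < ⊤ :=
  (lintegral_mono_set (Set.Ioc_subset_Ioc_left hs.le)).trans_lt
    (h.setLIntegral_force_lt_top (hs.trans_le hst))

/-- Testing the momentum equation with a solenoidal field removes the pressure. -/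
theorem IsSolution.integral_inner_sub (h : IsSolution η w₀ u₀ d₀ u π d) {s t : ℝ} (hs : 0 < s)
    (hst : s ≤ t) {v : E3 → E3} (hv : ContDiff ℝ 1 v) (hdiv : ∀ x, divergence v x = 0)
    (hv2 : nsq v < ⊤) :
    ∫ x, (inner ℝ (v x) (u t x - u s x) : ℝ)
      = ∫ r in Set.Ioc s t, ∫ x, (inner ℝ (v x) (force (u r) (d r) x) : ℝ) := by
  obtain ⟨P, hP, hP'⟩ := h.exists_pressure hs hst
  have hF := h.u_reg.cts_force h.d_reg
  have ht := hs.trans_le hst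
  have hF2 := h.setLIntegral_force_lt_top' hs hst
  have hvm : AEStronglyMeasurable v volume := hv.continuous.aestronglyMeasurable
  have hI : nsq (fun x => ∫ r in Set.Ioc s t, force (u r) (d r) x) < ⊤ :=
    (nsq_setIntegral_le hF hs.le).trans_lt (ENNReal.mul_lt_top ENNReal.ofReal_lt_top hF2)
  have hIm : AEStronglyMeasurable (fun x => ∫ r in Set.Ioc s t, force (u r) (d r) x) volume :=
    (hF.aestronglyMeasurable hs.le t).prod_swap.integral_prod_right'
  have hus := (h.u_reg.cts.slice hs).aestronglyMeasurable (μ := (volume : Measure E3))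
  have hut := (h.u_reg.cts.slice ht).aestronglyMeasurable (μ := (volume : Measure E3))
  have hGm := (continuous_gradient hP).aestronglyMeasurable (μ := (volume : Measure E3))
  -- No integrability of ∇π is assumed. Its time integral is a difference of L² fields by the
  -- momentum equation, hence lies in L² and is orthogonal to v.
  have hG2 : nsq (gradient P) < ⊤ := by
    have e1 : gradient P = fun x => (∫ r in Set.Ioc s t, force (u r) (d r) x)
        + (u s x + -u t x) := funext fun x => by
      have := hP' x
      rw [← sub_eq_add_neg, ← neg_sub (u t x), this]; abel
    have e2 : nsq (fun x => - u t x) = nsq (u t) := by simp [nsq]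
    rw [e1]
    refine (nsq_add_le hIm).trans_lt (ENNReal.add_lt_top.2
      ⟨ENNReal.mul_lt_top (by simp) hI, ENNReal.mul_lt_top (by simp) ?_⟩)
    refine (nsq_add_le hus).trans_lt (ENNReal.add_lt_top.2
      ⟨ENNReal.mul_lt_top (by simp) (h.nsq_lt_top hs), ENNReal.mul_lt_top (by simp) ?_⟩)
    rw [e2]; exact h.nsq_lt_top ht
  have h0 := integral_inner_gradient_eq_zero hv hdiv hv2 hP hG2
  have i1 := integrable_inner_of_nsq hvm hv2 hIm hI
  have i2 := integrable_inner_of_nsq hvm hv2 hGm hG2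
  simp only [hP', inner_sub_right]
  rw [integral_sub i1 i2, h0, sub_zero, integral_inner_setIntegral hv.continuous hv2 hF hs hst hF2]

end Solution

end LiquidCrystal

namespace LiquidCrystal

/-! ### Quadratic energies of solenoidal evolutions -/

/-- A positive symmetric contraction of `L²` which preserves smoothness and the divergence constraint. -/
structure IsFilter (K : (E3 → E3) → E3 → E3) : Prop where
  contDiff : ∀ f, ContDiff ℝ 1 f → ContDiff ℝ 1 (K f)
  nsq_le : ∀ f, Continuous f → nsq (K f) ≤ nsq f
  divergence_eq : ∀ f, ContDiff ℝ 1 f → (∀ x, divergence f x = 0) → ∀ x, divergence (K f) x = 0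
  sub : ∀ f g, Continuous f → Continuous g → ∀ x, K (fun y => f y - g y) x = K f x - K g x
  symm : ∀ f g, AEStronglyMeasurable f volume → AEStronglyMeasurable g volume → nsq f < ⊤ →
    nsq g < ⊤ → ∫ x, (inner ℝ (K f x) (g x) : ℝ) = ∫ x, (inner ℝ (f x) (K g x) : ℝ)
  aestronglyMeasurable : ∀ f, AEStronglyMeasurable f volume → nsq f < ⊤ →
    AEStronglyMeasurable (K f) volume ∧ nsq (K f) < ⊤
  nonneg : ∀ f, Continuous f → nsq f < ⊤ → 0 ≤ ∫ x, (inner ℝ (f x) (K f x) : ℝ)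

lemma isFilter_id : IsFilter id where
  contDiff _ h := h
  nsq_le _ _ := le_rfl
  divergence_eq _ _ h := h
  sub _ _ _ _ _ := rfl
  symm _ _ _ _ _ _ := rfl
  aestronglyMeasurable _ h h2 := ⟨h, h2⟩
  nonneg _ _ _ := integral_nonneg fun _ => real_inner_self_nonneg

lemma nsq_conv_moll_le_nsq {R : ℝ} (hR : 0 < R) {f : E3 → E3}
    (hf : AEStronglyMeasurable f volume) : nsq (conv (moll R) f) ≤ nsq f := by
  have := nsq_conv_le (continuous_moll R) hf
  rwa [lintegral_moll hR, one_pow, one_mul] at this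

lemma divergence_conv_moll {R : ℝ} (hR : 0 < R) {f : E3 → E3} (hf : ContDiff ℝ 1 f)
    (hdiv : ∀ x, divergence f x = 0) (x : E3) : divergence (conv (moll R) f) x = 0 := by
  have h1 : ∀ i, partialD i (conv (moll R) f) = conv (moll R) (partialD i f) := fun i => by
    rw [partialD_conv (contDiff_moll R) (hasCompactSupport_moll hR) hf.continuous.locallyIntegrable,
      conv_partial_eq (contDiff_moll R) (hasCompactSupport_moll hR) (isWeakPartial_partialD hf i)]
  have hi : ∀ i, Integrable (fun y => moll R y • partialD i f (x - y)) volume := fun i =>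
    (hasCompactSupport_moll hR).convolutionExists_left
      (ContinuousLinearMap.lsmul ℝ ℝ : ℝ →L[ℝ] E3 →L[ℝ] E3) (continuous_moll R)
      (continuous_partialD hf i).locallyIntegrable x
  have h2 : ∀ i, conv (moll R) (partialD i f) x i = ∫ y, moll R y * partialD i f (x - y) i :=
    fun i => ((EuclideanSpace.proj i : E3 →L[ℝ] ℝ).integral_comp_comm (hi i)).symm
  simp only [divergence, h1, h2]
  have h3 : ∀ i, Integrable (fun y => moll R y * partialD i f (x - y) i) volume := fun i =>
    (EuclideanSpace.proj i : E3 →L[ℝ] ℝ).integrable_comp (hi i)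
  rw [← integral_finsetSum _ fun i _ => h3 i]
  simp only [← Finset.mul_sum]
  have h4 : ∀ y, ∑ i, partialD i f (x - y) i = 0 := fun y => hdiv (x - y)
  simp [h4]

/-- The mollification A is a symmetric contraction, and its square is moreover positive: ⟨f, A²f⟩ =
‖Af‖². The identity serves the energy balance, A² the low frequencies. -/
lemma isFilter_conv_moll {R : ℝ} (hR : 0 < R) :
    IsFilter fun f => conv (moll R) (conv (moll R) f) := by
  have hk := contDiff_moll R
  have hs := hasCompactSupport_moll hR
  have hkc := continuous_moll R
  have hc : ∀ f : E3 → E3, Continuous f → ContDiff ℝ 1 (conv (moll R) f) := fun f hf =>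
    contDiff_one_of_top (contDiff_conv hk hs hf.locallyIntegrable)
  have he : ∀ y, moll R (-y) = moll R y := fun y => moll_neg y
  refine ⟨fun f hf => hc _ (hc f hf.continuous).continuous, fun f hf => ?_, fun f hf h => ?_,
    fun f g hf hg x => ?_, fun f g hf hg hf2 hg2 => ?_, fun f hf hf2 => ?_, fun f hf hf2 => ?_⟩
  · exact (nsq_conv_moll_le_nsq hR (hc f hf).continuous.aestronglyMeasurable).trans
      (nsq_conv_moll_le_nsq hR hf.aestronglyMeasurable)
  · exact divergence_conv_moll hR (hc f hf.continuous) (divergence_conv_moll hR hf h)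
  · have h1 : conv (moll R) (fun y => f y - g y) = fun x => conv (moll R) f x - conv (moll R) g x :=
      funext fun x => conv_sub hkc hs hf.locallyIntegrable hg.locallyIntegrable x
    rw [h1, conv_sub hkc hs (hc f hf).continuous.locallyIntegrable
      (hc g hg).continuous.locallyIntegrable]
  · have mf := memLp_two_iff_nsq.2 ⟨hf, hf2⟩
    have mg := memLp_two_iff_nsq.2 ⟨hg, hg2⟩
    rw [integral_inner_conv hkc hs he (memLp_conv hkc hs mf) mg,
      integral_inner_conv hkc hs he mf (memLp_conv hkc hs mg)]
  · exact memLp_two_iff_nsq.1 (memLp_conv hkc hs (memLp_conv hkc hs (memLp_two_iff_nsq.2 ⟨hf, hf2⟩)))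
  · have mf := memLp_two_iff_nsq.2 ⟨hf.aestronglyMeasurable, hf2⟩
    rw [← integral_inner_conv hkc hs he mf (memLp_conv hkc hs mf)]
    exact integral_nonneg fun _ => real_inner_self_nonneg

lemma nsq_fun_sub_lt_top {f g : E3 → E3} (hf : AEStronglyMeasurable f volume) (hf2 : nsq f < ⊤)
    (hg2 : nsq g < ⊤) : nsq (fun x => f x - g x) < ⊤ := by
  have e2 : nsq (fun x => - g x) = nsq g := by simp [nsq]
  simp only [sub_eq_add_neg]
  refine (nsq_add_le hf).trans_lt (ENNReal.add_lt_top.2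
    ⟨ENNReal.mul_lt_top (by simp) hf2, ENNReal.mul_lt_top (by simp) ?_⟩)
  rw [e2]; exact hg2

/-- Bounded sequences in `L²` converging pointwise converge weakly. -/
lemma tendsto_integral_inner_of_bounded {g f : E3 → E3} {F : ℕ → E3 → E3} {M : ℝ}
    (hg : AEStronglyMeasurable g volume) (hg2 : nsq g < ⊤) (hf : AEStronglyMeasurable f volume)
    (hfM : nsq f ≤ ENNReal.ofReal M) (hF : ∀ n, AEStronglyMeasurable (F n) volume)
    (hFM : ∀ n, nsq (F n) ≤ ENNReal.ofReal M) (hlim : ∀ x, Tendsto (F · x) atTop (𝓝 (f x))) :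
    Tendsto (fun n => ∫ x, (inner ℝ (g x) (F n x) : ℝ)) atTop
      (𝓝 (∫ x, (inner ℝ (g x) (f x) : ℝ))) := by
  have hH : ∀ n, AEStronglyMeasurable (fun x => F n x - f x) volume := fun n => (hF n).sub hf
  have hf2 := hfM.trans_lt ENNReal.ofReal_lt_top
  have hF2 := fun n => (hFM n).trans_lt ENNReal.ofReal_lt_top
  have hH2 : ∀ n, nsq (fun x => F n x - f x) < ⊤ := fun n => nsq_fun_sub_lt_top (hF n) (hF2 n) hf2
  obtain ⟨m, hm0, hHm⟩ : ∃ m : ℝ, 0 ≤ m ∧ ∀ n, sqn (fun x => F n x - f x) ≤ m := by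
    refine ⟨4 * max M 0, by positivity, fun n => ?_⟩
    rw [← ENNReal.ofReal_le_ofReal_iff (by positivity), ofReal_sqn (hH n) (hH2 n)]
    have e2 : nsq (fun x => - f x) = nsq f := by simp [nsq]
    have h1 := nsq_add_le (f := F n) (g := fun x => - f x) (hF n)
    simp only [← sub_eq_add_neg, e2] at h1
    have hM' : ENNReal.ofReal M = ENNReal.ofReal (max M 0) := by
      rw [ENNReal.ofReal_max, ENNReal.ofReal_zero, max_eq_left zero_le]
    refine h1.trans ((add_le_add (mul_le_mul_right (hFM n) _)
      (mul_le_mul_right hfM _)).trans (le_of_eq ?_))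
    rw [hM', ENNReal.ofReal_mul (by norm_num), ← add_mul]
    norm_num
  -- Truncating at K |g|² makes dominated convergence available; the part cut off is at most K⁻¹ |F
  -- n - f|², small for large K uniformly in n by the L² bound.
  have hdom : ∀ K : ℝ, 0 < K → Tendsto
      (fun n => ∫ x, min (‖g x‖ * ‖F n x - f x‖) (K * ‖g x‖ ^ 2)) atTop (𝓝 0) := by
    intro K hK
    have h := tendsto_integral_of_dominated_convergence (μ := (volume : Measure E3))
      (F := fun n x => min (‖g x‖ * ‖F n x - f x‖) (K * ‖g x‖ ^ 2)) (f := fun _ => (0 : ℝ))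
      (fun x => K * ‖g x‖ ^ 2)
      (fun n => (hg.norm.mul (hH n).norm).inf ((hg.norm.pow 2).const_mul K))
      ((integrable_norm_sq hg hg2).const_mul K)
      (fun n => Eventually.of_forall fun x => by
        rw [Real.norm_of_nonneg (le_min (by positivity) (by positivity))]
        exact min_le_right _ _)
      (Eventually.of_forall fun x => by
        have h1 : Tendsto (fun n => F n x - f x) atTop (𝓝 0) := by
          simpa using (hlim x).sub_const (f x)
        have h2 := ((h1.norm.const_mul ‖g x‖).min
          (tendsto_const_nhds (x := K * ‖g x‖ ^ 2)))
        rwa [norm_zero, mul_zero, min_eq_left (by positivity)] at h2)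
    simpa using h
  rw [Metric.tendsto_atTop]
  intro ε hε
  set K : ℝ := 2 * m / ε + 1 with hK
  have hK0 : 0 < K := by positivity
  obtain ⟨N, hN⟩ := Metric.tendsto_atTop.1 (hdom K hK0) (ε / 2) (by positivity)
  refine ⟨N, fun n hn => ?_⟩
  have i0 := integrable_norm_mul_norm hg hg2 (hH n) (hH2 n)
  have i1 : Integrable (fun x => min (‖g x‖ * ‖F n x - f x‖) (K * ‖g x‖ ^ 2)) volume :=
    i0.inf ((integrable_norm_sq hg hg2).const_mul K)
  have i2 : Integrable (fun x => K⁻¹ * ‖F n x - f x‖ ^ 2) volume :=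
    (integrable_norm_sq (hH n) (hH2 n)).const_mul _
  have hpt : ∀ x, |(inner ℝ (g x) (F n x - f x) : ℝ)|
      ≤ min (‖g x‖ * ‖F n x - f x‖) (K * ‖g x‖ ^ 2) + K⁻¹ * ‖F n x - f x‖ ^ 2 := fun x => by
    refine (abs_real_inner_le_norm _ _).trans ?_
    have hn : 0 ≤ K⁻¹ * ‖F n x - f x‖ ^ 2 := by positivity
    rcases le_total (‖g x‖ * ‖F n x - f x‖) (K * ‖g x‖ ^ 2) with hc | hc
    · rw [min_eq_left hc]; linarith
    · rw [min_eq_right hc]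
      have h3 : K * (K⁻¹ * ‖F n x - f x‖ ^ 2) = ‖F n x - f x‖ ^ 2 := by
        rw [← mul_assoc, mul_inv_cancel₀ hK0.ne', one_mul]
      refine le_of_mul_le_mul_left ?_ hK0
      rw [mul_add, h3]
      nlinarith [sq_nonneg (K * ‖g x‖ - ‖F n x - f x‖), sq_nonneg (K * ‖g x‖)]
  rw [dist_eq_norm, Real.norm_eq_abs, ← integral_sub (integrable_inner_of_nsq hg hg2 (hF n) (hF2 n))
    (integrable_inner_of_nsq hg hg2 hf hf2)]
  simp only [← inner_sub_right]
  have h1 := hN n hn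
  rw [dist_zero_right] at h1
  have h2 : ∫ x, K⁻¹ * ‖F n x - f x‖ ^ 2 ≤ K⁻¹ * m := by
    rw [integral_const_mul]
    exact mul_le_mul_of_nonneg_left (hHm n) (inv_pos.2 hK0).le
  have h3 : K⁻¹ * m < ε / 2 := by
    rw [inv_mul_lt_iff₀ hK0, hK]
    field_simp
    linarith
  calc _ ≤ ∫ x, |(inner ℝ (g x) (F n x - f x) : ℝ)| := abs_integral_le_integral_abs
    _ ≤ ∫ x, (min (‖g x‖ * ‖F n x - f x‖) (K * ‖g x‖ ^ 2) + K⁻¹ * ‖F n x - f x‖ ^ 2) :=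
        integral_mono_of_nonneg (Eventually.of_forall fun _ => abs_nonneg _) (i1.add i2)
          (Eventually.of_forall hpt)
    _ < ε := by
        rw [integral_add i1 i2]
        linarith [(le_abs_self _).trans_lt h1]

/-- Increments controlled by `∫ g(r, y) dr` on every interval `(x, y]` are controlled by the
diagonal integral. -/
lemma sub_le_setIntegral_diag {f b : ℝ → ℝ} {g : ℝ → ℝ → ℝ} {s t : ℝ} (hst : s ≤ t)
    (hb : IntegrableOn b (Set.Ioc s t))
    (hg : ∀ y ∈ Set.Icc s t, AEStronglyMeasurable (fun r => g r y) (volume.restrict (Set.Ioc s t)))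
    (hgb : ∀ᵐ r ∂(volume.restrict (Set.Ioc s t)), ∀ y ∈ Set.Icc s t, |g r y| ≤ b r)
    (hlim : ∀ᵐ r ∂(volume.restrict (Set.Ioc s t)), ∀ τ : ℕ → ℝ, (∀ n, τ n ∈ Set.Icc s t) →
      Tendsto τ atTop (𝓝 r) → Tendsto (fun n => g r (τ n)) atTop (𝓝 (g r r)))
    (h : ∀ x y, s ≤ x → x ≤ y → y ≤ t → f y - f x ≤ ∫ r in Set.Ioc x y, g r y) :
    f t - f s ≤ ∫ r in Set.Ioc s t, g r r := by
  rcases hst.eq_or_lt with rfl | hlt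
  · simp
  have hi : ∀ y ∈ Set.Icc s t, IntegrableOn (fun r => g r y) (Set.Ioc s t) := fun y hy =>
    Integrable.mono' hb (hg y hy) (hgb.mono fun r hr => hr y hy)
  set δ : ℕ → ℝ := fun n => (t - s) / ((n : ℝ) + 1) with hδ
  have hδ0 : ∀ n : ℕ, 0 < δ n := fun n => div_pos (sub_pos.2 hlt) (by positivity)
  have hδn : ∀ n : ℕ, ((n : ℝ) + 1) * δ n = t - s := fun n => mul_div_cancel₀ _ (by positivity)
  set p : ℕ → ℕ → ℝ := fun n k => s + k * δ n with hp
  -- Right endpoint of the cell (p k, p (k+1)] containing r; the ceiling fits cells that are closed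
  -- on the right. Summing the increments over the cells gives the integral of g r (τ n r), and τ n
  -- r → r.
  set τ : ℕ → ℝ → ℝ := fun n r => p n ⌈(r - s) / δ n⌉₊ with hτ
  have hmono : ∀ n k, p n k ≤ p n (k + 1) := fun n k => by
    simp only [hp]; push_cast; linarith [hδ0 n]
  have hτk : ∀ n k, ∀ r ∈ Set.Ioc (p n k) (p n (k + 1)), τ n r = p n (k + 1) := fun n k r hr => by
    have h1 : ⌈(r - s) / δ n⌉₊ = k + 1 := by
      rw [Nat.ceil_eq_iff (by omega), lt_div_iff₀ (hδ0 n), div_le_iff₀ (hδ0 n)]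
      simp only [hp] at hr
      exact ⟨by simpa using lt_sub_iff_add_lt'.2 hr.1, sub_le_iff_le_add'.2 hr.2⟩
    simp only [hτ, h1]
  have hp0 : ∀ n, p n 0 = s := fun n => by simp [hp]
  have hpn : ∀ n, p n (n + 1) = t := fun n => by simp only [hp]; push_cast; linarith [hδn n]
  have hpm : ∀ n, ∀ k ≤ n + 1, p n k ∈ Set.Icc s t := fun n k hk => by
    have h1 : (k : ℝ) ≤ (n : ℝ) + 1 := by exact_mod_cast hk
    have h2 := mul_le_mul_of_nonneg_right h1 (hδ0 n).le
    have h3 : 0 ≤ (k : ℝ) * δ n := mul_nonneg (Nat.cast_nonneg _) (hδ0 n).le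
    exact ⟨by simp only [hp]; linarith, by simp only [hp]; linarith [hδn n]⟩
  have hτ1 : ∀ n, ∀ r ∈ Set.Ioc s t, τ n r ∈ Set.Icc s t := fun n r hr => by
    refine hpm n _ (Nat.ceil_le.2 ?_)
    rw [div_le_iff₀ (hδ0 n)]
    push_cast
    linarith [hδn n, hr.2]
  have hτ2 : ∀ r ∈ Set.Ioc s t, Tendsto (fun n => τ n r) atTop (𝓝 r) := fun r hr => by
    have h0 : Tendsto δ atTop (𝓝 0) := ((tendsto_const_div_atTop_nhds_zero_nat (t - s)).comp
      (tendsto_add_atTop_nat 1)).congr fun n => by simp [hδ]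
    have hge : ∀ n, r ≤ τ n r := fun n => by
      have h1 := Nat.le_ceil ((r - s) / δ n)
      rw [div_le_iff₀ (hδ0 n)] at h1
      simp only [hτ, hp]; linarith
    have hle : ∀ n, τ n r ≤ r + δ n := fun n => by
      have h1 := Nat.ceil_lt_add_one (a := (r - s) / δ n)
        (div_nonneg (sub_nonneg.2 hr.1.le) (hδ0 n).le)
      have h2 := mul_lt_mul_of_pos_right h1 (hδ0 n)
      rw [add_mul, div_mul_cancel₀ _ (hδ0 n).ne'] at h2
      simp only [hτ, hp]; linarith
    refine tendsto_of_tendsto_of_tendsto_of_le_of_le tendsto_const_nhds ?_ hge hle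
    simpa using h0.const_add r
  have hint : ∀ n, ∀ k < n + 1,
      IntervalIntegrable (fun r => g r (τ n r)) volume (p n k) (p n (k + 1)) := fun n k hk => by
    rw [intervalIntegrable_iff_integrableOn_Ioc_of_le (hmono n k)]
    refine (((hi _ (hpm n (k + 1) hk)).mono_set (Set.Ioc_subset_Ioc (hpm n k (by omega)).1
      (hpm n (k + 1) hk).2)).congr_fun (fun r hr => ?_) measurableSet_Ioc)
    simp only [hτk n k r hr]
  have hle : ∀ n, f t - f s ≤ ∫ r in Set.Ioc s t, g r (τ n r) := fun n => by
    have h1 := Finset.sum_range_sub (fun k => f (p n k)) (n + 1)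
    have h2 := intervalIntegral.sum_integral_adjacent_intervals (hint n)
    simp only [hp0, hpn] at h1 h2
    rw [← intervalIntegral.integral_of_le hst, ← h1, ← h2]
    refine Finset.sum_le_sum fun k hk => ?_
    have hk' : k + 1 ≤ n + 1 := Finset.mem_range.1 hk
    refine (h _ _ (hpm n k (by omega)).1 (hmono n k) (hpm n (k + 1) hk').2).trans (le_of_eq ?_)
    rw [intervalIntegral.integral_of_le (hmono n k)]
    refine setIntegral_congr_fun measurableSet_Ioc fun r hr => ?_
    simp only [hτk n k r hr]
  refine ge_of_tendsto' (tendsto_integral_of_dominated_convergence b (fun n => ?_) hb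
    (fun n => ?_) ?_) hle
  · have h1 := IntervalIntegrable.trans_iterate (hint n)
    rw [hp0, hpn, intervalIntegrable_iff_integrableOn_Ioc_of_le hst] at h1
    exact h1.1
  · filter_upwards [hgb, ae_restrict_mem measurableSet_Ioc] with r hr hr'
    exact hr _ (hτ1 n r hr')
  · filter_upwards [hlim, ae_restrict_mem measurableSet_Ioc] with r hr hr'
    exact hr _ (fun n => hτ1 n r hr') (hτ2 r hr')

section Solution

variable {η : ℝ} {w₀ : E3} {u₀ d₀ : E3 → E3} {u d : ℝ → E3 → E3} {π : ℝ → E3 → ℝ}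

lemma IsSolution.contDiff_u (h : IsSolution η w₀ u₀ d₀ u π d) {t : ℝ} (ht : 0 < t) :
    ContDiff ℝ 1 (u t) := h.u_reg.contDiff_one ht

lemma IsSolution.integrableOn_sqn_force (h : IsSolution η w₀ u₀ d₀ u π d) {s t : ℝ} (hs : 0 < s)
    (hst : s ≤ t) : IntegrableOn (fun r => sqn (force (u r) (d r))) (Set.Ioc s t) :=
  integrableOn_sqn (h.u_reg.cts_force h.d_reg) hs.le (h.setLIntegral_force_lt_top' hs hst)

lemma IsSolution.integrableOn_inner_force (h : IsSolution η w₀ u₀ d₀ u π d) {s t : ℝ} (hs : 0 < s)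
    (hst : s ≤ t) {v : E3 → E3} (hv : Continuous v) (hv2 : nsq v < ⊤) :
    IntegrableOn (fun r => ∫ x, (inner ℝ (v x) (force (u r) (d r) x) : ℝ)) (Set.Ioc s t) :=
  integrableOn_integral_inner (F := fun _ => v) (Cts.of_space hv) (h.u_reg.cts_force h.d_reg) hs.le
    (setLIntegral_const_lt_top hv2 s t) (h.setLIntegral_force_lt_top' hs hst)

/-- The filtered energy `⟨u, K u⟩` evolves as if it were differentiable in time. -/
theorem IsSolution.filter_energy_le (h : IsSolution η w₀ u₀ d₀ u π d)
    {K : (E3 → E3) → E3 → E3} (hK : IsFilter K) {s t : ℝ} (hs : 0 < s) (hst : s ≤ t) :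
    (∫ x, (inner ℝ (u t x) (K (u t) x) : ℝ)) - ∫ x, (inner ℝ (u s x) (K (u s) x) : ℝ)
      ≤ ∫ r in Set.Ioc s t, 2 * ∫ x, (inner ℝ (K (u r) x) (force (u r) (d r) x) : ℝ) := by
  have hF := h.u_reg.cts_force h.d_reg
  obtain ⟨M, hM0, hM⟩ := h.exists_u_bound (T := t + 1) (by linarith)
  have hM' : ∀ y ∈ Set.Icc s t, nsq (u y) ≤ ENNReal.ofReal M := fun y hy =>
    (hM y ⟨hs.trans_le hy.1, by linarith [hy.2]⟩).1
  have uc : ∀ r, 0 < r → ContDiff ℝ 1 (u r) := fun r hr => h.contDiff_u hr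
  have u2 : ∀ r, 0 < r → nsq (u r) < ⊤ := fun r hr => h.nsq_lt_top hr
  have um := fun r (hr : 0 < r) =>
    (uc r hr).continuous.aestronglyMeasurable (μ := (volume : Measure E3))
  have kc : ∀ r, 0 < r → ContDiff ℝ 1 (K (u r)) := fun r hr => hK.contDiff _ (uc r hr)
  have k2 : ∀ r, 0 < r → nsq (K (u r)) < ⊤ := fun r hr =>
    (hK.nsq_le _ (uc r hr).continuous).trans_lt (u2 r hr)
  have km := fun r (hr : 0 < r) =>
    (kc r hr).continuous.aestronglyMeasurable (μ := (volume : Measure E3))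
  have hae := ae_nsq_lt_top hF hs.le (h.setLIntegral_force_lt_top' hs hst)
  refine sub_le_setIntegral_diag
    (f := fun t => ∫ x, (inner ℝ (u t x) (K (u t) x) : ℝ))
    (g := fun r y => 2 * ∫ x, (inner ℝ (K (u y) x) (force (u r) (d r) x) : ℝ))
    (b := fun r => M + sqn (force (u r) (d r))) hst ((integrable_const _).add
      (h.integrableOn_sqn_force hs hst)) (fun y hy => ?_) ?_ ?_ fun x y hx hxy hy => ?_
  · have hy0 := hs.trans_le hy.1
    exact ((h.integrableOn_inner_force hs hst (kc y hy0).continuous (k2 y hy0)).const_mul 2).1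
  · filter_upwards [hae, ae_restrict_mem measurableSet_Ioc] with r hr hr' y hy
    have hy0 := hs.trans_le hy.1
    have h1 := abs_integral_inner_le (km y hy0) (k2 y hy0)
      (hF.slice (hs.trans hr'.1)).aestronglyMeasurable hr one_pos
    have h2 : sqn (K (u y)) ≤ M := by
      rw [← ENNReal.ofReal_le_ofReal_iff hM0, ofReal_sqn (km y hy0) (k2 y hy0)]
      exact (hK.nsq_le _ (uc y hy0).continuous).trans (hM' y hy)
    rw [abs_mul, abs_two]
    linarith
  · filter_upwards [hae, ae_restrict_mem measurableSet_Ioc] with r hr hr' τ hτ hτr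
    have hr0 : 0 < r := hs.trans hr'.1
    have hτ0 : ∀ n, 0 < τ n := fun n => hs.trans_le (hτ n).1
    have fm := (hF.slice hr0).aestronglyMeasurable (μ := (volume : Measure E3))
    obtain ⟨km', k2'⟩ := hK.aestronglyMeasurable _ fm hr
    -- By symmetry the filter is moved onto the force, which is fixed while y varies; bounded
    -- pointwise convergence of u then gives continuity along the partition points.
    have h1 : ∀ y, 0 < y → ∫ x, (inner ℝ (K (u y) x) (force (u r) (d r) x) : ℝ)
        = ∫ x, (inner ℝ (K (force (u r) (d r)) x) (u y x) : ℝ) := fun y hy => by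
      rw [hK.symm _ _ (um y hy) fm (u2 y hy) hr]
      simp only [real_inner_comm]
    simp only [h1 _ hr0, fun n => h1 _ (hτ0 n)]
    refine (tendsto_integral_inner_of_bounded km' k2' (um r hr0) (hM' r ⟨hr'.1.le, hr'.2⟩)
      (fun n => um _ (hτ0 n)) (fun n => hM' _ (hτ n)) fun x => ?_).const_mul 2
    exact ((h.u_reg.cts.time x).continuousAt (Ioi_mem_nhds hr0)).tendsto.comp hτr
  · have hx0 : 0 < x := hs.trans_le hx
    have hy0 : 0 < y := hx0.trans_le hxy
    have hi := fun p q (hp : 0 < p) (hq : 0 < q) =>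
      integrable_inner_of_nsq (km p hp) (k2 p hp) (um q hq) (u2 q hq)
    have e1 := h.integral_inner_sub hx0 hxy (kc y hy0)
      (hK.divergence_eq _ (uc y hy0) (h.incompressible y hy0)) (k2 y hy0)
    simp only [inner_sub_right] at e1
    rw [integral_sub (hi y y hy0 hy0) (hi y x hy0 hx0)] at e1
    rw [integral_const_mul, ← e1]
    have hd : Continuous fun z => u y z - u x z := (uc y hy0).continuous.sub (uc x hx0).continuous
    -- Positivity on the increment is the convexity inequality ⟨u_y, K u_y⟩ - ⟨u_x, K u_x⟩ ≤ 2 ⟨K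
    -- u_y, u_y - u_x⟩, whose right side is known from testing the momentum equation with the
    -- solenoidal field K u_y.
    have e2 := hK.nonneg _ hd (nsq_fun_sub_lt_top (um y hy0) (u2 y hy0) (u2 x hx0))
    simp only [hK.sub _ _ (uc y hy0).continuous (uc x hx0).continuous, inner_sub_left,
      inner_sub_right] at e2
    have c1 : ∀ p q, ∫ x, (inner ℝ (u p x) (K (u q) x) : ℝ)
        = ∫ x, (inner ℝ (K (u q) x) (u p x) : ℝ) := fun p q => by simp only [real_inner_comm]
    have hj := fun p q (hp : 0 < p) (hq : 0 < q) =>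
      integrable_inner_of_nsq (um p hp) (u2 p hp) (km q hq) (k2 q hq)
    have i1 : Integrable (fun z => (inner ℝ (u y z) (K (u y) z) : ℝ) - inner ℝ (u y z) (K (u x) z))
        volume := (hj y y hy0 hy0).sub (hj y x hy0 hx0)
    have i2 : Integrable (fun z => (inner ℝ (u x z) (K (u y) z) : ℝ) - inner ℝ (u x z) (K (u x) z))
        volume := (hj x y hx0 hy0).sub (hj x x hx0 hx0)
    have c2 := hK.symm _ _ (um x hx0) (um y hy0) (u2 x hx0) (u2 y hy0)
    have e3 : 0 ≤ (∫ z, (inner ℝ (u y z) (K (u y) z) : ℝ)) - (∫ z, (inner ℝ (u y z) (K (u x) z) : ℝ))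
        - ((∫ z, (inner ℝ (u x z) (K (u y) z) : ℝ)) - ∫ z, (inner ℝ (u x z) (K (u x) z) : ℝ)) := by
      rw [← integral_sub (hj y y hy0 hy0) (hj y x hy0 hx0),
        ← integral_sub (hj x y hx0 hy0) (hj x x hx0 hx0), ← integral_sub i1 i2]
      refine e2.trans (le_of_eq (integral_congr_ae (Eventually.of_forall fun z => ?_)))
      ring
    rw [c1 y x, c2] at e3
    simp only [← c1]
    linarith

end Solution

end LiquidCrystal

namespace LiquidCrystal

/-! ### Integration by parts in space -/

lemma integral_inner_partialD {f g : E3 → E3} (hf : ContDiff ℝ 1 f) (hg : ContDiff ℝ 1 g)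
    (i : Fin 3) (hf2 : nsq f < ⊤) (hf'2 : nsq (partialD i f) < ⊤) (hg2 : nsq g < ⊤)
    (hg'2 : nsq (partialD i g) < ⊤) :
    ∫ x, (inner ℝ (partialD i f x) (g x) : ℝ) = - ∫ x, (inner ℝ (f x) (partialD i g x) : ℝ) := by
  have mf := hf.continuous.aestronglyMeasurable (μ := (volume : Measure E3))
  have mg := hg.continuous.aestronglyMeasurable (μ := (volume : Measure E3))
  have mf' := (continuous_partialD hf i).aestronglyMeasurable (μ := (volume : Measure E3))
  have mg' := (continuous_partialD hg i).aestronglyMeasurable (μ := (volume : Measure E3))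
  have h := integral_bilinear_hasLineDerivAt_right_eq_neg_left_of_integrable (μ := volume)
    (B := innerSL ℝ (E := E3)) (f := f) (f' := partialD i f) (g := g) (g' := partialD i g)
    (v := e i) (integrable_inner_of_nsq mf' hf'2 mg hg2) (integrable_inner_of_nsq mf hf2 mg' hg'2)
    (integrable_inner_of_nsq mf hf2 mg hg2) (fun x _ => hasLineDerivAt_partialD hf i x)
    (fun x _ => hasLineDerivAt_partialD hg i x)
  exact neg_eq_iff_eq_neg.1 h.symm

lemma integral_inner_lap {f g : E3 → E3} (hf : ContDiff ℝ 2 f) (hg : ContDiff ℝ 1 g)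
    (hf2 : ∀ i, nsq (partialD i f) < ⊤) (hf'2 : ∀ i, nsq (partialD i (partialD i f)) < ⊤)
    (hg2 : nsq g < ⊤) (hg'2 : ∀ i, nsq (partialD i g) < ⊤) :
    ∫ x, (inner ℝ (lap f x) (g x) : ℝ)
      = - ∑ i, ∫ x, (inner ℝ (partialD i f x) (partialD i g x) : ℝ) := by
  have hc : ∀ i, ContDiff ℝ 1 (partialD i f) := fun i => contDiff_partialD (n := 1) hf i
  have mg := hg.continuous.aestronglyMeasurable (μ := (volume : Measure E3))
  simp only [lap, sum_inner]
  rw [integral_finsetSum _ fun i _ => integrable_inner_of_nsq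
    (continuous_partialD (hc i) i).aestronglyMeasurable (hf'2 i) mg hg2, ← Finset.sum_neg_distrib]
  exact Finset.sum_congr rfl fun i _ =>
    integral_inner_partialD (hc i) hg i (hf2 i) (hf'2 i) hg2 (hg'2 i)

lemma integral_fderiv_apply_eq_zero {v : E3 → E3} (hv : ContDiff ℝ 1 v)
    (hdiv : ∀ x, divergence v x = 0) (hv2 : nsq v < ⊤) {Q : E3 → ℝ} (hQ : ContDiff ℝ 1 Q)
    (hQ2 : ∀ i, ∫⁻ x, ‖fderiv ℝ Q x (e i)‖ₑ ^ 2 < ⊤) : ∫ x, fderiv ℝ Q x (v x) = 0 := by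
  have hG : nsq (gradient Q) < ⊤ := by
    have hc : ∀ i, Continuous fun x => fderiv ℝ Q x (e i) := fun i =>
      (hQ.continuous_fderiv one_ne_zero).clm_apply continuous_const
    refine (nsq_le_sum_of_norm_sq_le (c := 1) zero_le_one (g := fun i x => fderiv ℝ Q x (e i) ^ 2)
      (fun i => (hc i).pow 2) (fun i x => sq_nonneg _) fun x => ?_).trans_lt ?_
    · rw [norm_sq_eq_sum_coord, one_mul]
      refine Finset.sum_le_sum fun i _ => le_of_eq ?_
      rw [fderiv_eq_inner_gradient, e, EuclideanSpace.inner_single_right]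
      simp
    · refine ENNReal.mul_lt_top ENNReal.ofReal_lt_top (ENNReal.sum_lt_top.2 fun i _ => ?_)
      have := hQ2 i
      simp only [enorm_sq_eq_ofReal, Real.norm_eq_abs, sq_abs] at this
      exact this
  have h := integral_inner_gradient_eq_zero hv hdiv hv2 hQ hG
  simpa only [fderiv_eq_inner_gradient, real_inner_comm] using h

lemma enorm_inner_sq_le (v w : E3) : ‖(inner ℝ v w : ℝ)‖ₑ ^ 2 ≤ ‖v‖ₑ ^ 2 * ‖w‖ₑ ^ 2 := by
  rw [← ofReal_sq_mul_sq, enorm_sq_eq_ofReal, ← mul_pow]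
  exact ENNReal.ofReal_le_ofReal (pow_le_pow_left₀ (norm_nonneg _) (norm_inner_le_norm v w) 2)

lemma enorm_inner_add_inner_sq_le (a b c d : E3) :
    ‖(inner ℝ a b : ℝ) + inner ℝ c d‖ₑ ^ 2
      ≤ 2 * (‖a‖ₑ ^ 2 * ‖b‖ₑ ^ 2) + 2 * (‖c‖ₑ ^ 2 * ‖d‖ₑ ^ 2) := by
  have h1 := mul_le_mul_right (enorm_inner_sq_le a b) 2
  have h2 := mul_le_mul_right (enorm_inner_sq_le c d) 2
  exact (enorm_add_sq_le _ _).trans (add_le_add h1 h2)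

/-- Solenoidal transport is orthogonal to functions of the transported field. -/
lemma integral_inner_advect_eq_zero {v f g : E3 → E3} (hv : ContDiff ℝ 1 v)
    (hdiv : ∀ x, divergence v x = 0) (hv2 : nsq v < ⊤) {Q : E3 → ℝ} (hQ : ContDiff ℝ 1 Q)
    (hfg : ∀ x w, fderiv ℝ Q x w = inner ℝ (g x) (fderiv ℝ f x w))
    (h2 : ∀ i, ∫⁻ x, ‖g x‖ₑ ^ 2 * ‖partialD i f x‖ₑ ^ 2 < ⊤) :
    ∫ x, (inner ℝ (g x) (advect v f x) : ℝ) = 0 := by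
  have h := integral_fderiv_apply_eq_zero hv hdiv hv2 hQ fun i => ?_
  · simp only [hfg] at h
    exact h
  · simp only [hfg]
    exact (lintegral_mono fun x => enorm_inner_sq_le _ _).trans_lt (h2 i)

lemma integral_inner_self_advect_eq_zero {v f : E3 → E3} (hv : ContDiff ℝ 1 v)
    (hdiv : ∀ x, divergence v x = 0) (hv2 : nsq v < ⊤) (hf : ContDiff ℝ 1 f)
    (h2 : ∀ i, ∫⁻ x, ‖f x‖ₑ ^ 2 * ‖partialD i f x‖ₑ ^ 2 < ⊤) :
    ∫ x, (inner ℝ (f x) (advect v f x) : ℝ) = 0 := by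
  refine integral_inner_advect_eq_zero hv hdiv hv2 (Q := fun x => 1 / 2 * ‖f x‖ ^ 2)
    (contDiff_const.mul (hf.norm_sq ℝ)) (fun x w => ?_) h2
  have h1 := (((hf.differentiable one_ne_zero x).hasFDerivAt).norm_sq).const_mul (1 / 2 : ℝ)
  rw [h1.fderiv]
  simp

/-- The last sum is w·∇(|∇d|²/2), which behaves like a pressure for solenoidal w. What remains is
the coupling Δd·(w·∇)d, also present in the director balance. -/
lemma divStress_inner {d : E3 → E3} (hd : ContDiff ℝ 2 d) (w : E3 → E3) (x : E3) :
    (inner ℝ (divStress d x) (w x) : ℝ) = inner ℝ (lap d x) (advect w d x)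
      + ∑ i, inner ℝ (partialD i d x) (advect w (partialD i d) x) := by
  have h1 : (inner ℝ (divStress d x) (w x) : ℝ) = ∑ j, w x j * divStress d x j := by
    simp [PiLp.inner_apply]
  rw [h1]
  simp only [divStress_apply hd, advect, fderiv_eq_sum_coord (f := d) x,
    fun i => fderiv_eq_sum_coord (f := partialD i d) x, lap, sum_inner, inner_sum,
    inner_smul_right, Finset.mul_sum, mul_add, Finset.sum_add_distrib,
    fun i j => partialD_comm hd i j x]
  rw [Finset.sum_comm]
  congr 1
  rw [Finset.sum_comm]
  exact Finset.sum_congr rfl fun i _ => Finset.sum_congr rfl fun j _ => by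
    rw [partialD_comm hd i j]

/-- Bounded solenoidal fields with gradient bounded by `L`. -/
structure IsTestField (w : E3 → E3) (L : ℝ) : Prop where
  contDiff : ContDiff ℝ 1 w
  nsq_lt : nsq w < ⊤
  bounded : ∃ B : ℝ, ∀ x, ‖w x‖ ≤ B
  partialD_le : ∀ i x, ‖partialD i w x‖ ≤ L

lemma lintegral_sq_mul_sq_lt_top {f g : E3 → E3} {B : ℝ} (hf : ∀ x, ‖f x‖ ≤ B) (hg : nsq g < ⊤) :
    ∫⁻ x, ‖f x‖ₑ ^ 2 * ‖g x‖ₑ ^ 2 < ⊤ := by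
  have hB : ∀ x, ‖f x‖ₑ ^ 2 * ‖g x‖ₑ ^ 2 ≤ ENNReal.ofReal (B ^ 2) * ‖g x‖ₑ ^ 2 := fun x => by
    rw [enorm_sq_eq_ofReal (f x)]
    gcongr
    exact hf x
  refine (lintegral_mono hB).trans_lt ?_
  rw [lintegral_const_mul' _ _ ENNReal.ofReal_ne_top]
  exact ENNReal.mul_lt_top ENNReal.ofReal_lt_top hg

lemma norm_advect_le (v f : E3 → E3) (x : E3) :
    ‖advect v f x‖ ≤ ‖v x‖ * ∑ i, ‖partialD i f x‖ := by
  rw [advect, fderiv_eq_sum_coord, Finset.mul_sum]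
  refine (norm_sum_le _ _).trans (Finset.sum_le_sum fun i _ => ?_)
  rw [norm_smul]
  exact mul_le_mul_of_nonneg_right (abs_coord_le _ i) (norm_nonneg _)

/-- As u is solenoidal, the derivative moves onto the test field: ⟨w, u·∇u⟩ = -⟨u·∇w, u⟩. Only ‖u‖₂²
and the gradient bound of w remain; the 3 counts the partial derivatives. -/
lemma IsTestField.abs_integral_inner_advect_le {w u : E3 → E3} {L : ℝ} (hw : IsTestField w L)
    (hu : ContDiff ℝ 1 u) (hdiv : ∀ x, divergence u x = 0) (hu2 : nsq u < ⊤)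
    (hu'2 : ∀ i, nsq (partialD i u) < ⊤) :
    |∫ x, (inner ℝ (w x) (advect u u x) : ℝ)| ≤ 3 * L * sqn u := by
  obtain ⟨B, hB⟩ := hw.bounded
  have hwd := hw.contDiff.differentiable one_ne_zero
  have hud := hu.differentiable one_ne_zero
  have hL := fun i x => hw.partialD_le i x
  have hQ : ∀ x v, fderiv ℝ (fun y => (inner ℝ (w y) (u y) : ℝ)) x v
      = inner ℝ (w x) (fderiv ℝ u x v) + inner ℝ (fderiv ℝ w x v) (u x) := fun x v =>
    fderiv_inner_apply ℝ (hwd x) (hud x) v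
  have h0 := integral_fderiv_apply_eq_zero hu hdiv hu2 (hw.contDiff.inner ℝ hu) fun i => by
    simp only [hQ]
    have hle : ∀ x, ‖(inner ℝ (w x) (fderiv ℝ u x (e i)) : ℝ)
        + inner ℝ (fderiv ℝ w x (e i)) (u x)‖ₑ ^ 2
        ≤ 2 * (‖w x‖ₑ ^ 2 * ‖partialD i u x‖ₑ ^ 2) + 2 * (‖partialD i w x‖ₑ ^ 2 * ‖u x‖ₑ ^ 2) :=
      fun x => enorm_inner_add_inner_sq_le (w x) (partialD i u x) (partialD i w x) (u x)
    refine (lintegral_mono hle).trans_lt ?_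
    have hm : Measurable fun x => 2 * (‖w x‖ₑ ^ 2 * ‖partialD i u x‖ₑ ^ 2) :=
      (((hw.contDiff.continuous.enorm.measurable.pow_const 2).mul
        ((continuous_partialD hu i).enorm.measurable.pow_const 2))).const_mul 2
    rw [lintegral_add_left hm, lintegral_const_mul' _ _ (by simp), lintegral_const_mul' _ _ (by simp)]
    exact ENNReal.add_lt_top.2 ⟨ENNReal.mul_lt_top (by simp) (lintegral_sq_mul_sq_lt_top hB (hu'2 i)),
      ENNReal.mul_lt_top (by simp) (lintegral_sq_mul_sq_lt_top (hL i) hu2)⟩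
  simp only [hQ] at h0
  have hadv : Continuous (advect u u) := (hu.continuous_fderiv one_ne_zero).clm_apply hu.continuous
  have mu := hu.continuous.aestronglyMeasurable (μ := (volume : Measure E3))
  have i2 : Integrable (fun x => 3 * L * ‖u x‖ ^ 2) volume := (integrable_norm_sq mu hu2).const_mul _
  have hb : ∀ x, ‖(inner ℝ (fderiv ℝ w x (u x)) (u x) : ℝ)‖ ≤ 3 * L * ‖u x‖ ^ 2 := fun x => by
    refine (norm_inner_le_norm _ _).trans ?_
    have h1 := norm_advect_le u w x
    have h2 : ∑ i, ‖partialD i w x‖ ≤ 3 * L := by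
      refine (Finset.sum_le_sum fun i _ => hL i x).trans (le_of_eq ?_)
      simp
    have h3 := mul_le_mul_of_nonneg_left h2 (norm_nonneg (u x))
    have h4 := mul_le_mul_of_nonneg_right (h1.trans h3) (norm_nonneg (u x))
    rw [advect] at h4
    linarith
  have i1 : Integrable (fun x => (inner ℝ (fderiv ℝ w x (u x)) (u x) : ℝ)) volume :=
    i2.mono' (((hw.contDiff.continuous_fderiv one_ne_zero).clm_apply hu.continuous).inner
      hu.continuous).aestronglyMeasurable (Eventually.of_forall hb)
  have i3 : Integrable (fun x => (inner ℝ (w x) (fderiv ℝ u x (u x)) : ℝ)) volume := by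
    have hs : Integrable (fun x => B * ∑ i, ‖u x‖ * ‖partialD i u x‖) volume :=
      (integrable_finsetSum _ fun i _ => integrable_norm_mul_norm mu hu2
        (continuous_partialD hu i).aestronglyMeasurable (hu'2 i)).const_mul B
    refine hs.mono' (hw.contDiff.continuous.inner hadv).aestronglyMeasurable
      (Eventually.of_forall fun x => (norm_inner_le_norm _ _).trans ?_)
    rw [← Finset.mul_sum]
    exact mul_le_mul (hB x) (norm_advect_le u u x) (norm_nonneg _) ((norm_nonneg _).trans (hB x))
  rw [integral_add i3 i1] at h0
  have h5 : ∫ x, (inner ℝ (w x) (advect u u x) : ℝ)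
      = - ∫ x, (inner ℝ (fderiv ℝ w x (u x)) (u x) : ℝ) := eq_neg_of_add_eq_zero_left h0
  rw [h5, abs_neg, sqn, ← integral_const_mul]
  exact (abs_integral_le_integral_abs).trans (integral_mono i1.norm i2 hb)

lemma contDiff_advect {w d : E3 → E3} (hw : ContDiff ℝ 1 w) (hd : ContDiff ℝ 2 d) :
    ContDiff ℝ 1 (advect w d) := (hd.fderiv_right (m := 1) (by norm_num)).clm_apply hw

lemma partialD_advect {w d : E3 → E3} (hw : ContDiff ℝ 1 w) (hd : ContDiff ℝ 2 d) (i : Fin 3)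
    (x : E3) : partialD i (advect w d) x
      = advect (partialD i w) d x + advect w (partialD i d) x := by
  have h : DifferentiableAt ℝ (fderiv ℝ d) x :=
    ((hd.fderiv_right (m := 1) (by norm_num)).differentiable one_ne_zero) x
  have h1 : advect w (partialD i d) x = fderiv ℝ (fderiv ℝ d) x (w x) (e i) := by
    unfold advect partialD
    rw [fderiv_clm_apply h (differentiableAt_const _)]
    simp
  rw [h1, (hd.contDiffAt.isSymmSndFDerivAt (by simp)) (w x) (e i)]
  unfold partialD advect
  rw [fderiv_clm_apply h (hw.differentiable one_ne_zero x)]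
  simp

lemma nsq_advect_lt_top {v f : E3 → E3} {B : ℝ} (hv : Continuous v) (hB : ∀ x, ‖v x‖ ≤ B)
    (hf : ContDiff ℝ 1 f) (hf2 : ∀ i, nsq (partialD i f) < ⊤) : nsq (advect v f) < ⊤ :=
  (nsq_advect_le hv hf).trans_lt (ENNReal.mul_lt_top (by simp)
    (ENNReal.sum_lt_top.2 fun i _ => lintegral_sq_mul_sq_lt_top hB (hf2 i)))

/-- Integrating Δd·(w·∇)d by parts cancels the second sum of `divStress_inner` and leaves -∑
∂ᵢd·(∂ᵢw·∇)d, which contains no second derivatives of d. -/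
lemma IsTestField.abs_integral_inner_divStress_le {w d : E3 → E3} {L : ℝ} (hw : IsTestField w L)
    (hd : ContDiff ℝ 2 d) (hd2 : ∀ i, nsq (partialD i d) < ⊤)
    (hdd2 : ∀ i j, nsq (partialD i (partialD j d)) < ⊤) :
    |∫ x, (inner ℝ (w x) (divStress d x) : ℝ)| ≤ 3 * L * ∑ i, sqn (partialD i d) := by
  obtain ⟨B, hB⟩ := hw.bounded
  have hd1 : ContDiff ℝ 1 d := hd.of_le (by norm_num)
  have hwc := hw.contDiff.continuous
  have hc : ∀ i, ContDiff ℝ 1 (partialD i d) := fun i => contDiff_partialD (n := 1) hd i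
  have hwd := contDiff_advect hw.contDiff hd
  have hL := fun i x => hw.partialD_le i x
  have hwi := fun i => continuous_partialD hw.contDiff i
  have a1 : ∀ i, Continuous (advect (partialD i w) d) := fun i =>
    (hd1.continuous_fderiv one_ne_zero).clm_apply (hwi i)
  have a2 : ∀ i, Continuous (advect w (partialD i d)) := fun i =>
    ((hc i).continuous_fderiv one_ne_zero).clm_apply hwc
  have n0 : nsq (advect w d) < ⊤ := nsq_advect_lt_top hwc hB hd1 hd2
  have n1 : ∀ i, nsq (advect (partialD i w) d) < ⊤ := fun i =>
    nsq_advect_lt_top (hwi i) (hL i) hd1 hd2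
  have n2 : ∀ i, nsq (advect w (partialD i d)) < ⊤ := fun i =>
    nsq_advect_lt_top hwc hB (hc i) fun j => hdd2 j i
  have n3 : ∀ i, nsq (partialD i (advect w d)) < ⊤ := fun i => by
    have e1 : partialD i (advect w d) = fun x => advect (partialD i w) d x
        + advect w (partialD i d) x := funext fun x => partialD_advect hw.contDiff hd i x
    rw [e1]
    exact (nsq_add_le (a1 i).aestronglyMeasurable).trans_lt (ENNReal.add_lt_top.2
      ⟨ENNReal.mul_lt_top (by simp) (n1 i), ENNReal.mul_lt_top (by simp) (n2 i)⟩)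
  have md := fun i => (hc i).continuous.aestronglyMeasurable (μ := (volume : Measure E3))
  have j1 := fun i => integrable_inner_of_nsq (md i) (hd2 i) (a1 i).aestronglyMeasurable (n1 i)
  have j2 := fun i => integrable_inner_of_nsq (md i) (hd2 i) (a2 i).aestronglyMeasurable (n2 i)
  have hlap : Continuous (lap d) := continuous_finsetSum _ fun i _ => continuous_partialD (hc i) i
  have nlap : nsq (lap d) < ⊤ := (nsq_lap_le hd).trans_lt (ENNReal.mul_lt_top (by simp)
    (ENNReal.sum_lt_top.2 fun i _ => hdd2 i i))
  have j0 := integrable_inner_of_nsq hlap.aestronglyMeasurable nlap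
    hwd.continuous.aestronglyMeasurable n0
  have key : ∫ x, (inner ℝ (w x) (divStress d x) : ℝ)
      = - ∫ x, ∑ i, (inner ℝ (partialD i d x) (advect (partialD i w) d x) : ℝ) := by
    simp only [fun x => real_inner_comm (divStress d x) (w x), divStress_inner hd]
    rw [integral_add j0 (integrable_finsetSum _ fun i _ => j2 i),
      integral_inner_lap hd hwd hd2 (fun i => hdd2 i i) n0 n3]
    simp only [partialD_advect hw.contDiff hd, inner_add_right]
    simp only [fun i => integral_add (j1 i) (j2 i)]
    rw [integral_finsetSum _ fun i _ => j1 i, integral_finsetSum _ fun i _ => j2 i,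
      Finset.sum_add_distrib]
    ring
  have hb : ∀ x, ‖∑ i, (inner ℝ (partialD i d x) (advect (partialD i w) d x) : ℝ)‖
      ≤ 3 * L * ∑ i, ‖partialD i d x‖ ^ 2 := fun x => by
    have hL0 : 0 ≤ L := (norm_nonneg _).trans (hL 0 x)
    set S := ∑ i, ‖partialD i d x‖ with hS
    have hS0 : 0 ≤ S := Finset.sum_nonneg fun i _ => norm_nonneg _
    calc _ ≤ ∑ i, ‖partialD i d x‖ * (L * S) := by
          refine (norm_sum_le _ _).trans (Finset.sum_le_sum fun i _ =>
            (norm_inner_le_norm _ _).trans (mul_le_mul_of_nonneg_left ?_ (norm_nonneg _)))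
          exact (norm_advect_le _ _ x).trans (mul_le_mul_of_nonneg_right (hL i x) hS0)
      _ = L * S ^ 2 := by rw [← Finset.sum_mul]; ring
      _ ≤ L * (3 * ∑ i, ‖partialD i d x‖ ^ 2) :=
          mul_le_mul_of_nonneg_left (sq_sum_three_le _) hL0
      _ = _ := by ring
  have i2 : Integrable (fun x => 3 * L * ∑ i, ‖partialD i d x‖ ^ 2) volume :=
    (integrable_finsetSum _ fun i _ => integrable_norm_sq (md i) (hd2 i)).const_mul _
  rw [key, abs_neg]
  refine (abs_integral_le_integral_abs).trans ((integral_mono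
    (integrable_finsetSum _ fun i _ => j1 i).norm i2 hb).trans (le_of_eq ?_))
  rw [integral_const_mul, integral_finsetSum _ fun i _ => integrable_norm_sq (md i) (hd2 i)]
  rfl

end LiquidCrystal

namespace LiquidCrystal

/-! ### Energy identities at a fixed time -/

lemma norm_conv_le {k : E3 → ℝ} {f : E3 → E3} {a b : ℝ} (ha : 0 ≤ a) (hk : Continuous k)
    (hf : AEStronglyMeasurable f volume) (h1 : ∫⁻ y, ‖k y‖ₑ ^ 2 ≤ ENNReal.ofReal a)
    (h2 : nsq f ≤ ENNReal.ofReal b) (x : E3) : ‖conv k f x‖ ≤ Real.sqrt (a * b) := by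
  have h := (enorm_conv_sq_le hk hf x).trans (mul_le_mul' h1 h2)
  rw [← ENNReal.ofReal_mul ha, enorm_sq_eq_ofReal] at h
  rcases le_or_gt (a * b) 0 with hab | hab
  · rw [ENNReal.ofReal_of_nonpos hab, nonpos_iff_eq_zero, ENNReal.ofReal_eq_zero] at h
    have : ‖conv k f x‖ = 0 := by nlinarith [sq_nonneg ‖conv k f x‖]
    rw [this]; positivity
  · exact Real.le_sqrt_of_sq_le ((ENNReal.ofReal_le_ofReal_iff hab.le).1 h)

lemma partialD_conv_moll {R : ℝ} (hR : 0 < R) {f : E3 → E3} (hf : ContDiff ℝ 1 f) (i : Fin 3) :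
    partialD i (conv (moll R) f) = conv (moll R) (partialD i f) := by
  rw [partialD_conv (contDiff_moll R) (hasCompactSupport_moll hR) hf.continuous.locallyIntegrable,
    conv_partial_eq (contDiff_moll R) (hasCompactSupport_moll hR) (isWeakPartial_partialD hf i)]

lemma contDiff_conv_moll {R : ℝ} (hR : 0 < R) {f : E3 → E3} (hf : Continuous f) :
    ContDiff ℝ 1 (conv (moll R) f) :=
  contDiff_one_of_top (contDiff_conv (contDiff_moll R) (hasCompactSupport_moll hR)
    hf.locallyIntegrable)

/-- The derivative falls on the outer kernel; Cauchy-Schwarz pairs its L² norm, of order R^(-5/2),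
with the L² norm of the inner mollification, at most ‖u‖₂. -/
lemma isTestField_conv_moll {R : ℝ} (hR : 0 < R) {u : E3 → E3} (hu : ContDiff ℝ 1 u)
    (hu2 : nsq u < ⊤) :
    IsTestField (conv (moll R) (conv (moll R) u)) (Real.sqrt (bumpConst * R⁻¹ ^ 5 * sqn u)) := by
  have hK := isFilter_conv_moll hR
  have hb := bumpConst_nonneg
  have hA := contDiff_conv_moll hR hu.continuous
  have um := hu.continuous.aestronglyMeasurable (μ := (volume : Measure E3))
  have am := hA.continuous.aestronglyMeasurable (μ := (volume : Measure E3))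
  have hA2 : nsq (conv (moll R) u) ≤ ENNReal.ofReal (sqn u) := by
    rw [ofReal_sqn um hu2]; exact nsq_conv_moll_le_nsq hR um
  refine ⟨hK.contDiff u hu, (hK.nsq_le u hu.continuous).trans_lt hu2,
    ⟨_, norm_conv_le (by positivity) (continuous_moll R) am (lintegral_moll_sq_le hR) hA2⟩,
    fun i x => ?_⟩
  rw [partialD_conv (contDiff_moll R) (hasCompactSupport_moll hR) hA.continuous.locallyIntegrable]
  exact norm_conv_le (by positivity) (contDiff_fderiv_apply (contDiff_moll R) _).continuous am
    (lintegral_fderiv_moll_sq_le hR i) hA2 x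

/-- The filter commutes with derivatives, so the integral equals -∑ ⟨∂ᵢu, K ∂ᵢu⟩ with K positive:
diffusion does not feed the low frequencies. -/
lemma integral_inner_filter_lap_nonpos {R : ℝ} (hR : 0 < R) {u : E3 → E3} (hu : ContDiff ℝ 2 u)
    (hu2 : nsq u < ⊤) (hu'2 : ∀ i, nsq (partialD i u) < ⊤)
    (hu''2 : ∀ i, nsq (partialD i (partialD i u)) < ⊤) :
    ∫ x, (inner ℝ (conv (moll R) (conv (moll R) u) x) (lap u x) : ℝ) ≤ 0 := by
  have hK := isFilter_conv_moll hR
  have hu1 : ContDiff ℝ 1 u := hu.of_le (by norm_num)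
  have hA := contDiff_conv_moll hR hu.continuous
  have hp : ∀ i, partialD i (conv (moll R) (conv (moll R) u))
      = conv (moll R) (conv (moll R) (partialD i u)) := fun i => by
    rw [partialD_conv_moll hR hA, partialD_conv_moll hR hu1]
  simp only [fun x => real_inner_comm (lap u x) (conv (moll R) (conv (moll R) u) x)]
  rw [integral_inner_lap hu (hK.contDiff u hu1) hu'2 hu''2
    ((hK.nsq_le u hu.continuous).trans_lt hu2) fun i => by
      rw [hp]; exact (hK.nsq_le _ (continuous_partialD hu1 i)).trans_lt (hu'2 i)]
  simp only [hp]
  exact neg_nonpos.2 (Finset.sum_nonneg fun i _ =>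
    hK.nonneg _ (continuous_partialD hu1 i) (hu'2 i))

section Solution

variable {η : ℝ} {w₀ : E3} {u₀ d₀ : E3 → E3} {u d : ℝ → E3 → E3} {π : ℝ → E3 → ℝ}

lemma IsSolution.nsq_partialD_u_lt_top (h : IsSolution η w₀ u₀ d₀ u π d) {t : ℝ} (ht : 0 < t)
    (i : Fin 3) : nsq (partialD i (u t)) < ⊤ := by
  obtain ⟨M, -, hM⟩ := h.exists_u_bound (T := t + 1) (by linarith)
  exact (nsq_partialD_le_gsq _ i).trans_lt
    ((hM t ⟨ht, by linarith⟩).2.1.trans_lt ENNReal.ofReal_lt_top)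

lemma IsSolution.nsq_partialD_d_lt_top (h : IsSolution η w₀ u₀ d₀ u π d) {t : ℝ} (ht : 0 < t)
    (i : Fin 3) : nsq (partialD i (d t)) < ⊤ := by
  obtain ⟨M, -, hM⟩ := h.exists_hessian_bound (T := t + 1) (by linarith)
  exact (hM t ⟨ht, by linarith⟩ i).1.trans_lt ENNReal.ofReal_lt_top

lemma IsSolution.nsq_hessian_d_lt_top (h : IsSolution η w₀ u₀ d₀ u π d) {t : ℝ} (ht : 0 < t)
    (i j : Fin 3) : nsq (partialD i (partialD j (d t))) < ⊤ := by
  obtain ⟨M, -, hM⟩ := h.exists_hessian_bound (T := t + 1) (by linarith)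
  exact (nsq_partialD_le_gsq _ i).trans_lt
    ((hM t ⟨ht, by linarith⟩ j).2.1.trans_lt ENNReal.ofReal_lt_top)

lemma IsSolution.ae_hessian_u_lt_top (h : IsSolution η w₀ u₀ d₀ u π d) {t : ℝ} (ht : 0 < t)
    (i j : Fin 3) : ∀ᵐ r ∂(volume.restrict (Set.Ioc 0 t)), nsq (partialD i (partialD j (u r))) < ⊤ :=
  ae_nsq_lt_top (h.u_reg.cts_partialD_partialD i j) le_rfl (h.setLIntegral_hessian_lt_top ht i j)

lemma ae_restrict_Ioc_of_zero {p : ℝ → Prop} {s t : ℝ} (hs : 0 < s)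
    (h : ∀ᵐ r ∂(volume.restrict (Set.Ioc 0 t)), p r) :
    ∀ᵐ r ∂(volume.restrict (Set.Ioc s t)), p r :=
  ae_restrict_of_ae_restrict_of_subset (Set.Ioc_subset_Ioc_left hs.le) h

lemma integral_inner_force {u d w : E3 → E3} (hu : ContDiff ℝ 2 u)
    (hw : AEStronglyMeasurable w volume) (hw2 : nsq w < ⊤) (hl : nsq (lap u) < ⊤)
    (ha : nsq (advect u u) < ⊤) (hs : nsq (divStress d) < ⊤) (hsc : Continuous (divStress d)) :
    ∫ x, (inner ℝ (w x) (force u d x) : ℝ) = (∫ x, (inner ℝ (w x) (lap u x) : ℝ))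
      - (∫ x, (inner ℝ (w x) (advect u u x) : ℝ)) - ∫ x, (inner ℝ (w x) (divStress d x) : ℝ) := by
  have hlc : Continuous (lap u) := continuous_finsetSum _ fun i _ =>
    continuous_partialD (contDiff_partialD (n := 1) hu i) i
  have hac : Continuous (advect u u) := (hu.continuous_fderiv (by norm_num)).clm_apply hu.continuous
  have i1 := integrable_inner_of_nsq hw hw2 hlc.aestronglyMeasurable hl
  have i2 := integrable_inner_of_nsq hw hw2 hac.aestronglyMeasurable ha
  have i3 := integrable_inner_of_nsq hw hw2 hsc.aestronglyMeasurable hs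
  have i12 : Integrable (fun x => (inner ℝ (w x) (lap u x) : ℝ) - inner ℝ (w x) (advect u u x))
    volume := i1.sub i2
  simp only [force, inner_sub_right]
  rw [integral_sub i12 i3, integral_sub i1 i2]

/-- The pieces of the forcing are square integrable at almost every time. -/
lemma IsSolution.ae_force_parts (h : IsSolution η w₀ u₀ d₀ u π d) {s t : ℝ} (hs : 0 < s)
    (hst : s ≤ t) : ∀ᵐ r ∂(volume.restrict (Set.Ioc s t)), 0 < r ∧ nsq (lap (u r)) < ⊤ ∧
      nsq (advect (u r) (u r)) < ⊤ ∧ nsq (divStress (d r)) < ⊤ ∧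
      (∀ i, nsq (partialD i (partialD i (u r))) < ⊤) ∧
      (∀ i, ∫⁻ x, ‖u r x‖ₑ ^ 2 * ‖partialD i (u r) x‖ₑ ^ 2 < ⊤) ∧
      ∀ k i, ∫⁻ x, ‖partialD k (d r) x‖ₑ ^ 2 * ‖partialD i (partialD k (d r)) x‖ₑ ^ 2 < ⊤ := by
  have ht := hs.trans_le hst
  refine ae_restrict_Ioc_of_zero hs ?_
  filter_upwards [ae_restrict_mem measurableSet_Ioc,
    ae_nsq_lt_top h.u_reg.cts_lap le_rfl (h.setLIntegral_lap_lt_top ht),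
    ae_nsq_lt_top (h.u_reg.cts_advect h.u_reg.cts) le_rfl (h.setLIntegral_advect_lt_top ht),
    ae_nsq_lt_top h.d_reg.cts_divStress le_rfl (h.setLIntegral_divStress_lt_top ht),
    ae_all_iff.2 fun i => h.ae_hessian_u_lt_top ht i i,
    ae_all_iff.2 fun i => h.ae_sq_mul_partialD_lt_top ht i,
    ae_all_iff.2 fun k => ae_all_iff.2 fun i => h.ae_partialD_sq_mul_lt_top ht k i k]
    with r h0 h1 h2 h3 h4 h5 h6
  exact ⟨h0.1, h1, h2, h3, h4, h5, h6⟩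

/-- Low frequencies of the velocity are produced only by the quadratic nonlinearities. -/
lemma IsSolution.ae_integral_inner_filter_force_le (h : IsSolution η w₀ u₀ d₀ u π d) {R : ℝ}
    (hR : 0 < R) {s t : ℝ} (hs : 0 < s) (hst : s ≤ t) :
    ∀ᵐ r ∂(volume.restrict (Set.Ioc s t)),
      2 * ∫ x, (inner ℝ (conv (moll R) (conv (moll R) (u r)) x) (force (u r) (d r) x) : ℝ)
        ≤ 6 * Real.sqrt (bumpConst * R⁻¹ ^ 5 * sqn (u r))
          * (sqn (u r) + ∑ i, sqn (partialD i (d r))) := by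
  filter_upwards [h.ae_force_parts hs hst] with r hr'
  obtain ⟨hr, h1, h2, h3, h4, -, -⟩ := hr'
  have hu := h.u_reg.diff_space r hr
  have hd := h.d_reg.diff_space r hr
  have hu1 := h.contDiff_u hr
  have hu2 := h.nsq_lt_top hr
  have hu'2 := h.nsq_partialD_u_lt_top hr
  have hw := isTestField_conv_moll hR hu1 hu2
  rw [integral_inner_force hu hw.contDiff.continuous.aestronglyMeasurable hw.nsq_lt h1 h2 h3
    (h.d_reg.cts_divStress.slice hr)]
  have a1 := integral_inner_filter_lap_nonpos hR hu hu2 hu'2 h4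
  have a2 := neg_le_of_abs_le (hw.abs_integral_inner_advect_le hu1 (h.incompressible r hr) hu2 hu'2)
  have a3 := neg_le_of_abs_le (hw.abs_integral_inner_divStress_le hd (h.nsq_partialD_d_lt_top hr)
    (h.nsq_hessian_d_lt_top hr))
  linarith

lemma norm_sq_sub_one_sq_le {w d : E3} (hw : ‖w‖ = 1) (hd : ‖d‖ ≤ 1) :
    (‖d‖ ^ 2 - 1) ^ 2 ≤ 4 * ‖d - w‖ ^ 2 := by
  have h1 : 1 - ‖d‖ ≤ ‖d - w‖ := by
    rw [← hw, norm_sub_rev]; exact norm_sub_norm_le w d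
  have h2 := norm_nonneg d
  have h3 : 1 - ‖d‖ ^ 2 ≤ 2 * ‖d - w‖ := by nlinarith
  have h4 : 0 ≤ 1 - ‖d‖ ^ 2 := by nlinarith
  nlinarith [pow_le_pow_left₀ h4 h3 2]

/-- Since d - w₀ is bounded in H², every term of the director equation is bounded in L² uniformly on
(0, T), in contrast with the momentum equation, whose forcing is controlled only for almost every
time. -/
lemma IsSolution.exists_director_bound (hD : IsData w₀ u₀ d₀) (h : IsSolution η w₀ u₀ d₀ u π d)
    {T : ℝ} (hT : 0 < T) : ∃ K : ℝ≥0∞, K ≠ ⊤ ∧ ∀ r ∈ Set.Ioo 0 T, nsq (lap (d r)) ≤ K ∧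
      nsq (advect (u r) (d r)) ≤ K ∧ nsq (fun x => glForce η (d r x)) ≤ K := by
  obtain ⟨M₁, -, hM₁⟩ := h.exists_u_bound hT
  obtain ⟨M₂, -, hM₂⟩ := h.exists_hessian_bound hT
  obtain ⟨M₃, -, hM₃⟩ := h.exists_nsq_bound hT
  set K₁ := 3 * (3 * ENNReal.ofReal M₂)
  set K₂ := 3 * (3 * ((sobConst * ENNReal.ofReal M₁) ^ 2 * (sobConst * ENNReal.ofReal M₂)
    * ENNReal.ofReal M₂ + 1))
  set K₃ := ENNReal.ofReal (4 * (1 / η ^ 2) ^ 2) * ENNReal.ofReal M₃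
  have hs := sobConst_ne_top
  refine ⟨K₁ + K₂ + K₃, by simp only [K₁, K₂, K₃]; finiteness, fun r hr => ⟨?_, ?_, ?_⟩⟩
  · refine (nsq_lap_le (h.d_reg.diff_space r hr.1)).trans (le_trans ?_
      (le_self_add.trans le_self_add : K₁ ≤ K₁ + K₂ + K₃))
    refine mul_le_mul_right ((Finset.sum_le_sum fun i _ =>
      (nsq_partialD_le_gsq _ i).trans (hM₂ r hr i).2.1).trans (le_of_eq ?_)) _
    simp
  · have hu := h.contDiff_u hr.1
    have hd := h.d_reg.contDiff_one hr.1
    refine (nsq_advect_le hu.continuous hd).trans (le_trans ?_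
      (le_add_self.trans le_self_add : K₂ ≤ K₁ + K₂ + K₃))
    refine mul_le_mul_right ((Finset.sum_le_sum fun i _ => le_add_one_of_sq_le
      (lintegral_sq_mul_sq_le_of_six (μ := volume) hu.continuous.enorm.aemeasurable
        (continuous_partialD hd i).enorm.aemeasurable (hM₁ r hr).2.2 (hM₂ r hr i).2.2
        (hM₂ r hr i).1)).trans (le_of_eq ?_)) _
    rw [Finset.sum_const, Finset.card_univ, Fintype.card_fin, nsmul_eq_mul]
    push_cast
    rfl
  · refine le_trans ?_ (le_add_self : K₃ ≤ K₁ + K₂ + K₃)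
    refine le_trans ?_ (mul_le_mul_right (hM₃ r hr).1 _)
    unfold nsq
    rw [← lintegral_const_mul' _ _ ENNReal.ofReal_ne_top]
    refine lintegral_mono fun x => ?_
    rw [enorm_sq_eq_ofReal, enorm_sq_eq_ofReal, ← ENNReal.ofReal_mul (by positivity)]
    refine ENNReal.ofReal_le_ofReal ?_
    have h1 := h.norm_le_one hD hr.1 x
    have h2 := norm_sq_sub_one_sq_le hD.norm_w₀ h1
    simp only [glForce, norm_smul, Real.norm_eq_abs, mul_pow, sq_abs]
    have h3 : ‖d r x‖ ^ 2 ≤ 1 := pow_le_one₀ (norm_nonneg _) h1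
    calc _ ≤ (1 / η ^ 2) ^ 2 * (4 * ‖d r x - w₀‖ ^ 2) * 1 := by gcongr
      _ = _ := by ring

lemma IsSolution.nsq_director_parts_lt_top (hD : IsData w₀ u₀ d₀)
    (h : IsSolution η w₀ u₀ d₀ u π d) {t : ℝ} (ht : 0 < t) : nsq (lap (d t)) < ⊤ ∧
      nsq (advect (u t) (d t)) < ⊤ ∧ nsq (fun x => glForce η (d t x)) < ⊤ := by
  obtain ⟨K, hK, hle⟩ := h.exists_director_bound hD (T := t + 1) (by linarith)
  obtain ⟨h1, h2, h3⟩ := hle t ⟨ht, by linarith⟩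
  exact ⟨h1.trans_lt hK.lt_top, h2.trans_lt hK.lt_top, h3.trans_lt hK.lt_top⟩

/-- The kinetic energy balance. -/
lemma IsSolution.ae_integral_inner_force_eq (hD : IsData w₀ u₀ d₀)
    (h : IsSolution η w₀ u₀ d₀ u π d) {s t : ℝ}
    (hs : 0 < s) (hst : s ≤ t) :
    ∀ᵐ r ∂(volume.restrict (Set.Ioc s t)),
      ∫ x, (inner ℝ (u r x) (force (u r) (d r) x) : ℝ)
        = - (∑ i, sqn (partialD i (u r))) - ∫ x, (inner ℝ (lap (d r) x) (advect (u r) (d r) x) : ℝ) := by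
  filter_upwards [h.ae_force_parts hs hst] with r hr'
  obtain ⟨hr, h1, h2, h3, h4, h5, h6⟩ := hr'
  have hu := h.u_reg.diff_space r hr
  have hd := h.d_reg.diff_space r hr
  have hu1 := h.contDiff_u hr
  have hu2 := h.nsq_lt_top hr
  have hu'2 := h.nsq_partialD_u_lt_top hr
  have hdiv := h.incompressible r hr
  have hc : ∀ i, ContDiff ℝ 1 (partialD i (d r)) := fun i => contDiff_partialD (n := 1) hd i
  rw [integral_inner_force hu hu.continuous.aestronglyMeasurable hu2 h1 h2 h3
    (h.d_reg.cts_divStress.slice hr), integral_inner_self_advect_eq_zero hu1 hdiv hu2 hu1 h5]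
  have e1 : ∫ x, (inner ℝ (u r x) (lap (u r) x) : ℝ) = - ∑ i, sqn (partialD i (u r)) := by
    simp only [fun x => real_inner_comm (lap (u r) x) (u r x)]
    rw [integral_inner_lap hu hu1 hu'2 h4 hu2 hu'2]
    simp only [real_inner_self_eq_norm_sq, sqn]
  -- Solenoidal transport of each ∂ₖd is orthogonal to ∂ₖd, so the gradient part of the stress does
  -- no work.
  have e2 : ∀ k, ∫ x, (inner ℝ (partialD k (d r) x) (advect (u r) (partialD k (d r)) x) : ℝ) = 0 :=
    fun k => integral_inner_self_advect_eq_zero hu1 hdiv hu2 (hc k) (h6 k)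
  have e3 : ∫ x, (inner ℝ (u r x) (divStress (d r) x) : ℝ)
      = ∫ x, (inner ℝ (lap (d r) x) (advect (u r) (d r) x) : ℝ) := by
    have j : ∀ k, Integrable (fun x =>
        (inner ℝ (partialD k (d r) x) (advect (u r) (partialD k (d r)) x) : ℝ)) volume := fun k => by
      have um := hu.continuous.aestronglyMeasurable (μ := (volume : Measure E3))
      have hs : Integrable (fun x => ∑ i, ‖u r x‖
          * ‖‖partialD k (d r) x‖ * ‖partialD i (partialD k (d r)) x‖‖) volume :=
        integrable_finsetSum _ fun i _ => integrable_norm_mul_norm um hu2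
          (g := fun x => ‖partialD k (d r) x‖ * ‖partialD i (partialD k (d r)) x‖)
          ((hc k).continuous.norm.mul (continuous_partialD (hc k) i).norm).aestronglyMeasurable (by
            simpa only [enorm_mul, enorm_norm, mul_pow] using h6 k i)
      refine hs.mono' ((hc k).continuous.inner (((hc k).continuous_fderiv one_ne_zero).clm_apply
        hu.continuous)).aestronglyMeasurable (Eventually.of_forall fun x => ?_)
      refine (norm_inner_le_norm _ _).trans ((mul_le_mul_of_nonneg_left (norm_advect_le _ _ x)
        (norm_nonneg _)).trans (le_of_eq ?_))
      simp only [norm_mul, norm_norm]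
      rw [Finset.mul_sum, Finset.mul_sum]
      exact Finset.sum_congr rfl fun i _ => by ring
    have j2 : Integrable (fun x => (inner ℝ (lap (d r) x) (advect (u r) (d r) x) : ℝ)) volume := by
      obtain ⟨n1, n2, -⟩ := h.nsq_director_parts_lt_top hD hr
      exact integrable_inner_of_nsq (h.d_reg.cts_lap.slice hr).aestronglyMeasurable n1
        ((h.d_reg.cts_advect h.u_reg.cts).slice hr).aestronglyMeasurable n2
    simp only [fun x => real_inner_comm (divStress (d r) x) (u r x), divStress_inner hd]
    rw [integral_add j2 (integrable_finsetSum _ fun k _ => j k), integral_finsetSum _ fun k _ => j k]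
    simp only [e2, Finset.sum_const_zero, add_zero]
  rw [e1, e3]
  ring

end Solution

end LiquidCrystal

namespace LiquidCrystal

/-! ### The energy inequality -/

/-- The Dirichlet energy as a real number. -/
noncomputable def dirichlet (f : E3 → E3) : ℝ := ∑ i, sqn (partialD i f)

lemma dirichlet_nonneg (f : E3 → E3) : 0 ≤ dirichlet f :=
  Finset.sum_nonneg fun _ _ => sqn_nonneg _

lemma ofReal_dirichlet {f : E3 → E3} (hf : ContDiff ℝ 1 f) (h : ∀ i, nsq (partialD i f) < ⊤) :
    ENNReal.ofReal (dirichlet f) = gsq f := by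
  rw [dirichlet, ENNReal.ofReal_sum_of_nonneg fun i _ => sqn_nonneg _]
  exact Finset.sum_congr rfl fun i _ =>
    ofReal_sqn (continuous_partialD hf i).aestronglyMeasurable (h i)

/-- Convexity: ‖f‖² - ‖g‖² = 2 ⟨f, f - g⟩ - ‖f - g‖². -/
lemma sqn_sub_sqn_le {f g : E3 → E3} (hf : AEStronglyMeasurable f volume) (hf2 : nsq f < ⊤)
    (hg : AEStronglyMeasurable g volume) (hg2 : nsq g < ⊤) :
    sqn f - sqn g ≤ 2 * ∫ x, (inner ℝ (f x) (f x - g x) : ℝ) := by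
  have i1 := integrable_norm_sq hf hf2
  have i2 := integrable_norm_sq hg hg2
  have i3 := integrable_inner_of_nsq hf hf2 hg hg2
  have i4 : Integrable (fun x => (inner ℝ (f x) (f x - g x) : ℝ)) volume := by
    simp only [inner_sub_right, real_inner_self_eq_norm_sq]
    exact i1.sub i3
  rw [sqn, sqn, ← integral_sub i1 i2, ← integral_const_mul]
  refine integral_mono (i1.sub i2) (i4.const_mul 2) fun x => ?_
  have h1 := norm_sub_sq_real (f x) (g x)
  simp only [inner_sub_right, real_inner_self_eq_norm_sq]
  nlinarith [sq_nonneg ‖f x - g x‖]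

section Solution

variable {η : ℝ} {w₀ : E3} {u₀ d₀ : E3 → E3} {u d : ℝ → E3 → E3} {π : ℝ → E3 → ℝ}

lemma IsSolution.deriv_d_eq (h : IsSolution η w₀ u₀ d₀ u π d) {t : ℝ} (ht : 0 < t) (x : E3) :
    deriv (fun s => d s x) t = lap (d t) x - glForce η (d t x) - advect (u t) (d t) x := by
  have h1 := h.director t ht x
  rw [laplacian_eq_sum_partialD (h.d_reg.diff_space t ht)] at h1
  rw [lap, advect, ← h1]
  abel

lemma nsq_sub_le {f g : E3 → E3} (hf : AEStronglyMeasurable f volume) :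
    nsq (fun x => f x - g x) ≤ 2 * nsq f + 2 * nsq g := by
  have h := nsq_add_le (g := fun x => -g x) hf
  have e : nsq (fun x => -g x) = nsq g := by simp [nsq]
  simpa only [← sub_eq_add_neg, e] using h

lemma IsC12.cts_glForce {d : ℝ → E3 → E3} (h : IsC12 d) (η : ℝ) :
    Cts (fun t x => glForce η (d t x)) :=
  ContinuousOn.smul ((h.cts.norm_sq.sub_const' 1).const_mul' _) h.cts

lemma IsSolution.exists_deriv_d_bound (hD : IsData w₀ u₀ d₀) (h : IsSolution η w₀ u₀ d₀ u π d)
    {T : ℝ} (hT : 0 < T) : ∃ M : ℝ, 0 ≤ M ∧ ∀ r ∈ Set.Ioo 0 T, nsq (lap (d r)) ≤ ENNReal.ofReal M ∧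
      nsq (fun x => deriv (fun s => d s x) r) ≤ ENNReal.ofReal M := by
  obtain ⟨K, hK, hle⟩ := h.exists_director_bound hD hT
  have hK' : 2 * (2 * K + 2 * K) + 2 * K ≠ ⊤ := by finiteness
  refine ⟨(2 * (2 * K + 2 * K) + 2 * K).toReal, ENNReal.toReal_nonneg, fun r hr => ?_⟩
  rw [ENNReal.ofReal_toReal hK']
  obtain ⟨h1, h2, h3⟩ := hle r hr
  have hl := (h.d_reg.cts_lap.slice hr.1).aestronglyMeasurable (μ := (volume : Measure E3))
  have hf := ((h.d_reg.cts_glForce η).slice hr.1).aestronglyMeasurable (μ := (volume : Measure E3))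
  refine ⟨h1.trans (le_trans ?_ le_add_self), ?_⟩
  · rw [two_mul]; exact le_self_add
  · simp only [h.deriv_d_eq hr.1]
    exact (nsq_sub_le (hl.sub hf)).trans (add_le_add (mul_le_mul_right ((nsq_sub_le hl).trans
      (add_le_add (mul_le_mul_right h1 _) (mul_le_mul_right h3 _))) _) (mul_le_mul_right h2 _))

lemma setLIntegral_lt_top_of_le_const {f : ℝ → ℝ≥0∞} {K : ℝ≥0∞} (hK : K < ⊤) {s t : ℝ}
    (h : ∀ r ∈ Set.Ioc s t, f r ≤ K) : ∫⁻ r in Set.Ioc s t, f r < ⊤ :=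
  (setLIntegral_mono' measurableSet_Ioc h).trans_lt (setLIntegral_const_lt_top hK s t)

lemma IsSolution.setLIntegral_deriv_d_lt_top (hD : IsData w₀ u₀ d₀)
    (h : IsSolution η w₀ u₀ d₀ u π d) {s t : ℝ} (hs : 0 < s) (hst : s ≤ t) :
    ∫⁻ r in Set.Ioc s t, nsq (fun x => deriv (fun q => d q x) r) < ⊤ := by
  obtain ⟨M, -, hM⟩ := h.exists_deriv_d_bound hD (T := t + 1) (by linarith)
  exact setLIntegral_lt_top_of_le_const ENNReal.ofReal_lt_top fun r hr =>
    (hM r ⟨hs.trans hr.1, by linarith [hr.2]⟩).2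

lemma IsSolution.sub_eq_setIntegral_deriv (h : IsSolution η w₀ u₀ d₀ u π d) {s t : ℝ} (hs : 0 < s)
    (hst : s ≤ t) (x : E3) :
    d t x - d s x = ∫ r in Set.Ioc s t, deriv (fun q => d q x) r := by
  rw [← intervalIntegral.integral_of_le hst]
  refine (intervalIntegral.integral_deriv_eq_sub (f := fun s => d s x) (fun r hr => ?_)
    (h.d_reg.cts_time.intervalIntegrable hs hst x)).symm
  rw [Set.uIcc_of_le hst] at hr
  exact h.d_reg.diff_time r (lt_of_lt_of_le hs hr.1) x

/-- No mixed derivative of d in time and space is available, so the Dirichlet energy is not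
differentiated. On each short interval convexity bounds its increment by -2 ⟨Δd(y), d(y) - d(x)⟩;
the increment of d is the integral of ∂ₜd, and refining the partition moves Δd to the diagonal. -/
theorem IsSolution.dirichlet_sub_le (hD : IsData w₀ u₀ d₀) (h : IsSolution η w₀ u₀ d₀ u π d)
    {s t : ℝ} (hs : 0 < s) (hst : s ≤ t) :
    dirichlet (d t) - dirichlet (d s) ≤ ∫ r in Set.Ioc s t,
      -2 * ∫ x, (inner ℝ (lap (d r) x) (deriv (fun q => d q x) r) : ℝ) := by
  obtain ⟨M, hM0, hM⟩ := h.exists_deriv_d_bound hD (T := t + 1) (by linarith)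
  have hM' : ∀ y ∈ Set.Icc s t, 0 < y ∧ nsq (lap (d y)) ≤ ENNReal.ofReal M ∧
      nsq (fun x => deriv (fun s => d s x) y) ≤ ENNReal.ofReal M := fun y hy =>
    ⟨hs.trans_le hy.1, hM y ⟨hs.trans_le hy.1, by linarith [hy.2]⟩⟩
  have lc := fun r (hr : 0 < r) => h.d_reg.cts_lap.slice hr
  have lm := fun r (hr : 0 < r) => (lc r hr).aestronglyMeasurable (μ := (volume : Measure E3))
  have Dm := fun r (hr : 0 < r) =>
    (h.d_reg.cts_time.slice hr).aestronglyMeasurable (μ := (volume : Measure E3))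
  have hlt : ∀ {f : E3 → E3}, nsq f ≤ ENNReal.ofReal M → nsq f < ⊤ := fun hf =>
    hf.trans_lt ENNReal.ofReal_lt_top
  refine sub_le_setIntegral_diag (f := fun t => dirichlet (d t))
    (g := fun r y => -2 * ∫ x, (inner ℝ (lap (d y) x) (deriv (fun q => d q x) r) : ℝ))
    (b := fun _ => M + M) hst (integrable_const _) (fun y hy => ?_) ?_ ?_ fun x y hx hxy hy => ?_
  · obtain ⟨hy0, h1, -⟩ := hM' y hy
    exact ((integrableOn_integral_inner (F := fun _ => lap (d y)) (Cts.of_space (lc y hy0))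
      h.d_reg.cts_time hs.le (setLIntegral_const_lt_top (hlt h1) s t)
      (h.setLIntegral_deriv_d_lt_top hD hs hst)).const_mul _).1
  · filter_upwards [ae_restrict_mem measurableSet_Ioc] with r hr' y hy
    obtain ⟨hy0, h1, -⟩ := hM' y hy
    obtain ⟨hr0, -, h2⟩ := hM' r ⟨hr'.1.le, hr'.2⟩
    have h3 := abs_integral_inner_le (lm y hy0) (hlt h1) (Dm r hr0) (hlt h2) one_pos
    have h4 : sqn (lap (d y)) ≤ M := by
      rwa [← ENNReal.ofReal_le_ofReal_iff hM0, ofReal_sqn (lm y hy0) (hlt h1)]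
    have h5 : sqn (fun x => deriv (fun s => d s x) r) ≤ M := by
      rwa [← ENNReal.ofReal_le_ofReal_iff hM0, ofReal_sqn (Dm r hr0) (hlt h2)]
    rw [abs_mul, abs_neg, abs_two]
    linarith
  · filter_upwards [ae_restrict_mem measurableSet_Ioc] with r hr' τ hτ hτr
    obtain ⟨hr0, h1, h2⟩ := hM' r ⟨hr'.1.le, hr'.2⟩
    have c : ∀ y, ∫ x, (inner ℝ (lap (d y) x) (deriv (fun q => d q x) r) : ℝ)
      = ∫ x, (inner ℝ (deriv (fun q => d q x) r) (lap (d y) x) : ℝ) := fun y => by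
        simp only [real_inner_comm]
    simp only [c]
    refine (tendsto_integral_inner_of_bounded (Dm r hr0) (hlt h2) (lm r hr0) h1
      (fun n => lm _ (hM' _ (hτ n)).1) (fun n => (hM' _ (hτ n)).2.1) fun x => ?_).const_mul (-2)
    exact ((h.d_reg.cts_lap.time x).continuousAt (Ioi_mem_nhds hr0)).tendsto.comp hτr
  · have hx0 : 0 < x := hs.trans_le hx
    have hy0 : 0 < y := hx0.trans_le hxy
    obtain ⟨-, h1, -⟩ := hM' y ⟨hx.trans hxy, hy⟩
    have cx := h.d_reg.contDiff_one hx0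
    have cy := h.d_reg.contDiff_one hy0
    have hsub : ContDiff ℝ 1 (fun z => d y z - d x z) := cy.sub cx
    have pm := fun r (hr : 0 < r) i =>
      (continuous_partialD (h.d_reg.contDiff_one hr) i).aestronglyMeasurable
        (μ := (volume : Measure E3))
    have p2 := fun r (hr : 0 < r) i => h.nsq_partialD_d_lt_top hr i
    have hp : ∀ i, partialD i (fun z => d y z - d x z)
        = fun z => partialD i (d y) z - partialD i (d x) z := fun i => funext fun z => by
      simp only [partialD]
      rw [fderiv_fun_sub (cy.differentiable one_ne_zero z) (cx.differentiable one_ne_zero z)]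
      rfl
    have hs2 : nsq (fun z => d y z - d x z) < ⊤ := by
      have e1 : (fun z => d y z - d x z) = fun z => (d y z - w₀) - (d x z - w₀) :=
        funext fun z => by abel
      rw [e1]
      exact nsq_fun_sub_lt_top (h.continuous_sub w₀ hy0).aestronglyMeasurable
        (h.nsq_sub_lt_top hy0) (h.nsq_sub_lt_top hx0)
    have e2 := integral_inner_lap (h.d_reg.diff_space y hy0) hsub (p2 y hy0)
      (fun i => h.nsq_hessian_d_lt_top hy0 i i) hs2 fun i => by
        rw [hp]; exact nsq_fun_sub_lt_top (pm y hy0 i) (p2 y hy0 i) (p2 x hx0 i)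
    simp only [h.sub_eq_setIntegral_deriv hx0 hxy] at e2
    rw [integral_inner_setIntegral (lc y hy0) (hlt h1) h.d_reg.cts_time hx0 hxy
      (h.setLIntegral_deriv_d_lt_top hD hx0 hxy)] at e2
    rw [integral_const_mul, e2, dirichlet, dirichlet, ← Finset.sum_sub_distrib]
    simp only [← h.sub_eq_setIntegral_deriv hx0 hxy, hp]
    rw [neg_mul_neg, Finset.mul_sum]
    exact Finset.sum_le_sum fun i _ => sqn_sub_sqn_le (pm y hy0 i) (p2 y hy0 i) (pm x hx0 i)
      (p2 x hx0 i)

end Solution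

end LiquidCrystal

/-! ### The potential energy and the balance of the total energy. -/

namespace LiquidCrystal

/-- The potential energy as a real number. -/
noncomputable def potentialReal (η : ℝ) (d : E3 → E3) : ℝ :=
  ∫ x, 1 / (2 * η ^ 2) * (‖d x‖ ^ 2 - 1) ^ 2

lemma potentialReal_nonneg (η : ℝ) (d : E3 → E3) : 0 ≤ potentialReal η d :=
  integral_nonneg fun x => by positivity

/-- Twice the total energy. -/
noncomputable def energy (η : ℝ) (u d : E3 → E3) : ℝ := sqn u + dirichlet d + potentialReal η d

section Solution

variable {η : ℝ} {w₀ : E3} {u₀ d₀ : E3 → E3} {u d : ℝ → E3 → E3} {π : ℝ → E3 → ℝ}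

lemma potential_density_le {w v : E3} (hw : ‖w‖ = 1) (hv : ‖v‖ ≤ 1) :
    1 / (2 * η ^ 2) * (‖v‖ ^ 2 - 1) ^ 2 ≤ 2 / η ^ 2 * ‖v - w‖ ^ 2 := by
  have h := mul_le_mul_of_nonneg_left (norm_sq_sub_one_sq_le hw hv)
    (by positivity : 0 ≤ 1 / (2 * η ^ 2))
  refine h.trans (le_of_eq ?_)
  rcases eq_or_ne η 0 with rfl | hη
  · simp
  · field_simp; ring

lemma IsSolution.integrable_potential (hD : IsData w₀ u₀ d₀) (h : IsSolution η w₀ u₀ d₀ u π d)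
    {t : ℝ} (ht : 0 < t) :
    Integrable (fun x => 1 / (2 * η ^ 2) * (‖d t x‖ ^ 2 - 1) ^ 2) volume := by
  refine ((integrable_norm_sq (h.continuous_sub w₀ ht).aestronglyMeasurable
    (h.nsq_sub_lt_top ht)).const_mul (2 / η ^ 2)).mono'
    ((h.d_reg.cts.potential η).slice ht).aestronglyMeasurable (Eventually.of_forall fun x => ?_)
  rw [Real.norm_of_nonneg (by positivity)]
  exact potential_density_le hD.norm_w₀ (h.norm_le_one hD ht x)

lemma IsSolution.ofReal_potentialReal (hD : IsData w₀ u₀ d₀) (h : IsSolution η w₀ u₀ d₀ u π d)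
    {t : ℝ} (ht : 0 < t) : ENNReal.ofReal (potentialReal η (d t)) = potential η (d t) :=
  ofReal_integral_eq_lintegral_ofReal (h.integrable_potential hD ht)
    (Eventually.of_forall fun x => by positivity)

lemma IsSolution.setLIntegral_glForce_lt_top (hD : IsData w₀ u₀ d₀)
    (h : IsSolution η w₀ u₀ d₀ u π d) {s t : ℝ} (hs : 0 < s) (hst : s ≤ t) :
    ∫⁻ r in Set.Ioc s t, nsq (fun x => glForce η (d r x)) < ⊤ := by
  obtain ⟨K, hK, hle⟩ := h.exists_director_bound hD (T := t + 1) (by linarith)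
  exact setLIntegral_lt_top_of_le_const hK.lt_top fun r hr =>
    (hle r ⟨hs.trans hr.1, by linarith [hr.2]⟩).2.2

lemma IsSolution.setLIntegral_nsq_lap_d_lt_top (hD : IsData w₀ u₀ d₀)
    (h : IsSolution η w₀ u₀ d₀ u π d) {s t : ℝ} (hs : 0 < s) (hst : s ≤ t) :
    ∫⁻ r in Set.Ioc s t, nsq (lap (d r)) < ⊤ := by
  obtain ⟨K, hK, hle⟩ := h.exists_director_bound hD (T := t + 1) (by linarith)
  exact setLIntegral_lt_top_of_le_const hK.lt_top fun r hr =>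
    (hle r ⟨hs.trans hr.1, by linarith [hr.2]⟩).1

lemma IsSolution.potentialReal_sub_eq (hη : η ≠ 0) (hD : IsData w₀ u₀ d₀)
    (h : IsSolution η w₀ u₀ d₀ u π d) {s t : ℝ} (hs : 0 < s) (hst : s ≤ t) :
    potentialReal η (d t) - potentialReal η (d s) = ∫ r in Set.Ioc s t,
      2 * ∫ x, (inner ℝ (glForce η (d r x)) (deriv (fun q => d q x) r) : ℝ) := by
  have ht := hs.trans_le hst
  have hG : Cts fun r x => (inner ℝ (glForce η (d r x)) (deriv (fun q => d q x) r) : ℝ) :=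
    (h.d_reg.cts_glForce η).inner' h.d_reg.cts_time
  have hpt : ∀ x, 1 / (2 * η ^ 2) * (‖d t x‖ ^ 2 - 1) ^ 2
      - 1 / (2 * η ^ 2) * (‖d s x‖ ^ 2 - 1) ^ 2 = ∫ r in Set.Ioc s t,
        2 * (inner ℝ (glForce η (d r x)) (deriv (fun q => d q x) r) : ℝ) := fun x => by
    rw [← intervalIntegral.integral_of_le hst]
    refine (intervalIntegral.integral_eq_sub_of_hasDerivAt
      (f := fun r => 1 / (2 * η ^ 2) * (‖d r x‖ ^ 2 - 1) ^ 2) (fun r hr => ?_)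
      (ContinuousOn.intervalIntegrable_of_Icc hst ?_)).symm
    · rw [Set.uIcc_of_le hst] at hr
      have h1 := (h.d_reg.diff_time r (lt_of_lt_of_le hs hr.1) x).hasDerivAt.norm_sq
      have h2 := ((h1.sub_const 1).pow 2).const_mul (1 / (2 * η ^ 2))
      convert! h2 using 1
      rw [glForce, inner_smul_left]
      simp
      field_simp
    · exact continuousOn_const.mul ((hG.time x).mono fun _ hr => lt_of_lt_of_le hs hr.1)
  rw [potentialReal, potentialReal, ← integral_sub (h.integrable_potential hD ht)
    (h.integrable_potential hD hs)]
  simp only [hpt, integral_const_mul]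
  congr 1
  exact (integral_integral_swap (integrable_prod_inner (h.d_reg.cts_glForce η) h.d_reg.cts_time hs.le
    (h.setLIntegral_glForce_lt_top hD hs hst) (h.setLIntegral_deriv_d_lt_top hD hs hst))).symm

lemma hasFDerivAt_potential_density {f : E3 → E3} (hη : η ≠ 0) (hf : ContDiff ℝ 1 f) (x w : E3) :
    fderiv ℝ (fun y => 1 / (4 * η ^ 2) * (‖f y‖ ^ 2 - 1) ^ 2) x w
      = inner ℝ (glForce η (f x)) (fderiv ℝ f x w) := by
  have h1 := ((((hf.differentiable one_ne_zero x).hasFDerivAt).norm_sq.sub_const 1).pow 2).const_mul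
    (1 / (4 * η ^ 2))
  rw [h1.fderiv, glForce, inner_smul_left]
  simp
  field_simp
  ring

lemma norm_glForce_le {v : E3} (hv : ‖v‖ ≤ 1) : ‖glForce η v‖ ≤ 1 / η ^ 2 := by
  rw [glForce, norm_smul, norm_mul, Real.norm_of_nonneg (by positivity : 0 ≤ 1 / η ^ 2), mul_assoc]
  refine mul_le_of_le_one_right (by positivity) (mul_le_one₀ ?_ (norm_nonneg _) hv)
  rw [Real.norm_eq_abs, abs_le]
  constructor <;> nlinarith [norm_nonneg v]

/-- The director part of the energy balance at a fixed time. -/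
lemma IsSolution.director_balance (hη : η ≠ 0) (hD : IsData w₀ u₀ d₀)
    (h : IsSolution η w₀ u₀ d₀ u π d) {t : ℝ} (ht : 0 < t) :
    (∫ x, (inner ℝ (glForce η (d t x)) (deriv (fun q => d q x) t) : ℝ))
      - (∫ x, (inner ℝ (lap (d t) x) (deriv (fun q => d q x) t) : ℝ))
      ≤ ∫ x, (inner ℝ (lap (d t) x) (advect (u t) (d t) x) : ℝ) := by
  obtain ⟨l2, a2, f2⟩ := h.nsq_director_parts_lt_top hD ht
  have lm := (h.d_reg.cts_lap.slice ht).aestronglyMeasurable (μ := (volume : Measure E3))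
  have fm := ((h.d_reg.cts_glForce η).slice ht).aestronglyMeasurable (μ := (volume : Measure E3))
  have am := ((h.d_reg.cts_advect h.u_reg.cts).slice ht).aestronglyMeasurable
    (μ := (volume : Measure E3))
  have Dm := (h.d_reg.cts_time.slice ht).aestronglyMeasurable (μ := (volume : Measure E3))
  obtain ⟨M, -, hM⟩ := h.exists_deriv_d_bound hD (T := t + 1) (by linarith)
  have D2 := (hM t ⟨ht, by linarith⟩).2.trans_lt ENNReal.ofReal_lt_top
  have h0 : ∫ x, (inner ℝ (glForce η (d t x)) (advect (u t) (d t) x) : ℝ) = 0 :=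
    integral_inner_advect_eq_zero (h.contDiff_u ht) (h.incompressible t ht) (h.nsq_lt_top ht)
      (contDiff_const.mul ((((h.d_reg.contDiff_one ht).norm_sq ℝ).sub contDiff_const).pow 2))
      (fun x w => hasFDerivAt_potential_density hη (h.d_reg.contDiff_one ht) x w)
      fun i => lintegral_sq_mul_sq_lt_top (fun x => norm_glForce_le (h.norm_le_one hD ht x))
        (h.nsq_partialD_d_lt_top ht i)
  have i1 := integrable_inner_of_nsq fm f2 Dm D2
  have i2 := integrable_inner_of_nsq lm l2 Dm D2
  have i3 := integrable_inner_of_nsq lm l2 am a2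
  have i4 := integrable_inner_of_nsq fm f2 am a2
  have i34 : Integrable (fun x => (inner ℝ (lap (d t) x) (advect (u t) (d t) x) : ℝ)
      - inner ℝ (glForce η (d t x)) (advect (u t) (d t) x)) volume := i3.sub i4
  rw [← sub_zero (∫ x, (inner ℝ (lap (d t) x) (advect (u t) (d t) x) : ℝ)), ← h0,
    ← integral_sub i1 i2, ← integral_sub i3 i4]
  refine integral_mono (i1.sub i2) i34 fun x => ?_
  simp only [h.deriv_d_eq ht, ← inner_sub_left]
  -- The discarded term is |Δd - f(d)|²; only the dissipation of the velocity is needed from the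
  -- energy law.
  have h1 : (0 : ℝ) ≤ inner ℝ (lap (d t) x - glForce η (d t x)) (lap (d t) x - glForce η (d t x)) :=
    real_inner_self_nonneg
  have h2 : glForce η (d t x) - lap (d t) x = -(lap (d t) x - glForce η (d t x)) := by abel
  rw [h2, inner_neg_left, inner_sub_right]
  linarith

/-- The energy inequality between positive times. -/
theorem IsSolution.energy_sub_le (hη : η ≠ 0) (hD : IsData w₀ u₀ d₀)
    (h : IsSolution η w₀ u₀ d₀ u π d) {s t : ℝ} (hs : 0 < s) (hst : s ≤ t) :
    energy η (u t) (d t) - energy η (u s) (d s)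
      ≤ - ∫ r in Set.Ioc s t, 2 * dirichlet (u r) := by
  obtain ⟨M, -, hM⟩ := h.exists_u_bound (T := t + 1) (by linarith)
  have hM' : ∀ r ∈ Set.Ioc s t, nsq (u r) ≤ ENNReal.ofReal M ∧ gsq (u r) ≤ ENNReal.ofReal M :=
    fun r hr => let a := hM r ⟨hs.trans hr.1, by linarith [hr.2]⟩; ⟨a.1, a.2.1⟩
  have e1 := h.filter_energy_le isFilter_id hs hst
  simp only [id, real_inner_self_eq_norm_sq] at e1
  have e2 := h.dirichlet_sub_le hD hs hst
  have e3 := h.potentialReal_sub_eq hη hD hs hst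
  have hD2 := h.setLIntegral_deriv_d_lt_top hD hs hst
  have j1 := (integrableOn_integral_inner h.u_reg.cts (h.u_reg.cts_force h.d_reg) hs.le
    (setLIntegral_lt_top_of_le_const ENNReal.ofReal_lt_top fun r hr => (hM' r hr).1)
    (h.setLIntegral_force_lt_top' hs hst)).const_mul 2
  have j2 := (integrableOn_integral_inner h.d_reg.cts_lap h.d_reg.cts_time hs.le
    (h.setLIntegral_nsq_lap_d_lt_top hD hs hst) hD2).const_mul (-2)
  have j3 := (integrableOn_integral_inner (h.d_reg.cts_glForce η) h.d_reg.cts_time hs.le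
    (h.setLIntegral_glForce_lt_top hD hs hst) hD2).const_mul 2
  have j4 : IntegrableOn (fun r => 2 * dirichlet (u r)) (Set.Ioc s t) :=
    (integrable_finsetSum _ fun i _ => integrableOn_sqn (h.u_reg.cts_partialD i) hs.le
      (setLIntegral_lt_top_of_le_const ENNReal.ofReal_lt_top fun r hr =>
        (nsq_partialD_le_gsq _ i).trans (hM' r hr).2)).const_mul 2
  -- The coupling ∫ Δd·(u·∇)d occurs with opposite signs in the kinetic and in the director balance
  -- and cancels.
  have key : (∫ r in Set.Ioc s t, 2 * ∫ x, (inner ℝ (u r x) (force (u r) (d r) x) : ℝ))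
      + (∫ r in Set.Ioc s t, -2 * ∫ x, (inner ℝ (lap (d r) x) (deriv (fun q => d q x) r) : ℝ))
      + (∫ r in Set.Ioc s t, 2 * ∫ x, (inner ℝ (glForce η (d r x)) (deriv (fun q => d q x) r) : ℝ))
      ≤ - ∫ r in Set.Ioc s t, 2 * dirichlet (u r) := by
    have j12 := j1.add j2
    rw [← integral_add j1 j2, ← integral_neg]
    refine (integral_add j12 j3).symm.le.trans ?_
    refine integral_mono_ae (j12.add j3) j4.neg ?_
    filter_upwards [h.ae_integral_inner_force_eq hD hs hst, ae_restrict_mem measurableSet_Ioc]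
      with r hr hr'
    have h1 := h.director_balance hη hD (hs.trans hr'.1)
    simp only [Pi.add_apply]
    rw [hr, dirichlet]
    linarith
  simp only [energy]
  simp only [sqn] at e1 ⊢
  linarith

end Solution

end LiquidCrystal

namespace LiquidCrystal

/-! ### The initial energy -/

section Solution

variable {η : ℝ} {w₀ : E3} {u₀ d₀ : E3 → E3} {u d : ℝ → E3 → E3} {π : ℝ → E3 → ℝ}

lemma energy_nonneg (η : ℝ) (u d : E3 → E3) : 0 ≤ energy η u d :=
  add_nonneg (add_nonneg (sqn_nonneg _) (dirichlet_nonneg _)) (potentialReal_nonneg _ _)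

lemma IsSolution.ofReal_energy (hD : IsData w₀ u₀ d₀) (h : IsSolution η w₀ u₀ d₀ u π d) {t : ℝ}
    (ht : 0 < t) :
    ENNReal.ofReal (energy η (u t) (d t)) = nsq (u t) + gsq (d t) + potential η (d t) := by
  rw [energy, ENNReal.ofReal_add (add_nonneg (sqn_nonneg _) (dirichlet_nonneg _))
    (potentialReal_nonneg _ _), ENNReal.ofReal_add (sqn_nonneg _) (dirichlet_nonneg _),
    ofReal_sqn (h.u_reg.cts.slice ht).aestronglyMeasurable (h.nsq_lt_top ht),
    ofReal_dirichlet (h.d_reg.contDiff_one ht) (h.nsq_partialD_d_lt_top ht),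
    h.ofReal_potentialReal hD ht]
  rfl

/-- The energy inequality in extended form. -/
lemma IsSolution.energy_add_le (hη : η ≠ 0) (hD : IsData w₀ u₀ d₀)
    (h : IsSolution η w₀ u₀ d₀ u π d) {s t : ℝ} (hs : 0 < s) (hst : s ≤ t) :
    ENNReal.ofReal (energy η (u t) (d t)) + ∫⁻ r in Set.Ioc s t, 2 * gsq (u r)
      ≤ ENNReal.ofReal (energy η (u s) (d s)) := by
  obtain ⟨M, -, hM⟩ := h.exists_u_bound (T := t + 1) (by linarith)
  have j : IntegrableOn (fun r => 2 * dirichlet (u r)) (Set.Ioc s t) :=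
    (integrable_finsetSum _ fun i _ => integrableOn_sqn (h.u_reg.cts_partialD i) hs.le
      (setLIntegral_lt_top_of_le_const ENNReal.ofReal_lt_top fun r hr =>
        (nsq_partialD_le_gsq _ i).trans (hM r ⟨hs.trans hr.1, by linarith [hr.2]⟩).2.1)).const_mul 2
  have e1 : ∫⁻ r in Set.Ioc s t, 2 * gsq (u r)
      = ENNReal.ofReal (∫ r in Set.Ioc s t, 2 * dirichlet (u r)) := by
    rw [ofReal_integral_eq_lintegral_ofReal j (Eventually.of_forall fun r =>
      mul_nonneg zero_le_two (dirichlet_nonneg _))]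
    refine setLIntegral_congr_fun measurableSet_Ioc fun r hr => ?_
    simp only [ENNReal.ofReal_mul zero_le_two, ENNReal.ofReal_ofNat,
      ofReal_dirichlet (h.contDiff_u (hs.trans hr.1)) (h.nsq_partialD_u_lt_top (hs.trans hr.1))]
  have h1 := h.energy_sub_le hη hD hs hst
  rw [e1, ← ENNReal.ofReal_add (energy_nonneg _ _ _)
    (integral_nonneg fun r => mul_nonneg zero_le_two (dirichlet_nonneg _))]
  exact ENNReal.ofReal_le_ofReal (by linarith)

lemma exists_isWeakPartial_of_sobolevSq_lt_top {f : E3 → E3} {k : ℕ} (h : sobolevSq (k + 1) f < ⊤)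
    (i : Fin 3) : ∃ g, IsWeakPartial i f g ∧ nsq g < ⊤ := by
  have h1 : ⨅ (g : E3 → E3) (_ : IsWeakPartial i f g), sobolevSq k g < ⊤ :=
    lt_of_le_of_lt (Finset.single_le_sum (f := fun i : Fin 3 =>
      ⨅ (g : E3 → E3) (_ : IsWeakPartial i f g), sobolevSq k g) (fun _ _ => zero_le)
      (Finset.mem_univ i)) (lt_of_le_of_lt le_add_self h)
  obtain ⟨g, hg⟩ := iInf_lt_iff.1 h1
  obtain ⟨hw, hg⟩ := iInf_lt_iff.1 hg
  exact ⟨g, hw, (nsq_le_sobolevSq k g).trans_lt hg⟩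

/-- The initial datum is attained in L², which says nothing directly about gradients. At a fixed
scale ε the mollified gradient does converge, because the derivative can be put on the kernel, and
the mollification error is ε times the bounded Hessian norm. The scale depends on the solution
through the Hessian bound M, with 2 ε² M ≤ 2, but the resulting bound does not. -/
lemma IsSolution.eventually_nsq_partialD_le (hD : IsData w₀ u₀ d₀)
    (h : IsSolution η w₀ u₀ d₀ u π d) {i : Fin 3} {g : E3 → E3}
    (hg : IsWeakPartial i (fun x => d₀ x - w₀) g) :
    ∀ᶠ s in 𝓝[>] (0 : ℝ), nsq (partialD i (d s)) ≤ 6 + 4 * nsq g := by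
  obtain ⟨M, hM0, hM⟩ := h.exists_hessian_bound (T := 1) one_pos
  set ε : ℝ := (Real.sqrt (M + 1))⁻¹ with hε
  have hε0 : 0 < ε := by positivity
  have hk := contDiff_moll ε
  have hks := hasCompactSupport_moll hε0
  have hk' := (contDiff_fderiv_apply hk (e i)).continuous
  have hk's : HasCompactSupport fun y => fderiv ℝ (moll ε) y (e i) := hks.fderiv_apply ℝ (e i)
  set A : ℝ≥0∞ := ∫⁻ y, ‖fderiv ℝ (moll ε) y (e i)‖ₑ with hA
  have hAtop : A ≠ ⊤ := (hk'.integrable_of_hasCompactSupport hk's).2.ne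
  have hlim : Tendsto (fun s => A ^ 2 * nsq (fun x => d s x - d₀ x)) (𝓝[>] 0) (𝓝 0) := by
    have := ENNReal.Tendsto.const_mul (a := A ^ 2) h.tendsto_nsq_sub
      (Or.inr (ENNReal.pow_ne_top hAtop))
    rwa [mul_zero] at this
  filter_upwards [hlim.eventually_le_const one_pos, Ioo_mem_nhdsGT one_pos] with s hs hs'
  have hc := h.contDiff_sub w₀ hs'.1
  have hf : ContDiff ℝ 1 (partialD i (fun x => d s x - w₀)) := contDiff_partialD (n := 1) hc i
  have h1 := nsq_le_conv_moll hε0 hf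
  rw [partialD_sub_const] at h1
  have hM' := (hM s hs' i).2.1
  have h2 : ENNReal.ofReal (2 * ε ^ 2) * gsq (partialD i (d s)) ≤ 2 := by
    refine (mul_le_mul_right hM' _).trans ?_
    rw [← ENNReal.ofReal_mul (by positivity), ← ENNReal.ofReal_ofNat 2]
    refine ENNReal.ofReal_le_ofReal ?_
    rw [hε, inv_pow, Real.sq_sqrt (by positivity), mul_assoc, inv_mul_eq_div]
    have : M / (M + 1) ≤ 1 := div_le_one_of_le₀ (by linarith) (by linarith)
    linarith
  have l1 : LocallyIntegrable (fun x => d s x - w₀) volume := hc.continuous.locallyIntegrable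
  have l0 : LocallyIntegrable (fun x => d₀ x - w₀) volume := hg.1
  have m1 : AEStronglyMeasurable (fun x => d s x - d₀ x) volume :=
    (h.d_reg.cts.slice hs'.1).aestronglyMeasurable.sub hD.aestronglyMeasurable
  have e1 : conv (moll ε) (partialD i (d s)) = fun x =>
      conv (fun y => fderiv ℝ (moll ε) y (e i)) (fun x => d s x - d₀ x) x + conv (moll ε) g x := by
    have h3 := conv_partial_eq hk hks
      (isWeakPartial_partialD (hc.of_le (by norm_num : (1 : WithTop ℕ∞) ≤ 2)) i)
    rw [partialD_sub_const] at h3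
    rw [← h3, ← conv_partial_eq hk hks hg]
    funext x
    have h4 := conv_sub hk' hk's l1 l0 x
    have h5 : (fun y => (d s y - w₀) - (d₀ y - w₀)) = fun y => d s y - d₀ y := funext fun y => by abel
    rw [h5] at h4
    rw [h4, sub_add_cancel]
  have m2 : AEStronglyMeasurable (conv (fun y => fderiv ℝ (moll ε) y (e i))
      (fun x => d s x - d₀ x)) volume := by
    have l2 : LocallyIntegrable (fun x => d s x - d₀ x) volume := by
      have h5 : (fun y => d s y - d₀ y) = fun y => (d s y - w₀) - (d₀ y - w₀) :=
        funext fun y => by abel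
      rw [h5]; exact l1.sub l0
    exact (contDiff_conv (contDiff_fderiv_apply hk _) hk's l2).continuous.aestronglyMeasurable
  have h6 : nsq (conv (moll ε) (partialD i (d s))) ≤ 2 * 1 + 2 * nsq g := by
    rw [e1]
    exact (nsq_add_le m2).trans (add_le_add (mul_le_mul_right ((nsq_conv_le hk' m1).trans hs) _)
      (mul_le_mul_right (nsq_conv_moll_le_nsq hε0 hg.2.1.aestronglyMeasurable) _))
  refine (h1.trans (add_le_add h2 (mul_le_mul_right h6 _))).trans (le_of_eq ?_)
  ring

lemma IsSolution.potential_le (hD : IsData w₀ u₀ d₀) (h : IsSolution η w₀ u₀ d₀ u π d) {t : ℝ}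
    (ht : 0 < t) :
    potential η (d t) ≤ ENNReal.ofReal (2 / η ^ 2) * nsq (fun x => d t x - w₀) := by
  unfold potential nsq
  rw [← lintegral_const_mul' _ _ ENNReal.ofReal_ne_top]
  refine lintegral_mono fun x => ?_
  rw [enorm_sq_eq_ofReal, ← ENNReal.ofReal_mul (by positivity)]
  exact ENNReal.ofReal_le_ofReal (potential_density_le hD.norm_w₀ (h.norm_le_one hD ht x))

/-- The energy is bounded in terms of the data. -/
theorem IsSolution.exists_energy_le (hη : η ≠ 0) (hD : IsData w₀ u₀ d₀) :
    ∃ C : ℝ, 0 < C ∧ ∀ u π d, IsSolution η w₀ u₀ d₀ u π d → ∀ t, 0 < t →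
      energy η (u t) (d t) ≤ C := by
  choose g hg hg2 using fun i => exists_isWeakPartial_of_sobolevSq_lt_top hD.d₀_mem.2 i
  have hu0 : nsq u₀ ≠ ⊤ := ((nsq_le_sobolevSq 1 u₀).trans_lt hD.u₀_mem.2).ne
  have hd0 : nsq (fun x => d₀ x - w₀) ≠ ⊤ := ((nsq_le_sobolevSq 2 _).trans_lt hD.d₀_mem.2).ne
  set K : ℝ≥0∞ := (2 + 2 * nsq u₀) + (∑ i, (6 + 4 * nsq (g i)))
    + ENNReal.ofReal (2 / η ^ 2) * (2 + 2 * nsq (fun x => d₀ x - w₀)) with hK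
  have hsum : ∑ i, (6 + 4 * nsq (g i)) ≠ ⊤ := (ENNReal.sum_lt_top.2 fun i _ => by
    have := (hg2 i).ne
    exact (by finiteness : 6 + 4 * nsq (g i) ≠ ⊤).lt_top).ne
  have hKtop : K ≠ ⊤ := by simp only [hK]; finiteness
  refine ⟨K.toReal + 1, by positivity, fun u π d h t ht => ?_⟩
  have hut : Tendsto (fun s => nsq (fun x => u s x - u₀ x)) (𝓝[>] 0) (𝓝 0) := by
    have := ENNReal.Tendsto.pow (n := 2) h.u_initial
    simpa only [eLpNorm_two_sq, zero_pow two_ne_zero] using this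
  have hev : ∀ᶠ s in 𝓝[>] (0 : ℝ), ENNReal.ofReal (energy η (u s) (d s)) ≤ K := by
    filter_upwards [hut.eventually_le_const one_pos, h.tendsto_nsq_sub.eventually_le_const one_pos,
      eventually_all.2 fun i => h.eventually_nsq_partialD_le hD (hg i), self_mem_nhdsWithin]
      with s h1 h2 h3 hs
    rw [h.ofReal_energy hD hs]
    refine add_le_add (add_le_add ?_ (Finset.sum_le_sum fun i _ => h3 i)) ?_
    · have h4 := nsq_add_le (f := fun x => u s x - u₀ x) (g := u₀)
        ((h.u_reg.cts.slice hs).aestronglyMeasurable.sub hD.u₀_mem.1)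
      simp only [sub_add_cancel] at h4
      refine h4.trans (add_le_add ?_ le_rfl)
      simpa using mul_le_mul_right h1 2
    · refine (h.potential_le hD hs).trans (mul_le_mul_right ?_ _)
      have h4 := nsq_add_le (f := fun x => d s x - d₀ x) (g := fun x => d₀ x - w₀)
        ((h.d_reg.cts.slice hs).aestronglyMeasurable.sub hD.aestronglyMeasurable)
      simp only [sub_add_sub_cancel] at h4
      refine h4.trans (add_le_add ?_ le_rfl)
      simpa using mul_le_mul_right h2 2
  obtain ⟨s, h1, hs⟩ := (hev.and (Ioo_mem_nhdsGT ht)).exists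
  have h2 := (le_self_add.trans (h.energy_add_le hη hD hs.1 hs.2.le)).trans h1
  have h3 := (ENNReal.ofReal_le_iff_le_toReal hKtop).1 h2
  linarith

end Solution

end LiquidCrystal

namespace LiquidCrystal

/-! ### Decay of the energy by Fourier splitting -/

lemma setLIntegral_rpow_le {p s t : ℝ} (hp : -1 < p) (hs : 0 ≤ s) (hst : s ≤ t) :
    ∫⁻ r in Set.Ioc s t, ENNReal.ofReal ((1 + r) ^ p)
      ≤ ENNReal.ofReal ((1 + t) ^ (p + 1) / (p + 1)) := by
  have hp1 : 0 < p + 1 := by linarith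
  have h := ofReal_eq_add_setLIntegral_deriv (W := fun r => (1 + r) ^ (p + 1) / (p + 1))
    (W' := fun r => (1 + r) ^ p) hst (by positivity) (fun r hr => ?_) ?_ ?_
  · rw [h]; exact le_add_self
  · have h0 : 0 < 1 + r := by linarith [hr.1]
    have := (((hasDerivAt_id r).const_add 1).rpow_const (p := p + 1) (Or.inl h0.ne')).div_const (p + 1)
    convert! this using 1
    rw [add_sub_cancel_right, id]
    field_simp
  · exact ContinuousOn.rpow_const (by fun_prop) fun r hr => Or.inl (by linarith [hr.1])
  · intro r hr
    have : 0 ≤ 1 + r := by linarith [hr.1]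
    positivity

section Solution

variable {η : ℝ} {w₀ : E3} {u₀ d₀ : E3 → E3} {u d : ℝ → E3 → E3} {π : ℝ → E3 → ℝ}

/-- The filtered energy is followed from time s and then s → 0. The factor 2 on the datum comes from
splitting u(s) into u₀ and u(s) - u₀; the latter vanishes in the limit. -/
lemma IsSolution.nsq_filter_le_add (hD : IsData w₀ u₀ d₀) (h : IsSolution η w₀ u₀ d₀ u π d)
    {R : ℝ} (hR : 0 < R) {Z : ℝ → ℝ} (hZ : ContinuousOn Z (Set.Ici 0)) (hZ0 : ∀ r, 0 < r → 0 ≤ Z r)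
    (hE : ∀ r, 0 < r → 6 * Real.sqrt (bumpConst * R⁻¹ ^ 5 * sqn (u r))
      * (sqn (u r) + dirichlet (d r)) ≤ Z r) {t : ℝ} (ht : 0 < t) :
    nsq (conv (moll R) (u t)) ≤ 2 * nsq (conv (moll R) u₀)
      + ∫⁻ r in Set.Ioc 0 t, ENNReal.ofReal (Z r) := by
  have hks := hasCompactSupport_moll hR
  have hkc := continuous_moll R
  have he : ∀ y, moll R (-y) = moll R y := fun y => moll_neg y
  have mu : ∀ r, 0 < r → MemLp (u r) 2 volume := fun r hr =>
    memLp_two_iff_nsq.2 ⟨(h.u_reg.cts.slice hr).aestronglyMeasurable, h.nsq_lt_top hr⟩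
  have hq : ∀ r, 0 < r → ENNReal.ofReal
      (∫ x, (inner ℝ (u r x) (conv (moll R) (conv (moll R) (u r)) x) : ℝ))
        = nsq (conv (moll R) (u r)) := fun r hr => by
    rw [← integral_inner_conv hkc hks he (mu r hr) (memLp_conv hkc hks (mu r hr))]
    simp only [real_inner_self_eq_norm_sq]
    obtain ⟨h1, h2⟩ := memLp_two_iff_nsq.1 (memLp_conv hkc hks (mu r hr))
    exact ofReal_sqn h1 h2
  have hstep : ∀ s, 0 < s → s ≤ t → nsq (conv (moll R) (u t)) ≤ nsq (conv (moll R) (u s))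
      + ∫⁻ r in Set.Ioc 0 t, ENNReal.ofReal (Z r) := fun s hs hst => by
    have hZi : IntegrableOn Z (Set.Ioc s t) := ((hZ.mono fun r hr => hs.le.trans hr.1).integrableOn_Icc
      (a := s) (b := t)).mono_set Set.Ioc_subset_Icc_self
    have hZn : 0 ≤ᵐ[volume.restrict (Set.Ioc s t)] Z :=
      ae_restrict_of_forall_mem measurableSet_Ioc fun r hr => hZ0 r (hs.trans hr.1)
    have h1 := h.filter_energy_le (isFilter_conv_moll hR) hs hst
    have h2 : ∫ r in Set.Ioc s t, 2 * ∫ x, (inner ℝ (conv (moll R) (conv (moll R) (u r)) x)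
        (force (u r) (d r) x) : ℝ) ≤ ∫ r in Set.Ioc s t, Z r := by
      by_cases hi : IntegrableOn (fun r => 2 * ∫ x, (inner ℝ (conv (moll R) (conv (moll R) (u r)) x)
        (force (u r) (d r) x) : ℝ)) (Set.Ioc s t)
      · refine integral_mono_ae hi hZi ?_
        filter_upwards [h.ae_integral_inner_filter_force_le hR hs hst,
          ae_restrict_mem measurableSet_Ioc] with r hr hr'
        exact hr.trans (hE r (hs.trans hr'.1))
      -- If the left integrand were not integrable, its integral would be zero by convention, and
      -- `Z` is nonnegative.
      · rw [integral_undef hi]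
        exact integral_nonneg_of_ae hZn
    have h3 := ENNReal.ofReal_le_ofReal (sub_le_iff_le_add'.1 (h1.trans h2))
    rw [hq t ht] at h3
    refine h3.trans (ENNReal.ofReal_add_le.trans ?_)
    rw [hq s hs, ofReal_integral_eq_lintegral_ofReal hZi hZn]
    exact add_le_add le_rfl (lintegral_mono_set (Set.Ioc_subset_Ioc_left hs.le))
  have hu0 : MemLp u₀ 2 volume := memLp_two_iff_nsq.2
    ⟨hD.u₀_mem.1, (nsq_le_sobolevSq 1 u₀).trans_lt hD.u₀_mem.2⟩
  have hA0 := memLp_conv hkc hks hu0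
  have hut : Tendsto (fun s => nsq (fun x => u s x - u₀ x)) (𝓝[>] 0) (𝓝 0) := by
    have := ENNReal.Tendsto.pow (n := 2) h.u_initial
    simpa only [eLpNorm_two_sq, zero_pow two_ne_zero] using this
  have hinit : ∀ s, 0 < s → nsq (conv (moll R) (u s))
      ≤ 2 * nsq (fun x => u s x - u₀ x) + 2 * nsq (conv (moll R) u₀) := fun s hs => by
    have e1 : conv (moll R) (u s) = fun x => conv (moll R) (fun y => u s y - u₀ y) x
        + conv (moll R) u₀ x := funext fun x => by
      rw [conv_sub hkc hks (locallyIntegrable_of_memLp_two (mu s hs))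
        (locallyIntegrable_of_memLp_two hu0), sub_add_cancel]
    have m1 := memLp_conv hkc hks ((mu s hs).sub hu0)
    have m2 : AEStronglyMeasurable (fun y => u s y - u₀ y) volume := (mu s hs).1.sub hu0.1
    rw [e1]
    exact (nsq_add_le m1.1).trans (add_le_add (mul_le_mul_right (nsq_conv_moll_le_nsq hR m2) _) le_rfl)
  have hlim := (ENNReal.Tendsto.const_mul (a := 2) hut (Or.inr (by simp))).add_const
    (2 * nsq (conv (moll R) u₀) + ∫⁻ r in Set.Ioc 0 t, ENNReal.ofReal (Z r))
  rw [mul_zero, zero_add] at hlim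
  refine ge_of_tendsto hlim ?_
  filter_upwards [Ioo_mem_nhdsGT ht] with s hs
  rw [← add_assoc]
  exact (hstep s hs.1 hs.2.le).trans (add_le_add (hinit s hs.1) le_rfl)

/-- All solutions with the given data have energy at most `C (1 + t)^{-a}`. -/
def EnergyDecay (η : ℝ) (w₀ : E3) (u₀ d₀ : E3 → E3) (a : ℝ) : Prop :=
  ∃ A : ℝ, 0 < A ∧ ∀ u π d, IsSolution η w₀ u₀ d₀ u π d → ∀ t, 0 < t →
    energy η (u t) (d t) ≤ A * (1 + t) ^ (-a)

/-- The forcing of the low frequencies has the homogeneity of energy to the power 3/2, which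
multiplies the decay exponent by 3/2. -/
lemma mul_sqrt_le_of_le {b A r a x y : ℝ} (hb : 0 ≤ b) (hr : 0 ≤ 1 + r) (hA : 0 ≤ A) (hx : 0 ≤ x)
    (hy : 0 ≤ y) (h : x + y ≤ A * (1 + r) ^ (-a)) :
    6 * Real.sqrt (b * x) * (x + y)
      ≤ 6 * Real.sqrt (b * A) * A * (1 + r) ^ (-(3 / 2 * a)) := by
  -- At 1 + r = 0 the convention 0 ^ (-a) = 0 for a ≠ 0 forces x = y = 0.
  rcases hr.eq_or_lt with h0 | h0
  · rcases eq_or_ne a 0 with rfl | ha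
    · have h' : x + y ≤ A := by simpa using h
      have : Real.sqrt (b * x) ≤ Real.sqrt (b * A) := Real.sqrt_le_sqrt (by nlinarith)
      simp only [mul_zero, neg_zero, Real.rpow_zero, mul_one]
      gcongr
    · rw [← h0, Real.zero_rpow (by simpa using ha), mul_zero] at h
      have hx0 : x = 0 := by linarith
      have hy0 : y = 0 := by linarith
      rw [hx0, hy0]
      simp only [mul_zero, Real.sqrt_zero, add_zero]
      positivity
  have hZ : Real.sqrt (b * x) ≤ Real.sqrt (b * A) * (1 + r) ^ (-(a / 2)) := by
    have e1 : (1 + r) ^ (-(a / 2)) = Real.sqrt ((1 + r) ^ (-a)) := by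
      rw [Real.sqrt_eq_rpow, ← Real.rpow_mul hr]; ring_nf
    rw [e1, ← Real.sqrt_mul (by positivity), mul_assoc]
    exact Real.sqrt_le_sqrt (mul_le_mul_of_nonneg_left (by linarith) hb)
  have e2 : (1 + r) ^ (-(3 / 2 * a)) = (1 + r) ^ (-(a / 2)) * (1 + r) ^ (-a) := by
    rw [← Real.rpow_add h0]; ring_nf
  rw [e2]
  calc _ ≤ 6 * (Real.sqrt (b * A) * (1 + r) ^ (-(a / 2))) * (A * (1 + r) ^ (-a)) := by gcongr
    _ = _ := by ring

/-- Decay of the part of the velocity at spatial scales above `√(1 + t)`. -/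
lemma EnergyDecay.exists_nsq_filter_le {a : ℝ} (hE : EnergyDecay η w₀ u₀ d₀ a)
    (ha : 3 / 2 * a < 1) (hD : IsData w₀ u₀ d₀) (hu1 : MemLp u₀ 1 volume) :
    ∃ C : ℝ, 0 < C ∧ ∀ u π d, IsSolution η w₀ u₀ d₀ u π d → ∀ t, 0 < t →
      nsq (conv (moll (Real.sqrt ((1 + t) / 2))) (u t))
        ≤ ENNReal.ofReal (C * (1 + t) ^ (-(1 / 4 + 3 / 2 * a))) := by
  obtain ⟨A, hA, hE⟩ := hE
  have hb := bumpConst_nonneg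
  set c : ℝ := 3 / 2 * a with hc
  have hL : ∫⁻ x, ‖u₀ x‖ₑ ≠ ⊤ := by
    have := hu1.eLpNorm_lt_top
    rw [eLpNorm_one_eq_lintegral_enorm] at this
    exact this.ne
  set L : ℝ := (∫⁻ x, ‖u₀ x‖ₑ).toReal with hL'
  set C₁ : ℝ := 2 * (bumpConst * 2 ^ (3 / 2 : ℝ) * L ^ 2)
  set C₂ : ℝ := 6 * Real.sqrt (bumpConst * 2 ^ (5 / 2 : ℝ) * A) * A / (1 - c)
  have hc1 : 0 < 1 - c := by linarith
  refine ⟨C₁ + C₂ + 1, by positivity, fun u π d h t ht => ?_⟩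
  have ht1 : 1 ≤ 1 + t := by linarith
  have ht0 : 0 < 1 + t := by linarith
  set R := Real.sqrt ((1 + t) / 2) with hR'
  have hR : 0 < R := Real.sqrt_pos.2 (by positivity)
  have hRk : ∀ k : ℕ, R⁻¹ ^ k = 2 ^ ((k : ℝ) / 2) * (1 + t) ^ (-((k : ℝ) / 2)) := fun k => by
    rw [hR', Real.sqrt_eq_rpow, ← Real.rpow_neg (by positivity), ← Real.rpow_natCast,
      ← Real.rpow_mul (by positivity), Real.div_rpow ht0.le (by norm_num), div_eq_mul_inv,
      ← Real.rpow_neg (by norm_num)]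
    ring_nf
  have hz : ∀ r, 0 < r → 6 * Real.sqrt (bumpConst * R⁻¹ ^ 5 * sqn (u r))
      * (sqn (u r) + dirichlet (d r))
      ≤ 6 * Real.sqrt (bumpConst * R⁻¹ ^ 5 * A) * A * (1 + r) ^ (-c) := fun r hr =>
    mul_sqrt_le_of_le (by positivity) (by linarith) hA.le (sqn_nonneg _) (dirichlet_nonneg _)
      (le_trans (le_add_of_nonneg_right (potentialReal_nonneg η (d r))) (hE u π d h r hr))
  have hcont : ContinuousOn (fun r : ℝ => 6 * Real.sqrt (bumpConst * R⁻¹ ^ 5 * A) * A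
      * (1 + r) ^ (-c)) (Set.Ici 0) :=
    continuousOn_const.mul (ContinuousOn.rpow_const (by fun_prop) fun r hr => Or.inl (by
      have : (0 : ℝ) ≤ r := hr
      linarith))
  refine (h.nsq_filter_le_add hD hR hcont (fun r hr => by positivity) hz ht).trans ?_
  have s1 : 2 * nsq (conv (moll R) u₀) ≤ ENNReal.ofReal (C₁ * (1 + t) ^ (-(1 / 4 + c))) := by
    have h1 := nsq_conv_moll_le_L1 hR hu1.1
    rw [← ENNReal.ofReal_toReal hL, ← ENNReal.ofReal_pow (by positivity),
      ← ENNReal.ofReal_mul (by positivity)] at h1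
    refine (mul_le_mul_right h1 _).trans ?_
    have e2 : ∀ X : ℝ, 2 * ENNReal.ofReal X = ENNReal.ofReal (2 * X) := fun X => by
      rw [ENNReal.ofReal_mul (by norm_num), ENNReal.ofReal_ofNat]
    rw [e2]
    refine ENNReal.ofReal_le_ofReal ?_
    -- The L¹ datum contributes R⁻³, of order (1 + t)^(-3/2), which is no slower than the claimed
    -- rate because c < 1.
    have h2 : (1 + t) ^ (-(3 / 2) : ℝ) ≤ (1 + t) ^ (-(1 / 4 + c)) :=
      Real.rpow_le_rpow_of_exponent_le ht1 (by linarith)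
    have h3 := hRk 3
    norm_num at h3
    rw [inv_pow, h3]
    calc _ = C₁ * (1 + t) ^ (-(3 / 2) : ℝ) := by simp only [C₁, hL']; ring
      _ ≤ _ := mul_le_mul_of_nonneg_left h2 (by positivity)
  have s2 : ∫⁻ r in Set.Ioc 0 t, ENNReal.ofReal (6 * Real.sqrt (bumpConst * R⁻¹ ^ 5 * A) * A
      * (1 + r) ^ (-c)) ≤ ENNReal.ofReal (C₂ * (1 + t) ^ (-(1 / 4 + c))) := by
    have e1 : ∀ r : ℝ, ENNReal.ofReal (6 * Real.sqrt (bumpConst * R⁻¹ ^ 5 * A) * A * (1 + r) ^ (-c))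
        = ENNReal.ofReal (6 * Real.sqrt (bumpConst * R⁻¹ ^ 5 * A) * A)
          * ENNReal.ofReal ((1 + r) ^ (-c)) := fun r => ENNReal.ofReal_mul (by positivity)
    simp only [e1]
    rw [lintegral_const_mul' _ _ ENNReal.ofReal_ne_top]
    refine (mul_le_mul_right (setLIntegral_rpow_le (by linarith) le_rfl ht.le) _).trans ?_
    rw [← ENNReal.ofReal_mul (by positivity)]
    refine ENNReal.ofReal_le_ofReal (le_of_eq ?_)
    have h3 := hRk 5
    norm_num at h3
    have h4 : Real.sqrt (bumpConst * R⁻¹ ^ 5 * A)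
        = Real.sqrt (bumpConst * 2 ^ (5 / 2 : ℝ) * A) * (1 + t) ^ (-(5 / 4) : ℝ) := by
      have e2 : (1 + t) ^ (-(5 / 4) : ℝ) = Real.sqrt ((1 + t) ^ (-(5 / 2) : ℝ)) := by
        rw [Real.sqrt_eq_rpow, ← Real.rpow_mul ht0.le]; norm_num
      rw [e2, ← Real.sqrt_mul (by positivity), inv_pow, h3]
      congr 1; ring
    -- The kernel gives R^(-5/2), of order (1 + t)^(-5/4), and the time integral of (1 + r)^(-c)
    -- gives 1 - c.
    have h5 : (1 + t) ^ (-(5 / 4) : ℝ) * (1 + t) ^ (-c + 1) = (1 + t) ^ (-(1 / 4 + c)) := by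
      rw [← Real.rpow_add ht0]; ring_nf
    rw [h4, ← h5]
    simp only [C₂]
    have e6 : -c + 1 = 1 - c := by ring
    rw [e6]
    ring
  refine (add_le_add s1 s2).trans ?_
  rw [← ENNReal.ofReal_add (by positivity) (by positivity)]
  refine ENNReal.ofReal_le_ofReal ?_
  have : 0 ≤ (1 + t) ^ (-(1 / 4 + c)) := by positivity
  linarith

/-- Improvement of the decay rate. -/
lemma EnergyDecay.improve {a : ℝ} (hE : EnergyDecay η w₀ u₀ d₀ a)
    (ha : 3 / 2 * a < 1) (hη : η ≠ 0) (hD : IsData w₀ u₀ d₀) (hu1 : MemLp u₀ 1 volume)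
    (hsm : nsq (fun x => d₀ x - w₀) ≤ ENNReal.ofReal (smallness η / 2)) :
    EnergyDecay η w₀ u₀ d₀ (1 / 4 + 3 / 2 * a) := by
  obtain ⟨C, hC, hlow⟩ := hE.exists_nsq_filter_le ha hD hu1
  obtain ⟨C₀, hC₀, hE₀⟩ := IsSolution.exists_energy_le hη hD (u₀ := u₀)
  obtain ⟨C₁, hC₁, hdis⟩ := IsSolution.exists_weighted_dissipation hη hD hsm
  set b : ℝ := 1 / 4 + 3 / 2 * a with hb
  have hb2 : 0 < 2 - b := by linarith
  refine ⟨4 * C₀ + 2 * C₁ + 4 * C / (2 - b), by positivity, fun u π d h t ht => ?_⟩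
  have ht0 : 0 < 1 + t := by linarith
  have ht1 : 1 ≤ 1 + t := by linarith
  -- The energy inequality holds between positive times only; a starting time at most 1 keeps the
  -- initial weight (1 + s)² below 4.
  set s : ℝ := min 1 (t / 2)
  have hs : 0 < s := by positivity
  have hst : s ≤ t := (min_le_right _ _).trans (by linarith)
  have hs1 : s ≤ 1 := min_le_left _ _
  have hw := weighted_energy_pow (X := fun r => ENNReal.ofReal (energy η (u r) (d r)))
    (D := fun r => 2 * gsq (u r)) hs.le hst ((h.u_reg.aemeasurable_gsq hs.le t).const_mul 2)
    (fun r hr => h.energy_add_le hη hD (hs.trans_le hr.1) hr.2) 2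
  set I := ∫⁻ q in Set.Ioc s t, ENNReal.ofReal ((1 + q) ^ 2) * (2 * gsq (u q)) with hI
  -- The weighted dissipation will be cancelled from both sides, so it must be finite; the bound may
  -- depend on the solution.
  have hItop : I ≠ ⊤ := by
    obtain ⟨M, -, hM⟩ := h.exists_u_bound (T := t + 1) (by linarith)
    refine (setLIntegral_lt_top_of_le_const (K := ENNReal.ofReal ((1 + t) ^ 2)
      * (2 * ENNReal.ofReal M)) (by finiteness) fun q hq => ?_).ne
    have hq0 := hs.trans hq.1
    have := (hM q ⟨hq0, by linarith [hq.2]⟩).2.1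
    gcongr
    exact hq.2
  have hX : ∀ r ∈ Set.Ioc s t, ENNReal.ofReal ((2 : ℕ) * (1 + r) ^ (2 - 1))
      * ENNReal.ofReal (energy η (u r) (d r))
      ≤ ENNReal.ofReal ((1 + r) ^ 2) * (2 * gsq (u r))
        + (ENNReal.ofReal (4 * C) * ENNReal.ofReal ((1 + r) ^ (1 - b))
          + 2 * (ENNReal.ofReal (1 + r) * (gsq (d r) + potential η (d r)))) := fun r hr => by
    have hr0 := hs.trans hr.1
    have hr1 : 0 < 1 + r := by linarith
    have hR : 0 < Real.sqrt ((1 + r) / 2) := Real.sqrt_pos.2 (by positivity)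
    -- With R² = (1 + r)/2 the gradient term is (1 + r) ‖∇u‖²; times the weight derivative 2 (1 + r)
    -- it equals exactly the weighted dissipation (1 + r)² · 2 ‖∇u‖².
    have h1 := nsq_le_conv_moll hR (h.contDiff_u hr0)
    rw [Real.sq_sqrt (by positivity), mul_div_cancel₀ _ two_ne_zero] at h1
    have h2 := h1.trans (add_le_add le_rfl (mul_le_mul_right (hlow u π d h r hr0) 2))
    have e1 : ENNReal.ofReal ((2 : ℕ) * (1 + r) ^ (2 - 1)) = 2 * ENNReal.ofReal (1 + r) := by
      rw [ENNReal.ofReal_mul (by positivity)]; simp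
    have e2 : ENNReal.ofReal ((1 + r) ^ 2) = ENNReal.ofReal (1 + r) * ENNReal.ofReal (1 + r) := by
      rw [sq, ENNReal.ofReal_mul hr1.le]
    have e3 : ENNReal.ofReal (4 * C) * ENNReal.ofReal ((1 + r) ^ (1 - b))
        = 2 * ENNReal.ofReal (1 + r) * (2 * ENNReal.ofReal (C * (1 + r) ^ (-b))) := by
      have e4 : (4 : ℝ) * C * (1 + r) ^ (1 - b) = 2 * (1 + r) * (2 * (C * (1 + r) ^ (-b))) := by
        rw [sub_eq_add_neg, Real.rpow_add hr1, Real.rpow_one]; ring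
      rw [← ENNReal.ofReal_mul (by positivity), e4, ENNReal.ofReal_mul (by positivity),
        ENNReal.ofReal_mul (by norm_num), ENNReal.ofReal_mul (by norm_num), ENNReal.ofReal_ofNat]
    rw [h.ofReal_energy hD hr0, e1, e2, e3]
    calc 2 * ENNReal.ofReal (1 + r) * (nsq (u r) + gsq (d r) + potential η (d r))
        = 2 * ENNReal.ofReal (1 + r) * nsq (u r)
          + 2 * (ENNReal.ofReal (1 + r) * (gsq (d r) + potential η (d r))) := by ring
      _ ≤ 2 * ENNReal.ofReal (1 + r) * (ENNReal.ofReal (1 + r) * gsq (u r)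
            + 2 * ENNReal.ofReal (C * (1 + r) ^ (-b)))
          + 2 * (ENNReal.ofReal (1 + r) * (gsq (d r) + potential η (d r))) :=
        add_le_add (mul_le_mul_right h2 _) le_rfl
      _ = _ := by ring
  have hJ : ∫⁻ r in Set.Ioc s t, ENNReal.ofReal ((2 : ℕ) * (1 + r) ^ (2 - 1))
      * ENNReal.ofReal (energy η (u r) (d r))
      ≤ I + ENNReal.ofReal (4 * C / (2 - b) * (1 + t) ^ (2 - b) + 2 * C₁) := by
    have mI : AEMeasurable (fun q => ENNReal.ofReal ((1 + q) ^ 2) * (2 * gsq (u q)))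
        (volume.restrict (Set.Ioc s t)) := AEMeasurable.mul (by fun_prop)
      ((h.u_reg.aemeasurable_gsq hs.le t).const_mul 2)
    have mr : AEMeasurable (fun r : ℝ => ENNReal.ofReal (4 * C) * ENNReal.ofReal ((1 + r) ^ (1 - b)))
        (volume.restrict (Set.Ioc s t)) := by fun_prop
    refine (setLIntegral_mono' measurableSet_Ioc hX).trans ?_
    rw [lintegral_add_left' mI, lintegral_add_left' mr, lintegral_const_mul' _ _ ENNReal.ofReal_ne_top,
      lintegral_const_mul' _ _ (by simp)]
    refine add_le_add le_rfl ?_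
    rw [ENNReal.ofReal_add (by positivity) (by positivity)]
    refine add_le_add ?_ ?_
    · refine (mul_le_mul_right (setLIntegral_rpow_le (by linarith) hs.le hst) _).trans ?_
      rw [← ENNReal.ofReal_mul (by positivity)]
      refine ENNReal.ofReal_le_ofReal (le_of_eq ?_)
      have e6 : 1 - b + 1 = 2 - b := by ring
      rw [e6]; ring
    · rw [ENNReal.ofReal_mul (by norm_num), ENNReal.ofReal_ofNat]
      exact mul_le_mul_right ((lintegral_mono_set (Set.Ioc_subset_Ioc_left hs.le)).trans
        (hdis u π d h t ht.le)) _
  have hw2 := hw.trans (add_le_add le_rfl hJ)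
  rw [← add_assoc, add_right_comm, ENNReal.add_le_add_iff_right hItop, ← ENNReal.ofReal_mul
    (by positivity), ← ENNReal.ofReal_mul (by positivity), ← ENNReal.ofReal_add
    (mul_nonneg (by positivity) (energy_nonneg _ _ _)) (by positivity),
    ENNReal.ofReal_le_ofReal_iff (add_nonneg (mul_nonneg (by positivity) (energy_nonneg _ _ _))
      (by positivity))] at hw2
  have h4 : (1 + s) ^ 2 * energy η (u s) (d s) ≤ 4 * C₀ := by
    refine mul_le_mul ?_ (hE₀ u π d h s hs) (energy_nonneg _ _ _) (by norm_num)
    nlinarith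
  have h5 : (1 : ℝ) ≤ (1 + t) ^ (2 - b) := Real.one_le_rpow ht1 hb2.le
  have h6 : (1 + t) ^ 2 * energy η (u t) (d t)
      ≤ (4 * C₀ + 2 * C₁ + 4 * C / (2 - b)) * (1 + t) ^ (2 - b) := by
    have h7 : 4 * C₀ + 2 * C₁ ≤ (4 * C₀ + 2 * C₁) * (1 + t) ^ (2 - b) :=
      le_mul_of_one_le_right (by positivity) h5
    linarith
  have h8 : (1 + t) ^ (2 - b) = (1 + t) ^ 2 * (1 + t) ^ (-b) := by
    rw [sub_eq_add_neg, Real.rpow_add ht0, Real.rpow_two]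
  rw [h8, mul_left_comm] at h6
  exact le_of_mul_le_mul_left h6 (by positivity)

/-- The map a ↦ 1/4 + 3a/2 takes 0 to 1/4, then to 5/8, then to 19/16. Each input satisfies 3a/2 <
1, the last one with 15/16, and 19/16 exceeds the exponent 3/4 that is kept. -/
theorem energyDecay (hη : η ≠ 0) (hD : IsData w₀ u₀ d₀) (hu1 : MemLp u₀ 1 volume)
    (hsm : nsq (fun x => d₀ x - w₀) ≤ ENNReal.ofReal (smallness η / 2)) :
    EnergyDecay η w₀ u₀ d₀ (3 / 4) := by
  obtain ⟨C, hC, h0⟩ := IsSolution.exists_energy_le hη hD (u₀ := u₀)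
  have d0 : EnergyDecay η w₀ u₀ d₀ 0 := ⟨C, hC, fun u π d h t ht => by simpa using h0 u π d h t ht⟩
  have d1 := d0.improve (by norm_num) hη hD hu1 hsm
  have d2 := d1.improve (by norm_num) hη hD hu1 hsm
  obtain ⟨A, hA, h3⟩ := d2.improve (by norm_num) hη hD hu1 hsm
  refine ⟨A, hA, fun u π d h t ht => (h3 u π d h t ht).trans ?_⟩
  exact mul_le_mul_of_nonneg_left
    (Real.rpow_le_rpow_of_exponent_le (by linarith) (by norm_num)) hA.le

end Solution

end LiquidCrystal

theorem theorem1p2 (η : ℝ) (hη : η ≠ 0) :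
    ∃ ε₀ : ℝ, 0 < ε₀ ∧
      ∀ (w₀ : LiquidCrystal.E3) (u₀ d₀ : LiquidCrystal.E3 → LiquidCrystal.E3),
        LiquidCrystal.IsData w₀ u₀ d₀ →
        MemLp u₀ 1 volume →
        LiquidCrystal.sobolevSq 1 u₀ + LiquidCrystal.sobolevSq 2 (fun x => d₀ x - w₀)
          ≤ ENNReal.ofReal ε₀ →
        (∀ p : ℝ, 1 ≤ p → ∃ C : ℝ, 0 < C ∧
          ∀ u π d, LiquidCrystal.IsSolution η w₀ u₀ d₀ u π d → ∀ t : ℝ, 0 < t →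
            eLpNorm (fun x => d t x - w₀) (ENNReal.ofReal p) volume
              ≤ ENNReal.ofReal C * eLpNorm (fun x => d₀ x - w₀) (ENNReal.ofReal p) volume
                * ENNReal.ofReal ((1 + t) ^ (-(3 / 2 : ℝ) * (1 - 1 / p)))) ∧
        (∃ C : ℝ, 0 < C ∧
          ∀ u π d, LiquidCrystal.IsSolution η w₀ u₀ d₀ u π d → ∀ t : ℝ, 0 < t →
            ∑ i : Fin 3,
                eLpNorm (LiquidCrystal.partialD i (fun x => d t x - w₀)) 2 volume ^ 2
              ≤ ENNReal.ofReal (C * (1 + t) ^ (-(3 / 4) : ℝ))) ∧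
        (∃ C : ℝ, 0 < C ∧
          ∀ u π d, LiquidCrystal.IsSolution η w₀ u₀ d₀ u π d → ∀ t : ℝ, 0 < t →
            eLpNorm (u t) 2 volume ^ 2
              ≤ ENNReal.ofReal (C * (1 + t) ^ (-(1 / 2) : ℝ))) := by
  refine ⟨LiquidCrystal.smallness η / 2, half_pos (LiquidCrystal.smallness_pos η),
    fun w₀ u₀ d₀ hD hu1 hs => ?_⟩
  have hsm : LiquidCrystal.nsq (fun x => d₀ x - w₀)
      ≤ ENNReal.ofReal (LiquidCrystal.smallness η / 2) :=
    (LiquidCrystal.nsq_le_sobolevSq 2 _).trans (le_add_self.trans hs)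
  obtain ⟨A, hA, hE⟩ := LiquidCrystal.energyDecay hη hD hu1 hsm
  -- Both ‖∇d‖² and ‖u‖² are summands of the energy, whose exponent 3/4 is the one required for ∇d
  -- and better than the 1/2 required for u.
  refine ⟨fun p hp => LiquidCrystal.IsSolution.exists_eLpNorm_decay hη hD hsm hp,
    ⟨A, hA, fun u π d h t ht => ?_⟩, ⟨A, hA, fun u π d h t ht => ?_⟩⟩
  · simp only [LiquidCrystal.partialD_sub_const, LiquidCrystal.eLpNorm_two_sq]
    refine le_trans ?_ (ENNReal.ofReal_le_ofReal (hE u π d h t ht))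
    rw [h.ofReal_energy hD ht]
    exact le_add_self.trans le_self_add
  · rw [LiquidCrystal.eLpNorm_two_sq]
    refine le_trans ?_ (ENNReal.ofReal_le_ofReal ((hE u π d h t ht).trans
      (mul_le_mul_of_nonneg_left (Real.rpow_le_rpow_of_exponent_le (by linarith)
        (by norm_num)) hA.le)))
    rw [h.ofReal_energy hD ht]
    exact le_self_add.trans le_self_add
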